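/- Write $D=\partial_x\partial_y(\partial_x-\partial_y)$. For $V\subset\mathbb R^2$ and $X\subset\mathbb R^2$ let $\mathrm{Conv}_V(X)$ be the smallest set $Y\supset X$ such that, for every $\vec v\in V$, whenever $a,b\in Y$ and $a-b$ is a real multiple of $\vec v$, the segment from $a$ to $b$ lies in $Y$. For $\lambda\in\mathbb R$ put $$\Lambda(f,g,h)=\iint_{\mathbb R^2} e^{i\lambda S(x,y)}f(x)\,g(y)\,h(x+y)\,\phi(x,y)\,dx\,dy .$$ Theorem. Let $2<p,q<4$ with $\frac1p+\frac1q=\frac34$, and let $A,c,K>0$. There is a constant $C>0$, depending only on $p,q,A,c,K$, such that the following holds for all $\delta_1,\delta_2,\mu>0$. Let $\phi:\mathbb R^2\to\mathbb C$ be smooth and compactly supported, such that $|x-x'|\le\delta_1$ whenever $(x,y),(x',y)\in\operatorname{supp}\phi$, and $|y-y'|\le\delta_2$ whenever $(x,y),(x,y')\in\operatorname{supp}\phi$ (the horizontal and vertical cross-sections of the support have width at most $\delta_1$ and $\delta_2$), and such that everywhere $$|\partial_y\phi|\le A\,\delta_2^{-1},\qquad |\partial_y^2\phi|\le A\,\delta_2^{-2}.$$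 Let $H=\mathrm{Conv}_{\{(1,0),(0,1),(-1,1)\}}(\operatorname{supp}\phi)$, and let $S$ be a real-valued function that is smooth on an open set containing $H$ and satisfies, at every point of $H$, $$|DS|\ge c\,\mu,\qquad |\partial_y^{l}DS|\le K\,\frac{\mu}{\delta_2^{l}}\quad(l=1,2).$$ Then for every real $\lambda\ne0$: (i) for all $f\in L^p(\mathbb R)$, $g\in L^q(\mathbb R)$, $h\in L^2(\mathbb R)$ the integral defining $\Lambda(f,g,h)$ converges absolutely and $$|\Lambda(f,g,h)|\le C\,|\lambda\mu|^{-1/4}\,\|f\|_p\|g\|_q\|h\|_2 ;$$ (ii) for all $f\in L^2(\mathbb R)$, $g\in L^p(\mathbb R)$, $h\in L^q(\mathbb R)$ the integral defining $\Lambda(f,g,h)$ converges absolutely and $$|\Lambda(f,g,h)|\le C\,|\lambda\mu|^{-1/4}\,\|f\|_2\|g\|_p\|h\|_q .$$ -/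

import Mathlib

open MeasureTheory
open scoped ContDiff

/-- `X` is convex in the direction `v`: whenever two points of `X` differ by a real multiple
of `v`, the segment joining them lies in `X`. -/
def DirConvex (v : ℝ × ℝ) (X : Set (ℝ × ℝ)) : Prop :=
  ∀ a ∈ X, ∀ b ∈ X, (∃ c : ℝ, a - b = c • v) → segment ℝ a b ⊆ X

/-- The smallest set containing `X` that is convex in every direction `v ∈ V`. -/
def dirHull (V : Set (ℝ × ℝ)) (X : Set (ℝ × ℝ)) : Set (ℝ × ℝ) :=
  ⋂₀ {Y | X ⊆ Y ∧ ∀ v ∈ V, DirConvex v Y}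

theorem subset_dirHull (V X : Set (ℝ × ℝ)) : X ⊆ dirHull V X :=
  Set.subset_sInter fun _ hY => hY.1

theorem dirConvex_dirHull (V X : Set (ℝ × ℝ)) {v : ℝ × ℝ} (hv : v ∈ V) :
    DirConvex v (dirHull V X) := fun a ha b hb hab =>
  Set.subset_sInter fun Y hY => hY.2 v hv a (ha Y hY) b (hb Y hY) hab

theorem dirHull_subset {V X Y : Set (ℝ × ℝ)} (hXY : X ⊆ Y) (hY : ∀ v ∈ V, DirConvex v Y) :
    dirHull V X ⊆ Y := Set.sInter_subset_of_mem ⟨hXY, hY⟩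

/-- The partial derivative with respect to the first variable. -/
noncomputable def partialX {E : Type*} [NormedAddCommGroup E] [NormedSpace ℝ E]
    (F : ℝ × ℝ → E) (z : ℝ × ℝ) : E := deriv (fun t : ℝ => F (t, z.2)) z.1

/-- The partial derivative with respect to the second variable. -/
noncomputable def partialY {E : Type*} [NormedAddCommGroup E] [NormedSpace ℝ E]
    (F : ℝ × ℝ → E) (z : ℝ × ℝ) : E := deriv (fun t : ℝ => F (z.1, t)) z.2

/-- The third-order differential operator `D = ∂ₓ ∂_y (∂ₓ - ∂_y)`. -/
noncomputable def opD (S : ℝ × ℝ → ℝ) : ℝ × ℝ → ℝ :=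
  partialX (partialY (fun z => partialX S z - partialY S z))

/-- The integrand `e^{i l S(x,y)} f(x) g(y) h(x+y) φ(x,y)`. -/
noncomputable def trilinearIntegrand (l : ℝ) (S : ℝ × ℝ → ℝ) (φ : ℝ × ℝ → ℂ)
    (f g h : ℝ → ℂ) (z : ℝ × ℝ) : ℂ :=
  Complex.exp (Complex.I * ((l * S z : ℝ) : ℂ)) * f z.1 * g z.2 * h (z.1 + z.2) * φ z

/-- The trilinear oscillatory form of convolution type. -/
noncomputable def trilinearForm (l : ℝ) (S : ℝ × ℝ → ℝ) (φ : ℝ × ℝ → ℂ)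
    (f g h : ℝ → ℂ) : ℂ :=
  ∫ z : ℝ × ℝ, trilinearIntegrand l S φ f g h z

/-- The `L^p` norm on the line with Lebesgue measure, for a real exponent `p`. -/
noncomputable def normLp (p : ℝ) (f : ℝ → ℂ) : ℝ :=
  (eLpNorm f (ENNReal.ofReal p) volume).toReal

/-! ### The Hardy–Littlewood–Sobolev inequality, by splitting the kernel at a level-dependent
radius. -/

section HardyLittlewoodSobolev

open Set ENNReal

/-! By duality each bound is an L² estimate for a bilinear operator: s ↦ ∫ e^{iλS}φ(s-y,y)
f(s-y)g(y) dy for (i), x ↦ ∫ e^{iλS}φ(x,y) g(y)h(x+y) dy for (ii). Expanding the square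
(`lintegral_sq_integral_le`) gives, for each shift τ, a bilinear form whose phase is a difference of
S and whose inputs are correlations such as g(y)·conj g(y+τ). If this form is at most |λμτ|^{-1/2}
times the L² norms of its inputs, one splits |τ|^{-1/2} as |τ|^{-a/2}|τ|^{-b/2} with a = 2-4/p, b =
2-4/q, and concludes by Cauchy–Schwarz and `hardy_littlewood_sobolev`; the conditions on p, q say
exactly that 0 < a, b < 1 and a+b = 1.

In (i) the form acts on functions of x and y. A further T T* in x leaves an integral in y whose
phase is a double difference of S over a parallelogram with sides (1,0) and (-1,1). Since D =
∂ₓ(∂ₓ-∂_y)∘∂_y, the y-derivative of that phase is λ(x-x')τ·DS at a point of the hull, and its higher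
derivatives are controlled in the same way (`exists_parallelogram_difference`). Two integrations by
parts and Schur's test finish (`PhaseHyp.norm_integral_kernel_le`, `enorm_bilinear_le_of_schur`).

In (ii) the form acts on functions of y and x+y, and the same T T* would require derivatives of DS
in directions in which nothing is assumed. Two ideas replace it. First, only DS matters: functions
a(x)+b(y)+c(x+y) are absorbed into the inputs, and by `exists_decomposition_of_opD_eq_zero` two
phases with the same DS on a region convex in the three directions differ by such a sum. On a
horizontal strip of height comparable to δ₂, DS extends to the plane (`exists_rowPhase_extension`)
and is integrated three times to a phase with ∂ₓ²∂_yS bounded below and |∂ₓ∂_y²S| much smaller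
(`exists_rowPhase`). After rescaling, the difference phase Q has Q_xx ≥ 9/10 and |Q_xy| ≤ 1/10
(`RowPhase.keyHyp`).

Second, for such Q the form ∬ e^{iQ(x,y)}G(y)H(x+y) is bounded on L² (`KeyHyp.exists_bilinear_le`).
On a unit block Q(x,y) nearly separates into a function of x plus a function of y; the x factor has
Fourier transform concentrated on the range of Q_x there, expressed by a difference of arctangents.
For a fixed piece of H these frequency windows overlap boundedly, by telescoping; for a fixed piece
of G the modulated functions Ge^{iQ(x₀,·)}, seen on their windows, are almost orthogonal
(`KeyHyp.sum_arctanWeight_le`, `KeyHyp.exists_sum_arctanWeight_le`).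

This controls g supported in one window of length w against h measured through its windows. The
windows are summed by comparing masses: on pairs where the window of g carries the larger relative
mass the exponents close exactly (`tsum_rpow_mul_le`), and the remaining pairs are handled by the
involution (x,y) ↦ (-x,x+y), which exchanges g and h and preserves D. Finally the hull is replaced
by the parts of its interior where DS has a fixed sign, and φ by truncations vanishing where |φ| is
small (`PhaseHyp.regionHyp`, `PhaseHyp.exists_lintegral_sq_le`). -/

theorem lintegral_comp_abs (F : ℝ → ℝ≥0∞) :
    ∫⁻ t, F |t| = 2 * ∫⁻ t in Ioi 0, F t := by
  have h1 : ∫⁻ t in Ioi 0, F |t| = ∫⁻ t in Ioi 0, F t :=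
    setLIntegral_congr_fun measurableSet_Ioi fun t ht => by rw [abs_of_pos ht]
  have h2 : ∫⁻ t in Iio 0, F |t| = ∫⁻ t in Ioi 0, F t := by
    have := (Measure.measurePreserving_neg (volume : Measure ℝ)).setLIntegral_comp_preimage_emb
      (MeasurableEquiv.neg ℝ).measurableEmbedding (fun t => F |t|) (Ioi 0)
    simp only [neg_preimage, neg_Ioi, neg_zero, abs_neg] at this
    rw [← h1, ← this]
  rw [← lintegral_add_compl _ (measurableSet_Ioi (a := (0:ℝ))), h1, compl_Ioi,
    setLIntegral_congr Iio_ae_eq_Iic.symm, h2, two_mul]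

theorem lintegral_abs_rpow_near {a ρ : ℝ} (ha : a < 1) (hρ : 0 < ρ) :
    ∫⁻ t : ℝ, (if |t| ≤ ρ then ENNReal.ofReal (|t| ^ (-a)) else 0) =
      ENNReal.ofReal (2 * ρ ^ (1 - a) / (1 - a)) := by
  rw [lintegral_comp_abs (fun t => if t ≤ ρ then ENNReal.ofReal (t ^ (-a)) else 0)]
  have e : ∫⁻ t in Ioi (0:ℝ), (if t ≤ ρ then ENNReal.ofReal (t ^ (-a)) else 0) =
      ∫⁻ t in Ioc 0 ρ, ENNReal.ofReal (t ^ (-a)) := by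
    rw [← Ioi_inter_Iic, inter_comm, ← setLIntegral_indicator measurableSet_Iic]
    rfl
  have hi := (intervalIntegral.intervalIntegrable_rpow' (a := 0) (b := ρ)
    (show -1 < -a by linarith)).1
  rw [e, ← ofReal_integral_eq_lintegral_ofReal hi, ← intervalIntegral.integral_of_le hρ.le,
    integral_rpow (Or.inl (by linarith)), Real.zero_rpow (by linarith)]
  · rw [show (2:ℝ≥0∞) = ENNReal.ofReal 2 by simp, ← ENNReal.ofReal_mul (by norm_num)]
    congr 1
    rw [show -a + 1 = 1 - a by ring]; ring
  · exact (ae_restrict_iff' measurableSet_Ioc).2 (ae_of_all _ fun t ht => Real.rpow_nonneg ht.1.le _)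

theorem lintegral_abs_rpow_far {b ρ : ℝ} (hb : 1 < b) (hρ : 0 < ρ) :
    ∫⁻ t : ℝ, (if ρ < |t| then ENNReal.ofReal (|t| ^ (-b)) else 0) =
      ENNReal.ofReal (2 * ρ ^ (1 - b) / (b - 1)) := by
  rw [lintegral_comp_abs (fun t => if ρ < t then ENNReal.ofReal (t ^ (-b)) else 0)]
  have e : ∫⁻ t in Ioi (0:ℝ), (if ρ < t then ENNReal.ofReal (t ^ (-b)) else 0) =
      ∫⁻ t in Ioi ρ, ENNReal.ofReal (t ^ (-b)) := by
    have : Ioi ρ = Ioi ρ ∩ Ioi 0 := by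
      rw [Ioi_inter_Ioi, sup_of_le_left hρ.le]
    rw [this, ← setLIntegral_indicator measurableSet_Ioi]
    rfl
  have hi := integrableOn_Ioi_rpow_of_lt (show -b < -1 by linarith) hρ
  rw [e, ← ofReal_integral_eq_lintegral_ofReal hi, integral_Ioi_rpow_of_lt (by linarith) hρ]
  · rw [show (2:ℝ≥0∞) = ENNReal.ofReal 2 by simp, ← ENNReal.ofReal_mul (by norm_num)]
    congr 1
    rw [show -b + 1 = 1 - b by ring, show (1 - b) = -(b - 1) by ring, div_neg]; ring
  · exact (ae_restrict_iff' measurableSet_Ioi).2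
      (ae_of_all _ fun t ht => Real.rpow_nonneg (hρ.trans ht).le _)

theorem measurable_ofReal_abs_rpow (a : ℝ) : Measurable fun t : ℝ => ENNReal.ofReal (|t| ^ a) := by
  fun_prop

/-- Near the diagonal u is bounded by U and the kernel is integrable; far away Hölder uses the total
mass A. The radius between the two regimes is free. -/
theorem hls_inner {a : ℝ} (ha : 0 < a) (ha' : a < 1) {u : ℝ → ℝ≥0∞} (hu : Measurable u)
    {A U : ℝ} (hA : 0 < A) (hU : 0 < U)
    (hAu : ∫⁻ x, u x ^ (2 / (2 - a)) = ENNReal.ofReal A) (x : ℝ) :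
    ∫⁻ y, (if u y ≤ ENNReal.ofReal U then u y * ENNReal.ofReal (|x - y| ^ (-a)) else 0) ≤
      ENNReal.ofReal ((2 / (1 - a) + 2 ^ (a / 2)) * A ^ (1 - a) * U ^ (a / (2 - a))) := by
  set r := 2 / (2 - a) with hr
  have h2a : 0 < 2 - a := by linarith
  -- This radius balances both contributions: each becomes a multiple of A^(1-a) U^(a/(2-a)).
  set ρ := A * U ^ (-r) with hρd
  have hρ : 0 < ρ := by positivity
  set k₁ : ℝ → ℝ≥0∞ := fun t => if |t| ≤ ρ then ENNReal.ofReal (|t| ^ (-a)) else 0 with hk1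
  set k₂ : ℝ → ℝ≥0∞ := fun t => if ρ < |t| then ENNReal.ofReal (|t| ^ (-a)) else 0 with hk2
  have mk2 : Measurable k₂ :=
    Measurable.ite (measurableSet_lt measurable_const (by fun_prop))
      (measurable_ofReal_abs_rpow _) measurable_const
  have mk1 : Measurable k₁ :=
    Measurable.ite (measurableSet_le (by fun_prop) measurable_const)
      (measurable_ofReal_abs_rpow _) measurable_const
  have hle : ∀ y, (if u y ≤ ENNReal.ofReal U then u y * ENNReal.ofReal (|x - y| ^ (-a)) else 0) ≤
      ENNReal.ofReal U * k₁ (x - y) + u y * k₂ (x - y) := by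
    intro y
    simp only [hk1, hk2]
    by_cases h : u y ≤ ENNReal.ofReal U
    · by_cases h' : |x - y| ≤ ρ
      · simp only [h, h', if_true, not_lt.2 h', if_false, mul_zero, add_zero]; gcongr
      · simp only [h, h', if_true, not_le.1 h', if_false, mul_zero, zero_add]; exact le_rfl
    · simp [h]
  -- The conjugate exponent 2/a turns the far kernel |t|^(-a) into |t|^(-2), whose tail integral is
  -- 2/ρ.
  have hconj : r.HolderConjugate (2 / a) := by
    rw [Real.holderConjugate_iff]
    refine ⟨?_, ?_⟩
    · rw [hr, lt_div_iff₀ h2a]; linarith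
    · rw [hr]; field_simp; ring
  have hb1 : ∫⁻ y, k₁ (x - y) = ENNReal.ofReal (2 * ρ ^ (1 - a) / (1 - a)) := by
    rw [lintegral_sub_left_eq_self k₁ x]; exact lintegral_abs_rpow_near ha' hρ
  have hb2 : ∫⁻ y, k₂ (x - y) ^ (2 / a) = ENNReal.ofReal (2 / ρ) := by
    rw [lintegral_sub_left_eq_self (fun t => k₂ t ^ (2 / a)) x]
    have := lintegral_abs_rpow_far (b := 2) (by norm_num) hρ
    have e : (2:ℝ) * ρ ^ (1 - 2 : ℝ) / (2 - 1) = 2 / ρ := by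
      rw [show (1 - 2 : ℝ) = -1 by norm_num, Real.rpow_neg_one]; norm_num; rfl
    rw [← e, ← this]
    refine lintegral_congr fun t => ?_
    simp only [hk2]
    split_ifs with h
    · have ht : 0 < |t| := hρ.trans h
      rw [ENNReal.ofReal_rpow_of_pos (by positivity), ← Real.rpow_mul ht.le]
      congr 2; field_simp
    · exact ENNReal.zero_rpow_of_pos (by positivity)
  have hH : ∫⁻ y, u y * k₂ (x - y) ≤ ENNReal.ofReal (A ^ (1 / r) * (2 / ρ) ^ (a / 2)) := by
    have := ENNReal.lintegral_mul_le_Lp_mul_Lq volume hconj hu.aemeasurable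
      (g := fun y => k₂ (x - y)) (mk2.comp (measurable_const.sub measurable_id)).aemeasurable
    refine this.trans_eq ?_
    rw [hAu, hb2, ENNReal.ofReal_rpow_of_pos hA, ENNReal.ofReal_rpow_of_pos (by positivity),
      ← ENNReal.ofReal_mul (by positivity)]
    congr 3; field_simp
  calc _ ≤ ∫⁻ y, (ENNReal.ofReal U * k₁ (x - y) + u y * k₂ (x - y)) := lintegral_mono hle
    _ = (ENNReal.ofReal U * ∫⁻ y, k₁ (x - y)) + ∫⁻ y, u y * k₂ (x - y) := by
        have m1 : Measurable fun y => k₁ (x - y) := mk1.comp (measurable_const.sub measurable_id)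
        rw [lintegral_add_left (m1.const_mul _), lintegral_const_mul _ m1]
    _ ≤ ENNReal.ofReal U * ENNReal.ofReal (2 * ρ ^ (1 - a) / (1 - a)) +
        ENNReal.ofReal (A ^ (1 / r) * (2 / ρ) ^ (a / 2)) := by rw [hb1]; gcongr
    _ = ENNReal.ofReal (U * (2 * ρ ^ (1 - a) / (1 - a)) + A ^ (1 / r) * (2 / ρ) ^ (a / 2)) := by
        have h1a : 0 < 1 - a := by linarith
        rw [← ENNReal.ofReal_mul hU.le, ← ENNReal.ofReal_add (by positivity) (by positivity)]
    _ = _ := by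
        congr 1
        have e1 : ρ ^ (1 - a) * U = A ^ (1 - a) * U ^ (a / (2 - a)) := by
          rw [hρd, Real.mul_rpow hA.le (by positivity), ← Real.rpow_mul hU.le, mul_assoc]
          congr 1
          nth_rw 2 [← Real.rpow_one U]
          rw [← Real.rpow_add hU]
          congr 1; rw [hr]; field_simp; ring
        have e2 : A ^ (1 / r) * (2 / ρ) ^ (a / 2) =
            2 ^ (a / 2) * (A ^ (1 - a) * U ^ (a / (2 - a))) := by
          rw [Real.div_rpow (by norm_num) hρ.le, hρd, Real.mul_rpow hA.le (by positivity),
            ← Real.rpow_mul hU.le, div_eq_mul_inv (2 ^ (a / 2) : ℝ), mul_inv, ← Real.rpow_neg hA.le,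
            ← Real.rpow_neg hU.le, mul_left_comm, ← mul_assoc (A ^ (1 / r)), ← Real.rpow_add hA]
          congr 3
          · rw [hr]; field_simp; ring
          · rw [hr]; field_simp
        rw [e2]; linear_combination (2 / (1 - a)) * e1

/-- The diagonal Hardy-Littlewood-Sobolev inequality on the line. -/
theorem hardy_littlewood_sobolev {a : ℝ} (ha : 0 < a) (ha' : a < 1) :
    ∃ C : ℝ, 0 < C ∧ ∀ u : ℝ → ℝ≥0∞, Measurable u →
      ∫⁻ x, ∫⁻ y, u x * u y * ENNReal.ofReal (|x - y| ^ (-a)) ≤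
        ENNReal.ofReal C * (∫⁻ x, u x ^ (2 / (2 - a))) ^ (2 - a) := by
  set r := 2 / (2 - a) with hr
  have h2a : 0 < 2 - a := by linarith
  have h1a : 0 < 1 - a := by linarith
  have hr0 : 0 < r := by positivity
  set C₁ : ℝ := 2 / (1 - a) + 2 ^ (a / 2) with hC1
  have hC1p : 0 < C₁ := by positivity
  refine ⟨2 * C₁, by positivity, fun u hu => ?_⟩
  rcases eq_or_ne (∫⁻ x, u x ^ r) ⊤ with hT | hT
  · rw [hT, ENNReal.top_rpow_of_pos h2a, ENNReal.mul_top (by simp; positivity)]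
    exact le_top
  rcases eq_or_ne (∫⁻ x, u x ^ r) 0 with h0 | h0
  · have : ∀ᵐ x, u x = 0 := by
      have := (lintegral_eq_zero_iff (hu.pow_const r)).1 h0
      filter_upwards [this] with x hx
      simpa [hr0, hr0.le, not_lt.2 hr0.le] using hx
    refine le_trans (le_of_eq ?_) zero_le
    rw [lintegral_eq_zero_iff' ]
    · filter_upwards [this] with x hx
      simp [hx]
    · refine Measurable.aemeasurable (Measurable.lintegral_prod_right' (f := fun z : ℝ × ℝ =>
        u z.1 * u z.2 * ENNReal.ofReal (|z.1 - z.2| ^ (-a))) ?_)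
      fun_prop
  obtain ⟨A, hA, hAu⟩ : ∃ A : ℝ, 0 < A ∧ ∫⁻ x, u x ^ r = ENNReal.ofReal A :=
    ⟨_, ENNReal.toReal_pos h0 hT, (ENNReal.ofReal_toReal hT).symm⟩
  -- By symmetry only the half u(y) ≤ u(x) matters. There `hls_inner` applies with U = u(x), and
  -- U·U^(a/(2-a)) = U^r integrates back to A.
  set F : ℝ → ℝ → ℝ≥0∞ := fun x y =>
    if u y ≤ u x then u x * u y * ENNReal.ofReal (|x - y| ^ (-a)) else 0 with hF
  have mF : Measurable (Function.uncurry F) := by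
    refine Measurable.ite (measurableSet_le (by fun_prop) (by fun_prop)) (by fun_prop)
      measurable_const
  have hsplit : ∀ x y, u x * u y * ENNReal.ofReal (|x - y| ^ (-a)) ≤ F x y + F y x := by
    intro x y
    simp only [hF]
    rcases le_total (u y) (u x) with h | h
    · rw [if_pos h]; exact le_self_add
    · rw [if_pos h, abs_sub_comm, mul_comm (u x)]; exact le_add_self
  have hswap : ∫⁻ x, ∫⁻ y, F y x = ∫⁻ x, ∫⁻ y, F x y :=
    lintegral_lintegral_swap (f := fun x y => F y x) (mF.comp measurable_swap).aemeasurable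
  have hfin : ∀ᵐ x, u x ≠ ⊤ := by
    have := ae_lt_top (hu.pow_const r) hT
    filter_upwards [this] with x hx h
    rw [h, ENNReal.top_rpow_of_pos hr0] at hx
    exact lt_irrefl _ hx
  have hin : ∀ᵐ x, ∫⁻ y, F x y ≤ ENNReal.ofReal (C₁ * A ^ (1 - a)) * u x ^ r := by
    filter_upwards [hfin] with x hx
    rcases eq_or_ne (u x) 0 with hx0 | hx0
    · simp [hF, hx0]
    obtain ⟨U, hU, hxU⟩ : ∃ U : ℝ, 0 < U ∧ u x = ENNReal.ofReal U :=
      ⟨_, ENNReal.toReal_pos hx0 hx, (ENNReal.ofReal_toReal hx).symm⟩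
    have e : ∀ y, F x y = u x *
        (if u y ≤ ENNReal.ofReal U then u y * ENNReal.ofReal (|x - y| ^ (-a)) else 0) := by
      intro y; simp only [hF, hxU]; split_ifs <;> simp [mul_assoc]
    simp_rw [e]
    rw [lintegral_const_mul' _ _ hx]
    refine (mul_le_mul_right (hls_inner ha ha' hu hA hU hAu x) _).trans_eq ?_
    · 
        rw [hxU, ENNReal.ofReal_rpow_of_pos hU, ← ENNReal.ofReal_mul hU.le,
          ← ENNReal.ofReal_mul (by positivity)]
        congr 1
        have : U ^ r = U * U ^ (a / (2 - a)) := by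
          nth_rw 2 [← Real.rpow_one U]
          rw [← Real.rpow_add hU]; congr 1; rw [hr]; field_simp; ring
        rw [this]; ring
  calc _ ≤ ∫⁻ x, ∫⁻ y, (F x y + F y x) := lintegral_mono fun x => lintegral_mono fun y => hsplit x y
    _ = (∫⁻ x, ∫⁻ y, F x y) + ∫⁻ x, ∫⁻ y, F y x := by
        have : ∀ x, ∫⁻ y, (F x y + F y x) = (∫⁻ y, F x y) + ∫⁻ y, F y x := fun x =>
          lintegral_add_left (f := fun y => F x y) (mF.comp measurable_prodMk_left) _
        simp_rw [this]
        exact lintegral_add_left mF.lintegral_prod_right _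
    _ = 2 * ∫⁻ x, ∫⁻ y, F x y := by rw [hswap, two_mul]
    _ ≤ 2 * ∫⁻ x, ENNReal.ofReal (C₁ * A ^ (1 - a)) * u x ^ r := by
        gcongr 2 * ?_
        exact lintegral_mono_ae hin
    _ = _ := by
        rw [lintegral_const_mul _ (hu.pow_const r), hAu, ENNReal.ofReal_rpow_of_pos hA,
          show (2:ℝ≥0∞) = ENNReal.ofReal 2 by simp, ← ENNReal.ofReal_mul (by positivity),
          ← ENNReal.ofReal_mul (by norm_num), ← ENNReal.ofReal_mul (by positivity)]
        congr 1
        have : A ^ (2 - a) = A ^ (1 - a) * A := by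
          nth_rw 3 [← Real.rpow_one A]
          rw [← Real.rpow_add hA]; congr 1; ring
        rw [this]; ring

end HardyLittlewoodSobolev

/-! ### T T* expansions and Schur's test. -/

section BilinearTools

open Set ENNReal ComplexConjugate

/-- Bounded measurable functions with bounded support. -/
structure IsCore {E : Type*} [NormedAddCommGroup E] [MeasurableSpace E] (F : E → ℂ) : Prop where
  meas : Measurable F
  bdd : ∃ B : ℝ, ∀ z, ‖F z‖ ≤ B
  supp : ∃ M : ℝ, ∀ z, M < ‖z‖ → F z = 0

theorem IsCore.integrable {E : Type*} [NormedAddCommGroup E] [MeasurableSpace E] [BorelSpace E]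
    [ProperSpace E] {F : E → ℂ} (hF : IsCore F) (μ : Measure E) [IsFiniteMeasureOnCompacts μ] :
    Integrable F μ := by
  obtain ⟨B, hB⟩ := hF.bdd
  obtain ⟨M, hM⟩ := hF.supp
  have : IntegrableOn F (Metric.closedBall 0 M) μ := by
    refine Measure.integrableOn_of_bounded (M := B)
      (isCompact_closedBall (0 : E) M).measure_lt_top.ne hF.meas.aestronglyMeasurable ?_
    exact ae_of_all _ hB
  refine (integrableOn_iff_integrable_of_support_subset ?_).1 this
  intro z hz
  by_contra h
  exact hz (hM z (by simpa using h))

theorem lintegral_enorm_sq_eq {X : Type*} [MeasurableSpace X] {ν : Measure X} {a : X → ℂ}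
    (ha : Integrable (fun x => ‖a x‖ ^ 2) ν) :
    ∫⁻ x, ‖a x‖ₑ ^ 2 ∂ν = ‖∫ x, a x * conj (a x) ∂ν‖ₑ := by
  have e : ∀ x, a x * conj (a x) = ((‖a x‖ ^ 2 : ℝ) : ℂ) := fun x => by
    rw [Complex.mul_conj, Complex.normSq_eq_norm_sq]
  simp_rw [e]
  rw [integral_complex_ofReal, ← ofReal_norm, Complex.norm_real, Real.norm_of_nonneg
    (integral_nonneg fun x => by positivity), ofReal_integral_eq_lintegral_ofReal ha
    (ae_of_all _ fun x => by positivity)]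
  refine lintegral_congr fun x => ?_
  rw [ENNReal.ofReal_pow (norm_nonneg _), ofReal_norm]

theorem IsCore.integral_right {F : ℝ × ℝ → ℂ} (hF : IsCore F) :
    IsCore fun x => ∫ y, F (x, y) := by
  obtain ⟨B, hB⟩ := hF.bdd
  obtain ⟨M, hM⟩ := hF.supp
  have hB0 : 0 ≤ B := (norm_nonneg _).trans (hB 0)
  have h0 : ∀ x y, M < |y| → F (x, y) = 0 := fun x y h =>
    hM _ (lt_of_lt_of_le h (by simpa using norm_snd_le (x, y)))
  refine ⟨?_, ⟨B * (volume (Icc (-M) M)).toReal, fun x => ?_⟩, M, fun x hx => ?_⟩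
  · exact (hF.meas.stronglyMeasurable.integral_prod_right').measurable
  · have : ∫ y, F (x, y) = ∫ y in Icc (-M) M, F (x, y) := by
      rw [setIntegral_eq_integral_of_forall_compl_eq_zero]
      intro y hy
      refine h0 x y ?_
      rw [mem_Icc, ← abs_le, not_le] at hy
      exact hy
    rw [this]
    exact norm_setIntegral_le_of_norm_le_const (by simp) (fun y _ => hB _)
  · have : ∀ y, F (x, y) = 0 := fun y =>
      hM _ (lt_of_lt_of_le hx (by simpa using norm_fst_le (x, y)))
    simp [this]

theorem IsCore.integrable_norm_sq {E : Type*} [NormedAddCommGroup E] [MeasurableSpace E]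
    [BorelSpace E] [ProperSpace E] {F : E → ℂ} (hF : IsCore F) (μ : Measure E)
    [IsFiniteMeasureOnCompacts μ] : Integrable (fun x => ‖F x‖ ^ 2) μ := by
  have h : IsCore fun x => F x * conj (F x) := by
    obtain ⟨B, hB⟩ := hF.bdd
    obtain ⟨M, hM⟩ := hF.supp
    refine ⟨hF.meas.mul (Complex.continuous_conj.measurable.comp hF.meas), ⟨B * B, fun z => ?_⟩,
      M, fun z hz => by simp [hM z hz]⟩
    rw [norm_mul, RCLike.norm_conj]
    have := hB z
    have hB0 := (norm_nonneg _).trans (hB z)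
    gcongr
  refine (h.integrable μ).norm.congr (ae_of_all _ fun x => ?_)
  simp [norm_mul, RCLike.norm_conj, sq]

/-- The `T T*` expansion of the `L²` norm of `x ↦ ∫ F(x,y) dy`. -/
theorem lintegral_sq_integral_le {F : ℝ × ℝ → ℂ} (hF : IsCore F) :
    ∫⁻ x, ‖∫ y, F (x, y)‖ₑ ^ 2 ≤
      ∫⁻ τ, ‖∫ z : ℝ × ℝ, F z * conj (F (z.1, z.2 + τ))‖ₑ := by
  have hI := hF.integral_right
  set I : ℝ → ℂ := fun x => ∫ y, F (x, y) with hId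
  rw [lintegral_enorm_sq_eq (hI.integrable_norm_sq volume)]
  obtain ⟨B, hB⟩ := hF.bdd
  obtain ⟨M, hM⟩ := hF.supp
  have hB0 : 0 ≤ B := (norm_nonneg _).trans (hB 0)
  have mconj : Measurable (conj : ℂ → ℂ) := Complex.continuous_conj.measurable
  -- Two points of the support differ by at most 2M in the second coordinate, so τ is confined as
  -- well and Fubini applies.
  have hG : IsCore fun w : (ℝ × ℝ) × ℝ => F w.1 * conj (F (w.1.1, w.1.2 + w.2)) := by
    refine ⟨?_, ⟨B * B, fun w => ?_⟩, 2 * M, fun w hw => ?_⟩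
    · exact (hF.meas.comp measurable_fst).mul (mconj.comp (hF.meas.comp (by fun_prop)))
    · rw [norm_mul, RCLike.norm_conj]
      have h1 := hB w.1
      have h2 := hB (w.1.1, w.1.2 + w.2)
      gcongr
    · by_contra h
      rw [mul_eq_zero, not_or] at h
      have h1 : ‖w.1‖ ≤ M := not_lt.1 fun h' => h.1 (hM _ h')
      have h2 : ‖(w.1.1, w.1.2 + w.2)‖ ≤ M := not_lt.1 fun h' => h.2 (by simp [hM _ h'])
      have h3 : |w.1.2| ≤ M := (norm_snd_le w.1).trans h1
      have h4 : |w.1.2 + w.2| ≤ M := (norm_snd_le (w.1.1, w.1.2 + w.2)).trans h2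
      have h5 : |w.2| ≤ 2 * M := by
        rw [abs_le] at *
        constructor <;> linarith
      have : ‖w‖ ≤ 2 * M := by
        rw [Prod.norm_def]
        exact max_le (by linarith [norm_nonneg w.1]) h5
      linarith
  have hGi := hG.integrable (volume.prod volume)
  have e : ∫ x, I x * conj (I x) = ∫ τ, ∫ z : ℝ × ℝ, F z * conj (F (z.1, z.2 + τ)) := by
    have hsw := integral_prod_symm _ hGi
    rw [integral_prod _ hGi] at hsw
    simp only [← Measure.volume_eq_prod] at hsw
    rw [← hsw]
    have h1 : ∀ z : ℝ × ℝ, ∫ τ, F z * conj (F (z.1, z.2 + τ)) = F z * conj (I z.1) := by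
      intro z
      rw [integral_const_mul, integral_conj]
      congr 2
      exact integral_add_left_eq_self (fun y => F (z.1, y)) z.2
    simp_rw [h1]
    have hc : IsCore fun z : ℝ × ℝ => F z * conj (I z.1) := by
      obtain ⟨B', hB'⟩ := hI.bdd
      refine ⟨hF.meas.mul (mconj.comp (hI.meas.comp measurable_fst)), ⟨B * B', fun w => ?_⟩, M,
        fun w hw => by simp [hM w hw]⟩
      rw [norm_mul, RCLike.norm_conj]
      have h1 := hB w
      have h2 := hB' w.1
      gcongr
    have := integral_prod _ (hc.integrable (volume.prod volume))
    rw [← Measure.volume_eq_prod] at this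
    rw [this]
    refine integral_congr_ae (ae_of_all _ fun x => ?_)
    simp only [hId]
    rw [integral_mul_const]
  rw [e]
  exact enorm_integral_le_lintegral_enorm _

theorem integrable_of_measurable_of_norm_le {Z : Type*} [MeasurableSpace Z] (κ : Measure Z)
    [IsFiniteMeasure κ] {F : Z → ℂ} {B : ℝ} (h1 : Measurable F) (h2 : ∀ z, ‖F z‖ ≤ B) :
    Integrable F κ :=
  Integrable.of_bound h1.aestronglyMeasurable B (ae_of_all _ h2)

theorem integrable_norm_sq_of_norm_le {Z : Type*} [MeasurableSpace Z] (κ : Measure Z)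
    [IsFiniteMeasure κ] {F : Z → ℂ} {B : ℝ} (h1 : Measurable F) (h2 : ∀ z, ‖F z‖ ≤ B) :
    Integrable (fun z => ‖F z‖ ^ 2) κ := by
  refine Integrable.of_bound (h1.norm.pow_const 2).aestronglyMeasurable (B ^ 2)
    (ae_of_all _ fun z => ?_)
  rw [norm_pow, norm_norm]
  exact pow_le_pow_left₀ (norm_nonneg _) (h2 z) 2

/-- Schur's test for a nonnegative symmetric kernel. -/
theorem schur_symmetric {X : Type*} [MeasurableSpace X] {ν : Measure X} [SFinite ν]
    {u : X → ℝ≥0∞} (hu : Measurable u) {K : X → X → ℝ≥0∞} (hKm : Measurable (Function.uncurry K))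
    (hsymm : ∀ x x', K x' x = K x x') {M : ℝ≥0∞} (hM : ∀ x, ∫⁻ x', K x x' ∂ν ≤ M) :
    ∫⁻ x, ∫⁻ x', u x * u x' * K x x' ∂ν ∂ν ≤ M * ∫⁻ x, u x ^ 2 ∂ν := by
  have hamgm : ∀ u v K : ℝ≥0∞, 2 * (u * v * K) ≤ u ^ 2 * K + v ^ 2 * K := fun u v K => by
    have : 2 * (u * v) ≤ u ^ 2 + v ^ 2 := by
      rcases eq_or_ne u ⊤ with rfl | hu
      · simp
      rcases eq_or_ne v ⊤ with rfl | hv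
      · simp
      lift u to NNReal using hu
      lift v to NNReal using hv
      norm_cast
      have := two_mul_le_add_sq (u : ℝ) v
      rw [← mul_assoc]
      exact_mod_cast this
    calc 2 * (u * v * K) = 2 * (u * v) * K := by ring
      _ ≤ (u ^ 2 + v ^ 2) * K := mul_le_mul_left this K
      _ = _ := add_mul _ _ _
  have mK : Measurable fun z : X × X => K z.1 z.2 := hKm
  have mKx : ∀ x, Measurable fun x' => K x x' := fun x => mK.comp measurable_prodMk_left
  have i1 : ∫⁻ x, ∫⁻ x', u x ^ 2 * K x x' ∂ν ∂ν ≤ M * ∫⁻ x, u x ^ 2 ∂ν := by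
    rw [← lintegral_const_mul _ (hu.pow_const 2)]
    refine lintegral_mono fun x => ?_
    rw [lintegral_const_mul _ (mKx x), mul_comm]
    exact mul_le_mul_left (hM x) _
  have i2 : ∫⁻ x, ∫⁻ x', u x' ^ 2 * K x x' ∂ν ∂ν ≤ M * ∫⁻ x, u x ^ 2 ∂ν := by
    rw [lintegral_lintegral_swap]
    · simp_rw [hsymm]
      exact i1
    · exact (((hu.comp measurable_snd).pow_const 2).mul mK).aemeasurable
  have m1 : Measurable fun z : X × X => u z.1 * u z.2 * K z.1 z.2 :=
    ((hu.comp measurable_fst).mul (hu.comp measurable_snd)).mul mK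
  have m2 : Measurable fun z : X × X => u z.1 ^ 2 * K z.1 z.2 :=
    ((hu.comp measurable_fst).pow_const 2).mul mK
  have i3 : 2 * ∫⁻ x, ∫⁻ x', u x * u x' * K x x' ∂ν ∂ν ≤ 2 * (M * ∫⁻ x, u x ^ 2 ∂ν) := by
    calc 2 * ∫⁻ x, ∫⁻ x', u x * u x' * K x x' ∂ν ∂ν
        = ∫⁻ x, ∫⁻ x', 2 * (u x * u x' * K x x') ∂ν ∂ν := by
          rw [← lintegral_const_mul _ m1.lintegral_prod_right']
          refine lintegral_congr fun x => ?_
          have m1x : Measurable fun x' => u x * u x' * K x x' := m1.comp measurable_prodMk_left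
          rw [lintegral_const_mul _ m1x]
      _ ≤ ∫⁻ x, ∫⁻ x', (u x ^ 2 * K x x' + u x' ^ 2 * K x x') ∂ν ∂ν :=
          lintegral_mono fun x => lintegral_mono fun x' => hamgm _ _ _
      _ = (∫⁻ x, ∫⁻ x', u x ^ 2 * K x x' ∂ν ∂ν) + ∫⁻ x, ∫⁻ x', u x' ^ 2 * K x x' ∂ν ∂ν := by
          rw [← lintegral_add_left m2.lintegral_prod_right']
          refine lintegral_congr fun x => ?_
          have m2x : Measurable fun x' => u x ^ 2 * K x x' := m2.comp measurable_prodMk_left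
          rw [lintegral_add_left m2x]
      _ ≤ M * (∫⁻ x, u x ^ 2 ∂ν) + M * ∫⁻ x, u x ^ 2 ∂ν := add_le_add i1 i2
      _ = _ := (two_mul _).symm
  exact (ENNReal.mul_le_mul_iff_right (by norm_num) (by norm_num)).1 i3

/-- Schur's test for `T T*`. -/
theorem schur_TTstar {X Y : Type*} [MeasurableSpace X] [MeasurableSpace Y] {ν : Measure X}
    {ρ : Measure Y} [IsFiniteMeasure ν] [IsFiniteMeasure ρ] {k : X × Y → ℂ} (hk : Measurable k)
    {B : ℝ} (hB : ∀ z, ‖k z‖ ≤ B) {b : Y → ℂ} (hb : Measurable b) {B' : ℝ} (hB' : ∀ y, ‖b y‖ ≤ B')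
    {M : ℝ≥0∞}
    (hM : ∀ x, ∫⁻ x', ‖∫ y, k (x, y) * conj (k (x', y)) ∂ρ‖ₑ ∂ν ≤ M) :
    ∫⁻ x, ‖∫ y, k (x, y) * b y ∂ρ‖ₑ ^ 2 ∂ν ≤ M * ∫⁻ y, ‖b y‖ₑ ^ 2 ∂ρ := by
  have mconj : Measurable (conj : ℂ → ℂ) := Complex.continuous_conj.measurable
  have hB0 : 0 ≤ |B| := abs_nonneg B
  have hB1 : ∀ z, ‖k z‖ ≤ |B| := fun z => (hB z).trans (le_abs_self B)
  have hB2 : ∀ z, ‖b z‖ ≤ |B'| := fun z => (hB' z).trans (le_abs_self B')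
  have hB20 : 0 ≤ |B'| := abs_nonneg B'
  set a : X → ℂ := fun x => ∫ y, k (x, y) * b y ∂ρ with ha
  have hkb : Measurable fun z : X × Y => k z * b z.2 := hk.mul (hb.comp measurable_snd)
  have ham : Measurable a := (hkb.stronglyMeasurable.integral_prod_right' (ν := ρ)).measurable
  obtain ⟨Ba, hBa0, hBa⟩ : ∃ Ba : ℝ, 0 ≤ Ba ∧ ∀ x, ‖a x‖ ≤ Ba := by
    refine ⟨|B| * |B'| * ρ.real univ, by positivity, fun x => ?_⟩
    refine norm_integral_le_of_norm_le_const (ae_of_all _ fun y => ?_)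
    rw [norm_mul]
    exact mul_le_mul (hB1 _) (hB2 _) (norm_nonneg _) hB0
  -- c represents the adjoint applied to a: ‖a‖² is the pairing of b with c, while ‖c‖² is the
  -- quadratic form of the T T* kernel at a, at most M‖a‖² by the symmetric Schur test.
  set c : Y → ℂ := fun y => ∫ x, conj (a x) * k (x, y) ∂ν with hc
  have hak : Measurable fun z : X × Y => conj (a z.1) * k z :=
    (mconj.comp (ham.comp measurable_fst)).mul hk
  have hakB : ∀ z : X × Y, ‖conj (a z.1) * k z‖ ≤ Ba * |B| := fun z => by
    rw [norm_mul, RCLike.norm_conj]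
    exact mul_le_mul (hBa _) (hB1 _) (norm_nonneg _) hBa0
  have hcm : Measurable c := (hak.stronglyMeasurable.integral_prod_left' (μ := ν)).measurable
  obtain ⟨Bc, hBc0, hBc⟩ : ∃ Bc : ℝ, 0 ≤ Bc ∧ ∀ y, ‖c y‖ ≤ Bc :=
    ⟨Ba * |B| * ν.real univ, by positivity, fun y =>
      norm_integral_le_of_norm_le_const (ae_of_all _ fun x => hakB (x, y))⟩
  set Xn : ℝ≥0∞ := ∫⁻ x, ‖a x‖ₑ ^ 2 ∂ν with hXn
  have hXfin : Xn ≠ ⊤ := by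
    rw [hXn, lintegral_enorm_sq_eq (integrable_norm_sq_of_norm_le ν ham hBa)]
    exact enorm_ne_top
  have hX1 : Xn = ‖∫ y, b y * c y ∂ρ‖ₑ := by
    rw [hXn, lintegral_enorm_sq_eq (integrable_norm_sq_of_norm_le ν ham hBa)]
    congr 1
    have e1 : ∀ x, a x * conj (a x) = ∫ y, conj (a x) * k (x, y) * b y ∂ρ := fun x => by
      rw [mul_comm, ha]
      simp only
      rw [← integral_const_mul]
      simp only [mul_assoc]
    simp_rw [e1]
    have hint : Integrable (Function.uncurry fun x y => conj (a x) * k (x, y) * b y)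
        (ν.prod ρ) := by
      refine integrable_of_measurable_of_norm_le _ (B := Ba * |B| * |B'|) (hak.mul (hb.comp measurable_snd)) fun z => ?_
      rw [Function.uncurry, norm_mul]
      exact mul_le_mul (hakB z) (hB2 _) (norm_nonneg _) (by positivity)
    rw [integral_integral_swap hint]
    refine integral_congr_ae (ae_of_all _ fun y => ?_)
    simp only [hc]
    rw [integral_mul_const, mul_comm]
  have hX2 : Xn ^ 2 ≤ (∫⁻ y, ‖b y‖ₑ ^ 2 ∂ρ) * ∫⁻ y, ‖c y‖ₑ ^ 2 ∂ρ := by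
    have h1 : Xn ≤ ∫⁻ y, ‖b y‖ₑ * ‖c y‖ₑ ∂ρ := by
      rw [hX1]
      refine (enorm_integral_le_lintegral_enorm _).trans (le_of_eq ?_)
      simp only [enorm_mul]
    have h2 := ENNReal.lintegral_mul_le_Lp_mul_Lq ρ Real.HolderConjugate.two_two
      hb.enorm.aemeasurable hcm.enorm.aemeasurable
    simp only [Pi.mul_apply, ENNReal.rpow_two] at h2
    calc Xn ^ 2 ≤ ((∫⁻ y, ‖b y‖ₑ ^ 2 ∂ρ) ^ (1 / (2:ℝ)) * (∫⁻ y, ‖c y‖ₑ ^ 2 ∂ρ) ^ (1 / (2:ℝ))) ^ 2 :=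
          pow_le_pow_left' (h1.trans h2) 2
      _ = _ := by
          rw [mul_pow, ← ENNReal.rpow_two, ← ENNReal.rpow_two, ← ENNReal.rpow_mul,
            ← ENNReal.rpow_mul]
          norm_num
  set Kk : X → X → ℂ := fun x x' => ∫ y, k (x, y) * conj (k (x', y)) ∂ρ with hKk
  have hKm : Measurable (Function.uncurry Kk) := by
    have : Measurable fun w : (X × X) × Y => k (w.1.1, w.2) * conj (k (w.1.2, w.2)) :=
      (hk.comp (by fun_prop)).mul (mconj.comp (hk.comp (by fun_prop)))
    exact (this.stronglyMeasurable.integral_prod_right' (ν := ρ)).measurable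
  have hKsymm : ∀ x x', ‖Kk x' x‖ₑ = ‖Kk x x'‖ₑ := fun x x' => by
    have : Kk x' x = conj (Kk x x') := by
      simp only [hKk]
      rw [← integral_conj]
      refine integral_congr_ae (ae_of_all _ fun y => ?_)
      simp only [map_mul, Complex.conj_conj]
      rw [mul_comm]
    rw [this, ← ofReal_norm, RCLike.norm_conj, ofReal_norm]
  have hX3 : ∫⁻ y, ‖c y‖ₑ ^ 2 ∂ρ ≤ M * Xn := by
    have e0 : ∫⁻ y, ‖c y‖ₑ ^ 2 ∂ρ =
        ‖∫ x, ∫ x', conj (a x) * a x' * Kk x x' ∂ν ∂ν‖ₑ := by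
      rw [lintegral_enorm_sq_eq (integrable_norm_sq_of_norm_le ρ hcm hBc)]
      congr 1
      have e1 : ∀ y, c y * conj (c y) = ∫ x, conj (a x) * k (x, y) * conj (c y) ∂ν := fun y => by
        rw [integral_mul_const]
      simp_rw [e1]
      have hint : Integrable (Function.uncurry fun y x => conj (a x) * k (x, y) * conj (c y))
          (ρ.prod ν) := by
        refine integrable_of_measurable_of_norm_le _ (B := Ba * |B| * Bc) ?_ fun z => ?_
        · exact (hak.comp measurable_swap).mul (mconj.comp (hcm.comp measurable_fst))
        · rw [Function.uncurry, norm_mul, RCLike.norm_conj]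
          exact mul_le_mul (hakB (z.2, z.1)) (hBc _) (norm_nonneg _) (by positivity)
      rw [integral_integral_swap hint]
      refine integral_congr_ae (ae_of_all _ fun x => ?_)
      have e2 : ∀ y, conj (a x) * k (x, y) * conj (c y) =
          ∫ x', conj (a x) * k (x, y) * (a x' * conj (k (x', y))) ∂ν := fun y => by
        rw [integral_const_mul]
        congr 1
        simp only [hc]
        rw [← integral_conj]
        simp only [map_mul, Complex.conj_conj]
      simp only [e2]
      have hint2 : Integrable (Function.uncurry fun y x' =>
          conj (a x) * k (x, y) * (a x' * conj (k (x', y)))) (ρ.prod ν) := by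
        refine integrable_of_measurable_of_norm_le _ (B := Ba * |B| * (Ba * |B|)) ?_ fun z => ?_
        · refine Measurable.mul ?_ ?_
          · exact hak.comp (f := fun z : Y × X => (x, z.1)) (by fun_prop)
          · exact (ham.comp measurable_snd).mul (mconj.comp (hk.comp measurable_swap))
        · rw [Function.uncurry, norm_mul, norm_mul (a z.2), RCLike.norm_conj]
          exact mul_le_mul (hakB (x, z.1)) (mul_le_mul (hBa _) (hB1 _) (norm_nonneg _) hBa0)
            (by positivity) (by positivity)
      rw [integral_integral_swap hint2]
      refine integral_congr_ae (ae_of_all _ fun x' => ?_)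
      simp only [hKk]
      rw [← integral_const_mul]
      refine integral_congr_ae (ae_of_all _ fun y => ?_)
      simp only
      ring
    rw [e0]
    refine (enorm_integral_le_lintegral_enorm _).trans ((lintegral_mono fun x =>
      enorm_integral_le_lintegral_enorm _).trans ?_)
    refine le_trans (le_of_eq (lintegral_congr fun x => lintegral_congr fun x' => ?_))
      (schur_symmetric (u := fun x => ‖a x‖ₑ) ham.enorm (K := fun x x' => ‖Kk x x'‖ₑ) hKm.enorm
        (fun x x' => hKsymm x x') hM)
    rw [enorm_mul, enorm_mul, ← ofReal_norm (conj (a x)), RCLike.norm_conj, ofReal_norm]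
  -- From Xn² ≤ ‖b‖²·M·Xn one factor Xn is cancelled; boundedness of a on a finite measure space
  -- makes Xn finite.
  rcases eq_or_ne Xn 0 with h0 | h0
  · rw [h0]; exact zero_le
  have : Xn * Xn ≤ Xn * (M * ∫⁻ y, ‖b y‖ₑ ^ 2 ∂ρ) := by
    calc Xn * Xn = Xn ^ 2 := (sq _).symm
      _ ≤ (∫⁻ y, ‖b y‖ₑ ^ 2 ∂ρ) * (M * Xn) := hX2.trans (by gcongr)
      _ = _ := by ring
  exact (ENNReal.mul_le_mul_iff_right h0 hXfin).1 this

end BilinearTools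

/-! ### Weighted integrals of autocorrelations. -/

section AutoCorrelation

open Set ENNReal

theorem measurable_autocorr {u : ℝ → ℝ≥0∞} (hu : Measurable u) :
    Measurable fun τ : ℝ => ∫⁻ x, u x * u (x + τ) := by
  have : Measurable fun z : ℝ × ℝ => u z.2 * u (z.2 + z.1) :=
    (hu.comp measurable_snd).mul (hu.comp (by fun_prop))
  exact this.lintegral_prod_right'

/-- The substitution y = x+τ turns a weighted autocorrelation into the double integral of the
Hardy–Littlewood–Sobolev inequality. -/
theorem lintegral_autocorr_eq {u : ℝ → ℝ≥0∞} (hu : Measurable u) {k : ℝ → ℝ≥0∞}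
    (hk : Measurable k) (hks : ∀ x, k (-x) = k x) :
    ∫⁻ τ, k τ * ∫⁻ x, u x * u (x + τ) = ∫⁻ x, ∫⁻ y, u x * u y * k (x - y) := by
  have m1 : Measurable fun z : ℝ × ℝ => k z.1 * (u z.2 * u (z.2 + z.1)) :=
    (hk.comp measurable_fst).mul ((hu.comp measurable_snd).mul (hu.comp (by fun_prop)))
  have h1 : ∀ τ, k τ * ∫⁻ x, u x * u (x + τ) = ∫⁻ x, k τ * (u x * u (x + τ)) := fun τ => by
    have : Measurable fun x => u x * u (x + τ) := hu.mul (hu.comp (by fun_prop))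
    rw [lintegral_const_mul _ this]
  simp_rw [h1]
  rw [lintegral_lintegral_swap m1.aemeasurable]
  refine lintegral_congr fun x => ?_
  rw [← lintegral_add_left_eq_self (fun y => u x * u y * k (x - y)) x]
  refine lintegral_congr fun τ => ?_
  rw [show x - (x + τ) = -τ by ring, hks]
  ring

/-- The Hardy–Littlewood–Sobolev inequality for an autocorrelation. -/
theorem hls_autocorr {a : ℝ} (ha : 0 < a) (ha1 : a < 1) :
    ∃ C : ℝ, 0 < C ∧ ∀ u : ℝ → ℝ≥0∞, Measurable u →
      ∫⁻ τ, ENNReal.ofReal (|τ| ^ (-a)) * ∫⁻ x, u x * u (x + τ) ≤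
        ENNReal.ofReal C * (∫⁻ x, u x ^ (2 / (2 - a))) ^ (2 - a) := by
  obtain ⟨C, hC, h⟩ := hardy_littlewood_sobolev ha ha1
  refine ⟨C, hC, fun u hu => ?_⟩
  rw [lintegral_autocorr_eq hu (measurable_ofReal_abs_rpow _) (fun x => by rw [abs_neg])]
  exact h u hu

/-- Cauchy–Schwarz for a product of two square roots with a split weight. -/
theorem lintegral_sqrt_mul_le {a b : ℝ} (hab : a + b = 1) {U V : ℝ → ℝ≥0∞} (hU : Measurable U)
    (hV : Measurable V) :
    ∫⁻ τ, ENNReal.ofReal (|τ| ^ (-(1 / 2) : ℝ)) * (U τ ^ (1 / 2 : ℝ) * V τ ^ (1 / 2 : ℝ)) ≤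
      (∫⁻ τ, ENNReal.ofReal (|τ| ^ (-a)) * U τ) ^ (1 / 2 : ℝ) *
        (∫⁻ τ, ENNReal.ofReal (|τ| ^ (-b)) * V τ) ^ (1 / 2 : ℝ) := by
  have hm : ∀ a : ℝ, Measurable fun τ : ℝ => ENNReal.ofReal (|τ| ^ (-a)) :=
    fun a => measurable_ofReal_abs_rpow _
  have h := ENNReal.lintegral_mul_le_Lp_mul_Lq volume Real.HolderConjugate.two_two
    (f := fun τ => (ENNReal.ofReal (|τ| ^ (-a)) * U τ) ^ (1 / 2 : ℝ))
    (g := fun τ => (ENNReal.ofReal (|τ| ^ (-b)) * V τ) ^ (1 / 2 : ℝ))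
    (((hm a).mul hU).pow_const _).aemeasurable (((hm b).mul hV).pow_const _).aemeasurable
  have e : ∀ t : ℝ≥0∞, (t ^ (1 / 2 : ℝ)) ^ (2 : ℝ) = t := fun t => by
    rw [← ENNReal.rpow_mul]; norm_num
  simp only [e] at h
  refine le_trans (lintegral_mono_ae ?_) h
  have h0 : ∀ᵐ τ : ℝ, τ ≠ 0 := by
    simp [ae_iff, measure_singleton]
  filter_upwards [h0] with τ hτ
  have hτ' : 0 < |τ| := abs_pos.2 hτ
  simp only [Pi.mul_apply]
  rw [ENNReal.mul_rpow_of_nonneg _ _ (by norm_num), ENNReal.mul_rpow_of_nonneg _ _ (by norm_num),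
    ENNReal.ofReal_rpow_of_nonneg (by positivity) (by norm_num),
    ENNReal.ofReal_rpow_of_nonneg (by positivity) (by norm_num), ← Real.rpow_mul hτ'.le,
    ← Real.rpow_mul hτ'.le]
  have : ENNReal.ofReal (|τ| ^ (-(1 / 2) : ℝ)) =
      ENNReal.ofReal (|τ| ^ (-a * (1 / 2))) * ENNReal.ofReal (|τ| ^ (-b * (1 / 2))) := by
    rw [← ENNReal.ofReal_mul (by positivity), ← Real.rpow_add hτ']
    congr 2
    linarith
  rw [this]
  exact le_of_eq (by ring)

/-- Cauchy–Schwarz distributes the weight |τ|^(-1/2) unevenly, so that the two functions may lie in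
different Lebesgue spaces. -/
theorem hls_autocorr_pair {a b : ℝ} (ha : 0 < a) (hb : 0 < b) (hab : a + b = 1) :
    ∃ C : ℝ, 0 < C ∧ ∀ u v : ℝ → ℝ≥0∞, Measurable u → Measurable v →
      ∫⁻ τ, ENNReal.ofReal (|τ| ^ (-(1 / 2) : ℝ)) *
          ((∫⁻ x, u x * u (x + τ)) ^ (1 / 2 : ℝ) * (∫⁻ x, v x * v (x + τ)) ^ (1 / 2 : ℝ)) ≤
        ENNReal.ofReal C * ((∫⁻ x, u x ^ (2 / (2 - a))) ^ ((2 - a) / 2) *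
          (∫⁻ x, v x ^ (2 / (2 - b))) ^ ((2 - b) / 2)) := by
  obtain ⟨C1, hC1, h1⟩ := hls_autocorr ha (by linarith)
  obtain ⟨C2, hC2, h2⟩ := hls_autocorr hb (by linarith)
  refine ⟨C1 ^ (1 / 2 : ℝ) * C2 ^ (1 / 2 : ℝ), by positivity, fun u v hu hv => ?_⟩
  refine (lintegral_sqrt_mul_le hab (measurable_autocorr hu) (measurable_autocorr hv)).trans ?_
  refine (mul_le_mul' (ENNReal.rpow_le_rpow (h1 u hu) (by norm_num))
    (ENNReal.rpow_le_rpow (h2 v hv) (by norm_num))).trans (le_of_eq ?_)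
  rw [ENNReal.mul_rpow_of_nonneg _ _ (by norm_num), ENNReal.mul_rpow_of_nonneg _ _ (by norm_num),
    ENNReal.ofReal_mul (by positivity), ENNReal.ofReal_rpow_of_nonneg hC1.le (by norm_num),
    ENNReal.ofReal_rpow_of_nonneg hC2.le (by norm_num), ← ENNReal.rpow_mul, ← ENNReal.rpow_mul,
    mul_one_div, mul_one_div]
  ring

end AutoCorrelation

/-! ### Nonstationary phase: two integrations by parts. -/

section Oscillation

open Set Complex

theorem hasDerivAt_zero_of_notMem_tsupport {ψ : ℝ → ℂ} {F : ℝ → ℂ} (hF : ∀ y, ψ y = 0 → F y = 0)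
    {y : ℝ} (hy : y ∉ tsupport ψ) : HasDerivAt F 0 y := by
  have : F =ᶠ[nhds y] fun _ => 0 := by
    have h := (notMem_tsupport_iff_eventuallyEq.1 hy)
    filter_upwards [h] with z hz
    exact hF z hz
  exact (hasDerivAt_const y (0 : ℂ)).congr_of_eventuallyEq this

/-- Two integrations by parts in an oscillatory integral. -/
theorem norm_integral_mul_exp_le {ψ ψ1 ψ2 : ℝ → ℂ} {θ θ1 u u1 : ℝ → ℝ} {a0 w D B E0 α : ℝ}
    (hw : 0 < w) (hD : 0 ≤ D) (hB : 0 ≤ B) (ha0 : 0 ≤ a0) (hE0 : 0 ≤ E0)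
    (hψ : ∀ y, HasDerivAt ψ (ψ1 y) y) (hψ1 : ∀ y, HasDerivAt ψ1 (ψ2 y) y)
    (hsupp : ∀ y, ψ y ≠ 0 → y ∈ Icc α (α + w))
    (hb0 : ∀ y, ‖ψ y‖ ≤ a0) (hb1 : ∀ y, ‖ψ1 y‖ ≤ a0 / w) (hb2 : ∀ y, ‖ψ2 y‖ ≤ a0 / w ^ 2)
    (hθ : ∀ y ∈ tsupport ψ, HasDerivAt θ (θ1 y) y)
    (hθ1 : ∀ y ∈ tsupport ψ, HasDerivAt θ1 (u y) y)
    (hu : ∀ y ∈ tsupport ψ, HasDerivAt u (u1 y) y)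
    (hθD : ∀ y ∈ tsupport ψ, D ≤ |θ1 y|)
    (huB : ∀ y ∈ tsupport ψ, |u y| ≤ B * D / w)
    (hu1B : ∀ y ∈ tsupport ψ, |u1 y| ≤ B * D / w ^ 2 + E0) :
    ‖∫ y, ψ y * exp (I * θ y)‖ ≤ 14 * (1 + B) ^ 2 * a0 * w / (1 + (w * D) ^ 2) +
      a0 * E0 * w / D ^ 3 := by
  have hnorm : ∀ y, ‖exp (I * θ y)‖ = 1 := fun y => by
    rw [mul_comm]; exact norm_exp_ofReal_mul_I (θ y)
  have htr : ∀ (G : ℝ → ℂ) (C : ℝ), (∀ y, ψ y = 0 → y ∉ Icc α (α + w) → G y = 0) →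
      (∀ y, ‖G y‖ ≤ C) → ‖∫ y, G y‖ ≤ C * w := fun G C h1 h2 => by
    have : ∫ y, G y = ∫ y in Icc α (α + w), G y := by
      rw [setIntegral_eq_integral_of_forall_compl_eq_zero]
      intro y hy
      refine h1 y ?_ hy
      by_contra h
      exact hy (hsupp y h)
    rw [this]
    refine (norm_setIntegral_le_of_norm_le_const (by simp) (fun y _ => h2 y)).trans ?_
    simp [hw.le]
  have hwD : 0 ≤ w * D := by positivity
  -- Without a full oscillation across the support the trivial bound a0·w is enough.
  rcases lt_or_ge (w * D) 1 with hlt | hge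
  · have h1 : ‖∫ y, ψ y * exp (I * θ y)‖ ≤ a0 * w := by
      refine htr _ _ (fun y h _ => by simp [h]) fun y => ?_
      rw [norm_mul, hnorm, mul_one]
      exact hb0 y
    refine h1.trans (le_add_of_le_of_nonneg ?_ (by positivity))
    rw [le_div_iff₀ (by positivity)]
    have h2 : (w * D) ^ 2 ≤ 1 := pow_le_one₀ hwD hlt.le
    have h3 : 0 ≤ a0 * w := by positivity
    have h4 : (1:ℝ) ≤ (1 + B) ^ 2 := by nlinarith
    nlinarith
  have hD0 : 0 < D := by
    rcases hD.lt_or_eq with h | h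
    · exact h
    · rw [← h] at hge; norm_num at hge
  have hts : ∀ y ∈ tsupport ψ, (θ1 y : ℂ) ≠ 0 := fun y hy => by
    have := hθD y hy
    rw [Ne, ofReal_eq_zero]
    intro h0
    rw [h0, abs_zero] at this
    linarith
  have htsIcc : tsupport ψ ⊆ Icc α (α + w) := by
    refine closure_minimal (fun y hy => hsupp y hy) isClosed_Icc
  have hψ0 : ∀ y, y ∉ tsupport ψ → ψ y = 0 := fun y hy => image_eq_zero_of_notMem_tsupport hy
  have hψ10 : ∀ y, y ∉ tsupport ψ → ψ1 y = 0 := fun y hy =>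
    (hψ y).unique (hasDerivAt_zero_of_notMem_tsupport (fun _ h => h) hy)
  -- F collects the boundary terms of both integrations by parts, so that F' = iψe^{iθ} + E, with E
  -- of second order in 1/θ'. The part of u1 not proportional to D enters E only over θ'³, hence the
  -- separate term with E0.
  set F : ℝ → ℂ := fun y => (ψ y / θ1 y + I * (ψ1 y / θ1 y ^ 2 - ψ y * u y / θ1 y ^ 3)) *
    exp (I * θ y) with hF
  set E : ℝ → ℂ := fun y => (I * (ψ2 y / θ1 y ^ 2 -
    3 * (ψ1 y * u y / θ1 y ^ 3) - ψ y * u1 y / θ1 y ^ 3 +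
    3 * (ψ y * u y ^ 2 / θ1 y ^ 4))) * exp (I * θ y) with hE
  have hFd : ∀ y ∈ tsupport ψ, HasDerivAt F (I * (ψ y * exp (I * θ y)) + E y) y := by
    intro y hy
    have hn := hts y hy
    have d1 : HasDerivAt (fun y => (θ y : ℂ)) (θ1 y) y := (hθ y hy).ofReal_comp
    have d2 : HasDerivAt (fun y => (θ1 y : ℂ)) (u y) y := (hθ1 y hy).ofReal_comp
    have d3 : HasDerivAt (fun y => (u y : ℂ)) (u1 y) y := (hu y hy).ofReal_comp
    have d4 := (d1.const_mul I).cexp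
    have d5 := ((((hψ y).div d2 hn)).add ((((hψ1 y).div (d2.pow 2) (pow_ne_zero 2 hn)).sub
      (((hψ y).mul d3).div (d2.pow 3) (pow_ne_zero 3 hn))).const_mul I)).mul d4
    refine (d5.congr_deriv ?_)
    simp only [hE, Pi.div_apply, Pi.mul_apply, Pi.pow_apply, Pi.add_apply, Pi.sub_apply]
    push_cast
    have hI : I ^ 2 = -1 := I_sq
    field_simp
    ring_nf
    rw [hI]
    ring
  have hEb : ∀ y ∈ tsupport ψ, ‖E y‖ ≤ 7 * (1 + B) ^ 2 * a0 / (w * D) ^ 2 + a0 * E0 / D ^ 3 := by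
    intro y hy
    simp only [hE]
    rw [norm_mul, hnorm, mul_one]
    have hd := hθD y hy
    have p2 : D ^ 2 ≤ |θ1 y| ^ 2 := pow_le_pow_left₀ hD hd 2
    have p3 : D ^ 3 ≤ |θ1 y| ^ 3 := pow_le_pow_left₀ hD hd 3
    have p4 : D ^ 4 ≤ |θ1 y| ^ 4 := pow_le_pow_left₀ hD hd 4
    have q2 : ∀ N b : ℝ, N ≤ b → 0 ≤ b → N / |θ1 y| ^ 2 ≤ b / D ^ 2 := fun N b h h' => by gcongr
    have q3 : ∀ N b : ℝ, N ≤ b → 0 ≤ b → N / |θ1 y| ^ 3 ≤ b / D ^ 3 := fun N b h h' => by gcongr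
    have q4 : ∀ N b : ℝ, N ≤ b → 0 ≤ b → N / |θ1 y| ^ 4 ≤ b / D ^ 4 := fun N b h h' => by gcongr
    set X : ℝ := a0 / (w * D) ^ 2 with hX
    have hX0 : 0 ≤ X := by positivity
    have b0 := hb0 y
    have b1 := hb1 y
    have b2 := hb2 y
    have bu := huB y hy
    have bu1 := hu1B y hy
    have nn : ∀ t : ℝ, ‖(t : ℂ)‖ = |t| := fun t => by rw [norm_real, Real.norm_eq_abs]
    have t2 : ‖ψ2 y / θ1 y ^ 2‖ ≤ X := by
      rw [norm_div, norm_pow, nn]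
      refine (q2 _ (a0 / w ^ 2) b2 (by positivity)).trans (le_of_eq ?_)
      rw [hX]; field_simp
    have t3 : ‖3 * (ψ1 y * u y / θ1 y ^ 3)‖ ≤ 3 * (B * X) := by
      rw [norm_mul, norm_div, norm_mul, norm_pow, nn, nn]
      refine mul_le_mul (by simp) ?_ (by positivity) (by norm_num)
      refine (q3 _ ((a0 / w) * (B * D / w)) (by gcongr) (by positivity)).trans (le_of_eq ?_)
      rw [hX]; field_simp
    have t5 : ‖ψ y * u1 y / θ1 y ^ 3‖ ≤ B * X + a0 * E0 / D ^ 3 := by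
      rw [norm_div, norm_mul, norm_pow, nn, nn]
      refine (q3 _ (a0 * (B * D / w ^ 2 + E0)) (by gcongr) (by positivity)).trans (le_of_eq ?_)
      rw [hX]; field_simp
    have t6 : ‖3 * (ψ y * u y ^ 2 / θ1 y ^ 4)‖ ≤ 3 * (B ^ 2 * X) := by
      rw [norm_mul, norm_div, norm_mul, norm_pow, norm_pow, nn, nn]
      refine mul_le_mul (by simp) ?_ (by positivity) (by norm_num)
      refine (q4 _ (a0 * (B * D / w) ^ 2) (by gcongr) (by positivity)).trans (le_of_eq ?_)
      rw [hX]; field_simp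
    have tot : ∀ z2 z3 z5 z6 : ℂ, ‖I * (z2 - z3 - z5 + z6)‖ ≤
        ‖z2‖ + ‖z3‖ + ‖z5‖ + ‖z6‖ := fun z2 z3 z5 z6 => by
      rw [norm_mul, norm_I, one_mul]
      refine (norm_add_le _ _).trans ?_
      gcongr
      refine (norm_sub_le _ _).trans ?_
      gcongr
      exact norm_sub_le _ _
    refine (tot _ _ _ _).trans ?_
    have : 7 * (1 + B) ^ 2 * a0 / (w * D) ^ 2 = 7 * (1 + B) ^ 2 * X := by rw [hX]; ring
    rw [this]
    nlinarith [mul_nonneg hB hX0, mul_nonneg (sq_nonneg B) hX0]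
  have hEb' : ∀ y, y ∉ tsupport ψ → deriv F y - I * (ψ y * exp (I * θ y)) = 0 := by
    intro y hy
    have : F =ᶠ[nhds y] fun _ => 0 := by
      have ho : (tsupport ψ)ᶜ ∈ nhds y := (isClosed_tsupport ψ).isOpen_compl.mem_nhds hy
      filter_upwards [ho] with z hz
      simp [hF, hψ0 z hz, hψ10 z hz]
    rw [((hasDerivAt_const y (0 : ℂ)).congr_of_eventuallyEq this).deriv, hψ0 y hy]
    simp
  have hFd' : ∀ y, HasDerivAt F (deriv F y) y := by
    intro y
    by_cases hy : y ∈ tsupport ψ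
    · exact (hFd y hy).differentiableAt.hasDerivAt
    · have : F =ᶠ[nhds y] fun _ => 0 := by
        have ho : (tsupport ψ)ᶜ ∈ nhds y := (isClosed_tsupport ψ).isOpen_compl.mem_nhds hy
        filter_upwards [ho] with z hz
        simp [hF, hψ0 z hz, hψ10 z hz]
      exact ((hasDerivAt_const y (0 : ℂ)).congr_of_eventuallyEq
        this).differentiableAt.hasDerivAt
  have hpc : Continuous fun y => ψ y * exp (I * θ y) := by
    rw [continuous_iff_continuousAt]
    intro y
    by_cases hy : y ∈ tsupport ψ
    · exact ((hψ y).mul (((hθ y hy).ofReal_comp).const_mul I).cexp).continuousAt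
    · exact (hasDerivAt_zero_of_notMem_tsupport (F := fun y => ψ y * exp (I * θ y))
        (fun z hz => by simp [hz]) hy).continuousAt
  have hcs : ∀ G : ℝ → ℂ, (∀ y, y ∉ tsupport ψ → G y = 0) → HasCompactSupport G := fun G hG =>
    HasCompactSupport.intro (isCompact_Icc (a := α) (b := α + w)) fun y hy =>
      hG y fun h => hy (htsIcc h)
  have hpi : Integrable fun y => ψ y * exp (I * θ y) :=
    hpc.integrable_of_hasCompactSupport (hcs _ fun y hy => by simp [hψ0 y hy])
  have hFi : Integrable F := by
    refine Continuous.integrable_of_hasCompactSupport ?_ (hcs _ fun y hy => by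
      simp [hF, hψ0 y hy, hψ10 y hy])
    exact continuous_iff_continuousAt.2 fun y => (hFd' y).continuousAt
  set G : ℝ → ℂ := fun y => deriv F y - I * (ψ y * exp (I * θ y)) with hG
  have hGb : ∀ y, ‖G y‖ ≤ 7 * (1 + B) ^ 2 * a0 / (w * D) ^ 2 + a0 * E0 / D ^ 3 := fun y => by
    by_cases hy : y ∈ tsupport ψ
    · have : G y = E y := by
        simp only [hG]
        rw [(hFd y hy).deriv]; ring
      rw [this]
      exact hEb y hy
    · rw [show G y = 0 from hEb' y hy, norm_zero]
      positivity
  have hG0 : ∀ y, y ∉ Icc α (α + w) → G y = 0 := fun y hy => hEb' y fun h => hy (htsIcc h)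
  have hGi : Integrable G := by
    have hm : AEStronglyMeasurable G volume :=
      ((measurable_deriv F).sub ((measurable_const.mul hpc.measurable))).aestronglyMeasurable
    have : IntegrableOn G (Icc α (α + w)) := Measure.integrableOn_of_bounded
      (M := 7 * (1 + B) ^ 2 * a0 / (w * D) ^ 2 + a0 * E0 / D ^ 3) (by simp) hm (ae_of_all _ hGb)
    refine (integrableOn_iff_integrable_of_support_subset ?_).1 this
    intro y hy
    by_contra h
    exact hy (hG0 y h)
  have hFi' : Integrable (deriv F) := by
    refine (hGi.add (hpi.const_mul I)).congr (ae_of_all _ fun y => ?_)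
    simp [hG]
  have hz := integral_eq_zero_of_hasDerivAt_of_integrable hFd' hFi' hFi
  have key : I * ∫ y, ψ y * exp (I * θ y) = -∫ y, G y := by
    rw [hG, integral_sub hFi' (hpi.const_mul I), hz, integral_const_mul]
    ring
  have : ‖∫ y, ψ y * exp (I * θ y)‖ = ‖∫ y, G y‖ := by
    rw [← norm_neg (∫ y, G y), ← key, norm_mul, norm_I, one_mul]
  rw [this]
  refine (htr G _ (fun y _ h => hG0 y h) hGb).trans ?_
  rw [add_mul, div_mul_eq_mul_div, div_mul_eq_mul_div]
  gcongr ?_ + _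
  -- As wD ≥ 1, 1/(wD)² ≤ 2/(1+(wD)²); this doubles 7 to 14.
  rw [div_le_div_iff₀ (by positivity) (by positivity)]
  have h1 : 1 ≤ (w * D) ^ 2 := one_le_pow₀ hge
  have h3 : 0 ≤ 7 * (1 + B) ^ 2 * a0 * w := by positivity
  nlinarith

end Oscillation

/-! ### Partial derivatives of functions smooth on an open subset of the plane. -/

section PartialCalculus

open Set

variable {E : Type*} [NormedAddCommGroup E] [NormedSpace ℝ E] {F G : ℝ × ℝ → E} {U : Set (ℝ × ℝ)}

theorem ContDiffOn.differentiableAt_of_isOpen (hF : ContDiffOn ℝ ∞ F U) (hU : IsOpen U)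
    {z : ℝ × ℝ} (hz : z ∈ U) : DifferentiableAt ℝ F z :=
  (hF.contDiffAt (hU.mem_nhds hz)).differentiableAt (by simp)

theorem hasDerivAt_line (hF : ContDiffOn ℝ ∞ F U) (hU : IsOpen U) {z v : ℝ × ℝ} {t : ℝ}
    (hz : z + t • v ∈ U) :
    HasDerivAt (fun t : ℝ => F (z + t • v)) (fderiv ℝ F (z + t • v) v) t := by
  have h1 := (hF.differentiableAt_of_isOpen hU hz).hasFDerivAt
  have h2 : HasDerivAt (fun t : ℝ => z + t • v) v t := by
    simpa using ((hasDerivAt_id t).smul_const v).const_add z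
  exact h1.comp_hasDerivAt t h2

theorem hasDerivAt_fst (hF : ContDiffOn ℝ ∞ F U) (hU : IsOpen U) {x y : ℝ} (hz : (x, y) ∈ U) :
    HasDerivAt (fun t => F (t, y)) (fderiv ℝ F (x, y) (1, 0)) x := by
  have h := hasDerivAt_line hF hU (z := (0, y)) (v := (1, 0)) (t := x) (by simpa using hz)
  simpa using h

theorem hasDerivAt_snd (hF : ContDiffOn ℝ ∞ F U) (hU : IsOpen U) {x y : ℝ} (hz : (x, y) ∈ U) :
    HasDerivAt (fun t => F (x, t)) (fderiv ℝ F (x, y) (0, 1)) y := by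
  have h := hasDerivAt_line hF hU (z := (x, 0)) (v := (0, 1)) (t := y) (by simpa using hz)
  simpa using h

theorem partialX_eq_fderiv (hF : ContDiffOn ℝ ∞ F U) (hU : IsOpen U) {z : ℝ × ℝ} (hz : z ∈ U) :
    partialX F z = fderiv ℝ F z (1, 0) := (hasDerivAt_fst hF hU (x := z.1) (y := z.2) hz).deriv

theorem partialY_eq_fderiv (hF : ContDiffOn ℝ ∞ F U) (hU : IsOpen U) {z : ℝ × ℝ} (hz : z ∈ U) :
    partialY F z = fderiv ℝ F z (0, 1) := (hasDerivAt_snd hF hU (x := z.1) (y := z.2) hz).deriv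

theorem hasDerivAt_partialX (hF : ContDiffOn ℝ ∞ F U) (hU : IsOpen U) {x y : ℝ}
    (hz : (x, y) ∈ U) : HasDerivAt (fun t => F (t, y)) (partialX F (x, y)) x := by
  rw [partialX_eq_fderiv hF hU hz]; exact hasDerivAt_fst hF hU hz

theorem hasDerivAt_partialY (hF : ContDiffOn ℝ ∞ F U) (hU : IsOpen U) {x y : ℝ}
    (hz : (x, y) ∈ U) : HasDerivAt (fun t => F (x, t)) (partialY F (x, y)) y := by
  rw [partialY_eq_fderiv hF hU hz]; exact hasDerivAt_snd hF hU hz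

theorem fderiv_antidiagonal (hF : ContDiffOn ℝ ∞ F U) (hU : IsOpen U) {z : ℝ × ℝ} (hz : z ∈ U) :
    fderiv ℝ F z (1, -1) = partialX F z - partialY F z := by
  rw [partialX_eq_fderiv hF hU hz, partialY_eq_fderiv hF hU hz, ← map_sub]
  simp

theorem contDiffOn_fderiv_apply (hF : ContDiffOn ℝ ∞ F U) (hU : IsOpen U) (v : ℝ × ℝ) :
    ContDiffOn ℝ ∞ (fun z => fderiv ℝ F z v) U :=
  (hF.fderiv_of_isOpen hU (by simp)).clm_apply contDiffOn_const

theorem ContDiffOn.partialX (hF : ContDiffOn ℝ ∞ F U) (hU : IsOpen U) :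
    ContDiffOn ℝ ∞ (partialX F) U :=
  (contDiffOn_fderiv_apply hF hU (1, 0)).congr fun _ hz => partialX_eq_fderiv hF hU hz

theorem ContDiffOn.partialY (hF : ContDiffOn ℝ ∞ F U) (hU : IsOpen U) :
    ContDiffOn ℝ ∞ (partialY F) U :=
  (contDiffOn_fderiv_apply hF hU (0, 1)).congr fun _ hz => partialY_eq_fderiv hF hU hz

theorem fderiv_apply_comm (hF : ContDiffOn ℝ ∞ F U) (hU : IsOpen U) {z : ℝ × ℝ} (hz : z ∈ U)
    (v w : ℝ × ℝ) :
    fderiv ℝ (fun z => fderiv ℝ F z v) z w = fderiv ℝ (fun z => fderiv ℝ F z w) z v := by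
  have hs : IsSymmSndFDerivAt ℝ F z := by
    refine (hF.contDiffAt (hU.mem_nhds hz)).isSymmSndFDerivAt ?_
    simp only [minSmoothness_of_isRCLikeNormedField]
    exact WithTop.coe_le_coe.2 le_top
  have hd : DifferentiableAt ℝ (fderiv ℝ F) z :=
    ((hF.fderiv_of_isOpen hU (m := ∞) (by simp)).contDiffAt
      (hU.mem_nhds hz)).differentiableAt (by simp)
  have e : ∀ v w, fderiv ℝ (fun z => fderiv ℝ F z v) z w = fderiv ℝ (fderiv ℝ F) z w v := by
    intro v w
    rw [fderiv_clm_apply hd (differentiableAt_const v)]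
    simp
  rw [e, e]
  exact hs w v

theorem fderiv_congr_of_isOpen (hU : IsOpen U) (h : EqOn F G U) {z : ℝ × ℝ} (hz : z ∈ U) :
    fderiv ℝ F z = fderiv ℝ G z :=
  Filter.EventuallyEq.fderiv_eq (h.eventuallyEq_of_mem (hU.mem_nhds hz))

theorem partialX_congr (hU : IsOpen U) (h : EqOn F G U) : EqOn (partialX F) (partialX G) U := by
  intro z hz
  refine Filter.EventuallyEq.deriv_eq ?_
  have : ∀ᶠ t in nhds z.1, (t, z.2) ∈ U :=
    (Continuous.prodMk_left z.2).continuousAt.eventually (hU.mem_nhds hz)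
  filter_upwards [this] with t ht using h ht

theorem partialY_congr (hU : IsOpen U) (h : EqOn F G U) : EqOn (partialY F) (partialY G) U := by
  intro z hz
  refine Filter.EventuallyEq.deriv_eq ?_
  have : ∀ᶠ t in nhds z.2, (z.1, t) ∈ U :=
    (Continuous.prodMk_right z.1).continuousAt.eventually (hU.mem_nhds hz)
  filter_upwards [this] with t ht using h ht

theorem partialX_partialY_comm (hF : ContDiffOn ℝ ∞ F U) (hU : IsOpen U) :
    EqOn (partialX (partialY F)) (partialY (partialX F)) U := by
  intro z hz
  rw [partialX_eq_fderiv (hF.partialY hU) hU hz, partialY_eq_fderiv (hF.partialX hU) hU hz,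
    fderiv_congr_of_isOpen hU (fun w hw => partialY_eq_fderiv hF hU hw) hz,
    fderiv_congr_of_isOpen hU (fun w hw => partialX_eq_fderiv hF hU hw) hz]
  exact fderiv_apply_comm hF hU hz _ _

theorem partialX_sub (hF : ContDiffOn ℝ ∞ F U) (hG : ContDiffOn ℝ ∞ G U) (hU : IsOpen U) :
    EqOn (partialX fun z => F z - G z) (fun z => partialX F z - partialX G z) U := by
  intro z hz
  exact ((hasDerivAt_partialX hF hU (x := z.1) (y := z.2) hz).sub
    (hasDerivAt_partialX hG hU (x := z.1) (y := z.2) hz)).deriv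

theorem partialY_sub (hF : ContDiffOn ℝ ∞ F U) (hG : ContDiffOn ℝ ∞ G U) (hU : IsOpen U) :
    EqOn (partialY fun z => F z - G z) (fun z => partialY F z - partialY G z) U := by
  intro z hz
  exact ((hasDerivAt_partialY hF hU (x := z.1) (y := z.2) hz).sub
    (hasDerivAt_partialY hG hU (x := z.1) (y := z.2) hz)).deriv

end PartialCalculus

/-! ### Factoring D through a vertical derivative, and double differences over parallelograms. -/

section PhaseOperator

open Set

variable {S Ψ : ℝ × ℝ → ℝ} {U : Set (ℝ × ℝ)}

/-- The second-order operator `∂ₓ(∂ₓ - ∂_y)`. -/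
noncomputable def opQ (Ψ : ℝ × ℝ → ℝ) : ℝ × ℝ → ℝ :=
  partialX fun z => partialX Ψ z - partialY Ψ z

theorem ContDiffOn.opQ (h : ContDiffOn ℝ ∞ Ψ U) (hU : IsOpen U) : ContDiffOn ℝ ∞ (opQ Ψ) U :=
  ((h.partialX hU).sub (h.partialY hU)).partialX hU

theorem opQ_partialY (h : ContDiffOn ℝ ∞ Ψ U) (hU : IsOpen U) :
    EqOn (opQ (partialY Ψ)) (partialY (opQ Ψ)) U := by
  intro z hz
  have h1 : EqOn (fun z => partialX (partialY Ψ) z - partialY (partialY Ψ) z)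
      (partialY fun z => partialX Ψ z - partialY Ψ z) U := fun w hw => by
    rw [partialY_sub (h.partialX hU) (h.partialY hU) hU hw]
    simp only [partialX_partialY_comm h hU hw]
  rw [opQ, partialX_congr hU h1 hz]
  exact partialX_partialY_comm ((h.partialX hU).sub (h.partialY hU)) hU hz

/-- The order of differentiation is chosen so that parallelogram differences of the successive
vertical derivatives of S are governed by DS, ∂_y DS and ∂_y² DS, which are the quantities under
control. -/
theorem opD_eq_opQ (h : ContDiffOn ℝ ∞ S U) (hU : IsOpen U) :
    EqOn (opD S) (opQ (partialY S)) U := by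
  intro z hz
  rw [opQ_partialY h hU hz]
  exact partialX_partialY_comm ((h.partialX hU).sub (h.partialY hU)) hU hz

theorem ContDiffOn.opD (h : ContDiffOn ℝ ∞ S U) (hU : IsOpen U) : ContDiffOn ℝ ∞ (opD S) U :=
  (((h.partialX hU).sub (h.partialY hU)).partialY hU).partialX hU

theorem partialY_opD (h : ContDiffOn ℝ ∞ S U) (hU : IsOpen U) :
    EqOn (partialY (opD S)) (opQ (partialY (partialY S))) U := fun z hz => by
  rw [opQ_partialY (h.partialY hU) hU hz]
  exact partialY_congr hU (opD_eq_opQ h hU) hz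

theorem partialY_partialY_opD (h : ContDiffOn ℝ ∞ S U) (hU : IsOpen U) :
    EqOn (partialY (partialY (opD S))) (opQ (partialY (partialY (partialY S)))) U := fun z hz => by
  rw [opQ_partialY ((h.partialY hU).partialY hU) hU hz]
  exact partialY_congr hU (partialY_opD h hU) hz

theorem DirConvex.horizontal {X : Set (ℝ × ℝ)} (h : DirConvex (1, 0) X) {x x' ξ y : ℝ}
    (h1 : (x, y) ∈ X) (h2 : (x', y) ∈ X) (hξ : ξ ∈ uIcc x x') : (ξ, y) ∈ X := by
  refine h _ h1 _ h2 ⟨x - x', by simp⟩ ?_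
  rw [← segment_eq_uIcc] at hξ
  obtain ⟨a, b, ha, hb, hab, rfl⟩ := hξ
  refine ⟨a, b, ha, hb, hab, ?_⟩
  ext
  · simp
  · simp [← add_mul, hab]

theorem DirConvex.vertical {X : Set (ℝ × ℝ)} (h : DirConvex (0, 1) X) {x y y' η : ℝ}
    (h1 : (x, y) ∈ X) (h2 : (x, y') ∈ X) (hη : η ∈ uIcc y y') : (x, η) ∈ X := by
  refine h _ h1 _ h2 ⟨y - y', by simp⟩ ?_
  rw [← segment_eq_uIcc] at hη
  obtain ⟨a, b, ha, hb, hab, rfl⟩ := hη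
  refine ⟨a, b, ha, hb, hab, ?_⟩
  ext
  · simp [← add_mul, hab]
  · simp

theorem DirConvex.antidiagonal {X : Set (ℝ × ℝ)} (h : DirConvex (-1, 1) X) {s y y' η : ℝ}
    (h1 : (s - y, y) ∈ X) (h2 : (s - y', y') ∈ X) (hη : η ∈ uIcc y y') : (s - η, η) ∈ X := by
  refine h _ h1 _ h2 ⟨y - y', by simp⟩ ?_
  rw [← segment_eq_uIcc] at hη
  obtain ⟨a, b, ha, hb, hab, rfl⟩ := hη
  refine ⟨a, b, ha, hb, hab, ?_⟩
  ext
  · simp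
    linear_combination s * hab
  · simp

/-- The double difference of a function over a parallelogram with sides `(1,0)` and `(-1,1)`. -/
theorem exists_parallelogram_difference {X : Set (ℝ × ℝ)} (hX1 : DirConvex (1, 0) X)
    (hX2 : DirConvex (-1, 1) X) (hXU : X ⊆ U) (hU : IsOpen U) (hΨ : ContDiffOn ℝ ∞ Ψ U)
    {x x' y τ : ℝ} (h1 : (x, y) ∈ X) (h2 : (x', y) ∈ X) (h3 : (x - τ, y + τ) ∈ X)
    (h4 : (x' - τ, y + τ) ∈ X) :
    ∃ z ∈ X, Ψ (x, y) - Ψ (x - τ, y + τ) - (Ψ (x', y) - Ψ (x' - τ, y + τ)) =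
      (x - x') * τ * opQ Ψ z := by
  -- A mean value theorem for unordered, possibly equal endpoints: neither x-x' nor τ has a
  -- prescribed sign.
  have mvt : ∀ (f f' : ℝ → ℝ) (a b : ℝ), (∀ t ∈ uIcc a b, HasDerivAt f (f' t) t) →
      ∃ ξ ∈ uIcc a b, f b - f a = f' ξ * (b - a) := by
    intro f f' a b hf
    rcases lt_trichotomy a b with hab | hab | hab
    · rw [uIcc_of_le hab.le] at *
      obtain ⟨ξ, hξ, e⟩ := exists_hasDerivAt_eq_slope f f' hab
        (fun t ht => (hf t ht).continuousAt.continuousWithinAt)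
        (fun t ht => hf t (Ioo_subset_Icc_self ht))
      refine ⟨ξ, Ioo_subset_Icc_self hξ, ?_⟩
      rw [e, div_mul_cancel₀ _ (by linarith)]
    · exact ⟨a, left_mem_uIcc, by rw [hab]; ring⟩
    · rw [uIcc_of_ge hab.le] at *
      obtain ⟨ξ, hξ, e⟩ := exists_hasDerivAt_eq_slope f f' hab
        (fun t ht => (hf t ht).continuousAt.continuousWithinAt)
        (fun t ht => hf t (Ioo_subset_Icc_self ht))
      refine ⟨ξ, Ioo_subset_Icc_self hξ, ?_⟩
      rw [e, div_mul_eq_mul_div, eq_div_iff (by linarith)]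
      ring
  have m1 : ∀ ξ ∈ uIcc x' x, (ξ, y) ∈ X := fun ξ hξ => hX1.horizontal h2 h1 hξ
  have m2 : ∀ ξ ∈ uIcc x' x, (ξ - τ, y + τ) ∈ X := fun ξ hξ => by
    refine hX1.horizontal h4 h3 ?_
    rw [mem_uIcc] at hξ ⊢
    rcases hξ with h | h
    · exact Or.inl ⟨by linarith, by linarith⟩
    · exact Or.inr ⟨by linarith, by linarith⟩
  -- First mean value in x, along the two horizontal sides; the second, along the antidiagonal
  -- through (ξ,y), then meets only points of X.
  obtain ⟨ξ, hξ, e1⟩ := mvt (fun t => Ψ (t, y) - Ψ (t - τ, y + τ))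
    (fun t => partialX Ψ (t, y) - partialX Ψ (t - τ, y + τ)) x' x (fun t ht => by
      refine (hasDerivAt_partialX hΨ hU (hXU (m1 t ht))).sub ?_
      exact (hasDerivAt_partialX hΨ hU (hXU (m2 t ht))).comp_sub_const t τ)
  have m3 : ∀ t ∈ uIcc τ 0, (ξ - t, y + t) ∈ X := fun t ht => by
    have := hX2.antidiagonal (s := ξ + y) (y := y + τ) (y' := y) (η := y + t)
      (by convert m2 ξ hξ using 2; ring) (by convert m1 ξ hξ using 2; ring) (by
        rw [mem_uIcc] at ht ⊢
        rcases ht with h | h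
        · exact Or.inl ⟨by linarith, by linarith⟩
        · exact Or.inr ⟨by linarith, by linarith⟩)
    convert this using 2
    ring
  obtain ⟨t, ht, e2⟩ := mvt (fun t => partialX Ψ (ξ - t, y + t))
    (fun t => -opQ Ψ (ξ - t, y + t)) τ 0 (fun t ht => by
      have hz := hXU (m3 t ht)
      have h := hasDerivAt_line (hΨ.partialX hU) hU (z := (ξ, y)) (v := (-1, 1)) (t := t)
        (by simpa [sub_eq_add_neg] using hz)
      have e : ∀ t : ℝ, (ξ, y) + t • ((-1 : ℝ), (1 : ℝ)) = (ξ - t, y + t) := fun t => by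
        simp [sub_eq_add_neg]
      simp only [e] at h
      refine h.congr_deriv ?_
      rw [show ((-1 : ℝ), (1 : ℝ)) = -((1 : ℝ), (-1 : ℝ)) by simp, map_neg,
        fderiv_antidiagonal (hΨ.partialX hU) hU hz]
      rw [opQ, partialX_sub (hΨ.partialX hU) (hΨ.partialY hU) hU hz]
      simp only [partialX_partialY_comm hΨ hU hz])
  refine ⟨(ξ - t, y + t), m3 t ht, ?_⟩
  simp only [sub_zero, add_zero] at e1 e2
  rw [e1, e2]
  ring

end PhaseOperator

/-! ### Amplitudes adapted to a length scale. -/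

section Amplitude

open Set Complex ComplexConjugate

/-- `C²` functions whose derivatives are controlled at scale `w`. -/
def IsAmplitude (w a : ℝ) (ψ : ℝ → ℂ) : Prop :=
  ∃ ψ1 ψ2 : ℝ → ℂ, (∀ y, HasDerivAt ψ (ψ1 y) y) ∧ (∀ y, HasDerivAt ψ1 (ψ2 y) y) ∧
    (∀ y, ‖ψ y‖ ≤ a) ∧ (∀ y, ‖ψ1 y‖ ≤ a / w) ∧ ∀ y, ‖ψ2 y‖ ≤ a / w ^ 2

theorem IsAmplitude.conj {w a : ℝ} {ψ : ℝ → ℂ} (h : IsAmplitude w a ψ) :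
    IsAmplitude w a fun y => conj (ψ y) := by
  obtain ⟨ψ1, ψ2, h1, h2, b0, b1, b2⟩ := h
  refine ⟨fun y => conj (ψ1 y), fun y => conj (ψ2 y), fun y => ?_, fun y => ?_, ?_⟩
  · exact (h1 y).star
  · exact (h2 y).star
  · simpa only [RCLike.norm_conj] using ⟨b0, b1, b2⟩

theorem IsAmplitude.comp_add_const {w a : ℝ} {ψ : ℝ → ℂ} (h : IsAmplitude w a ψ) (τ : ℝ) :
    IsAmplitude w a fun y => ψ (y + τ) := by
  obtain ⟨ψ1, ψ2, h1, h2, b0, b1, b2⟩ := h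
  exact ⟨fun y => ψ1 (y + τ), fun y => ψ2 (y + τ), fun y => (h1 _).comp_add_const y τ,
    fun y => (h2 _).comp_add_const y τ, fun y => b0 _, fun y => b1 _, fun y => b2 _⟩

theorem IsAmplitude.nonneg {w a : ℝ} {ψ : ℝ → ℂ} (h : IsAmplitude w a ψ) : 0 ≤ a := by
  obtain ⟨_, _, _, _, b0, _⟩ := h
  exact (norm_nonneg _).trans (b0 0)

/-- The factor 4 is the number of terms, with multiplicity, in the Leibniz rule for the second
derivative. -/
theorem IsAmplitude.mul {w a b : ℝ} {ψ χ : ℝ → ℂ} (hψ : IsAmplitude w a ψ) (hχ : IsAmplitude w b χ)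
    (hw : 0 < w) : IsAmplitude w (4 * (a * b)) fun y => ψ y * χ y := by
  have ha := hψ.nonneg
  have hb := hχ.nonneg
  obtain ⟨ψ1, ψ2, h1, h2, b0, b1, b2⟩ := hψ
  obtain ⟨χ1, χ2, k1, k2, c0, c1, c2⟩ := hχ
  refine ⟨fun y => ψ1 y * χ y + ψ y * χ1 y,
    fun y => (ψ2 y * χ y + ψ1 y * χ1 y) + (ψ1 y * χ1 y + ψ y * χ2 y),
    fun y => (h1 y).mul (k1 y), fun y => ((h2 y).mul (k1 y)).add ((h1 y).mul (k2 y)),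
    fun y => ?_, fun y => ?_, fun y => ?_⟩
  · rw [norm_mul]
    have := mul_le_mul (b0 y) (c0 y) (norm_nonneg _) ha
    nlinarith [mul_nonneg ha hb]
  · refine (norm_add_le _ _).trans ?_
    rw [norm_mul, norm_mul]
    have e1 := mul_le_mul (b1 y) (c0 y) (norm_nonneg _) (by positivity)
    have e2 := mul_le_mul (b0 y) (c1 y) (norm_nonneg _) ha
    refine (add_le_add e1 e2).trans ?_
    have : 0 ≤ a * b / w := by positivity
    calc a / w * b + a * (b / w) = 2 * (a * b / w) := by ring
      _ ≤ 4 * (a * b / w) := by linarith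
      _ = _ := by ring
  · refine (norm_add_le _ _).trans ((add_le_add (norm_add_le _ _) (norm_add_le _ _)).trans ?_)
    simp only [norm_mul]
    have e1 := mul_le_mul (b2 y) (c0 y) (norm_nonneg _) (by positivity)
    have e2 := mul_le_mul (b1 y) (c1 y) (norm_nonneg _) (by positivity)
    have e3 := mul_le_mul (b0 y) (c2 y) (norm_nonneg _) ha
    refine (add_le_add (add_le_add e1 e2) (add_le_add e2 e3)).trans (le_of_eq ?_)
    field_simp
    ring

theorem norm_integral_amplitude_mul_exp_le {ψ : ℝ → ℂ} {θ θ1 u u1 : ℝ → ℝ} {a0 w D B E0 α : ℝ}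
    (hw : 0 < w) (hD : 0 ≤ D) (hB : 0 ≤ B) (hE0 : 0 ≤ E0) (hψ : IsAmplitude w a0 ψ)
    (hsupp : ∀ y, ψ y ≠ 0 → y ∈ Icc α (α + w))
    (hθ : ∀ y ∈ tsupport ψ, HasDerivAt θ (θ1 y) y)
    (hθ1 : ∀ y ∈ tsupport ψ, HasDerivAt θ1 (u y) y)
    (hu : ∀ y ∈ tsupport ψ, HasDerivAt u (u1 y) y)
    (hθD : ∀ y ∈ tsupport ψ, D ≤ |θ1 y|)
    (huB : ∀ y ∈ tsupport ψ, |u y| ≤ B * D / w)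
    (hu1B : ∀ y ∈ tsupport ψ, |u1 y| ≤ B * D / w ^ 2 + E0) :
    ‖∫ y, ψ y * exp (I * θ y)‖ ≤ 14 * (1 + B) ^ 2 * a0 * w / (1 + (w * D) ^ 2) +
      a0 * E0 * w / D ^ 3 := by
  have ha := hψ.nonneg
  obtain ⟨ψ1, ψ2, h1, h2, b0, b1, b2⟩ := hψ
  exact norm_integral_mul_exp_le hw hD hB ha hE0 h1 h2 hsupp b0 b1 b2 hθ hθ1 hu hθD huB hu1B

end Amplitude

/-! ### Integrals of the decaying kernel, the shear of the plane, and Schur's test on the line. -/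

section KernelTools

open Set ENNReal ComplexConjugate

/-- The scale w cancels: this is why estimates of the correlation kernels do not depend on the width
of the support. -/
theorem lintegral_inv_one_add_sq {w N : ℝ} (hw : 0 < w) (hN : 0 < N) (x : ℝ) :
    ∫⁻ x', ENNReal.ofReal (w / (1 + (w * (N * |x - x'|)) ^ 2)) = ENNReal.ofReal (Real.pi / N) := by
  have hwN : w * N ≠ 0 := by positivity
  have e : ∀ x', w / (1 + (w * (N * |x - x'|)) ^ 2) = w * (1 + ((w * N) * (x' - x)) ^ 2)⁻¹ := by
    intro x'
    rw [div_eq_mul_inv, ← mul_assoc, mul_pow, sq_abs, mul_pow, ← sq_abs (x - x'), abs_sub_comm,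
      sq_abs, mul_pow, mul_pow]
  simp_rw [e]
  have h1 : Integrable fun x' : ℝ => w * (1 + ((w * N) * (x' - x)) ^ 2)⁻¹ :=
    ((integrable_inv_one_add_sq.comp_mul_left' hwN).comp_sub_right x).const_mul w
  rw [← ofReal_integral_eq_lintegral_ofReal h1 (ae_of_all _ fun t => by positivity),
    integral_const_mul, integral_sub_right_eq_self (fun t => (1 + ((w * N) * t) ^ 2)⁻¹) x,
    Measure.integral_comp_mul_left (fun t => (1 + t ^ 2)⁻¹), integral_univ_inv_one_add_sq]
  congr 1
  rw [abs_of_pos (by positivity), smul_eq_mul]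
  field_simp

theorem integral_shear (G : ℝ × ℝ → ℂ) : ∫ z : ℝ × ℝ, G z = ∫ z : ℝ × ℝ, G (z.1 + z.2, z.2) := by
  have h1 : MeasurePreserving (fun z : ℝ × ℝ => (z.2, z.2 + z.1)) (volume.prod volume)
      (volume.prod volume) := measurePreserving_prod_add_swap volume volume
  have h2 := (Measure.measurePreserving_swap (μ := (volume : Measure ℝ))
    (ν := (volume : Measure ℝ))).comp (h1)
  have h3 : MeasurePreserving (fun z : ℝ × ℝ => (z.1 + z.2, z.2)) (volume.prod volume)
      (volume.prod volume) := by
    convert h2 using 1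
    funext z
    simp [add_comm]
  let e : (ℝ × ℝ) ≃ᵐ (ℝ × ℝ) :=
    { toFun := fun z => (z.1 + z.2, z.2)
      invFun := fun z => (z.1 - z.2, z.2)
      left_inv := fun z => by simp
      right_inv := fun z => by simp
      measurable_toFun := by change Measurable fun z : ℝ × ℝ => (z.1 + z.2, z.2); fun_prop
      measurable_invFun := by change Measurable fun z : ℝ × ℝ => (z.1 - z.2, z.2); fun_prop }
  exact (MeasurePreserving.integral_comp' (f := e) h3 G).symm

/-- Schur's test for a bilinear form on the line. -/
theorem enorm_bilinear_le_of_schur {k : ℝ × ℝ → ℂ} (hk : IsCore k) {a b : ℝ → ℂ} (ha : IsCore a)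
    (hb : IsCore b) {M : ℝ≥0∞}
    (hM : ∀ x, ∫⁻ x', ‖∫ y, k (x, y) * conj (k (x', y))‖ₑ ≤ M) :
    ‖∫ z : ℝ × ℝ, k z * (a z.1 * b z.2)‖ₑ ≤
      (∫⁻ x, ‖a x‖ₑ ^ 2) ^ (1 / 2 : ℝ) * (M * ∫⁻ y, ‖b y‖ₑ ^ 2) ^ (1 / 2 : ℝ) := by
  obtain ⟨Bk, hBk⟩ := hk.bdd
  obtain ⟨Ba, hBa⟩ := ha.bdd
  obtain ⟨Bb, hBb⟩ := hb.bdd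
  obtain ⟨N, hN⟩ := hk.supp
  have hk0 : ∀ x y, y ∉ Icc (-N) N → k (x, y) = 0 := fun x y hy => by
    rw [mem_Icc, ← abs_le, not_le] at hy
    exact hN _ (hy.trans_le (by simpa using norm_snd_le (x, y)))
  have hk0' : ∀ x y, x ∉ Icc (-N) N → k (x, y) = 0 := fun x y hy => by
    rw [mem_Icc, ← abs_le, not_le] at hy
    exact hN _ (hy.trans_le (by simpa using norm_fst_le (x, y)))
  have hBk0 : 0 ≤ Bk := (norm_nonneg _).trans (hBk 0)
  have hBa0 : 0 ≤ Ba := (norm_nonneg _).trans (hBa 0)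
  have hKb : IsCore fun z : ℝ × ℝ => k z * (a z.1 * b z.2) := by
    refine ⟨hk.meas.mul ((ha.meas.comp measurable_fst).mul (hb.meas.comp measurable_snd)),
      ⟨Bk * (Ba * Bb), fun z => ?_⟩, N, fun z hz => by simp [hN z hz]⟩
    rw [norm_mul, norm_mul]
    exact mul_le_mul (hBk z) (mul_le_mul (hBa _) (hBb _) (norm_nonneg _) hBa0) (by positivity) hBk0
  have hset : ∀ x (F : ℝ → ℂ), ∫ y in Icc (-N) N, k (x, y) * F y = ∫ y, k (x, y) * F y :=
    fun x F => setIntegral_eq_integral_of_forall_compl_eq_zero fun y hy => by simp [hk0 x y hy]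
  -- The abstract test needs finite measures; since k is supported in a square, both variables may
  -- be restricted to an interval without changing any integral.
  have hS := schur_TTstar (ν := volume.restrict (Icc (-N) N)) (ρ := volume.restrict (Icc (-N) N))
    hk.meas hBk hb.meas hBb (M := M) (fun x => by
      simp only [hset]
      exact (setLIntegral_le_lintegral _ _).trans (hM x))
  simp only [hset] at hS
  have hfull : ∫⁻ x in Icc (-N) N, ‖∫ y, k (x, y) * b y‖ₑ ^ 2 = ∫⁻ x, ‖∫ y, k (x, y) * b y‖ₑ ^ 2 := by
    rw [← lintegral_indicator measurableSet_Icc]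
    refine lintegral_congr fun x => ?_
    by_cases hx : x ∈ Icc (-N) N
    · rw [indicator_of_mem hx]
    · rw [indicator_of_notMem hx]
      simp [hk0' x _ hx]
  rw [hfull] at hS
  have e1 : ∫ z : ℝ × ℝ, k z * (a z.1 * b z.2) = ∫ x, a x * ∫ y, k (x, y) * b y := by
    have := integral_prod _ (hKb.integrable (volume.prod volume))
    rw [← Measure.volume_eq_prod] at this
    rw [this]
    refine integral_congr_ae (ae_of_all _ fun x => ?_)
    simp only
    rw [← integral_const_mul]
    refine integral_congr_ae (ae_of_all _ fun y => ?_)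
    simp only
    ring
  rw [e1]
  have mk : Measurable fun x => ∫ y, k (x, y) * b y :=
    ((hk.meas.mul (hb.meas.comp measurable_snd)).stronglyMeasurable.integral_prod_right'
      (ν := volume)).measurable
  refine (enorm_integral_le_lintegral_enorm _).trans ?_
  simp only [enorm_mul]
  have := ENNReal.lintegral_mul_le_Lp_mul_Lq volume Real.HolderConjugate.two_two
    ha.meas.enorm.aemeasurable mk.enorm.aemeasurable
  simp only [Pi.mul_apply, ENNReal.rpow_two] at this
  refine this.trans ?_
  gcongr
  exact hS.trans (by gcongr; exact Measure.restrict_le_self)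

theorem exists_subset_Icc_of_diam {T : Set ℝ} {δ : ℝ} (h : ∀ y ∈ T, ∀ y' ∈ T, |y - y'| ≤ δ) :
    ∃ α, T ⊆ Icc α (α + δ) := by
  rcases T.eq_empty_or_nonempty with rfl | ⟨y0, hy0⟩
  · exact ⟨0, empty_subset _⟩
  have hb : BddBelow T := ⟨y0 - δ, fun y hy => by linarith [(abs_le.1 (h y0 hy0 y hy)).2]⟩
  refine ⟨sInf T, fun y hy => ⟨csInf_le hb hy, ?_⟩⟩
  have : y - δ ≤ sInf T :=
    le_csInf ⟨y0, hy0⟩ fun y' hy' => by linarith [(abs_le.1 (h y hy y' hy')).2]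
  linarith

end KernelTools

/-! ### The square function estimate for part (i). -/

section ConvolutionForm

open Set ENNReal ComplexConjugate

/-- The three directions of the singular fibres. -/
def fibreDirections : Set (ℝ × ℝ) := {((1 : ℝ), (0 : ℝ)), ((0 : ℝ), (1 : ℝ)), ((-1 : ℝ), (1 : ℝ))}

/-- The hypotheses on amplitude and phase. -/
structure PhaseHyp (A c K δ μ : ℝ) (φ : ℝ × ℝ → ℂ) (S : ℝ × ℝ → ℝ) (U : Set (ℝ × ℝ)) : Prop where
  pos_A : 0 < A
  pos_c : 0 < c
  pos_K : 0 < K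
  pos_δ : 0 < δ
  pos_μ : 0 < μ
  smooth : ContDiff ℝ ∞ φ
  compact : HasCompactSupport φ
  width : ∀ x y y' : ℝ, (x, y) ∈ tsupport φ → (x, y') ∈ tsupport φ → |y - y'| ≤ δ
  bound1 : ∀ z, ‖partialY φ z‖ ≤ A * δ⁻¹
  bound2 : ∀ z, ‖partialY (partialY φ) z‖ ≤ A * (δ ^ 2)⁻¹
  isOpen : IsOpen U
  hull : dirHull fibreDirections (tsupport φ) ⊆ U
  phase : ContDiffOn ℝ ∞ S U
  lower : ∀ z ∈ dirHull fibreDirections (tsupport φ), c * μ ≤ |opD S z|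
  upper1 : ∀ z ∈ dirHull fibreDirections (tsupport φ), |partialY (opD S) z| ≤ K * (μ / δ)
  upper2 : ∀ z ∈ dirHull fibreDirections (tsupport φ),
    |partialY (partialY (opD S)) z| ≤ K * (μ / δ ^ 2)

/-- The oscillating amplitude `e^{ilS} φ`. -/
noncomputable def oscAmp (l : ℝ) (S : ℝ × ℝ → ℝ) (φ : ℝ × ℝ → ℂ) (z : ℝ × ℝ) : ℂ :=
  Complex.exp (Complex.I * ((l * S z : ℝ) : ℂ)) * φ z

variable {A c K δ μ : ℝ} {φ : ℝ × ℝ → ℂ} {S : ℝ × ℝ → ℝ} {U : Set (ℝ × ℝ)}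

theorem norm_oscAmp (l : ℝ) (z : ℝ × ℝ) : ‖oscAmp l S φ z‖ = ‖φ z‖ := by
  rw [oscAmp, norm_mul, mul_comm Complex.I, Complex.norm_exp_ofReal_mul_I, one_mul]

theorem PhaseHyp.tsupport_subset (h : PhaseHyp A c K δ μ φ S U) : tsupport φ ⊆ U :=
  (subset_dirHull _ _).trans h.hull

theorem PhaseHyp.continuous_oscAmp (h : PhaseHyp A c K δ μ φ S U) (l : ℝ) :
    Continuous (oscAmp l S φ) := by
  rw [continuous_iff_continuousAt]
  intro z
  by_cases hz : z ∈ tsupport φ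
  · have h1 : ContinuousAt S z :=
      (h.phase.differentiableAt_of_isOpen h.isOpen (h.tsupport_subset hz)).continuousAt
    have h2 : ContinuousAt φ z := h.smooth.continuous.continuousAt
    unfold oscAmp
    fun_prop
  · have : oscAmp l S φ =ᶠ[nhds z] fun _ => 0 := by
      filter_upwards [notMem_tsupport_iff_eventuallyEq.1 hz] with w hw
      simp [oscAmp, hw]
    exact this.continuousAt

/-- A point of the vertical line at distance 2δ lies outside the support, so the size of φ is
recovered from the bound on its vertical derivative. -/
theorem PhaseHyp.norm_le (h : PhaseHyp A c K δ μ φ S U) (z : ℝ × ℝ) : ‖φ z‖ ≤ 2 * A := by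
  by_cases hz : φ z = 0
  · rw [hz, norm_zero]; linarith [h.pos_A]
  have hδ := h.pos_δ
  have h1 : φ (z.1, z.2 + 2 * δ) = 0 := by
    by_contra hne
    have := h.width z.1 z.2 (z.2 + 2 * δ) (subset_tsupport _ hz) (subset_tsupport _ hne)
    rw [show z.2 - (z.2 + 2 * δ) = -(2 * δ) by ring, abs_neg, abs_of_pos (by positivity)] at this
    linarith
  have hd : ∀ y, HasDerivAt (fun t => φ (z.1, t)) (partialY φ (z.1, y)) y := fun y =>
    hasDerivAt_partialY (contDiffOn_univ.2 h.smooth) isOpen_univ (mem_univ _)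
  have := Convex.norm_image_sub_le_of_norm_hasDerivWithin_le (f := fun t => φ (z.1, t))
    (s := univ) (fun y _ => (hd y).hasDerivWithinAt) (fun y _ => h.bound1 _) convex_univ
    (mem_univ (z.2 + 2 * δ)) (mem_univ z.2)
  simp only [h1, sub_zero] at this
  refine this.trans (le_of_eq ?_)
  rw [show z.2 - (z.2 + 2 * δ) = -(2 * δ) by ring, norm_neg, Real.norm_of_nonneg (by positivity)]
  field_simp

theorem PhaseHyp.isAmplitude (h : PhaseHyp A c K δ μ φ S U) (x : ℝ) :
    IsAmplitude δ (2 * A) fun y => φ (x, y) := by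
  have hA := h.pos_A
  have hδ := h.pos_δ
  have h0 : ContDiffOn ℝ ∞ φ univ := contDiffOn_univ.2 h.smooth
  refine ⟨fun y => partialY φ (x, y), fun y => partialY (partialY φ) (x, y), fun y => ?_,
    fun y => ?_, fun y => h.norm_le _, fun y => ?_, fun y => ?_⟩
  · exact hasDerivAt_partialY h0 isOpen_univ (mem_univ _)
  · exact hasDerivAt_partialY (h0.partialY isOpen_univ) isOpen_univ (mem_univ _)
  · refine (h.bound1 _).trans ?_
    rw [div_eq_mul_inv]; gcongr; linarith
  · refine (h.bound2 _).trans ?_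
    rw [div_eq_mul_inv]; gcongr; linarith

theorem PhaseHyp.isCore_oscAmp (h : PhaseHyp A c K δ μ φ S U) (l : ℝ) :
    IsCore (oscAmp l S φ) := by
  obtain ⟨M, hM⟩ := h.compact.isCompact.isBounded.exists_norm_le
  refine ⟨(h.continuous_oscAmp l).measurable, ⟨2 * A, fun z => ?_⟩, M, fun z hz => ?_⟩
  · rw [norm_oscAmp]; exact h.norm_le z
  · have : φ z = 0 := by
      by_contra hne
      exact absurd (hM z (subset_tsupport _ hne)) (not_le.2 hz)
    simp [oscAmp, this]

/-- The kernel of the bilinear form obtained by the `T T*` method. -/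
theorem PhaseHyp.norm_integral_kernel_le (h : PhaseHyp A c K δ μ φ S U) (l τ x x' : ℝ) :
    ‖∫ y, (oscAmp l S φ (x, y) * conj (oscAmp l S φ (x - τ, y + τ))) *
        conj (oscAmp l S φ (x', y) * conj (oscAmp l S φ (x' - τ, y + τ)))‖ ≤
      14 * (1 + K / c) ^ 2 * (1024 * A ^ 4) * δ /
        (1 + (δ * (c * μ * |l| * |τ| * |x - x'|)) ^ 2) := by
  have hδ := h.pos_δ
  have hc := h.pos_c
  have hK := h.pos_K
  have hμ := h.pos_μ
  set X := dirHull fibreDirections (tsupport φ) with hX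
  have hX1 : DirConvex (1, 0) X := dirConvex_dirHull _ _ (by simp [fibreDirections])
  have hX2 : DirConvex (-1, 1) X := dirConvex_dirHull _ _ (by simp [fibreDirections])
  set ψ : ℝ → ℂ := fun y => (φ (x, y) * conj (φ (x - τ, y + τ))) *
    conj (φ (x', y) * conj (φ (x' - τ, y + τ))) with hψ
  -- Four factors of size 2A: the inner products cost 4(2A)² = 16A², and the outer one 4(16A²)² =
  -- 1024A⁴.
  have hamp : IsAmplitude δ (1024 * A ^ 4) ψ := by
    have h1 := fun x => (h.isAmplitude x).mul (((h.isAmplitude (x - τ)).comp_add_const τ).conj) hδ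
    have h2 := (h1 x).mul (h1 x').conj hδ
    convert h2 using 1
    ring
  have hmem : ∀ y ∈ tsupport ψ, (x, y) ∈ tsupport φ ∧ (x - τ, y + τ) ∈ tsupport φ ∧
      (x', y) ∈ tsupport φ ∧ (x' - τ, y + τ) ∈ tsupport φ := by
    have hcl : IsClosed {y | (x, y) ∈ tsupport φ ∧ (x - τ, y + τ) ∈ tsupport φ ∧
      (x', y) ∈ tsupport φ ∧ (x' - τ, y + τ) ∈ tsupport φ} := by
      have hc := isClosed_tsupport φ
      refine (hc.preimage (by fun_prop : Continuous fun y : ℝ => (x, y))).inter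
        ((hc.preimage (by fun_prop : Continuous fun y : ℝ => (x - τ, y + τ))).inter
        ((hc.preimage (by fun_prop : Continuous fun y : ℝ => (x', y))).inter
        (hc.preimage (by fun_prop : Continuous fun y : ℝ => (x' - τ, y + τ)))))
    refine fun y hy => closure_minimal ?_ hcl hy
    intro y hy
    rw [Function.mem_support, hψ] at hy
    simp only [ne_eq, mul_eq_zero, map_eq_zero, not_or] at hy
    exact ⟨subset_tsupport _ hy.1.1, subset_tsupport _ hy.1.2, subset_tsupport _ hy.2.1,
      subset_tsupport _ hy.2.2⟩
  obtain ⟨α, hα⟩ := exists_subset_Icc_of_diam (T := {y | (x, y) ∈ tsupport φ})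
    fun y hy y' hy' => h.width x y y' hy hy'
  set d : (ℝ × ℝ → ℝ) → ℝ → ℝ := fun Ψ y =>
    l * (Ψ (x, y) - Ψ (x - τ, y + τ) - (Ψ (x', y) - Ψ (x' - τ, y + τ))) with hd
  have hdd : ∀ Ψ : ℝ × ℝ → ℝ, ContDiffOn ℝ ∞ Ψ U → ∀ y ∈ tsupport ψ,
      HasDerivAt (d Ψ) (d (partialY Ψ) y) y := by
    intro Ψ hΨ y hy
    obtain ⟨m1, m2, m3, m4⟩ := hmem y hy
    have q : ∀ {x y}, (x, y) ∈ tsupport φ →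
        HasDerivAt (fun t => Ψ (x, t)) (partialY Ψ (x, y)) y := fun hz =>
      hasDerivAt_partialY hΨ h.isOpen (h.tsupport_subset hz)
    exact (((q m1).sub ((q m2).comp_add_const y τ)).sub
      ((q m3).sub ((q m4).comp_add_const y τ))).const_mul l
  -- The four points entering the phase are the vertices of a parallelogram with sides in directions
  -- (1,0) and (-1,1), so its successive derivatives are mixed differences of ∂_y^j S.
  have hmix : ∀ Ψ : ℝ × ℝ → ℝ, ContDiffOn ℝ ∞ Ψ U → ∀ y ∈ tsupport ψ,
      ∃ z ∈ X, |d Ψ y| = |l| * |τ| * |x - x'| * |opQ Ψ z| := by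
    intro Ψ hΨ y hy
    obtain ⟨m1, m2, m3, m4⟩ := hmem y hy
    have q := subset_dirHull fibreDirections (tsupport φ)
    obtain ⟨z, hz, e⟩ := exists_parallelogram_difference hX1 hX2 h.hull h.isOpen hΨ (q m1) (q m3)
      (q m2) (q m4)
    refine ⟨z, hz, ?_⟩
    rw [hd]
    simp only [e, abs_mul]
    ring
  have hS1 := h.phase.partialY h.isOpen
  have hS2 := hS1.partialY h.isOpen
  have hS3 := hS2.partialY h.isOpen
  have key := norm_integral_amplitude_mul_exp_le (ψ := ψ) (θ := d S) (θ1 := d (partialY S))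
    (u := d (partialY (partialY S))) (E0 := 0) (u1 := d (partialY (partialY (partialY S))))
    (D := c * μ * |l| * |τ| * |x - x'|) (B := K / c) (α := α) hδ (by positivity) (by positivity)
    le_rfl hamp (fun y hy => hα (hmem y (subset_tsupport _ hy)).1) (hdd S h.phase)
    (hdd _ hS1) (hdd _ hS2) ?_ ?_ ?_
  · rw [mul_zero, zero_mul, zero_div, add_zero] at key
    refine le_trans (le_of_eq ?_) key
    congr 1
    refine integral_congr_ae (ae_of_all _ fun y => ?_)
    have ce : ∀ t : ℝ, conj (Complex.exp (Complex.I * (t : ℂ))) =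
        Complex.exp (-(Complex.I * (t : ℂ))) := fun t => by
      rw [← Complex.exp_conj]; simp
    have ce' : Complex.exp (Complex.I * ((d S y : ℝ) : ℂ)) =
        Complex.exp (Complex.I * ((l * S (x, y) : ℝ) : ℂ)) *
        Complex.exp (-(Complex.I * ((l * S (x - τ, y + τ) : ℝ) : ℂ))) *
        (Complex.exp (-(Complex.I * ((l * S (x', y) : ℝ) : ℂ))) *
        Complex.exp (Complex.I * ((l * S (x' - τ, y + τ) : ℝ) : ℂ))) := by
      rw [← Complex.exp_add, ← Complex.exp_add, ← Complex.exp_add]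
      congr 1
      rw [hd]
      push_cast
      ring
    have ce2 : ∀ t : ℝ, conj (Complex.exp (-(Complex.I * (t : ℂ)))) =
        Complex.exp (Complex.I * (t : ℂ)) := fun t => by
      rw [← Complex.exp_conj]; simp
    simp only [oscAmp, map_mul, ce, ce2, Complex.conj_conj, ce', hψ]
    ring
  · intro y hy
    obtain ⟨z, hz, e⟩ := hmix _ hS1 y hy
    rw [e, ← opD_eq_opQ h.phase h.isOpen (h.hull hz)]
    have := h.lower z hz
    calc c * μ * |l| * |τ| * |x - x'| = |l| * |τ| * |x - x'| * (c * μ) := by ring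
      _ ≤ _ := by gcongr
  · intro y hy
    obtain ⟨z, hz, e⟩ := hmix _ hS2 y hy
    rw [e, ← partialY_opD h.phase h.isOpen (h.hull hz)]
    have := h.upper1 z hz
    calc |l| * |τ| * |x - x'| * |partialY (opD S) z| ≤ |l| * |τ| * |x - x'| * (K * (μ / δ)) := by
          gcongr
      _ = _ := by field_simp
  · intro y hy
    obtain ⟨z, hz, e⟩ := hmix _ hS3 y hy
    rw [e, ← partialY_partialY_opD h.phase h.isOpen (h.hull hz)]
    have := h.upper2 z hz
    calc |l| * |τ| * |x - x'| * |partialY (partialY (opD S)) z| ≤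
          |l| * |τ| * |x - x'| * (K * (μ / δ ^ 2)) := by gcongr
      _ = _ := by rw [add_zero]; field_simp

/-- The square function estimate underlying the first part of the theorem. -/
theorem exists_lintegral_sq_convolution_le {A c K p q : ℝ} (hA : 0 < A) (hc : 0 < c) (hK : 0 < K)
    (hp : 2 < p) (hp' : p < 4) (hq : 2 < q) (hq' : q < 4) (hpq : 1 / p + 1 / q = 3 / 4) :
    ∃ C : ℝ, 0 < C ∧ ∀ (δ μ : ℝ) (φ : ℝ × ℝ → ℂ) (S : ℝ × ℝ → ℝ) (U : Set (ℝ × ℝ)),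
      PhaseHyp A c K δ μ φ S U → ∀ l : ℝ, l ≠ 0 → ∀ f g : ℝ → ℂ, IsCore f → IsCore g →
      ∫⁻ s, ‖∫ y, oscAmp l S φ (s - y, y) * (f (s - y) * g y)‖ₑ ^ 2 ≤
        ENNReal.ofReal (C * |l * μ| ^ (-(1 / 2) : ℝ)) *
          ((∫⁻ x, ‖f x‖ₑ ^ p) ^ (2 / p) * (∫⁻ x, ‖g x‖ₑ ^ q) ^ (2 / q)) := by
  have hp0 : 0 < p := by linarith
  have hq0 : 0 < q := by linarith
  -- With a = 2 - 4/p the exponent 2/(2-a) equals p/2, so Hardy–Littlewood–Sobolev for |f|² yields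
  -- the L^p norm of f.
  have ha : 0 < 2 - 4 / p := by
    have : 4 / p < 2 := by rw [div_lt_iff₀ hp0]; linarith
    linarith
  have hb : 0 < 2 - 4 / q := by
    have : 4 / q < 2 := by rw [div_lt_iff₀ hq0]; linarith
    linarith
  have hab : (2 - 4 / p) + (2 - 4 / q) = 1 := by
    have : 4 / p + 4 / q = 3 := by
      rw [← mul_one_div 4 p, ← mul_one_div 4 q, ← mul_add, hpq]; norm_num
    linarith
  obtain ⟨C0, hC0, hls⟩ := hls_autocorr_pair ha hb hab
  set C1 : ℝ := 14 * (1 + K / c) ^ 2 * (1024 * A ^ 4) * (Real.pi / c) with hC1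
  have hC1p : 0 < C1 := by positivity
  refine ⟨C1 ^ (1 / 2 : ℝ) * C0, by positivity, fun δ μ φ S U h l hl f g hf hg => ?_⟩
  have hμ := h.pos_μ
  have hδ := h.pos_δ
  have mconj : Measurable (conj : ℂ → ℂ) := Complex.continuous_conj.measurable
  obtain ⟨Bf, hBf⟩ := hf.bdd
  obtain ⟨Mf, hMf⟩ := hf.supp
  obtain ⟨Bg, hBg⟩ := hg.bdd
  obtain ⟨Mg, hMg⟩ := hg.supp
  have hE := h.isCore_oscAmp l
  set E := oscAmp l S φ with hEd
  obtain ⟨BE, hBE⟩ := hE.bdd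
  obtain ⟨ME, hME⟩ := hE.supp
  have hBf0 : 0 ≤ Bf := (norm_nonneg _).trans (hBf 0)
  have hBg0 : 0 ≤ Bg := (norm_nonneg _).trans (hBg 0)
  have hBE0 : 0 ≤ BE := (norm_nonneg _).trans (hBE 0)
  have hME0 : ∀ x y, E (x, y) ≠ 0 → |x| ≤ ME ∧ |y| ≤ ME := fun x y hne => by
    have : ‖(x, y)‖ ≤ ME := not_lt.1 fun h' => hne (hME _ h')
    exact ⟨(norm_fst_le (x, y)).trans this, (norm_snd_le (x, y)).trans this⟩
  have hF : IsCore fun z : ℝ × ℝ => E (z.1 - z.2, z.2) * (f (z.1 - z.2) * g z.2) := by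
    refine ⟨(hE.meas.comp (by fun_prop)).mul
      ((hf.meas.comp (by fun_prop)).mul (hg.meas.comp measurable_snd)), ⟨BE * (Bf * Bg),
      fun z => ?_⟩, 2 * ME, fun z hz => ?_⟩
    · rw [norm_mul, norm_mul]
      exact mul_le_mul (hBE _) (mul_le_mul (hBf _) (hBg _) (norm_nonneg _) hBf0) (by positivity)
        hBE0
    · by_contra hne
      have h1 := hME0 _ _ (left_ne_zero_of_mul hne)
      have h2 : |z.1| ≤ 2 * ME := by
        calc |z.1| = |(z.1 - z.2) + z.2| := by ring_nf
          _ ≤ _ := (abs_add_le _ _).trans (by linarith [h1.1, h1.2])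
      have h3 : ‖z‖ ≤ 2 * ME := by
        rw [Prod.norm_def]
        exact max_le h2 (h1.2.trans (by linarith [abs_nonneg z.2, h1.2]))
      linarith
  refine (lintegral_sq_integral_le hF).trans ?_
  set uf : ℝ → ℝ≥0∞ := fun x => ‖f x‖ₑ ^ 2 with huf
  set ug : ℝ → ℝ≥0∞ := fun x => ‖g x‖ₑ ^ 2 with hug
  have muf : Measurable uf := hf.meas.enorm.pow_const 2
  have mug : Measurable ug := hg.meas.enorm.pow_const 2
  have hτ : ∀ τ : ℝ, τ ≠ 0 → ‖∫ z : ℝ × ℝ, E (z.1 - z.2, z.2) * (f (z.1 - z.2) * g z.2) *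
      conj (E (z.1 - (z.2 + τ), z.2 + τ) * (f (z.1 - (z.2 + τ)) * g (z.2 + τ)))‖ₑ ≤
      ENNReal.ofReal (C1 ^ (1 / 2 : ℝ) * |l * μ| ^ (-(1 / 2) : ℝ)) *
        (ENNReal.ofReal (|τ| ^ (-(1 / 2) : ℝ)) *
        ((∫⁻ x, uf x * uf (x + τ)) ^ (1 / 2 : ℝ) * (∫⁻ x, ug x * ug (x + τ)) ^ (1 / 2 : ℝ))) := by
    intro τ hτ
    have hτ' : 0 < |τ| := abs_pos.2 hτ
    have hl' : 0 < |l| := abs_pos.2 hl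
    -- With x = s-y the form becomes bilinear in correlations of f in x and of g in y.
    rw [integral_shear]
    set k : ℝ × ℝ → ℂ := fun z => E z * conj (E (z.1 - τ, z.2 + τ)) with hk
    set a : ℝ → ℂ := fun x => f x * conj (f (x - τ)) with hav
    set b : ℝ → ℂ := fun y => g y * conj (g (y + τ)) with hbv
    have e1 : ∀ z : ℝ × ℝ, E (z.1 + z.2 - z.2, z.2) * (f (z.1 + z.2 - z.2) * g z.2) *
        conj (E (z.1 + z.2 - (z.2 + τ), z.2 + τ) * (f (z.1 + z.2 - (z.2 + τ)) * g (z.2 + τ))) =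
        k z * (a z.1 * b z.2) := fun z => by
      rw [add_sub_cancel_right, show z.1 + z.2 - (z.2 + τ) = z.1 - τ by ring]
      simp only [hk, hav, hbv, map_mul]
      ring
    simp only [e1]
    have hkc : IsCore k := by
      refine ⟨hE.meas.mul (mconj.comp (hE.meas.comp (by fun_prop))), ⟨BE * BE, fun z => ?_⟩, ME,
        fun z hz => by simp [hk, hME z hz]⟩
      rw [hk, norm_mul, RCLike.norm_conj]
      exact mul_le_mul (hBE _) (hBE _) (norm_nonneg _) hBE0
    have hac : IsCore a := by
      refine ⟨hf.meas.mul (mconj.comp (hf.meas.comp (by fun_prop))), ⟨Bf * Bf, fun z => ?_⟩, Mf,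
        fun z hz => by simp [hav, hMf z hz]⟩
      rw [hav, norm_mul, RCLike.norm_conj]
      exact mul_le_mul (hBf _) (hBf _) (norm_nonneg _) hBf0
    have hbc : IsCore b := by
      refine ⟨hg.meas.mul (mconj.comp (hg.meas.comp (by fun_prop))), ⟨Bg * Bg, fun z => ?_⟩, Mg,
        fun z hz => by simp [hbv, hMg z hz]⟩
      rw [hbv, norm_mul, RCLike.norm_conj]
      exact mul_le_mul (hBg _) (hBg _) (norm_nonneg _) hBg0
    have hN : 0 < c * μ * |l| * |τ| := mul_pos (mul_pos (mul_pos hc hμ) hl') hτ'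
    -- Integration in x' leaves 1/|lμτ| up to a constant; its square root is the weight |τ|^(-1/2)
    -- needed below.
    have hM : ∀ x, ∫⁻ x', ‖∫ y, k (x, y) * conj (k (x', y))‖ₑ ≤
        ENNReal.ofReal (C1 * (|l * μ| * |τ|)⁻¹) := by
      intro x
      calc ∫⁻ x', ‖∫ y, k (x, y) * conj (k (x', y))‖ₑ
          ≤ ∫⁻ x', ENNReal.ofReal (14 * (1 + K / c) ^ 2 * (1024 * A ^ 4)) *
            ENNReal.ofReal (δ / (1 + (δ * (c * μ * |l| * |τ| * |x - x'|)) ^ 2)) := by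
            refine lintegral_mono fun x' => ?_
            rw [← ENNReal.ofReal_mul (by positivity), ← ofReal_norm]
            refine ENNReal.ofReal_le_ofReal ?_
            refine (h.norm_integral_kernel_le l τ x x').trans (le_of_eq ?_)
            ring
        _ = ENNReal.ofReal (14 * (1 + K / c) ^ 2 * (1024 * A ^ 4)) *
            ENNReal.ofReal (Real.pi / (c * μ * |l| * |τ|)) := by
            rw [lintegral_const_mul' _ _ ENNReal.ofReal_ne_top, lintegral_inv_one_add_sq hδ hN]
        _ = _ := by
            rw [← ENNReal.ofReal_mul (by positivity), abs_mul l μ, abs_of_pos hμ, hC1]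
            congr 1
            field_simp
    refine (enorm_bilinear_le_of_schur hkc hac hbc hM).trans (le_of_eq ?_)
    have ea : ∫⁻ x, ‖a x‖ₑ ^ 2 = ∫⁻ x, uf x * uf (x + τ) := by
      rw [← lintegral_add_right_eq_self (fun x => ‖a x‖ₑ ^ 2) τ]
      refine lintegral_congr fun x => ?_
      simp only [hav, huf]
      rw [add_sub_cancel_right, enorm_mul, ← ofReal_norm (conj (f x)), RCLike.norm_conj,
        ofReal_norm]
      ring
    have eb : ∫⁻ x, ‖b x‖ₑ ^ 2 = ∫⁻ x, ug x * ug (x + τ) := by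
      refine lintegral_congr fun x => ?_
      simp only [hbv, hug]
      rw [enorm_mul, ← ofReal_norm (conj (g (x + τ))), RCLike.norm_conj, ofReal_norm]
      ring
    have hlμ : 0 < |l * μ| := abs_pos.2 (mul_ne_zero hl hμ.ne')
    have er : (C1 * (|l * μ| * |τ|)⁻¹) ^ (1 / 2 : ℝ) =
        C1 ^ (1 / 2 : ℝ) * |l * μ| ^ (-(1 / 2) : ℝ) * |τ| ^ (-(1 / 2) : ℝ) := by
      rw [Real.mul_rpow hC1p.le (by positivity), Real.inv_rpow (by positivity),
        ← Real.rpow_neg (by positivity), Real.mul_rpow hlμ.le hτ'.le, mul_assoc]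
    rw [ea, eb, ENNReal.mul_rpow_of_nonneg _ _ (by norm_num : (0:ℝ) ≤ 1 / 2),
      ENNReal.ofReal_rpow_of_nonneg (by positivity) (by norm_num), er,
      ENNReal.ofReal_mul (by positivity)]
    ring
  have h0 : ∀ᵐ τ : ℝ, τ ≠ 0 := by
    simp [ae_iff, measure_singleton]
  calc ∫⁻ τ, ‖∫ z : ℝ × ℝ, E (z.1 - z.2, z.2) * (f (z.1 - z.2) * g z.2) *
      conj (E (z.1 - (z.2 + τ), z.2 + τ) * (f (z.1 - (z.2 + τ)) * g (z.2 + τ)))‖ₑ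
      ≤ ∫⁻ τ, ENNReal.ofReal (C1 ^ (1 / 2 : ℝ) * |l * μ| ^ (-(1 / 2) : ℝ)) *
        (ENNReal.ofReal (|τ| ^ (-(1 / 2) : ℝ)) *
        ((∫⁻ x, uf x * uf (x + τ)) ^ (1 / 2 : ℝ) * (∫⁻ x, ug x * ug (x + τ)) ^ (1 / 2 : ℝ))) := by
        refine lintegral_mono_ae ?_
        filter_upwards [h0] with τ hne using hτ τ hne
    _ ≤ _ := by
        rw [lintegral_const_mul' _ _ ENNReal.ofReal_ne_top]
        refine (mul_le_mul_right (hls uf ug muf mug) _).trans (le_of_eq ?_)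
        have hpw : ∀ r : ℝ, 0 < r → ∀ F : ℝ → ℂ,
            (∫⁻ x, (‖F x‖ₑ ^ 2) ^ (2 / (2 - (2 - 4 / r)))) ^ ((2 - (2 - 4 / r)) / 2) =
            (∫⁻ x, ‖F x‖ₑ ^ r) ^ (2 / r) := fun r hr F => by
          have e1 : 2 / (2 - (2 - 4 / r)) = r / 2 := by
            rw [_root_.sub_sub_cancel]; field_simp; norm_num
          have e2 : (2 - (2 - 4 / r)) / 2 = 2 / r := by
            rw [_root_.sub_sub_cancel]; field_simp; norm_num
          rw [e1, e2]
          congr 1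
          refine lintegral_congr fun x => ?_
          rw [← ENNReal.rpow_two, ← ENNReal.rpow_mul]
          congr 1
          ring
        rw [hpw p hp0, hpw q hq0, ← mul_assoc, ← ENNReal.ofReal_mul (by positivity)]
        congr 2
        ring

end ConvolutionForm

/-! ### From bounded functions of bounded support to Lebesgue spaces, and duality. -/

section Density

open Set ENNReal ComplexConjugate Filter

theorem measurePreserving_shear :
    MeasurePreserving (fun z : ℝ × ℝ => (z.1 + z.2, z.2)) (volume.prod volume)
      (volume.prod volume) := by
  have h1 : MeasurePreserving (fun z : ℝ × ℝ => (z.2, z.2 + z.1)) (volume.prod volume)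
      (volume.prod volume) := measurePreserving_prod_add_swap volume volume
  have h2 := (Measure.measurePreserving_swap (μ := (volume : Measure ℝ))
    (ν := (volume : Measure ℝ))).comp (h1)
  convert h2 using 1
  funext z
  simp [add_comm]

theorem ofReal_normLp {p : ℝ} (hp : 0 < p) {f : ℝ → ℂ}
    (hf : MemLp f (ENNReal.ofReal p) volume) :
    ENNReal.ofReal (normLp p f) = (∫⁻ x, ‖f x‖ₑ ^ p) ^ (1 / p) := by
  rw [normLp, ENNReal.ofReal_toReal hf.2.ne, eLpNorm_eq_lintegral_rpow_enorm_toReal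
    (by simpa using hp) ENNReal.ofReal_ne_top, ENNReal.toReal_ofReal hp.le]

theorem IsCore.memLp {f : ℝ → ℂ} (hf : IsCore f) (p : ℝ≥0∞) : MemLp f p volume := by
  obtain ⟨B, hB⟩ := hf.bdd
  obtain ⟨M, hM⟩ := hf.supp
  have h1 : MemLp f p (volume.restrict (Icc (-M) M)) :=
    MemLp.of_bound hf.meas.aestronglyMeasurable B (ae_of_all _ hB)
  have h2 := (memLp_indicator_iff_restrict measurableSet_Icc).2 h1
  convert h2 using 1
  funext x
  by_cases hx : x ∈ Icc (-M) M
  · rw [indicator_of_mem hx]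
  · rw [indicator_of_notMem hx]
    rw [mem_Icc, ← abs_le, not_le] at hx
    exact hM x hx

/-- Truncation to a bounded function with bounded support. -/
noncomputable def truncate (n : ℕ) (f : ℝ → ℂ) : ℝ → ℂ :=
  indicator {x | ‖f x‖ ≤ n ∧ |x| ≤ n} f

theorem isCore_truncate {f : ℝ → ℂ} (hf : Measurable f) (n : ℕ) : IsCore (truncate n f) := by
  refine ⟨?_, ⟨n, fun z => ?_⟩, n, fun z hz => ?_⟩
  · exact hf.indicator ((measurableSet_le hf.norm measurable_const).inter
      (measurableSet_le measurable_norm measurable_const))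
  · unfold truncate
    by_cases h : z ∈ {x | ‖f x‖ ≤ n ∧ |x| ≤ n}
    · rw [indicator_of_mem h]; exact h.1
    · rw [indicator_of_notMem h]; simp
  · exact indicator_of_notMem (fun h => absurd h.2 (not_le.2 hz)) _

theorem norm_truncate_le (n : ℕ) (f : ℝ → ℂ) (x : ℝ) : ‖truncate n f x‖ ≤ ‖f x‖ :=
  norm_indicator_le_norm_self _ _

theorem truncate_eventually_eq (f : ℝ → ℂ) (x : ℝ) : ∀ᶠ n : ℕ in atTop, truncate n f x = f x := by
  filter_upwards [eventually_ge_atTop ⌈max ‖f x‖ |x|⌉₊] with n hn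
  have h : max ‖f x‖ |x| ≤ n := (Nat.le_ceil _).trans (by exact_mod_cast hn)
  exact indicator_of_mem (s := {x | ‖f x‖ ≤ n ∧ |x| ≤ n})
    ⟨(le_max_left _ _).trans h, (le_max_right _ _).trans h⟩ f

theorem normLp_truncate_le {p : ℝ} {f : ℝ → ℂ} (hf : MemLp f (ENNReal.ofReal p) volume) (n : ℕ) :
    normLp p (truncate n f) ≤ normLp p f :=
  ENNReal.toReal_mono hf.2.ne (eLpNorm_mono (norm_truncate_le n f))

theorem integrable_indicator_sq {p : ℝ} (hp : 2 ≤ p) {f : ℝ → ℂ}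
    (hf : MemLp f (ENNReal.ofReal p) volume) (N : ℝ) :
    Integrable (indicator (Icc (-N) N) fun x => ‖f x‖ ^ 2) := by
  rw [integrable_indicator_iff measurableSet_Icc]
  have h1 : MemLp f 2 (volume.restrict (Icc (-N) N)) :=
    (hf.restrict _).mono_exponent (by
      rw [show (2 : ℝ≥0∞) = ENNReal.ofReal 2 by simp]
      exact ENNReal.ofReal_le_ofReal hp)
  exact (memLp_two_iff_integrable_sq_norm h1.1).1 h1

/-- On the bounded support of E, exponents at least 2 give local square integrability, and |fgh| ≤
|f|²|g|² + |h|² is integrable, the last term after the shear. -/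
theorem integrable_trilinear {E : ℝ × ℝ → ℂ} (hE : IsCore E) {p1 p2 p3 : ℝ} (h1 : 2 ≤ p1)
    (h2 : 2 ≤ p2) (h3 : 2 ≤ p3) {f g h : ℝ → ℂ} (mf : Measurable f) (mg : Measurable g)
    (mh : Measurable h) (hf : MemLp f (ENNReal.ofReal p1) volume)
    (hg : MemLp g (ENNReal.ofReal p2) volume) (hh : MemLp h (ENNReal.ofReal p3) volume) :
    Integrable fun z : ℝ × ℝ => E z * (f z.1 * g z.2 * h (z.1 + z.2)) := by
  obtain ⟨B, hB⟩ := hE.bdd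
  obtain ⟨N, hN⟩ := hE.supp
  have hB0 : 0 ≤ B := (norm_nonneg _).trans (hB 0)
  have i1 := (integrable_indicator_sq h1 hf N).mul_prod (integrable_indicator_sq h2 hg N)
  have i2 : Integrable fun z : ℝ × ℝ => (indicator (Icc (-(2 * N)) (2 * N)) fun x => ‖h x‖ ^ 2)
      (z.1 + z.2) * indicator (Icc (-N) N) (fun _ => (1 : ℝ)) z.2 := by
    have := (integrable_indicator_sq h3 hh (2 * N)).mul_prod
      ((integrable_indicator_iff (μ := (volume : Measure ℝ)) (measurableSet_Icc (a := -N) (b := N))).2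
        (integrableOn_const (C := (1 : ℝ)) (by simp)))
    exact (measurePreserving_shear.integrable_comp_of_integrable this)
  rw [← Measure.volume_eq_prod] at i1
  refine ((i1.add i2).const_mul B).mono' ?_ (ae_of_all _ fun z => ?_)
  · exact (hE.meas.mul (((mf.comp measurable_fst).mul (mg.comp measurable_snd)).mul
      (mh.comp (by fun_prop)))).aestronglyMeasurable
  · simp only [Pi.add_apply]
    by_cases hz : N < ‖z‖
    · rw [hN z hz, zero_mul, norm_zero]
      refine mul_nonneg hB0 (add_nonneg (mul_nonneg ?_ ?_) (mul_nonneg ?_ ?_)) <;>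
      exact indicator_nonneg (fun _ _ => by positivity) _
    · have hx : |z.1| ≤ N := (norm_fst_le z).trans (not_lt.1 hz)
      have hy : |z.2| ≤ N := (norm_snd_le z).trans (not_lt.1 hz)
      have hs : |z.1 + z.2| ≤ 2 * N := (abs_add_le _ _).trans (by linarith)
      have mx : z.1 ∈ Icc (-N) N := abs_le.1 hx
      have my : z.2 ∈ Icc (-N) N := abs_le.1 hy
      have ms : z.1 + z.2 ∈ Icc (-(2 * N)) (2 * N) := abs_le.1 hs
      rw [indicator_of_mem mx, indicator_of_mem my, indicator_of_mem ms, indicator_of_mem my,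
        norm_mul, norm_mul,
        norm_mul, mul_one]
      refine mul_le_mul (hB z) ?_ (by positivity) hB0
      nlinarith [sq_nonneg (‖f z.1‖ * ‖g z.2‖ - ‖h (z.1 + z.2)‖), sq_nonneg (‖f z.1‖ * ‖g z.2‖),
        sq_nonneg ‖h (z.1 + z.2)‖]

/-- A trilinear bound extends from bounded functions with bounded support to Lebesgue spaces. -/
theorem trilinear_bound_of_core {E : ℝ × ℝ → ℂ} (hE : IsCore E) {p1 p2 p3 : ℝ} (h1 : 2 ≤ p1)
    (h2 : 2 ≤ p2) (h3 : 2 ≤ p3) {C : ℝ} (hC : 0 ≤ C)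
    (hcore : ∀ f g h : ℝ → ℂ, IsCore f → IsCore g → IsCore h →
      ‖∫ z : ℝ × ℝ, E z * (f z.1 * g z.2 * h (z.1 + z.2))‖ ≤
        C * normLp p1 f * normLp p2 g * normLp p3 h)
    {f g h : ℝ → ℂ} (hf : MemLp f (ENNReal.ofReal p1) volume)
    (hg : MemLp g (ENNReal.ofReal p2) volume) (hh : MemLp h (ENNReal.ofReal p3) volume) :
    Integrable (fun z : ℝ × ℝ => E z * (f z.1 * g z.2 * h (z.1 + z.2))) ∧
    ‖∫ z : ℝ × ℝ, E z * (f z.1 * g z.2 * h (z.1 + z.2))‖ ≤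
        C * normLp p1 f * normLp p2 g * normLp p3 h := by
  -- Measurable representatives suffice: both projections and the sum map pull null sets back to
  -- null sets.
  wlog hm : Measurable f ∧ Measurable g ∧ Measurable h generalizing f g h with H
  · have mf := hf.1.stronglyMeasurable_mk.measurable
    have mg := hg.1.stronglyMeasurable_mk.measurable
    have mh := hh.1.stronglyMeasurable_mk.measurable
    have ef := hf.1.ae_eq_mk
    have eg := hg.1.ae_eq_mk
    have eh := hh.1.ae_eq_mk
    have nf : ∀ {p : ℝ} {u v : ℝ → ℂ}, u =ᵐ[volume] v → normLp p u = normLp p v := fun he => by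
      rw [normLp, normLp, eLpNorm_congr_ae he]
    have q1 : (fun z : ℝ × ℝ => f z.1) =ᵐ[volume.prod volume] fun z => hf.1.mk f z.1 :=
      Measure.quasiMeasurePreserving_fst.ae_eq_comp ef
    have q2 : (fun z : ℝ × ℝ => g z.2) =ᵐ[volume.prod volume] fun z => hg.1.mk g z.2 :=
      Measure.quasiMeasurePreserving_snd.ae_eq_comp eg
    have q3 : (fun z : ℝ × ℝ => h (z.1 + z.2)) =ᵐ[volume.prod volume]
        fun z => hh.1.mk h (z.1 + z.2) :=
      (Measure.quasiMeasurePreserving_fst.comp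
        measurePreserving_shear.quasiMeasurePreserving).ae_eq_comp eh
    rw [← Measure.volume_eq_prod] at q1 q2 q3
    have he : (fun z : ℝ × ℝ => E z * (f z.1 * g z.2 * h (z.1 + z.2))) =ᵐ[volume]
        fun z => E z * (hf.1.mk f z.1 * hg.1.mk g z.2 * hh.1.mk h (z.1 + z.2)) := by
      filter_upwards [q1, q2, q3] with z e1 e2 e3
      rw [e1, e2, e3]
    obtain ⟨r1, r2⟩ := H ((memLp_congr_ae ef).1 hf) ((memLp_congr_ae eg).1 hg)
      ((memLp_congr_ae eh).1 hh) ⟨mf, mg, mh⟩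
    rw [integral_congr_ae he, nf ef, nf eg, nf eh]
    exact ⟨r1.congr he.symm, r2⟩
  obtain ⟨mf, mg, mh⟩ := hm
  have hi := integrable_trilinear hE h1 h2 h3 mf mg mh hf hg hh
  refine ⟨hi, ?_⟩
  have hlim : Tendsto (fun n : ℕ => ∫ z : ℝ × ℝ, E z * (truncate n f z.1 * truncate n g z.2 *
      truncate n h (z.1 + z.2))) atTop
      (nhds (∫ z : ℝ × ℝ, E z * (f z.1 * g z.2 * h (z.1 + z.2)))) := by
    refine tendsto_integral_of_dominated_convergence
      (fun z => ‖E z * (f z.1 * g z.2 * h (z.1 + z.2))‖) (fun n => ?_) hi.norm (fun n => ?_) ?_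
    · exact (hE.meas.mul ((((isCore_truncate mf n).meas.comp measurable_fst).mul
        ((isCore_truncate mg n).meas.comp measurable_snd)).mul
        ((isCore_truncate mh n).meas.comp (by fun_prop)))).aestronglyMeasurable
    · refine ae_of_all _ fun z => ?_
      simp only [norm_mul]
      have a1 := norm_truncate_le n f z.1
      have a2 := norm_truncate_le n g z.2
      have a3 := norm_truncate_le n h (z.1 + z.2)
      gcongr
    · refine ae_of_all _ fun z => tendsto_const_nhds.congr' ?_
      filter_upwards [truncate_eventually_eq f z.1, truncate_eventually_eq g z.2,
        truncate_eventually_eq h (z.1 + z.2)] with n e1 e2 e3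
      rw [e1, e2, e3]
  refine le_of_tendsto hlim.norm (Eventually.of_forall fun n => ?_)
  refine (hcore _ _ _ (isCore_truncate mf n) (isCore_truncate mg n) (isCore_truncate mh n)).trans ?_
  have nn : ∀ p u, 0 ≤ normLp p u := fun p u => ENNReal.toReal_nonneg
  have a1 := normLp_truncate_le hf n
  have a2 := normLp_truncate_le hg n
  have a3 := normLp_truncate_le hh n
  have := nn p1 (truncate n f)
  have := nn p2 (truncate n g)
  have := nn p3 (truncate n h)
  have := nn p1 f
  have := nn p2 g
  have := nn p3 h
  gcongr

/-- Duality: an `L²` bound for a bilinear operator bounds the trilinear form. -/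
theorem norm_integral_mul_le_of_sq {G : ℝ × ℝ → ℂ} (hG : IsCore G) {u : ℝ → ℂ} (hu : IsCore u)
    {D p q : ℝ} (hD : 0 ≤ D) (hp : 0 < p) (hq : 0 < q) {v w : ℝ → ℂ} (hv : IsCore v)
    (hw : IsCore w)
    (h : ∫⁻ x, ‖∫ y, G (x, y)‖ₑ ^ 2 ≤
      ENNReal.ofReal D * ((∫⁻ x, ‖v x‖ₑ ^ p) ^ (2 / p) * (∫⁻ x, ‖w x‖ₑ ^ q) ^ (2 / q))) :
    ‖∫ z : ℝ × ℝ, u z.1 * G z‖ ≤ D ^ (1 / 2 : ℝ) * normLp 2 u * normLp p v * normLp q w := by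
  obtain ⟨BG, hBG⟩ := hG.bdd
  obtain ⟨N, hN⟩ := hG.supp
  obtain ⟨Bu, hBu⟩ := hu.bdd
  have hBu0 : 0 ≤ Bu := (norm_nonneg _).trans (hBu 0)
  have hc : IsCore fun z : ℝ × ℝ => u z.1 * G z := by
    refine ⟨(hu.meas.comp measurable_fst).mul hG.meas, ⟨Bu * BG, fun z => ?_⟩, N,
      fun z hz => by simp [hN z hz]⟩
    rw [norm_mul]
    exact mul_le_mul (hBu _) (hBG _) (norm_nonneg _) hBu0
  have e1 : ∫ z : ℝ × ℝ, u z.1 * G z = ∫ x, u x * ∫ y, G (x, y) := by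
    have := integral_prod _ (hc.integrable (volume.prod volume))
    rw [← Measure.volume_eq_prod] at this
    rw [this]
    simp only [integral_const_mul]
  have mI := hG.integral_right.meas
  have h2 : ‖∫ z : ℝ × ℝ, u z.1 * G z‖ₑ ≤
      (∫⁻ x, ‖u x‖ₑ ^ (2:ℝ)) ^ (1 / (2:ℝ)) * (∫⁻ x, ‖∫ y, G (x, y)‖ₑ ^ 2) ^ (1 / 2 : ℝ) := by
    rw [e1]
    refine (enorm_integral_le_lintegral_enorm _).trans ?_
    simp only [enorm_mul]
    have := ENNReal.lintegral_mul_le_Lp_mul_Lq volume Real.HolderConjugate.two_two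
      hu.meas.enorm.aemeasurable mI.enorm.aemeasurable
    simpa only [Pi.mul_apply, ENNReal.rpow_two] using this
  have nn : ∀ p u, 0 ≤ normLp p u := fun p u => ENNReal.toReal_nonneg
  have h3 : ‖∫ z : ℝ × ℝ, u z.1 * G z‖ₑ ≤
      ENNReal.ofReal (D ^ (1 / 2 : ℝ) * normLp 2 u * normLp p v * normLp q w) := by
    refine h2.trans ?_
    have a1 := nn 2 u
    have a2 := nn p v
    have a3 := nn q w
    rw [ENNReal.ofReal_mul (by positivity), ENNReal.ofReal_mul (by positivity),
      ENNReal.ofReal_mul (by positivity), ofReal_normLp (by norm_num) (hu.memLp _),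
      ofReal_normLp hp (hv.memLp _), ofReal_normLp hq (hw.memLp _),
      ← ENNReal.ofReal_rpow_of_nonneg hD (by norm_num)]
    refine (mul_le_mul_right (ENNReal.rpow_le_rpow h (by norm_num)) _).trans (le_of_eq ?_)
    rw [ENNReal.mul_rpow_of_nonneg _ _ (by norm_num), ENNReal.mul_rpow_of_nonneg _ _ (by norm_num),
      ← ENNReal.rpow_mul, ← ENNReal.rpow_mul, show 2 / p * (1 / 2) = 1 / p by ring,
      show 2 / q * (1 / 2) = 1 / q by ring]
    ring
  rw [← ofReal_norm] at h3
  have a1 := nn 2 u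
  have a2 := nn p v
  have a3 := nn q w
  exact (ENNReal.ofReal_le_ofReal_iff (by positivity)).1 h3

end Density

/-! ### The trilinear bound of part (i). -/

section PartOne

open Set ENNReal

theorem trilinearIntegrand_eq (l : ℝ) (S : ℝ × ℝ → ℝ) (φ : ℝ × ℝ → ℂ) (f g h : ℝ → ℂ) :
    trilinearIntegrand l S φ f g h =
      fun z => oscAmp l S φ z * (f z.1 * g z.2 * h (z.1 + z.2)) := by
  funext z
  rw [trilinearIntegrand, oscAmp]
  ring

theorem rpow_neg_half_sqrt {C t : ℝ} (hC : 0 ≤ C) (ht : 0 ≤ t) :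
    (C * t ^ (-(1 / 2) : ℝ)) ^ (1 / 2 : ℝ) = C ^ (1 / 2 : ℝ) * t ^ (-(1 / 4) : ℝ) := by
  rw [Real.mul_rpow hC (by positivity), ← Real.rpow_mul ht]
  norm_num

/-- The bound with `h` in `L²`. -/
theorem exists_trilinear_bound_sum {A c K p q : ℝ} (hA : 0 < A) (hc : 0 < c) (hK : 0 < K)
    (hp : 2 < p) (hp' : p < 4) (hq : 2 < q) (hq' : q < 4) (hpq : 1 / p + 1 / q = 3 / 4) :
    ∃ C : ℝ, 0 < C ∧ ∀ (δ μ : ℝ) (φ : ℝ × ℝ → ℂ) (S : ℝ × ℝ → ℝ) (U : Set (ℝ × ℝ)),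
      PhaseHyp A c K δ μ φ S U → ∀ l : ℝ, l ≠ 0 → ∀ f g h : ℝ → ℂ,
      MemLp f (ENNReal.ofReal p) volume → MemLp g (ENNReal.ofReal q) volume →
      MemLp h (ENNReal.ofReal 2) volume →
        Integrable (trilinearIntegrand l S φ f g h) volume ∧
        ‖trilinearForm l S φ f g h‖ ≤
          C * |l * μ| ^ (-(1 / 4) : ℝ) * normLp p f * normLp q g * normLp 2 h := by
  obtain ⟨C, hC, hmain⟩ := exists_lintegral_sq_convolution_le hA hc hK hp hp' hq hq' hpq
  refine ⟨C ^ (1 / 2 : ℝ), by positivity, fun δ μ φ S U H l hl f g h hf hg hh => ?_⟩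
  rw [trilinearForm, trilinearIntegrand_eq]
  refine trilinear_bound_of_core (H.isCore_oscAmp l) hp.le hq.le le_rfl (by positivity) ?_ hf hg hh
  intro f g h hf hg hh
  have hE := H.isCore_oscAmp l
  have h0 := hmain δ μ φ S U H l hl f g hf hg
  set E := oscAmp l S φ with hEd
  obtain ⟨Bf, hBf⟩ := hf.bdd
  obtain ⟨Bg, hBg⟩ := hg.bdd
  obtain ⟨BE, hBE⟩ := hE.bdd
  obtain ⟨ME, hME⟩ := hE.supp
  have hBf0 : 0 ≤ Bf := (norm_nonneg _).trans (hBf 0)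
  have hBE0 : 0 ≤ BE := (norm_nonneg _).trans (hBE 0)
  have hG : IsCore fun z : ℝ × ℝ => E (z.1 - z.2, z.2) * (f (z.1 - z.2) * g z.2) := by
    refine ⟨(hE.meas.comp (by fun_prop)).mul
      ((hf.meas.comp (by fun_prop)).mul (hg.meas.comp measurable_snd)), ⟨BE * (Bf * Bg),
      fun z => ?_⟩, 2 * ME, fun z hz => ?_⟩
    · rw [norm_mul, norm_mul]
      exact mul_le_mul (hBE _) (mul_le_mul (hBf _) (hBg _) (norm_nonneg _) hBf0) (by positivity)
        hBE0
    · by_contra hne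
      have h0 : ‖(z.1 - z.2, z.2)‖ ≤ ME := not_lt.1 fun h' => hne (by simp [hME _ h'])
      have h1 : |z.1 - z.2| ≤ ME := (norm_fst_le (z.1 - z.2, z.2)).trans h0
      have h1' : |z.2| ≤ ME := (norm_snd_le (z.1 - z.2, z.2)).trans h0
      have h2 : |z.1| ≤ 2 * ME := by
        calc |z.1| = |(z.1 - z.2) + z.2| := by ring_nf
          _ ≤ _ := (abs_add_le _ _).trans (by linarith)
      have h3 : ‖z‖ ≤ 2 * ME := by
        rw [Prod.norm_def]
        exact max_le h2 (h1'.trans (by linarith [abs_nonneg z.2]))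
      linarith
  have key := norm_integral_mul_le_of_sq hG hh (by positivity) (by linarith) (by linarith) hf hg h0
  rw [integral_shear, rpow_neg_half_sqrt hC.le (abs_nonneg _)] at key
  simp only [add_sub_cancel_right] at key
  calc ‖∫ z : ℝ × ℝ, E z * (f z.1 * g z.2 * h (z.1 + z.2))‖
      = ‖∫ z : ℝ × ℝ, h (z.1 + z.2) * (E z * (f z.1 * g z.2))‖ := by
        congr 2
        funext z
        ring
    _ ≤ _ := key
    _ = _ := by ring

end PartOne

/-! ### Smooth cutoffs at a given scale. -/

section Cutoff

open Set

/-- Passing to a longer scale weakens the admissible derivative bounds, so the constant must grow by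
the square of the ratio. -/
theorem IsAmplitude.scale {w w' a : ℝ} {ψ : ℝ → ℂ} (h : IsAmplitude w a ψ) (hw : 0 < w)
    (hw' : w ≤ w') : IsAmplitude w' (a * (w' / w) ^ 2) ψ := by
  have ha := h.nonneg
  obtain ⟨ψ1, ψ2, h1, h2, b0, b1, b2⟩ := h
  have hw'0 : 0 < w' := hw.trans_le hw'
  have hr : 1 ≤ w' / w := (one_le_div hw).2 hw'
  refine ⟨ψ1, ψ2, h1, h2, fun y => (b0 y).trans ?_, fun y => (b1 y).trans ?_,
    fun y => (b2 y).trans (le_of_eq ?_)⟩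
  · exact le_mul_of_one_le_right ha (one_le_pow₀ hr)
  · calc a / w = a * (w' / w) / w' := by field_simp
      _ ≤ a * (w' / w) ^ 2 / w' := by
        gcongr
        exact le_self_pow₀ hr (by norm_num)
  · field_simp

theorem IsAmplitude.rescale {a : ℝ} {ψ : ℝ → ℂ} (h : IsAmplitude 1 a ψ) {w : ℝ} (hw : 0 < w)
    (α : ℝ) : IsAmplitude w a fun y => ψ ((y - α) / w) := by
  obtain ⟨ψ1, ψ2, h1, h2, b0, b1, b2⟩ := h
  have hd : ∀ y, HasDerivAt (fun y => (y - α) / w) (1 / w) y := fun y =>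
    ((hasDerivAt_id y).sub_const α).div_const w
  have hwn : ‖(1 / w : ℝ)‖ = 1 / w := Real.norm_of_nonneg (by positivity)
  refine ⟨fun y => (1 / w) • ψ1 ((y - α) / w), fun y => (1 / w) • (1 / w) • ψ2 ((y - α) / w),
    fun y => ?_, fun y => ?_, fun y => b0 _, fun y => ?_, fun y => ?_⟩
  · exact HasDerivAt.scomp y (h1 _) (hd y)
  · exact (HasDerivAt.scomp y (h2 _) (hd y)).const_smul (1 / w)
  · rw [norm_smul, hwn]
    have := b1 ((y - α) / w)
    rw [div_one] at this
    calc 1 / w * ‖ψ1 ((y - α) / w)‖ ≤ 1 / w * a := by gcongr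
      _ = _ := by ring
  · rw [norm_smul, norm_smul, hwn]
    have := b2 ((y - α) / w)
    rw [one_pow, div_one] at this
    calc 1 / w * (1 / w * ‖ψ2 ((y - α) / w)‖) ≤ 1 / w * (1 / w * a) := by gcongr
      _ = _ := by ring

/-- A fixed smooth bump, equal to one on `[-1,1]` and supported in `[-3/2,3/2]`. -/
noncomputable def unitBump : ContDiffBump (0 : ℝ) := ⟨1, 3 / 2, by norm_num, by norm_num⟩

theorem unitBump_contDiff : ContDiff ℝ ∞ (unitBump : ℝ → ℝ) := unitBump.contDiff

theorem unitBump_eq_one {x : ℝ} (hx : |x| ≤ 1) : unitBump x = 1 :=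
  unitBump.one_of_mem_closedBall (by simpa [unitBump] using hx)

theorem unitBump_tsupport : tsupport (unitBump : ℝ → ℝ) = Icc (-(3 / 2)) (3 / 2) := by
  rw [unitBump.tsupport_eq, Real.closedBall_eq_Icc]
  simp [unitBump]

theorem exists_bound_of_tsupport {f : ℝ → ℝ} (hf : Continuous f)
    (h : ∀ x, x ∉ Icc (-(3 / 2) : ℝ) (3 / 2) → f x = 0) : ∃ a : ℝ, 0 ≤ a ∧ ∀ x, |f x| ≤ a := by
  obtain ⟨a, ha⟩ := (HasCompactSupport.intro (isCompact_Icc) h).exists_bound_of_continuous hf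
  exact ⟨a, (norm_nonneg _).trans (ha 0), ha⟩

theorem exists_unitBump_bound : ∃ a : ℝ, 1 ≤ a ∧ (∀ x, |unitBump x| ≤ a) ∧
    (∀ x, |deriv unitBump x| ≤ a) ∧ ∀ x, |deriv (deriv unitBump) x| ≤ a := by
  have c0 := unitBump_contDiff
  have c1 : ContDiff ℝ ∞ (deriv (unitBump : ℝ → ℝ)) := by
    simpa using c0.iterate_deriv 1
  have c2 : ContDiff ℝ ∞ (deriv (deriv (unitBump : ℝ → ℝ))) := by
    simpa using c1.iterate_deriv 1
  have s0 : ∀ x, x ∉ Icc (-(3 / 2) : ℝ) (3 / 2) → unitBump x = 0 := fun x hx =>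
    image_eq_zero_of_notMem_tsupport (by rwa [unitBump_tsupport])
  have s1 : ∀ x, x ∉ Icc (-(3 / 2) : ℝ) (3 / 2) → deriv (unitBump : ℝ → ℝ) x = 0 := fun x hx => by
    by_contra h
    exact hx (unitBump_tsupport ▸ support_deriv_subset h)
  have s2 : ∀ x, x ∉ Icc (-(3 / 2) : ℝ) (3 / 2) → deriv (deriv (unitBump : ℝ → ℝ)) x = 0 :=
    fun x hx => by
    by_contra h
    have h1 := support_deriv_subset (f := deriv (unitBump : ℝ → ℝ)) h
    exact hx (unitBump_tsupport ▸ tsupport_deriv_subset h1)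
  obtain ⟨a0, p0, h0⟩ := exists_bound_of_tsupport c0.continuous s0
  obtain ⟨a1, p1, h1⟩ := exists_bound_of_tsupport c1.continuous s1
  obtain ⟨a2, p2, h2⟩ := exists_bound_of_tsupport c2.continuous s2
  exact ⟨1 + a0 + a1 + a2, by linarith, fun x => (h0 x).trans (by linarith),
    fun x => (h1 x).trans (by linarith), fun x => (h2 x).trans (by linarith)⟩

theorem hasDerivAt_unitBump (x : ℝ) : HasDerivAt unitBump (deriv unitBump x) x :=
  (unitBump_contDiff.differentiable (by simp) x).hasDerivAt

theorem hasDerivAt_deriv_unitBump (x : ℝ) :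
    HasDerivAt (deriv unitBump) (deriv (deriv unitBump) x) x := by
  have c1 : ContDiff ℝ ∞ (deriv (unitBump : ℝ → ℝ)) := by
    simpa using unitBump_contDiff.iterate_deriv 1
  exact (c1.differentiable (by simp) x).hasDerivAt

/-- Multiplying a rough function on an interval by this cutoff changes nothing, but gives
correlation kernels a smooth amplitude with constants independent of the interval. -/
theorem exists_isAmplitude_cutoff : ∃ a : ℝ, 0 < a ∧ ∀ (w α : ℝ), 0 < w → ∃ ζ : ℝ → ℂ,
    IsAmplitude (3 * w) a ζ ∧ (∀ y, ζ y ≠ 0 → y ∈ Icc (α - w) (α - w + 3 * w)) ∧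
    ∀ y ∈ Icc α (α + w), ζ y = 1 := by
  obtain ⟨a, ha, h0, h1, h2⟩ := exists_unitBump_bound
  have hamp : IsAmplitude 1 a fun x => (unitBump x : ℂ) := by
    refine ⟨fun x => (deriv unitBump x : ℝ), fun x => (deriv (deriv unitBump) x : ℝ),
      fun x => (hasDerivAt_unitBump x).ofReal_comp, fun x =>
      (hasDerivAt_deriv_unitBump x).ofReal_comp, fun x => ?_, fun x => ?_, fun x => ?_⟩
    · rw [Complex.norm_real]; exact h0 x
    · rw [Complex.norm_real, div_one]; exact h1 x
    · rw [Complex.norm_real, one_pow, div_one]; exact h2 x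
  refine ⟨a * 9, by linarith, fun w α hw => ⟨fun y => (unitBump ((y - (α + w / 2)) / w) : ℂ),
    ?_, fun y hy => ?_, fun y hy => ?_⟩⟩
  · have := (hamp.rescale hw (α + w / 2)).scale (w' := 3 * w) hw (by linarith)
    convert this using 2
    field_simp; norm_num
  · have h3 : (y - (α + w / 2)) / w ∈ tsupport (unitBump : ℝ → ℝ) :=
      subset_tsupport _ (by simpa using hy)
    rw [unitBump_tsupport, mem_Icc, le_div_iff₀ hw, div_le_iff₀ hw] at h3
    constructor <;> linarith [h3.1, h3.2]
  · have : |(y - (α + w / 2)) / w| ≤ 1 := by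
      rw [abs_le, le_div_iff₀ hw, div_le_iff₀ hw]
      constructor <;> linarith [hy.1, hy.2]
    simp only [unitBump_eq_one this, Complex.ofReal_one]

end Cutoff

/-! ### A van der Corput bound in terms of the arctangent of the phase derivative. -/

section VanDerCorput

open Set Complex

/-- Van der Corput's lemma, with the bound expressed through the range of the derivative of the
phase. -/
theorem exists_norm_integral_le_arctan : ∃ C : ℝ, 0 < C ∧
    ∀ (ψ ψ1 ψ2 : ℝ → ℂ) (Θ d d' : ℝ → ℝ) (a0 x0 : ℝ), 0 ≤ a0 →
    (∀ x, HasDerivAt ψ (ψ1 x) x) → (∀ x, HasDerivAt ψ1 (ψ2 x) x) → Continuous ψ2 →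
    tsupport ψ ⊆ Ioo (x0 - 2) (x0 + 2) → (∀ x, ‖ψ x‖ ≤ a0) → (∀ x, ‖ψ1 x‖ ≤ a0) →
    (∀ x, ‖ψ2 x‖ ≤ a0) → (∀ x, HasDerivAt Θ (d x) x) → (∀ x, HasDerivAt d (d' x) x) →
    Continuous d' → (∀ x, 9 / 10 ≤ d' x) →
    ‖∫ x, ψ x * exp (I * Θ x)‖ ≤
      C * a0 * (Real.arctan (d (x0 + 2)) - Real.arctan (d (x0 - 2))) := by
  -- Over the interval d grows by at least 4·(9/10) = 18/5; 9/5 is half of this.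
  set c0 : ℝ := Real.arctan (9 / 5) - Real.arctan 1 with hc0
  have hc0p : 0 < c0 := sub_pos.2 (Real.arctan_strictMono (by norm_num))
  refine ⟨4 / c0 + 10, by positivity, ?_⟩
  intro ψ ψ1 ψ2 Θ d d' a0 x0 ha0 h1 h2 hc2 hsupp b0 b1 b2 hΘ hd hd'c hd'
  have hnorm : ∀ y, ‖exp (I * Θ y)‖ = 1 := fun y => by
    rw [mul_comm]; exact norm_exp_ofReal_mul_I (Θ y)
  have hmono : StrictMono d := strictMono_of_hasDerivAt_pos hd fun x => by linarith [hd' x]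
  set Δ : ℝ := Real.arctan (d (x0 + 2)) - Real.arctan (d (x0 - 2)) with hΔ
  have hΔ0 : 0 ≤ Δ := sub_nonneg.2 (Real.arctan_strictMono.monotone (hmono.monotone (by linarith)))
  have hψ0 : ∀ x, x ∉ Ioo (x0 - 2) (x0 + 2) → ψ x = 0 := fun x hx =>
    image_eq_zero_of_notMem_tsupport fun h => hx (hsupp h)
  have hψ10 : ∀ x, x ∉ Ioo (x0 - 2) (x0 + 2) → ψ1 x = 0 := fun x hx =>
    (h1 x).unique (hasDerivAt_zero_of_notMem_tsupport (fun _ h => h) fun h => hx (hsupp h))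
  have hint : ∫ x, ψ x * exp (I * Θ x) = ∫ x in (x0 - 2)..(x0 + 2), ψ x * exp (I * Θ x) := by
    rw [intervalIntegral.integral_of_le (by linarith), setIntegral_eq_integral_of_forall_compl_eq_zero]
    intro x hx
    rw [hψ0 x fun h => hx (Ioo_subset_Ioc_self h), zero_mul]
  rw [hint]
  have hgap : d (x0 + 2) - d (x0 - 2) ≥ 18 / 5 := by
    have := Convex.mul_sub_le_image_sub_of_le_deriv (D := univ) (C := 9 / 10) convex_univ
      (f := d) (continuousOn_univ.2 (continuous_iff_continuousAt.2 fun x => (hd x).continuousAt))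
      (fun x _ => (hd x).differentiableAt.differentiableWithinAt)
      (fun x _ => by rw [(hd x).deriv]; exact hd' x) (x0 - 2) (mem_univ _) (x0 + 2) (mem_univ _)
      (by linarith)
    linarith
  have hsmall : Real.arctan 1 + c0 = Real.arctan (9 / 5) := by rw [hc0]; ring
  -- If the range of d meets [-1,1], its length forces it to reach ±9/5, so the arctangent
  -- difference is at least c0 and the trivial bound suffices. Otherwise |d| ≥ 1 throughout.
  by_cases hcase : d (x0 - 2) ≤ 1 ∧ -1 ≤ d (x0 + 2)
  · have hΔc : c0 ≤ Δ := by
      rcases le_total (9 / 5) (d (x0 + 2)) with hb | hb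
      · have e1 := Real.arctan_strictMono.monotone hb
        have e2 := Real.arctan_strictMono.monotone hcase.1
        linarith
      · have e1 := Real.arctan_strictMono.monotone (show d (x0 - 2) ≤ -(9 / 5) by linarith)
        have e2 := Real.arctan_strictMono.monotone hcase.2
        rw [Real.arctan_neg] at e1 e2
        linarith
    have := intervalIntegral.norm_integral_le_of_norm_le_const (a := x0 - 2) (b := x0 + 2)
      (C := a0) (f := fun x => ψ x * exp (I * Θ x)) (fun x _ => by
        rw [norm_mul, hnorm, mul_one]; exact b0 x)
    refine this.trans ?_
    rw [show x0 + 2 - (x0 - 2) = 4 by ring, abs_of_pos (by norm_num : (0:ℝ) < 4)]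
    have h4 : 4 ≤ 4 / c0 * Δ := by
      rw [div_mul_eq_mul_div, le_div_iff₀ hc0p]
      linarith
    calc a0 * 4 ≤ a0 * (4 / c0 * Δ) := by gcongr
      _ ≤ a0 * (4 / c0 * Δ) + 10 * (a0 * Δ) := by
        have : 0 ≤ a0 * Δ := by positivity
        linarith
      _ = _ := by ring
  have habs : ∀ x ∈ Icc (x0 - 2) (x0 + 2), 1 ≤ |d x| := by
    intro x hx
    rw [not_and_or, not_le, not_le] at hcase
    rcases hcase with h | h
    · exact le_abs.2 (Or.inl (h.le.trans (hmono.monotone hx.1)))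
    · refine le_abs.2 (Or.inr ?_)
      have := hmono.monotone hx.2
      linarith
  have hne : ∀ x ∈ Icc (x0 - 2) (x0 + 2), (d x : ℂ) ≠ 0 := fun x hx h => by
    have := habs x hx
    rw [ofReal_eq_zero.1 h, abs_zero] at this
    linarith
  -- E is the error after integrating by parts. The term ψd'/d² is not integrated again: for |d| ≥ 1
  -- it is comparable to the derivative of arctan d, which is why no upper bound on d' is needed.
  set E : ℝ → ℂ := fun x => (-(ψ x * d' x / d x ^ 2) + I * (ψ2 x / d x ^ 2 -
    2 * (ψ1 x * d' x / d x ^ 3))) * exp (I * Θ x) with hE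
  set F : ℝ → ℂ := fun x => (ψ x / d x + I * (ψ1 x / d x ^ 2)) * exp (I * Θ x) with hF
  have hFd : ∀ x ∈ Icc (x0 - 2) (x0 + 2),
      HasDerivAt F (I * (ψ x * exp (I * Θ x)) + E x) x := by
    intro y hy
    have hn := hne y hy
    have d1 : HasDerivAt (fun y => (Θ y : ℂ)) (d y) y := (hΘ y).ofReal_comp
    have d2 : HasDerivAt (fun y => (d y : ℂ)) (d' y) y := (hd y).ofReal_comp
    have d4 := (d1.const_mul I).cexp
    have d5 := (((h1 y).div d2 hn).add (((h2 y).div (d2.pow 2) (pow_ne_zero 2 hn)).const_mul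
      I)).mul d4
    refine (d5.congr_deriv ?_)
    simp only [hE, Pi.div_apply, Pi.mul_apply, Pi.pow_apply, Pi.add_apply, Pi.sub_apply]
    push_cast
    have hI : I ^ 2 = -1 := I_sq
    field_simp
    ring_nf
    rw [hI]
    ring
  have cψ : Continuous ψ := continuous_iff_continuousAt.2 fun x => (h1 x).continuousAt
  have cψ1 : Continuous ψ1 := continuous_iff_continuousAt.2 fun x => (h2 x).continuousAt
  have cd : Continuous d := continuous_iff_continuousAt.2 fun x => (hd x).continuousAt
  have cΘ : Continuous Θ := continuous_iff_continuousAt.2 fun x => (hΘ x).continuousAt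
  have cxp : Continuous fun x => exp (I * Θ x) := by fun_prop
  have hle : x0 - 2 ≤ x0 + 2 := by linarith
  have cE : ContinuousOn E (uIcc (x0 - 2) (x0 + 2)) := by
    rw [uIcc_of_le hle]
    have q : ∀ n : ℕ, ∀ x ∈ Icc (x0 - 2) (x0 + 2), ((d x : ℂ)) ^ n ≠ 0 :=
      fun n x hx => pow_ne_zero n (hne x hx)
    have cd1 : Continuous fun x => (d x : ℂ) := continuous_ofReal.comp cd
    have cd2 : Continuous fun x => (d' x : ℂ) := continuous_ofReal.comp hd'c
    refine ContinuousOn.mul (ContinuousOn.add (ContinuousOn.neg ?_) (ContinuousOn.mul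
      continuousOn_const (ContinuousOn.sub ?_ (ContinuousOn.mul continuousOn_const ?_))))
      cxp.continuousOn
    · exact ContinuousOn.div (by fun_prop) (by fun_prop) (q 2)
    · exact ContinuousOn.div (by fun_prop) (by fun_prop) (q 2)
    · exact ContinuousOn.div (by fun_prop) (by fun_prop) (q 3)
  have iE : IntervalIntegrable E volume (x0 - 2) (x0 + 2) := cE.intervalIntegrable
  have iψ : IntervalIntegrable (fun x => I * (ψ x * exp (I * Θ x))) volume (x0 - 2) (x0 + 2) :=
    (continuous_const.mul (cψ.mul cxp)).intervalIntegrable _ _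
  have hftc := intervalIntegral.integral_eq_sub_of_hasDerivAt (a := x0 - 2) (b := x0 + 2)
    (fun x hx => hFd x (by rwa [uIcc_of_le hle] at hx)) (iψ.add iE)
  have hF0 : ∀ x, x ∉ Ioo (x0 - 2) (x0 + 2) → F x = 0 := fun x hx => by
    simp [hF, hψ0 x hx, hψ10 x hx]
  rw [hF0 (x0 + 2) (by simp), hF0 (x0 - 2) (by simp), sub_zero,
    intervalIntegral.integral_add iψ iE, intervalIntegral.integral_const_mul] at hftc
  have hnE : ‖∫ x in (x0 - 2)..(x0 + 2), ψ x * exp (I * Θ x)‖ = ‖∫ x in (x0 - 2)..(x0 + 2), E x‖ := by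
    have : I * (∫ x in (x0 - 2)..(x0 + 2), ψ x * exp (I * Θ x)) = -∫ x in (x0 - 2)..(x0 + 2), E x :=
      eq_neg_of_add_eq_zero_left hftc
    rw [← norm_neg (∫ x in (x0 - 2)..(x0 + 2), E x), ← this, norm_mul, norm_I, one_mul]
  have hder : ∀ x, HasDerivAt (fun x => Real.arctan (d x)) (1 / (1 + d x ^ 2) * d' x) x := fun x =>
    (hd x).arctan
  have cder : Continuous fun x => 1 / (1 + d x ^ 2) * d' x := by
    refine Continuous.mul (Continuous.div continuous_const (by fun_prop) fun x => ?_) hd'c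
    positivity
  have hint2 : ∫ x in (x0 - 2)..(x0 + 2), 1 / (1 + d x ^ 2) * d' x = Δ :=
    intervalIntegral.integral_eq_sub_of_hasDerivAt (fun x _ => hder x) (cder.intervalIntegrable _ _)
  rw [hnE]
  calc ‖∫ x in (x0 - 2)..(x0 + 2), E x‖
      ≤ ∫ x in (x0 - 2)..(x0 + 2), (10 * a0) * (1 / (1 + d x ^ 2) * d' x) := by
        refine intervalIntegral.norm_integral_le_of_norm_le hle ?_
          ((continuous_const.mul cder).intervalIntegrable _ _)
        refine ae_of_all _ fun x hx => ?_
        have hx' := Ioc_subset_Icc_self hx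
        have hd1 := habs x hx'
        have hdp := hd' x
        have hd2 : 1 ≤ |d x| ^ 2 := one_le_pow₀ hd1
        have hd3 : |d x| ^ 2 ≤ |d x| ^ 3 := pow_le_pow_right₀ hd1 (by norm_num)
        have nn : ∀ t : ℝ, ‖(t : ℂ)‖ = |t| := fun t => by rw [norm_real, Real.norm_eq_abs]
        have hd'a : |d' x| = d' x := abs_of_pos (by linarith)
        have t1 : ‖ψ x * d' x / d x ^ 2‖ ≤ a0 * d' x / |d x| ^ 2 := by
          rw [norm_div, norm_mul, norm_pow, nn, nn, hd'a]
          have := b0 x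
          gcongr
        -- The lower bound on d' lets a factor d' be inserted at the price of a constant.
        have t2 : ‖ψ2 x / d x ^ 2‖ ≤ 2 * (a0 * d' x) / |d x| ^ 2 := by
          rw [norm_div, norm_pow, nn]
          have := b2 x
          gcongr
          nlinarith
        have t3 : ‖ψ1 x * d' x / d x ^ 3‖ ≤ a0 * d' x / |d x| ^ 2 := by
          rw [norm_div, norm_mul, norm_pow, nn, nn, hd'a]
          have := b1 x
          gcongr
        have hX : a0 * d' x / |d x| ^ 2 ≤ 2 * (a0 * (1 / (1 + d x ^ 2) * d' x)) := by
          rw [sq_abs] at hd2 ⊢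
          rw [div_le_iff₀ (by linarith)]
          have e : 2 * (a0 * (1 / (1 + d x ^ 2) * d' x)) * d x ^ 2 =
              a0 * d' x * (2 * d x ^ 2 / (1 + d x ^ 2)) := by field_simp
          rw [e]
          refine le_mul_of_one_le_right (by positivity) ?_
          rw [one_le_div (by positivity)]
          linarith
        have hE3 : ‖E x‖ ≤ ‖ψ x * d' x / d x ^ 2‖ + (‖ψ2 x / d x ^ 2‖ +
            2 * ‖ψ1 x * d' x / d x ^ 3‖) := by
          simp only [hE]
          rw [norm_mul, hnorm, mul_one]
          refine (norm_add_le _ _).trans ?_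
          rw [norm_neg, norm_mul, norm_I, one_mul]
          gcongr
          refine (norm_sub_le _ _).trans ?_
          rw [norm_mul (2 : ℂ)]
          simp
        have t2' : 2 * (a0 * d' x) / |d x| ^ 2 = 2 * (a0 * d' x / |d x| ^ 2) := by ring
        linarith
    _ = 10 * a0 * Δ := by rw [intervalIntegral.integral_const_mul, hint2]
    _ ≤ (4 / c0 + 10) * a0 * Δ := by
      have : 0 ≤ 4 / c0 * (a0 * Δ) := by positivity
      linarith

end VanDerCorput

/-! ### Almost orthogonality across frequency intervals, and Bessel's inequality. -/

section FrequencySchur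

open Set ENNReal ComplexConjugate

/-- An almost orthogonality estimate for a finite family of modulated phases observed on disjoint
frequency intervals. -/
theorem sum_lintegral_sq_le_of_kernel {ι : Type*} [Fintype ι] [MeasurableSpace ι]
    [MeasurableSingletonClass ι] {p : ι → ℝ → ℝ} (hp : ∀ i, Continuous (p i)) {lo hi : ι → ℝ}
    (hdisj : ∀ i j, i ≠ j → Disjoint (Icc (lo i) (hi i)) (Icc (lo j) (hi j)))
    {ζ : ℝ → ℂ} (hζ : Continuous ζ) {β γ : ℝ} (hζs : ∀ y, ζ y ≠ 0 → y ∈ Icc β γ)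
    {Φ : ℝ → ℝ≥0∞} {M : ℝ≥0∞} (hM : ∀ t, ∫⁻ ξ, Φ (t - ξ) ≤ M)
    (hker : ∀ i j, ∀ ξ ∈ Icc (lo i) (hi i), ∀ ξ' ∈ Icc (lo j) (hi j),
      ‖∫ y, ζ y * conj (ζ y) * Complex.exp (Complex.I *
        (((p i y - ξ * y) - (p j y - ξ' * y) : ℝ) : ℂ))‖ₑ ≤ Φ (ξ - ξ'))
    {G : ℝ → ℂ} (hG : IsCore G) (hζG : ∀ y, ζ y * G y = G y) :
    ∑ i, ∫⁻ ξ in Icc (lo i) (hi i),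
      ‖∫ y, G y * Complex.exp (Complex.I * ((p i y - ξ * y : ℝ) : ℂ))‖ₑ ^ 2 ≤
      M * ∫⁻ y, ‖G y‖ₑ ^ 2 := by
  obtain ⟨BG, hBG⟩ := hG.bdd
  obtain ⟨Bζ, hBζ⟩ := (HasCompactSupport.intro (isCompact_Icc (a := β) (b := γ)) fun y hy => by
    by_contra h; exact hy (hζs y h)).exists_bound_of_continuous hζ
  have hBζ0 : 0 ≤ Bζ := (norm_nonneg _).trans (hBζ 0)
  set J : Set ℝ := ⋃ i, Icc (lo i) (hi i) with hJ
  have hJm : MeasurableSet J := MeasurableSet.iUnion fun i => measurableSet_Icc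
  have hJf : volume J < ⊤ := by
    refine (measure_iUnion_fintype_le _ _).trans_lt (ENNReal.sum_lt_top.2 fun i _ => by simp)
  have : IsFiniteMeasure (volume.restrict J : Measure ℝ) := ⟨by simpa using hJf⟩
  classical
  -- One operator from functions of y to functions of (i,ξ), cut to the i-th interval; the T T* form
  -- of Schur's test is applied with counting measure in i.
  set k : (ι × ℝ) × ℝ → ℂ := fun z => if z.1.2 ∈ Icc (lo z.1.1) (hi z.1.1) then
    ζ z.2 * Complex.exp (Complex.I * ((p z.1.1 z.2 - z.1.2 * z.2 : ℝ) : ℂ)) else 0 with hk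
  have hk0 : ∀ i ξ y, ξ ∉ Icc (lo i) (hi i) → k ((i, ξ), y) = 0 := fun i ξ y h => if_neg h
  have hnorm : ∀ t : ℝ, ‖Complex.exp (Complex.I * (t : ℂ))‖ = 1 := fun t => by
    rw [mul_comm]; exact Complex.norm_exp_ofReal_mul_I t
  have mp : Measurable fun z : (ι × ℝ) × ℝ => p z.1.1 z.2 := by
    have h1 : Measurable (Function.uncurry p) :=
      measurable_from_prod_countable_right fun i => (hp i).measurable
    exact h1.comp (by fun_prop : Measurable fun z : (ι × ℝ) × ℝ => (z.1.1, z.2))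
  have mlo : Measurable fun z : (ι × ℝ) × ℝ => lo z.1.1 :=
    (measurable_of_countable lo).comp (by fun_prop)
  have mhi : Measurable fun z : (ι × ℝ) × ℝ => hi z.1.1 :=
    (measurable_of_countable hi).comp (by fun_prop)
  have hkm : Measurable k := by
    refine Measurable.ite ?_ ?_ measurable_const
    · exact (measurableSet_le mlo (by fun_prop)).inter (measurableSet_le (by fun_prop) mhi)
    · refine (hζ.measurable.comp measurable_snd).mul (Complex.measurable_exp.comp
        (measurable_const.mul (Complex.measurable_ofReal.comp (mp.sub ?_))))
      fun_prop
  have hkB : ∀ z, ‖k z‖ ≤ Bζ := fun z => by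
    simp only [hk]
    split_ifs
    · rw [norm_mul, hnorm, mul_one]; exact hBζ _
    · simpa using hBζ0
  have hset : ∀ F : ℝ → ℂ, (∀ y, ζ y = 0 → F y = 0) → ∫ y in Icc β γ, F y = ∫ y, F y :=
    fun F hF => setIntegral_eq_integral_of_forall_compl_eq_zero fun y hy => hF y (by
      by_contra h; exact hy (hζs y h))
  have key := schur_TTstar (ν := (Measure.count : Measure ι).prod (volume.restrict J))
    (ρ := volume.restrict (Icc β γ)) hkm hkB hG.meas hBG (M := M) ?_
  · have hmeasI : Measurable fun z : ι × ℝ => ‖∫ y in Icc β γ, k (z, y) * G y‖ₑ ^ 2 := by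
      have : Measurable fun z : (ι × ℝ) × ℝ => k z * G z.2 := hkm.mul (hG.meas.comp measurable_snd)
      exact ((this.stronglyMeasurable.integral_prod_right'
        (ν := volume.restrict (Icc β γ))).measurable.enorm.pow_const 2)
    rw [lintegral_prod _ hmeasI.aemeasurable, lintegral_count, tsum_fintype] at key
    refine le_trans (le_of_eq (Finset.sum_congr rfl fun i _ => ?_)) (key.trans
      (mul_le_mul_right (setLIntegral_le_lintegral _ _) _))
    have e1 : ∀ ξ, ‖∫ y in Icc β γ, k ((i, ξ), y) * G y‖ₑ ^ 2 = indicator (Icc (lo i) (hi i))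
        (fun ξ => ‖∫ y, G y * Complex.exp (Complex.I * ((p i y - ξ * y : ℝ) : ℂ))‖ₑ ^ 2) ξ := by
      intro ξ
      by_cases hξ : ξ ∈ Icc (lo i) (hi i)
      · rw [indicator_of_mem hξ, hset _ (fun y hy => by rw [← hζG y, hy]; ring)]
        congr 2
        refine integral_congr_ae (ae_of_all _ fun y => ?_)
        simp only [hk, if_pos hξ]
        rw [mul_right_comm, hζG]
      · rw [indicator_of_notMem hξ]
        simp [hk0 i ξ _ hξ]
    simp only [e1]
    rw [lintegral_indicator measurableSet_Icc, Measure.restrict_restrict measurableSet_Icc,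
      inter_eq_left.2 (subset_iUnion (fun i => Icc (lo i) (hi i)) i)]
  · rintro ⟨i, ξ⟩
    by_cases hξ : ξ ∈ Icc (lo i) (hi i)
    · have e2 : ∀ z : ι × ℝ, ‖∫ y in Icc β γ, k ((i, ξ), y) * conj (k (z, y))‖ₑ ≤
          indicator (Icc (lo z.1) (hi z.1)) (fun ξ' => Φ (ξ - ξ')) z.2 := by
        rintro ⟨j, ξ'⟩
        by_cases hξ' : ξ' ∈ Icc (lo j) (hi j)
        · rw [indicator_of_mem hξ']
          refine le_trans (le_of_eq ?_) (hker i j ξ hξ ξ' hξ')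
          rw [hset _ fun y hy => by simp [hk, hy]]
          congr 1
          refine integral_congr_ae (ae_of_all _ fun y => ?_)
          simp only [hk, if_pos hξ, if_pos hξ', map_mul, ← Complex.exp_conj, Complex.conj_I,
            Complex.conj_ofReal]
          rw [mul_mul_mul_comm, ← Complex.exp_add]
          congr 2
          push_cast
          ring
        · simp [hk0 j ξ' _ hξ']
      refine (lintegral_mono e2).trans ?_
      refine (lintegral_prod_le _).trans ?_
      rw [lintegral_count, tsum_fintype]
      calc ∑ j, ∫⁻ ξ' in J, indicator (Icc (lo j) (hi j)) (fun ξ' => Φ (ξ - ξ')) ξ'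
          ≤ ∑ j, ∫⁻ ξ' in Icc (lo j) (hi j), Φ (ξ - ξ') := by
            refine Finset.sum_le_sum fun j _ => ?_
            rw [← lintegral_indicator measurableSet_Icc]
            exact setLIntegral_le_lintegral _ _
        -- Disjointness is used here: the sum over j becomes one integral, so the bound does not
        -- depend on the number of indices.
        _ = ∫⁻ ξ' in J, Φ (ξ - ξ') := by
            rw [hJ, lintegral_iUnion (fun i => measurableSet_Icc) (fun i j h => hdisj i j h),
              tsum_fintype]
        _ ≤ M := (setLIntegral_le_lintegral _ _).trans (hM ξ)
    · simp [hk0 i ξ _ hξ]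

/-- A Bessel inequality for the Fourier transform of a function supported in an interval. -/
theorem exists_lintegral_fourier_sq_le : ∃ C : ℝ, 0 < C ∧ ∀ (w α : ℝ), 0 < w → ∀ G : ℝ → ℂ,
    IsCore G → (∀ y, G y ≠ 0 → y ∈ Icc α (α + w)) →
    ∫⁻ ξ : ℝ, ‖∫ y, G y * Complex.exp (Complex.I * ((-(ξ * y) : ℝ) : ℂ))‖ₑ ^ 2 ≤
      ENNReal.ofReal C * ∫⁻ y, ‖G y‖ₑ ^ 2 := by
  obtain ⟨a, ha, hcut⟩ := exists_isAmplitude_cutoff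
  refine ⟨14 * (4 * (a * a)) * Real.pi, by positivity, fun w α hw G hG hGs => ?_⟩
  obtain ⟨ζ, hζ, hζs, hζ1⟩ := hcut w α hw
  have hw3 : 0 < 3 * w := by positivity
  have hamp := hζ.mul hζ.conj hw3
  have hζc : Continuous ζ := by
    obtain ⟨ψ1, _, h1, _⟩ := hζ
    exact continuous_iff_continuousAt.2 fun y => (h1 y).continuousAt
  have hn : ∀ n : ℕ, ∫⁻ ξ in Icc (-(n : ℝ)) n,
      ‖∫ y, G y * Complex.exp (Complex.I * ((-(ξ * y) : ℝ) : ℂ))‖ₑ ^ 2 ≤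
      ENNReal.ofReal (14 * (4 * (a * a)) * Real.pi) * ∫⁻ y, ‖G y‖ₑ ^ 2 := by
    intro n
    -- A single interval [-n,n] with zero phase; the bound is uniform in n, and n tends to infinity
    -- afterwards.
    have key := sum_lintegral_sq_le_of_kernel (ι := Unit) (p := fun _ _ => 0)
      (fun _ => continuous_const) (lo := fun _ => -(n : ℝ)) (hi := fun _ => (n : ℝ))
      (fun i j h => absurd (Subsingleton.elim i j) h) hζc hζs
      (Φ := fun t => ENNReal.ofReal (14 * (4 * (a * a)) *
        ((3 * w) / (1 + ((3 * w) * (1 * |t|)) ^ 2))))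
      (M := ENNReal.ofReal (14 * (4 * (a * a)) * Real.pi)) (fun t => ?_)
      (fun _ _ ξ _ ξ' _ => ?_) hG (fun y => ?_)
    · simpa using key
    · have : ∀ ξ, ENNReal.ofReal (14 * (4 * (a * a)) *
          ((3 * w) / (1 + ((3 * w) * (1 * |t - ξ|)) ^ 2))) = ENNReal.ofReal (14 * (4 * (a * a))) *
          ENNReal.ofReal ((3 * w) / (1 + ((3 * w) * (1 * |t - ξ|)) ^ 2)) := fun ξ => by
        rw [ENNReal.ofReal_mul (by positivity)]
      simp_rw [this]
      rw [lintegral_const_mul' _ _ ENNReal.ofReal_ne_top, lintegral_inv_one_add_sq hw3 one_pos,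
        ← ENNReal.ofReal_mul (by positivity), div_one]
    · rw [← ofReal_norm]
      refine ENNReal.ofReal_le_ofReal ?_
      have := norm_integral_amplitude_mul_exp_le (θ := fun y => (0 - ξ * y) - (0 - ξ' * y))
        (θ1 := fun _ => -ξ + ξ') (u := fun _ => 0) (u1 := fun _ => 0) (D := 1 * |ξ - ξ'|) (B := 0)
        (E0 := 0) (α := α - w) hw3 (by positivity) le_rfl le_rfl hamp
        (fun y hy => hζs y fun h => hy (by simp [h])) (fun y _ => ?_)
        (fun y _ => hasDerivAt_const _ _) (fun y _ => hasDerivAt_const _ _) (fun y _ => ?_)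
        (fun y _ => by simp) (fun y _ => by simp)
      · refine this.trans (le_of_eq ?_)
        ring
      · have h1 := (((hasDerivAt_id y).const_mul ξ).const_sub 0).sub
          (((hasDerivAt_id y).const_mul ξ').const_sub 0)
        refine h1.congr_deriv ?_
        ring
      · rw [one_mul, abs_sub_comm, show ξ' - ξ = -ξ + ξ' by ring]
    · by_cases h : G y = 0
      · simp [h]
      · rw [hζ1 y (hGs y h), one_mul]
  have hU : (⋃ n : ℕ, Icc (-(n : ℝ)) n) = univ := by
    refine eq_univ_of_forall fun x => mem_iUnion.2 ?_
    obtain ⟨n, hn⟩ := exists_nat_ge |x|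
    exact ⟨n, abs_le.1 hn⟩
  rw [← setLIntegral_univ, ← hU, setLIntegral_iUnion_of_directed]
  · exact iSup_le hn
  · refine Monotone.directed_le fun m n hmn => Icc_subset_Icc ?_ ?_
    · have : (m : ℝ) ≤ n := by exact_mod_cast hmn
      linarith
    · exact_mod_cast hmn

end FrequencySchur

/-! ### Normalized phases and their horizontal differences. -/

section KeyHypotheses

open Set ENNReal ComplexConjugate

/-- Normalized hypotheses on the phase of a bilinear form `∬ e^{iQ(x,y)} G(y) H(x+y)`. -/
structure KeyHyp (B w : ℝ) (Q : ℝ × ℝ → ℝ) : Prop where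
  smooth : ContDiff ℝ ∞ Q
  xx : ∀ z, 9 / 10 ≤ partialX (partialX Q) z
  xy : ∀ z, |partialY (partialX Q) z| ≤ 1 / 10
  xxy : ∀ z, |partialX (partialY (partialX Q)) z| ≤ B / w
  xyy : ∀ z, |partialY (partialY (partialX Q)) z| ≤ B / w
  mixed : ∀ z, |opQ (partialY (partialY Q)) z| ≤ B / w ^ 2

theorem abs_sub_le_of_hasDerivAt {f f' : ℝ → ℝ} {C : ℝ} (hf : ∀ x, HasDerivAt f (f' x) x)
    (hC : ∀ x, |f' x| ≤ C) (x x' : ℝ) : |f x - f x'| ≤ C * |x - x'| :=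
  Convex.norm_image_sub_le_of_norm_hasDerivWithin_le (s := univ)
    (fun y _ => (hf y).hasDerivWithinAt) (fun y _ => hC y) convex_univ (mem_univ x') (mem_univ x)

theorem le_sub_of_hasDerivAt {f f' : ℝ → ℝ} {C : ℝ} (hf : ∀ x, HasDerivAt f (f' x) x)
    (hC : ∀ x, C ≤ f' x) {x x' : ℝ} (h : x' ≤ x) : C * (x - x') ≤ f x - f x' :=
  Convex.mul_sub_le_image_sub_of_le_deriv (D := univ) convex_univ
    (continuousOn_univ.2 (continuous_iff_continuousAt.2 fun x => (hf x).continuousAt))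
    (fun x _ => (hf x).differentiableAt.differentiableWithinAt)
    (fun x _ => by rw [(hf x).deriv]; exact hC x) x' (mem_univ _) x (mem_univ _) h

variable {B w : ℝ} {Q : ℝ × ℝ → ℝ}

theorem ContDiff.partialX {E : Type*} [NormedAddCommGroup E] [NormedSpace ℝ E] {F : ℝ × ℝ → E}
    (h : ContDiff ℝ ∞ F) : ContDiff ℝ ∞ (partialX F) :=
  contDiffOn_univ.1 ((contDiffOn_univ.2 h).partialX isOpen_univ)

theorem ContDiff.partialY {E : Type*} [NormedAddCommGroup E] [NormedSpace ℝ E] {F : ℝ × ℝ → E}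
    (h : ContDiff ℝ ∞ F) : ContDiff ℝ ∞ (partialY F) :=
  contDiffOn_univ.1 ((contDiffOn_univ.2 h).partialY isOpen_univ)

theorem ContDiff.hasDerivAt_partialX {E : Type*} [NormedAddCommGroup E] [NormedSpace ℝ E]
    {F : ℝ × ℝ → E} (h : ContDiff ℝ ∞ F) (x y : ℝ) :
    HasDerivAt (fun t => F (t, y)) (_root_.partialX F (x, y)) x :=
  _root_.hasDerivAt_partialX (contDiffOn_univ.2 h) isOpen_univ (mem_univ _)

theorem ContDiff.hasDerivAt_partialY {E : Type*} [NormedAddCommGroup E] [NormedSpace ℝ E]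
    {F : ℝ × ℝ → E} (h : ContDiff ℝ ∞ F) (x y : ℝ) :
    HasDerivAt (fun t => F (x, t)) (_root_.partialY F (x, y)) y :=
  _root_.hasDerivAt_partialY (contDiffOn_univ.2 h) isOpen_univ (mem_univ _)

theorem ContDiff.partialX_partialY_comm {E : Type*} [NormedAddCommGroup E] [NormedSpace ℝ E]
    {F : ℝ × ℝ → E} (h : ContDiff ℝ ∞ F) :
    _root_.partialX (_root_.partialY F) = _root_.partialY (_root_.partialX F) := by
  funext z
  exact _root_.partialX_partialY_comm (contDiffOn_univ.2 h) isOpen_univ (mem_univ z)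

theorem KeyHyp.sub_le (h : KeyHyp B w Q) (y : ℝ) {x x' : ℝ} (hx : x' ≤ x) :
    9 / 10 * (x - x') ≤ partialX Q (x, y) - partialX Q (x', y) :=
  le_sub_of_hasDerivAt (f := fun x => partialX Q (x, y))
    (fun x => h.smooth.partialX.hasDerivAt_partialX x y) (fun x => h.xx _) hx

theorem KeyHyp.abs_partialY_sub_le (h : KeyHyp B w Q) (y x x' : ℝ) :
    |partialY Q (x, y) - partialY Q (x', y)| ≤ 1 / 10 * |x - x'| :=
  abs_sub_le_of_hasDerivAt (f := fun x => partialY Q (x, y))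
    (fun x => h.smooth.partialY.hasDerivAt_partialX x y)
    (fun x => by rw [h.smooth.partialX_partialY_comm]; exact h.xy _) x x'

theorem KeyHyp.abs_partialYY_sub_le (h : KeyHyp B w Q) (y x x' : ℝ) :
    |partialY (partialY Q) (x, y) - partialY (partialY Q) (x', y)| ≤ B / w * |x - x'| :=
  abs_sub_le_of_hasDerivAt (f := fun x => partialY (partialY Q) (x, y))
    (fun x => h.smooth.partialY.partialY.hasDerivAt_partialX x y)
    (fun x => by
      rw [h.smooth.partialY.partialX_partialY_comm, h.smooth.partialX_partialY_comm]
      exact h.xyy _) x x'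

/-- There is no bound on ∂ₓ∂_y³Q alone. The mixed hypothesis controls the x-derivative of ∂ₓ∂_y²Q -
∂_y³Q, and ∂ₓ∂_y²Q is itself bounded; this leaves the remainder 2B/w, not proportional to |x-x'|. -/
theorem KeyHyp.abs_partialYYY_sub_le (h : KeyHyp B w Q) (y x x' : ℝ) :
    |partialY (partialY (partialY Q)) (x, y) - partialY (partialY (partialY Q)) (x', y)| ≤
      B / w ^ 2 * |x - x'| + 2 * (B / w) := by
  have s2 := h.smooth.partialY.partialY
  have h1 := abs_sub_le_of_hasDerivAt (C := B / w ^ 2)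
    (f := fun x => partialX (partialY (partialY Q)) (x, y) - partialY (partialY (partialY Q)) (x, y))
    (fun x => (s2.partialX.hasDerivAt_partialX x y).sub (s2.partialY.hasDerivAt_partialX x y))
    (fun x => by
      have e := partialX_sub (contDiffOn_univ.2 s2.partialX) (contDiffOn_univ.2 s2.partialY)
        isOpen_univ (mem_univ (x, y))
      have := h.mixed (x, y)
      rw [opQ, e] at this
      exact this) x x'
  have e : partialX (partialY (partialY Q)) = partialY (partialY (partialX Q)) := by
    rw [h.smooth.partialY.partialX_partialY_comm, h.smooth.partialX_partialY_comm]
  simp only [e] at h1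
  have a1 := abs_le.1 (h.xyy (x, y))
  have a2 := abs_le.1 (h.xyy (x', y))
  rw [abs_le] at h1 ⊢
  constructor <;> linarith [h1.1, h1.2, a1.1, a1.2, a2.1, a2.2]

end KeyHypotheses

/-! ### Almost orthogonality of modulated phases in the windows of ∂ₓQ. -/

section FrequencyWindows

open Set ENNReal ComplexConjugate

theorem IsAmplitude.continuous {w a : ℝ} {ψ : ℝ → ℂ} (h : IsAmplitude w a ψ) : Continuous ψ := by
  obtain ⟨ψ1, _, h1, _⟩ := h
  exact continuous_iff_continuousAt.2 fun y => (h1 y).continuousAt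

theorem exists_lintegral_kernel_le {C1 C2 N W : ℝ} (hC1 : 0 ≤ C1) (hC2 : 0 ≤ C2) (hN : 0 < N)
    (hW : 0 < W) (t : ℝ) :
    ∫⁻ ξ : ℝ, ENNReal.ofReal (C1 * (W / (1 + (W * (N * |t - ξ|)) ^ 2)) +
      C2 * (1 / (1 + (1 * (1 * |t - ξ|)) ^ 2))) ≤ ENNReal.ofReal ((C1 / N + C2) * Real.pi) := by
  have e : ∀ ξ : ℝ, ENNReal.ofReal (C1 * (W / (1 + (W * (N * |t - ξ|)) ^ 2)) +
      C2 * (1 / (1 + (1 * (1 * |t - ξ|)) ^ 2))) =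
      ENNReal.ofReal C1 * ENNReal.ofReal (W / (1 + (W * (N * |t - ξ|)) ^ 2)) +
      ENNReal.ofReal C2 * ENNReal.ofReal (1 / (1 + (1 * (1 * |t - ξ|)) ^ 2)) := fun ξ => by
    rw [ENNReal.ofReal_add (by positivity) (by positivity), ENNReal.ofReal_mul hC1,
      ENNReal.ofReal_mul hC2]
  simp_rw [e]
  rw [lintegral_add_left (by fun_prop), lintegral_const_mul' _ _ ENNReal.ofReal_ne_top,
    lintegral_const_mul' _ _ ENNReal.ofReal_ne_top, lintegral_inv_one_add_sq hW hN,
    lintegral_inv_one_add_sq one_pos one_pos, ← ENNReal.ofReal_mul hC1, ← ENNReal.ofReal_mul hC2,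
    ← ENNReal.ofReal_add (by positivity) (by positivity)]
  refine ENNReal.ofReal_le_ofReal (le_of_eq ?_)
  ring

variable {B w : ℝ} {Q : ℝ × ℝ → ℝ}

/-- The frequency windows attached to two points at distance at least `20` are separated. -/
theorem KeyHyp.window_gap (h : KeyHyp B w Q) {x x' y ξ ξ' : ℝ} (hx : 20 ≤ |x - x'|)
    (hξ : ξ ∈ Icc (partialX Q (x - 2, y)) (partialX Q (x + 2, y)))
    (hξ' : ξ' ∈ Icc (partialX Q (x' - 2, y)) (partialX Q (x' + 2, y))) :
    72 / 100 * |x - x'| ≤ |ξ - ξ'| := by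
  -- The windows are separated by at least (9/10)(|x-x'|-4), and 72/100 = (9/10)(1-4/20).
  rcases le_total x' x with hle | hle
  · rw [abs_of_nonneg (by linarith)] at hx ⊢
    have := h.sub_le y (show x' + 2 ≤ x - 2 by linarith)
    exact le_abs.2 (Or.inl (by linarith [hξ.1, hξ'.2]))
  · rw [abs_of_nonpos (by linarith)] at hx ⊢
    have := h.sub_le y (show x + 2 ≤ x' - 2 by linarith)
    exact le_abs.2 (Or.inr (by linarith [hξ.2, hξ'.1]))

/-- Decay of the correlation of two modulated phases in separated frequency windows. -/
theorem KeyHyp.norm_integral_correlation_le (h : KeyHyp B w Q) (hw : 0 < w) (hB : 0 ≤ B)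
    {ψ : ℝ → ℂ} {a α : ℝ} (hψ : IsAmplitude (3 * w) a ψ)
    (hsupp : ∀ y, ψ y ≠ 0 → y ∈ Icc α (α + 3 * w)) {x x' y0 ξ ξ' : ℝ}
    (hx : x = x' ∨ 20 ≤ |x - x'|)
    (hξ : ξ ∈ Icc (partialX Q (x - 2, y0)) (partialX Q (x + 2, y0)))
    (hξ' : ξ' ∈ Icc (partialX Q (x' - 2, y0)) (partialX Q (x' + 2, y0))) :
    ‖∫ y, ψ y * Complex.exp (Complex.I *
        (((Q (x, y) - ξ * y) - (Q (x', y) - ξ' * y) : ℝ) : ℂ))‖ ≤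
      14 * (1 + 16 * B) ^ 2 * a * ((3 * w) / (1 + ((3 * w) * (8 / 10 * |ξ - ξ'|)) ^ 2)) +
      24 * B * a * (1 / (1 + (1 * (1 * |ξ - ξ'|)) ^ 2)) := by
  have ha := hψ.nonneg
  have hgen : ∀ E0 : ℝ, 0 ≤ E0 → 1 / 10 * |x - x'| ≤ 2 / 10 * |ξ - ξ'| →
      |x - x'| ≤ 1 / (72 / 100) * |ξ - ξ'| →
      (∀ y, |partialY (partialY (partialY Q)) (x, y) - partialY (partialY (partialY Q)) (x', y)| ≤
        B / w ^ 2 * |x - x'| + E0) →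
      ‖∫ y, ψ y * Complex.exp (Complex.I *
        (((Q (x, y) - ξ * y) - (Q (x', y) - ξ' * y) : ℝ) : ℂ))‖ ≤
      14 * (1 + 16 * B) ^ 2 * a * (3 * w) / (1 + ((3 * w) * (8 / 10 * |ξ - ξ'|)) ^ 2) +
        a * E0 * (3 * w) / (8 / 10 * |ξ - ξ'|) ^ 3 := by
    intro E0 hE0 hs1 hs2 h3
    -- The phase derivative is at least |ξ-ξ'| - |x-x'|/10 ≥ (8/10)|ξ-ξ'|. Comparing |x-x'| ≤
    -- |ξ-ξ'|/0.72 with this over the scale 3w needs the constant 9/(0.8·0.72) < 16 for the third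
    -- derivative, hence 16B.
    refine norm_integral_amplitude_mul_exp_le
      (θ := fun y => (Q (x, y) - ξ * y) - (Q (x', y) - ξ' * y))
      (θ1 := fun y => (partialY Q (x, y) - ξ) - (partialY Q (x', y) - ξ'))
      (u := fun y => partialY (partialY Q) (x, y) - partialY (partialY Q) (x', y))
      (u1 := fun y => partialY (partialY (partialY Q)) (x, y) -
        partialY (partialY (partialY Q)) (x', y))
      (by positivity) (by positivity) (by positivity) hE0 hψ hsupp
      (fun y _ => ?_) (fun y _ => ?_) (fun y _ => ?_) (fun y _ => ?_) (fun y _ => ?_) (fun y _ => ?_)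
    · have e1 := (h.smooth.hasDerivAt_partialY x y).sub ((hasDerivAt_id y).const_mul ξ)
      have e2 := (h.smooth.hasDerivAt_partialY x' y).sub ((hasDerivAt_id y).const_mul ξ')
      refine (e1.sub e2).congr_deriv ?_
      ring
    · exact ((h.smooth.partialY.hasDerivAt_partialY x y).sub_const ξ).sub
        ((h.smooth.partialY.hasDerivAt_partialY x' y).sub_const ξ')
    · exact (h.smooth.partialY.partialY.hasDerivAt_partialY x y).sub
        (h.smooth.partialY.partialY.hasDerivAt_partialY x' y)
    · have e1 := h.abs_partialY_sub_le y x x'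
      have e2 : |ξ - ξ'| ≤ |(partialY Q (x, y) - ξ) - (partialY Q (x', y) - ξ')| +
          |partialY Q (x, y) - partialY Q (x', y)| := by
        rw [← abs_neg ((partialY Q (x, y) - ξ) - (partialY Q (x', y) - ξ'))]
        refine le_trans (le_of_eq ?_) (abs_add_le _ _)
        congr 1; ring
      linarith
    · refine (h.abs_partialYY_sub_le y x x').trans ?_
      calc B / w * |x - x'| ≤ B / w * (1 / (72 / 100) * |ξ - ξ'|) := by gcongr
        _ ≤ B / w * ((16 * (8 / 10) / 3) * |ξ - ξ'|) :=
          mul_le_mul_of_nonneg_left (mul_le_mul_of_nonneg_right (by norm_num) (abs_nonneg _))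
            (by positivity)
        _ = _ := by field_simp
    · refine (h3 y).trans (add_le_add_left ?_ _)
      calc B / w ^ 2 * |x - x'| ≤ B / w ^ 2 * (1 / (72 / 100) * |ξ - ξ'|) := by gcongr
        _ ≤ B / w ^ 2 * ((16 * (8 / 10) / 9) * |ξ - ξ'|) :=
          mul_le_mul_of_nonneg_left (mul_le_mul_of_nonneg_right (by norm_num) (abs_nonneg _))
            (by positivity)
        _ = _ := by field_simp; ring
  rcases hx with rfl | hx
  · have h1 := hgen 0 le_rfl (by simp) (by simp) (fun y => by simp)
    refine h1.trans ?_
    rw [mul_div_assoc]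
    simp only [mul_zero, zero_mul, zero_div]
    refine add_le_add_right ?_ _
    positivity
  · have hg := h.window_gap hx hξ hξ'
    have h1 := hgen (2 * (B / w)) (by positivity) (by linarith)
      (by rw [one_div, ← div_eq_inv_mul, le_div_iff₀ (by norm_num)]; linarith)
      (fun y => h.abs_partialYYY_sub_le y x x')
    refine h1.trans (add_le_add (le_of_eq (by ring)) ?_)
    -- Separated windows keep t = |ξ-ξ'| away from 0, so the remainder, of size t⁻³ and with w
    -- cancelled, is dominated by 1/(1+t²).
    have ht : 1 ≤ |ξ - ξ'| := by linarith
    set t := |ξ - ξ'|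
    rw [div_le_iff₀ (by positivity)]
    have e : a * (2 * (B / w)) * (3 * w) = 6 * (B * a) := by field_simp; ring
    rw [e]
    have e2 : 24 * B * a * (1 / (1 + (1 * (1 * t)) ^ 2)) * (8 / 10 * t) ^ 3 =
      6 * (B * a) * (4 * (8 / 10 * t) ^ 3 / (1 + t ^ 2)) := by
      field_simp; ring
    rw [e2]
    refine le_mul_of_one_le_right (by positivity) ?_
    rw [one_le_div (by positivity)]
    nlinarith [mul_nonneg (sq_nonneg t) (sub_nonneg.2 ht), sq_nonneg t]

/-- Points 20 apart have disjoint windows and correlations decaying in ξ-ξ', so the abstract almost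
orthogonality applies. The cutoff constant a is fixed in advance to keep the bound uniform. -/
theorem KeyHyp.sum_window_le_of_separated (hB : 0 ≤ B) {a : ℝ}
    (hcut : ∀ (w α : ℝ), 0 < w → ∃ ζ : ℝ → ℂ,
      IsAmplitude (3 * w) a ζ ∧ (∀ y, ζ y ≠ 0 → y ∈ Icc (α - w) (α - w + 3 * w)) ∧
      ∀ y ∈ Icc α (α + w), ζ y = 1) (h : KeyHyp B w Q) (hw : 0 < w) (b y0 α : ℝ) (F : Finset ℤ)
    (hF : ∀ k ∈ F, ∀ k' ∈ F, k ≠ k' → 20 ≤ |k - k'|) {G : ℝ → ℂ} (hG : IsCore G)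
    (hGs : ∀ y, G y ≠ 0 → y ∈ Icc α (α + w)) :
    ∑ k ∈ F, ∫⁻ ξ in Icc (partialX Q (k + b - 2, y0)) (partialX Q (k + b + 2, y0)),
      ‖∫ y, G y * Complex.exp (Complex.I * ((Q (k + b, y) - ξ * y : ℝ) : ℂ))‖ₑ ^ 2 ≤
      ENNReal.ofReal ((14 * (1 + 16 * B) ^ 2 * (4 * (a * a)) / (8 / 10) + 24 * B * (4 * (a * a))) *
        Real.pi) * ∫⁻ y, ‖G y‖ₑ ^ 2 := by
  obtain ⟨ζ, hζ, hζs, hζ1⟩ := hcut w α hw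
  have hw3 : 0 < 3 * w := by positivity
  have ha := hζ.nonneg
  have hamp := hζ.mul hζ.conj hw3
  have hsep : ∀ i j : F, i ≠ j → 20 ≤ |((i : ℤ) + b : ℝ) - ((j : ℤ) + b)| := fun i j hij => by
    have := hF i i.2 j j.2 fun h => hij (Subtype.ext h)
    rw [add_sub_add_right_eq_sub]
    exact_mod_cast this
  have key := sum_lintegral_sq_le_of_kernel (ι := F) (p := fun i y => Q ((i : ℤ) + b, y))
    (fun i => h.smooth.continuous.comp (by fun_prop))
    (lo := fun i => partialX Q ((i : ℤ) + b - 2, y0))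
    (hi := fun i => partialX Q ((i : ℤ) + b + 2, y0)) (fun i j hij => ?_) hζ.continuous hζs
    (Φ := fun t => ENNReal.ofReal (14 * (1 + 16 * B) ^ 2 * (4 * (a * a)) *
      ((3 * w) / (1 + ((3 * w) * (8 / 10 * |t|)) ^ 2)) +
      24 * B * (4 * (a * a)) * (1 / (1 + (1 * (1 * |t|)) ^ 2))))
    (fun t => exists_lintegral_kernel_le (C1 := 14 * (1 + 16 * B) ^ 2 * (4 * (a * a)))
      (C2 := 24 * B * (4 * (a * a))) (N := 8 / 10) (by positivity) (by positivity) (by norm_num)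
      hw3 t) (fun i j ξ hξ ξ' hξ' => ?_) hG (fun y => ?_)
  · rwa [Finset.sum_coe_sort F fun k => ∫⁻ ξ in Icc (partialX Q (k + b - 2, y0))
      (partialX Q (k + b + 2, y0)), ‖∫ y, G y * Complex.exp (Complex.I *
      ((Q (k + b, y) - ξ * y : ℝ) : ℂ))‖ₑ ^ 2] at key
  · refine disjoint_left.2 fun ξ hξ hξ' => ?_
    have := h.window_gap (hsep i j hij) hξ hξ'
    simp only [_root_.sub_self, abs_zero] at this
    linarith [hsep i j hij]
  · rw [← ofReal_norm]
    refine ENNReal.ofReal_le_ofReal ?_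
    refine (h.norm_integral_correlation_le hw hB hamp
      (fun y hy => hζs y fun h => hy (by simp [h])) ?_ hξ hξ')
    by_cases hij : i = j
    · exact Or.inl (by rw [hij])
    · exact Or.inr (hsep i j hij)
  · by_cases h : G y = 0
    · simp [h]
    · rw [hζ1 y (hGs y h), one_mul]

/-- Distinct integers in one residue class modulo 20 are separated, and there are 20 classes. -/
theorem KeyHyp.exists_sum_window_le (hB : 0 ≤ B) : ∃ C : ℝ, 0 < C ∧ ∀ (w : ℝ) (Q : ℝ × ℝ → ℝ),
    0 < w → KeyHyp B w Q → ∀ (b y0 α : ℝ) (F : Finset ℤ) (G : ℝ → ℂ), IsCore G →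
    (∀ y, G y ≠ 0 → y ∈ Icc α (α + w)) →
    ∑ k ∈ F, ∫⁻ ξ in Icc (partialX Q (k + b - 2, y0)) (partialX Q (k + b + 2, y0)),
      ‖∫ y, G y * Complex.exp (Complex.I * ((Q (k + b, y) - ξ * y : ℝ) : ℂ))‖ₑ ^ 2 ≤
      ENNReal.ofReal C * ∫⁻ y, ‖G y‖ₑ ^ 2 := by
  obtain ⟨a, ha, hcut⟩ := exists_isAmplitude_cutoff
  set C0 := (14 * (1 + 16 * B) ^ 2 * (4 * (a * a)) / (8 / 10) + 24 * B * (4 * (a * a))) * Real.pi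
    with hC0
  have hC0p : 0 < C0 := by positivity
  refine ⟨20 * C0, by positivity, fun w Q hw h b y0 α F G hG hGs => ?_⟩
  rw [← Finset.sum_fiberwise_of_maps_to (t := Finset.Ico (0 : ℤ) 20) (g := fun k => k % 20)
    (fun k _ => Finset.mem_Ico.2 ⟨Int.emod_nonneg _ (by norm_num), Int.emod_lt_of_pos _
      (by norm_num)⟩)]
  calc _ ≤ ∑ r ∈ Finset.Ico (0 : ℤ) 20, ENNReal.ofReal C0 * ∫⁻ y, ‖G y‖ₑ ^ 2 := by
        refine Finset.sum_le_sum fun r _ => ?_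
        refine h.sum_window_le_of_separated hB hcut hw b y0 α _ ?_ hG hGs
        intro k hk k' hk' hne
        rw [Finset.mem_filter] at hk hk'
        have : (20 : ℤ) ∣ k - k' := Int.ModEq.dvd (show k' ≡ k [ZMOD 20] from
          hk'.2.trans hk.2.symm)
        exact Int.le_of_dvd (abs_pos.2 (sub_ne_zero.2 hne)) ((dvd_abs _ _).2 this)
    _ = _ := by
      rw [Finset.sum_const, Int.card_Ico, ENNReal.ofReal_mul (p := 20) (by norm_num), nsmul_eq_mul,
        mul_assoc, show ((20 - 0 : ℤ).toNat : ℝ≥0∞) = ENNReal.ofReal 20 by simp]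

end FrequencyWindows

/-! ### Arctangent weights as averages of sharp windows, and their bounded overlap. -/

section ArctanWindows

open Set ENNReal ComplexConjugate

theorem ofReal_arctan_sub_eq {a b : ℝ} (hab : a ≤ b) (ξ : ℝ) :
    ENNReal.ofReal (Real.arctan (b - ξ) - Real.arctan (a - ξ)) =
      ∫⁻ v : ℝ, ENNReal.ofReal (1 + v ^ 2)⁻¹ * indicator (Icc a b) 1 (ξ + v) := by
  have h1 : IntegrableOn (fun v : ℝ => (1 + v ^ 2)⁻¹) (Ioc (a - ξ) (b - ξ)) :=
    integrable_inv_one_add_sq.integrableOn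
  rw [← integral_inv_one_add_sq, intervalIntegral.integral_of_le (by linarith),
    ofReal_integral_eq_lintegral_ofReal h1 (ae_of_all _ fun t => by positivity),
    setLIntegral_congr Ioc_ae_eq_Icc, ← lintegral_indicator measurableSet_Icc]
  refine lintegral_congr fun v => ?_
  by_cases hv : v ∈ Icc (a - ξ) (b - ξ)
  · have h : ξ + v ∈ Icc a b := ⟨by linarith [hv.1], by linarith [hv.2]⟩
    rw [indicator_of_mem hv, indicator_of_mem h]
    simp
  · have h : ξ + v ∉ Icc a b := fun h => hv ⟨by linarith [h.1], by linarith [h.2]⟩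
    rw [indicator_of_notMem hv, indicator_of_notMem h]
    simp

/-- Averaging a frequency window estimate over translations of the window. -/
theorem lintegral_arctan_mul_eq {a b : ℝ} (hab : a ≤ b) {f : ℝ → ℝ≥0∞} (hf : Measurable f) :
    ∫⁻ ξ, ENNReal.ofReal (Real.arctan (b - ξ) - Real.arctan (a - ξ)) * f ξ =
      ∫⁻ v : ℝ, ENNReal.ofReal (1 + v ^ 2)⁻¹ * ∫⁻ ξ in Icc a b, f (ξ - v) := by
  have hm : Measurable fun z : ℝ × ℝ => ENNReal.ofReal (1 + z.2 ^ 2)⁻¹ *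
      indicator (Icc a b) (1 : ℝ → ℝ≥0∞) (z.1 + z.2) * f z.1 := by
    refine Measurable.mul (Measurable.mul (by fun_prop) ?_) (hf.comp measurable_fst)
    exact (measurable_one.indicator measurableSet_Icc).comp (by fun_prop : Measurable fun z : ℝ × ℝ => z.1 + z.2)
  calc _ = ∫⁻ ξ, ∫⁻ v : ℝ, ENNReal.ofReal (1 + v ^ 2)⁻¹ * indicator (Icc a b) 1 (ξ + v) * f ξ := by
        refine lintegral_congr fun ξ => ?_
        rw [ofReal_arctan_sub_eq hab, lintegral_mul_const]
        refine Measurable.mul (by fun_prop) ?_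
        exact (measurable_one.indicator measurableSet_Icc).comp (by fun_prop)
    _ = ∫⁻ v : ℝ, ∫⁻ ξ, ENNReal.ofReal (1 + v ^ 2)⁻¹ * indicator (Icc a b) 1 (ξ + v) * f ξ :=
        lintegral_lintegral_swap hm.aemeasurable
    _ = _ := by
        refine lintegral_congr fun v => ?_
        simp_rw [mul_assoc]
        rw [lintegral_const_mul' _ _ ENNReal.ofReal_ne_top, ← lintegral_indicator measurableSet_Icc,
          ← lintegral_add_right_eq_self (indicator (Icc a b) fun ξ => f (ξ - v)) v]
        congr 1
        refine lintegral_congr fun ξ => ?_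
        by_cases h : ξ + v ∈ Icc a b
        · rw [indicator_of_mem h, indicator_of_mem h, add_sub_cancel_right]; simp
        · rw [indicator_of_notMem h, indicator_of_notMem h, zero_mul]

theorem lintegral_inv_one_add_sq_eq_pi :
    ∫⁻ v : ℝ, ENNReal.ofReal (1 + v ^ 2)⁻¹ = ENNReal.ofReal Real.pi := by
  rw [← ofReal_integral_eq_lintegral_ofReal integrable_inv_one_add_sq
    (ae_of_all _ fun t => by positivity), integral_univ_inv_one_add_sq]

theorem measurable_integral_mul_exp {G : ℝ → ℂ} (hG : Measurable G) {p : ℝ → ℝ}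
    (hp : Measurable p) :
    Measurable fun ξ : ℝ => ∫ y, G y * Complex.exp (Complex.I * ((p y - ξ * y : ℝ) : ℂ)) := by
  have : Measurable fun z : ℝ × ℝ =>
      G z.2 * Complex.exp (Complex.I * ((p z.2 - z.1 * z.2 : ℝ) : ℂ)) := by
    refine (hG.comp measurable_snd).mul (Complex.measurable_exp.comp
      (measurable_const.mul (Complex.measurable_ofReal.comp ?_)))
    exact (hp.comp measurable_snd).sub (by fun_prop)
  exact this.stronglyMeasurable.integral_prod_right'.measurable

theorem IsCore.mul_bounded {E : Type*} [NormedAddCommGroup E] [MeasurableSpace E] {F u : E → ℂ}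
    (hF : IsCore F) (hu : Measurable u) {b : ℝ} (hb : ∀ y, ‖u y‖ ≤ b) : IsCore fun y => F y * u y := by
  obtain ⟨B, hB⟩ := hF.bdd
  obtain ⟨M, hM⟩ := hF.supp
  refine ⟨hF.meas.mul hu, ⟨B * b, fun z => ?_⟩, M, fun z hz => by rw [hM z hz, zero_mul]⟩
  rw [norm_mul]
  exact mul_le_mul (hB z) (hb z) (norm_nonneg _) ((norm_nonneg _).trans (hB z))

theorem norm_exp_I_mul (t : ℝ) : ‖Complex.exp (Complex.I * (t : ℂ))‖ = 1 := by
  rw [mul_comm]; exact Complex.norm_exp_ofReal_mul_I t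

/-- The weight attached to the frequency window of `Q` around `x`. -/
noncomputable def arctanWeight (Q : ℝ × ℝ → ℝ) (x y ξ : ℝ) : ℝ :=
  Real.arctan (partialX Q (x + 2, y) - ξ) - Real.arctan (partialX Q (x - 2, y) - ξ)

variable {B w : ℝ} {Q : ℝ × ℝ → ℝ}

theorem measurable_arctanWeight (x y : ℝ) : Measurable (arctanWeight Q x y) :=
  (Real.measurable_arctan.comp (by fun_prop)).sub (Real.measurable_arctan.comp (by fun_prop))

theorem KeyHyp.partialX_le (h : KeyHyp B w Q) (x y : ℝ) :
    partialX Q (x - 2, y) ≤ partialX Q (x + 2, y) := by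
  have := h.sub_le y (show x - 2 ≤ x + 2 by linarith)
  linarith

theorem KeyHyp.arctanWeight_nonneg (h : KeyHyp B w Q) (x y ξ : ℝ) : 0 ≤ arctanWeight Q x y ξ :=
  sub_nonneg.2 (Real.arctan_strictMono.monotone (by linarith [h.partialX_le x y]))

/-- Finiteness of the weight is what makes the Fourier transform it dominates integrable, so that
inversion is available. -/
theorem KeyHyp.lintegral_arctanWeight_lt_top (h : KeyHyp B w Q) (x y : ℝ) :
    ∫⁻ ξ, ENNReal.ofReal (arctanWeight Q x y ξ) < ⊤ := by
  have := lintegral_arctan_mul_eq (h.partialX_le x y) (f := fun _ => 1) measurable_const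
  simp only [mul_one, lintegral_one, Measure.restrict_apply_univ, Real.volume_Icc] at this
  unfold arctanWeight
  rw [this, lintegral_mul_const _ (by fun_prop), lintegral_inv_one_add_sq_eq_pi]
  exact ENNReal.mul_lt_top ENNReal.ofReal_lt_top ENNReal.ofReal_lt_top

/-- The weight averages translates of a sharp window against 1/(1+v²). A translation by v amounts to
multiplying G by e^{ivy}, which changes neither its norm nor its support, so the sharp estimate
holds uniformly in v. -/
theorem KeyHyp.exists_sum_arctanWeight_le (hB : 0 ≤ B) : ∃ C : ℝ, 0 < C ∧
    ∀ (w : ℝ) (Q : ℝ × ℝ → ℝ), 0 < w → KeyHyp B w Q → ∀ (b y0 α : ℝ) (F : Finset ℤ) (G : ℝ → ℂ),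
    IsCore G → (∀ y, G y ≠ 0 → y ∈ Icc α (α + w)) →
    ∑ k ∈ F, ∫⁻ ξ, ENNReal.ofReal (arctanWeight Q (k + b) y0 ξ) *
      ‖∫ y, G y * Complex.exp (Complex.I * ((Q (k + b, y) - ξ * y : ℝ) : ℂ))‖ₑ ^ 2 ≤
      ENNReal.ofReal C * ∫⁻ y, ‖G y‖ₑ ^ 2 := by
  obtain ⟨C, hC, hbd⟩ := KeyHyp.exists_sum_window_le hB
  refine ⟨Real.pi * C, by positivity, fun w Q hw h b y0 α F G hG hGs => ?_⟩
  have hm : ∀ k : ℤ, Measurable fun ξ : ℝ =>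
      ‖∫ y, G y * Complex.exp (Complex.I * ((Q (k + b, y) - ξ * y : ℝ) : ℂ))‖ₑ ^ 2 := fun k =>
    (measurable_integral_mul_exp hG.meas
      (h.smooth.continuous.measurable.comp (by fun_prop))).enorm.pow_const 2
  have hm2 : ∀ k : ℤ, Measurable fun v : ℝ => ENNReal.ofReal (1 + v ^ 2)⁻¹ *
      ∫⁻ ξ in Icc (partialX Q (k + b - 2, y0)) (partialX Q (k + b + 2, y0)),
      ‖∫ y, G y * Complex.exp (Complex.I * ((Q (k + b, y) - (ξ - v) * y : ℝ) : ℂ))‖ₑ ^ 2 := fun k => by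
    refine Measurable.mul (by fun_prop) ?_
    exact Measurable.lintegral_prod_right' (f := fun z : ℝ × ℝ => ‖∫ y, G y * Complex.exp (Complex.I *
      ((Q (k + b, y) - (z.2 - z.1) * y : ℝ) : ℂ))‖ₑ ^ 2)
      ((hm k).comp (by fun_prop : Measurable fun z : ℝ × ℝ => z.2 - z.1))
  calc _ = ∑ k ∈ F, ∫⁻ v : ℝ, ENNReal.ofReal (1 + v ^ 2)⁻¹ *
      ∫⁻ ξ in Icc (partialX Q (k + b - 2, y0)) (partialX Q (k + b + 2, y0)),
      ‖∫ y, G y * Complex.exp (Complex.I * ((Q (k + b, y) - (ξ - v) * y : ℝ) : ℂ))‖ₑ ^ 2 :=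
        Finset.sum_congr rfl fun k _ => lintegral_arctan_mul_eq (h.partialX_le _ _) (hm k)
    _ = ∫⁻ v : ℝ, ENNReal.ofReal (1 + v ^ 2)⁻¹ * ∑ k ∈ F,
      ∫⁻ ξ in Icc (partialX Q (k + b - 2, y0)) (partialX Q (k + b + 2, y0)),
      ‖∫ y, G y * Complex.exp (Complex.I * ((Q (k + b, y) - (ξ - v) * y : ℝ) : ℂ))‖ₑ ^ 2 := by
        rw [← lintegral_finsetSum _ fun k _ => hm2 k]
        simp_rw [Finset.mul_sum]
    _ ≤ ∫⁻ v : ℝ, ENNReal.ofReal (1 + v ^ 2)⁻¹ * (ENNReal.ofReal C * ∫⁻ y, ‖G y‖ₑ ^ 2) := by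
        refine lintegral_mono fun v => mul_le_mul_right ?_ _
        have hG' : IsCore fun y => G y * Complex.exp (Complex.I * ((v * y : ℝ) : ℂ)) :=
          hG.mul_bounded (by fun_prop) fun y => (norm_exp_I_mul _).le
        have key := hbd w Q hw h b y0 α F _ hG' fun y hy => hGs y fun h0 => hy (by simp [h0])
        have e : ∀ (k : ℤ) (ξ y : ℝ), G y * Complex.exp (Complex.I * ((v * y : ℝ) : ℂ)) *
            Complex.exp (Complex.I * ((Q (k + b, y) - ξ * y : ℝ) : ℂ)) = G y *
            Complex.exp (Complex.I * ((Q (k + b, y) - (ξ - v) * y : ℝ) : ℂ)) := fun k ξ y => by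
          rw [mul_assoc, ← Complex.exp_add]
          congr 2
          push_cast; ring
        simp only [e] at key
        refine key.trans (le_of_eq ?_)
        congr 1
        refine lintegral_congr fun y => ?_
        rw [enorm_mul, ← ofReal_norm (Complex.exp _), norm_exp_I_mul, ENNReal.ofReal_one, mul_one]
    _ = _ := by
        rw [lintegral_mul_const _ (by fun_prop), lintegral_inv_one_add_sq_eq_pi,
          ENNReal.ofReal_mul Real.pi_pos.le, mul_assoc]

/-- Telescoping with step n leaves only n initial and n final terms, whatever N is. -/
theorem sum_range_sub_shift_le {f : ℕ → ℝ} {c : ℝ} (hf : ∀ j, |f j| ≤ c) (n N : ℕ) :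
    ∑ j ∈ Finset.range N, (f j - f (j + n)) ≤ 2 * (n * c) := by
  have e : ∑ j ∈ Finset.range N, (f j - f (j + n)) =
      ∑ j ∈ Finset.range n, f j - ∑ j ∈ Finset.range n, f (N + j) := by
    induction N with
    | zero => simp
    | succ N ih =>
      have h1 := Finset.sum_range_succ (fun j => f (N + j)) n
      have h2 := Finset.sum_range_succ' (fun j => f (N + j)) n
      rw [Finset.sum_range_succ, ih]
      have h3 : ∀ j, f (N + 1 + j) = f (N + (j + 1)) := fun j => by congr 1; omega
      simp only [h3, add_zero] at h1 h2 ⊢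
      linarith
  have a1 : ∑ j ∈ Finset.range n, f j ≤ n * c := by
    have := Finset.sum_le_card_nsmul (Finset.range n) f c fun j _ => (abs_le.1 (hf j)).2
    simpa using this
  have a2 : -(n * c) ≤ ∑ j ∈ Finset.range n, f (N + j) := by
    have := Finset.card_nsmul_le_sum (Finset.range n) (fun j => f (N + j)) (-c)
      fun j _ => (abs_le.1 (hf _)).1
    simpa using this
  linarith

/-- For fixed s the blocks march along an antidiagonal, on which ∂ₓQ is monotone because Q_xx
dominates Q_xy. The lower end of one window therefore lies above the upper end of the window ten
blocks later, and the sum telescopes. -/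
theorem KeyHyp.sum_arctanWeight_le (h : KeyHyp B w Q) {N : ℕ} {θ : ℝ} (hθ : N = 1 ∨ 1 / 2 ≤ θ)
    (s α ξ : ℝ) :
    ∑ j ∈ Finset.range N, arctanWeight Q (s - (α + j * θ)) (α + j * θ) ξ ≤ 10 * Real.pi := by
  have habs : ∀ t : ℝ, |Real.arctan t| ≤ Real.pi / 2 := fun t =>
    abs_le.2 ⟨(Real.neg_pi_div_two_lt_arctan t).le, (Real.arctan_lt_pi_div_two t).le⟩
  rcases hθ with rfl | hθ
  · have hle : ∀ t t' : ℝ, Real.arctan t - Real.arctan t' ≤ 10 * Real.pi := fun t t' => by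
      linarith [(abs_le.1 (habs t)).2, (abs_le.1 (habs t')).1, Real.pi_pos]
    rw [Finset.sum_range_one]
    exact hle _ _
  -- With shift 10 the required inequality is 0.9(10θ-4) ≥ 0.1·10θ, valid for θ ≥ 1/2; the total is
  -- 2·10·(π/2) = 10π.
  · have key := sum_range_sub_shift_le (f := fun j : ℕ =>
      Real.arctan (partialX Q (s - (α + j * θ) + 2, α + j * θ) - ξ)) (fun j => habs _) 10 N
    refine (Finset.sum_le_sum fun j _ => ?_).trans (key.trans (le_of_eq (by push_cast; ring)))
    refine sub_le_sub_left (Real.arctan_strictMono.monotone (sub_le_sub_right ?_ _)) _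
    push_cast
    have h1 := h.sub_le (α + (j + 10) * θ) (x := s - (α + j * θ) - 2)
      (x' := s - (α + (j + 10) * θ) + 2) (by nlinarith)
    have h2 := abs_le.1 (abs_sub_le_of_hasDerivAt
      (f := fun y => partialX Q (s - (α + j * θ) - 2, y))
      (fun y => h.smooth.partialX.hasDerivAt_partialY _ y) (fun y => h.xy _) (α + (j + 10) * θ)
      (α + j * θ))
    have h3 : |α + (j + 10) * θ - (α + j * θ)| = 10 * θ := by
      rw [show α + (j + 10) * θ - (α + j * θ) = 10 * θ by ring]; exact abs_of_nonneg (by linarith)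
    rw [h3] at h2
    nlinarith [h2.2]

end ArctanWindows

/-! ### Fourier inversion for forms with separated phase. -/

section FourierSeparation

open Set ENNReal ComplexConjugate FourierTransform

/-- This passes from the 2π-normalized transform to the kernel e^{iξx}; the Jacobian 1/(2π) is at
most 1 and is discarded. -/
theorem lintegral_comp_two_pi_le {f : ℝ → ℝ≥0∞} (hf : Measurable f) :
    ∫⁻ ξ, f (2 * Real.pi * ξ) ≤ ∫⁻ ξ, f ξ := by
  have h2 : (2 * Real.pi : ℝ) ≠ 0 := by positivity
  conv_rhs => rw [← Real.smul_map_volume_mul_left h2]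
  rw [lintegral_smul_measure, lintegral_map hf (by fun_prop), smul_eq_mul]
  refine le_mul_of_one_le_left zero_le ?_
  rw [ENNReal.one_le_ofReal, abs_of_pos (by positivity)]
  linarith [Real.pi_gt_three]

/-- Fourier inversion applied to one factor of a trilinear form. -/
theorem enorm_integral_mul_convolution_le {a : ℝ → ℂ} (ha : Continuous a) (hac : IsCore a)
    {m : ℝ → ℝ≥0∞} (hm : Measurable m) (hmf : ∫⁻ ξ, m ξ ≠ ⊤)
    (ham : ∀ ξ : ℝ, ‖∫ x, a x * Complex.exp (Complex.I * ((-(ξ * x) : ℝ) : ℂ))‖ₑ ≤ m ξ)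
    {g H : ℝ → ℂ} (hg : IsCore g) (hH : IsCore H) :
    ‖∫ z : ℝ × ℝ, a z.1 * g z.2 * H (z.1 + z.2)‖ₑ ≤ ∫⁻ ξ : ℝ, m ξ *
      (‖∫ s, H s * Complex.exp (Complex.I * ((ξ * s : ℝ) : ℂ))‖ₑ *
        ‖∫ y, g y * Complex.exp (Complex.I * ((-(ξ * y) : ℝ) : ℂ))‖ₑ) := by
  have e𝓕 : ∀ ξ, 𝓕 a ξ = ∫ x, a x * Complex.exp (Complex.I * ((-(2 * Real.pi * ξ * x) : ℝ) : ℂ)) := by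
    intro ξ
    rw [Real.fourier_real_eq_integral_exp_smul]
    refine integral_congr_ae (ae_of_all _ fun x => ?_)
    simp only [smul_eq_mul]
    rw [mul_comm]
    congr 2
    push_cast
    ring
  have hai : Integrable a := hac.integrable volume
  have h𝓕m : Measurable (𝓕 a) := by
    have h1 := measurable_integral_mul_exp hac.meas (p := fun _ => 0) measurable_const
    have h2 := h1.comp (by fun_prop : Measurable fun ξ : ℝ => 2 * Real.pi * ξ)
    convert h2 using 1
    funext ξ
    simp only [e𝓕, Function.comp, zero_sub]
  have h𝓕b : ∀ ξ, ‖𝓕 a ξ‖ₑ ≤ m (2 * Real.pi * ξ) := fun ξ => by rw [e𝓕]; exact ham _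
  have h𝓕i : Integrable (𝓕 a) := by
    refine ⟨h𝓕m.aestronglyMeasurable, ?_⟩
    rw [HasFiniteIntegral]
    exact (lintegral_mono h𝓕b).trans_lt
      ((lintegral_comp_two_pi_le hm).trans_lt (lt_top_iff_ne_top.2 hmf))
  have hinv : ∀ x, a x = ∫ ξ, 𝓕 a ξ * Complex.exp (Complex.I * ((2 * Real.pi * ξ * x : ℝ) : ℂ)) := by
    intro x
    conv_lhs => rw [← ha.fourierInv_fourier_eq hai h𝓕i]
    rw [Real.fourierInv_eq']
    refine integral_congr_ae (ae_of_all _ fun ξ => ?_)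
    simp only [smul_eq_mul]
    rw [mul_comm]
    congr 2
    simp
    ring
  have hgH : Integrable fun z : ℝ × ℝ => g z.2 * H (z.1 + z.2) := by
    have h1 : Integrable fun z : ℝ × ℝ => H z.1 * g z.2 :=
      (hH.integrable volume).mul_prod (hg.integrable volume)
    have h2 := measurePreserving_shear.integrable_comp_of_integrable h1
    refine h2.congr (ae_of_all _ fun z => ?_)
    simp [mul_comm]
  set K : ℝ → ℂ := fun ξ => (∫ s, H s * Complex.exp (Complex.I * ((2 * Real.pi * ξ * s : ℝ) : ℂ))) *
    ∫ y, g y * Complex.exp (Complex.I * ((-(2 * Real.pi * ξ * y) : ℝ) : ℂ)) with hK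
  have hswap : ∫ z : ℝ × ℝ, a z.1 * g z.2 * H (z.1 + z.2) = ∫ ξ, 𝓕 a ξ * K ξ := by
    calc _ = ∫ z : ℝ × ℝ, ∫ ξ, 𝓕 a ξ * Complex.exp (Complex.I * ((2 * Real.pi * ξ * z.1 : ℝ) : ℂ)) *
        (g z.2 * H (z.1 + z.2)) := by
          refine integral_congr_ae (ae_of_all _ fun z => ?_)
          simp only []
          rw [integral_mul_const, ← hinv, mul_assoc]
      _ = ∫ ξ, ∫ z : ℝ × ℝ, 𝓕 a ξ * Complex.exp (Complex.I * ((2 * Real.pi * ξ * z.1 : ℝ) : ℂ)) *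
        (g z.2 * H (z.1 + z.2)) := by
          rw [integral_integral_swap]
          have h1 : Integrable fun p : (ℝ × ℝ) × ℝ => (g p.1.2 * H (p.1.1 + p.1.2)) * 𝓕 a p.2 :=
            hgH.mul_prod h𝓕i
          have h2 : Measurable fun p : (ℝ × ℝ) × ℝ =>
              Complex.exp (Complex.I * ((2 * Real.pi * p.2 * p.1.1 : ℝ) : ℂ)) := by fun_prop
          refine (h1.bdd_mul (c := 1) h2.aestronglyMeasurable
            (ae_of_all _ fun p => (norm_exp_I_mul _).le)).congr (ae_of_all _ fun p => ?_)
          simp only [Function.uncurry]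
          ring
      _ = ∫ ξ, 𝓕 a ξ * K ξ := by
          refine integral_congr_ae (ae_of_all _ fun ξ => ?_)
          simp only [mul_assoc (𝓕 a ξ)]
          rw [integral_const_mul]
          congr 1
          rw [hK]
          simp only []
          -- At fixed frequency e^{iξx} = e^{iξ(x+y)}e^{-iξy}, so the double integral factors into a
          -- transform of H and one of g.
          rw [← integral_prod_mul, ← Measure.volume_eq_prod, integral_shear fun z : ℝ × ℝ =>
            (H z.1 * Complex.exp (Complex.I * ((2 * Real.pi * ξ * z.1 : ℝ) : ℂ))) *
            (g z.2 * Complex.exp (Complex.I * ((-(2 * Real.pi * ξ * z.2) : ℝ) : ℂ)))]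
          refine integral_congr_ae (ae_of_all _ fun z => ?_)
          simp only []
          rw [show Complex.exp (Complex.I * ((2 * Real.pi * ξ * z.1 : ℝ) : ℂ)) =
            Complex.exp (Complex.I * ((2 * Real.pi * ξ * (z.1 + z.2) : ℝ) : ℂ)) *
            Complex.exp (Complex.I * ((-(2 * Real.pi * ξ * z.2) : ℝ) : ℂ)) by
            rw [← Complex.exp_add]; congr 1; push_cast; ring]
          ring
  have hmR : Measurable fun ξ : ℝ => m ξ *
      (‖∫ s, H s * Complex.exp (Complex.I * ((ξ * s : ℝ) : ℂ))‖ₑ *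
        ‖∫ y, g y * Complex.exp (Complex.I * ((-(ξ * y) : ℝ) : ℂ))‖ₑ) := by
    have h1 := measurable_integral_mul_exp hg.meas (p := fun _ => 0) measurable_const
    have h2 := (measurable_integral_mul_exp hH.meas (p := fun _ => 0) measurable_const).comp
      measurable_neg
    simp only [zero_sub, Function.comp_def, neg_mul, neg_neg] at h1 h2
    exact hm.mul (h2.enorm.mul h1.enorm)
  rw [hswap]
  refine (enorm_integral_le_lintegral_enorm _).trans (le_trans (lintegral_mono fun ξ => ?_)
    (lintegral_comp_two_pi_le hmR))
  rw [enorm_mul, hK]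
  simp only []
  rw [enorm_mul]
  exact mul_le_mul_left (h𝓕b ξ) _

variable {B w : ℝ} {Q : ℝ × ℝ → ℝ}

/-- A bilinear form with separated phase is controlled by the frequency window of the phase. -/
theorem exists_separated_form_le : ∃ C : ℝ, 0 < C ∧
    ∀ (B w : ℝ) (Q : ℝ × ℝ → ℝ), KeyHyp B w Q → ∀ (ψ ψ1 ψ2 : ℝ → ℂ) (a0 x0 y0 : ℝ), 0 ≤ a0 →
    (∀ x, HasDerivAt ψ (ψ1 x) x) → (∀ x, HasDerivAt ψ1 (ψ2 x) x) → Continuous ψ2 →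
    tsupport ψ ⊆ Ioo (x0 - 2) (x0 + 2) → (∀ x, ‖ψ x‖ ≤ a0) → (∀ x, ‖ψ1 x‖ ≤ a0) →
    (∀ x, ‖ψ2 x‖ ≤ a0) → ∀ G H : ℝ → ℂ, IsCore G → IsCore H →
    ‖∫ z : ℝ × ℝ, ψ z.1 * Complex.exp (Complex.I * (Q (z.1, y0) : ℂ)) *
      (G z.2 * Complex.exp (Complex.I * (Q (x0, z.2) : ℂ))) * H (z.1 + z.2)‖ₑ ≤
    ENNReal.ofReal (C * a0) * ∫⁻ ξ : ℝ, ENNReal.ofReal (arctanWeight Q x0 y0 ξ) *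
      (‖∫ s, H s * Complex.exp (Complex.I * ((ξ * s : ℝ) : ℂ))‖ₑ ^ 2 +
        ‖∫ y, G y * Complex.exp (Complex.I * ((Q (x0, y) - ξ * y : ℝ) : ℂ))‖ₑ ^ 2) := by
  obtain ⟨C, hC, hvdc⟩ := exists_norm_integral_le_arctan
  refine ⟨C, hC, fun B w Q h ψ ψ1 ψ2 a0 x0 y0 ha0 h1 h2 hc2 hsupp b0 b1 b2 G H hG hH => ?_⟩
  have cψ : Continuous ψ := continuous_iff_continuousAt.2 fun x => (h1 x).continuousAt
  have cQ : Continuous Q := h.smooth.continuous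
  have cQx : Continuous fun x => Q (x, y0) := cQ.comp (by fun_prop)
  have hψc : IsCore ψ := by
    refine ⟨cψ.measurable, ⟨a0, b0⟩, |x0| + 2, fun x hx => image_eq_zero_of_notMem_tsupport
      fun hmem => ?_⟩
    have := hsupp hmem
    rw [Real.norm_eq_abs] at hx
    have h3 := abs_sub_abs_le_abs_sub x x0
    have h4 : |x - x0| < 2 := abs_lt.2 ⟨by linarith [this.1], by linarith [this.2]⟩
    linarith
  have key := enorm_integral_mul_convolution_le
    (a := fun x => ψ x * Complex.exp (Complex.I * (Q (x, y0) : ℂ))) (by fun_prop)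
    (hψc.mul_bounded (by fun_prop) fun y => (norm_exp_I_mul _).le)
    (m := fun ξ => ENNReal.ofReal (C * a0) * ENNReal.ofReal (arctanWeight Q x0 y0 ξ))
    ((measurable_arctanWeight x0 y0).ennreal_ofReal.const_mul _) ?_ (fun ξ => ?_)
    (hG.mul_bounded (u := fun y => Complex.exp (Complex.I * (Q (x0, y) : ℂ)))
      (by fun_prop) fun y => (norm_exp_I_mul _).le) hH
  · refine key.trans ?_
    simp only [mul_assoc (ENNReal.ofReal (C * a0))]
    rw [lintegral_const_mul' _ _ ENNReal.ofReal_ne_top]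
    refine mul_le_mul_right (lintegral_mono fun ξ => mul_le_mul_right ?_ _) _
    have e : ∀ y, G y * Complex.exp (Complex.I * (Q (x0, y) : ℂ)) *
        Complex.exp (Complex.I * ((-(ξ * y) : ℝ) : ℂ)) =
        G y * Complex.exp (Complex.I * ((Q (x0, y) - ξ * y : ℝ) : ℂ)) := fun y => by
      rw [mul_assoc, ← Complex.exp_add]; congr 2; push_cast; ring
    simp only [e]
    generalize ‖∫ s, H s * Complex.exp (Complex.I * ((ξ * s : ℝ) : ℂ))‖ₑ = u
    generalize ‖∫ y, G y * Complex.exp (Complex.I * ((Q (x0, y) - ξ * y : ℝ) : ℂ))‖ₑ = v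
    rcases le_total u v with huv | huv
    · exact (mul_le_mul_left huv v).trans (by rw [sq v]; exact le_add_self)
    · exact (mul_le_mul_right huv u).trans (by rw [sq u]; exact le_self_add)
  · rw [lintegral_const_mul' _ _ ENNReal.ofReal_ne_top]
    exact ENNReal.mul_ne_top ENNReal.ofReal_ne_top (h.lintegral_arctanWeight_lt_top _ _).ne
  · rw [← ENNReal.ofReal_mul (by positivity), ← ofReal_norm]
    refine ENNReal.ofReal_le_ofReal ?_
    have := hvdc ψ ψ1 ψ2 (fun x => Q (x, y0) - ξ * x) (fun x => partialX Q (x, y0) - ξ)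
      (fun x => partialX (partialX Q) (x, y0)) a0 x0 ha0 h1 h2 hc2 hsupp b0 b1 b2 (fun x => ?_)
      (fun x => (h.smooth.partialX.hasDerivAt_partialX x y0).sub_const ξ)
      (h.smooth.partialX.partialX.continuous.comp (by fun_prop)) (fun x => h.xx _)
    · refine le_trans (le_of_eq ?_) this
      congr 1
      refine integral_congr_ae (ae_of_all _ fun x => ?_)
      simp only [mul_assoc, ← Complex.exp_add]
      congr 2; push_cast; ring
    · refine ((h.smooth.hasDerivAt_partialX x y0).sub
        ((hasDerivAt_id x).const_mul ξ)).congr_deriv ?_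
      ring

end FourierSeparation

/-! ### Amplitudes produced by removing the non-separated part of the phase. -/

section BlockAmplitude

open Set Complex

/-- Amplitudes of the form `χ(x - x₀) q(x) e^{iA(x)}`. -/
theorem exists_modulated_bump {a b : ℝ} (hb : 1 ≤ b) (h0 : ∀ x, |unitBump x| ≤ a)
    (h1 : ∀ x, |deriv unitBump x| ≤ a) (h2 : ∀ x, |deriv (deriv unitBump) x| ≤ a) {x0 : ℝ}
    {q q1 q2 A A1 A2 : ℝ → ℝ} (dq : ∀ x, HasDerivAt q (q1 x) x) (dq1 : ∀ x, HasDerivAt q1 (q2 x) x)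
    (dA : ∀ x, HasDerivAt A (A1 x) x) (dA1 : ∀ x, HasDerivAt A1 (A2 x) x) (cq2 : Continuous q2)
    (cA2 : Continuous A2) (bq : ∀ x ∈ Icc (x0 - 3 / 2) (x0 + 3 / 2), |q x| ≤ 1)
    (bq1 : ∀ x, |q1 x| ≤ 1) (bq2 : ∀ x, |q2 x| ≤ b) (bA1 : ∀ x, |A1 x| ≤ 1)
    (bA2 : ∀ x, |A2 x| ≤ b) :
    ∃ ψ1 ψ2 : ℝ → ℂ, (∀ x, HasDerivAt (fun x => (unitBump (x - x0) : ℂ) *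
        (I * q x * exp (I * A x))) (ψ1 x) x) ∧ (∀ x, HasDerivAt ψ1 (ψ2 x) x) ∧ Continuous ψ2 ∧
      (∀ x, ‖(unitBump (x - x0) : ℂ) * (I * q x * exp (I * A x))‖ ≤ 10 * (a * b)) ∧
      (∀ x, ‖ψ1 x‖ ≤ 10 * (a * b)) ∧ ∀ x, ‖ψ2 x‖ ≤ 10 * (a * b) := by
  have ha : 0 ≤ a := (abs_nonneg _).trans (h0 0)
  set e : ℝ → ℂ := fun x => exp (I * A x) with he
  have de : ∀ x, HasDerivAt e (e x * (I * A1 x)) x := fun x =>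
    ((dA x).ofReal_comp.const_mul I).cexp
  set m : ℝ → ℂ := fun x => I * q x * e x with hm
  set m1 : ℝ → ℂ := fun x => (I * q1 x - q x * A1 x) * e x with hm1
  set m2 : ℝ → ℂ := fun x => (I * q2 x - 2 * (q1 x * A1 x) - q x * A2 x - I * (q x * A1 x * A1 x)) * e x
    with hm2
  have dm : ∀ x, HasDerivAt m (m1 x) x := fun x => by
    refine (((dq x).ofReal_comp.const_mul I).mul (de x)).congr_deriv ?_
    simp only [hm1]
    linear_combination (q x * A1 x * e x) * I_mul_I
  have dm1 : ∀ x, HasDerivAt m1 (m2 x) x := fun x => by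
    refine ((((dq1 x).ofReal_comp.const_mul I).sub ((dq x).ofReal_comp.mul
      (dA1 x).ofReal_comp)).mul (de x)).congr_deriv ?_
    simp only [hm2, Pi.sub_apply, Pi.mul_apply]
    linear_combination (q1 x * A1 x * e x) * I_mul_I
  set c : ℝ → ℂ := fun x => (unitBump (x - x0) : ℂ) with hc
  set c1 : ℝ → ℂ := fun x => (deriv unitBump (x - x0) : ℝ) with hc1
  set c2 : ℝ → ℂ := fun x => (deriv (deriv unitBump) (x - x0) : ℝ) with hc2
  have dc : ∀ x, HasDerivAt c (c1 x) x := fun x =>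
    ((hasDerivAt_unitBump (x - x0)).comp_sub_const x x0).ofReal_comp
  have dc1 : ∀ x, HasDerivAt c1 (c2 x) x := fun x =>
    ((hasDerivAt_deriv_unitBump (x - x0)).comp_sub_const x x0).ofReal_comp
  have nn : ∀ t : ℝ, ‖(t : ℂ)‖ = |t| := fun t => by rw [norm_real, Real.norm_eq_abs]
  have ne : ∀ x, ‖e x‖ = 1 := fun x => norm_exp_I_mul _
  have bm : ∀ x ∈ Icc (x0 - 3 / 2) (x0 + 3 / 2), ‖m x‖ ≤ b := fun x hx => by
    simp only [hm, norm_mul, ne, nn, norm_I]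
    linarith [bq x hx]
  have bm1 : ∀ x ∈ Icc (x0 - 3 / 2) (x0 + 3 / 2), ‖m1 x‖ ≤ 2 * b := fun x hx => by
    simp only [hm1, norm_mul, ne, mul_one]
    refine (norm_sub_le _ _).trans ?_
    simp only [norm_mul, nn, norm_I, one_mul]
    have := mul_le_mul (bq x hx) (bA1 x) (abs_nonneg _) zero_le_one
    linarith [bq1 x]
  have bm2 : ∀ x ∈ Icc (x0 - 3 / 2) (x0 + 3 / 2), ‖m2 x‖ ≤ 5 * b := fun x hx => by
    simp only [hm2, norm_mul, ne, mul_one]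
    refine (norm_sub_le _ _).trans (le_trans (add_le_add_left ((norm_sub_le _ _).trans
      (add_le_add_left (norm_sub_le _ _) _)) _) ?_)
    simp only [norm_mul, nn, norm_I, one_mul, RCLike.norm_ofNat]
    have e1 := mul_le_mul (bq1 x) (bA1 x) (abs_nonneg _) zero_le_one
    have e2 := mul_le_mul (bq x hx) (bA2 x) (abs_nonneg _) zero_le_one
    have e3 := mul_le_mul (mul_le_mul (bq x hx) (bA1 x) (abs_nonneg _) zero_le_one) (bA1 x)
      (abs_nonneg _) (by norm_num)
    linarith [bq2 x]
  have c0 : ∀ x, x ∉ Icc (x0 - 3 / 2) (x0 + 3 / 2) → c x = 0 ∧ c1 x = 0 ∧ c2 x = 0 := by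
    intro x hx
    have hx' : x - x0 ∉ tsupport (unitBump : ℝ → ℝ) := fun h => hx (by
      rw [unitBump_tsupport] at h; exact ⟨by linarith [h.1], by linarith [h.2]⟩)
    have hx1 : x - x0 ∉ tsupport (deriv unitBump) := fun h => hx' (tsupport_deriv_subset h)
    have hx2 : x - x0 ∉ tsupport (deriv (deriv unitBump)) := fun h => hx1 (tsupport_deriv_subset h)
    refine ⟨?_, ?_, ?_⟩
    · simp only [hc, image_eq_zero_of_notMem_tsupport hx', ofReal_zero]
    · simp only [hc1, image_eq_zero_of_notMem_tsupport hx1, ofReal_zero]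
    · simp only [hc2, image_eq_zero_of_notMem_tsupport hx2, ofReal_zero]
  have bc : ∀ x, ‖c x‖ ≤ a := fun x => by simp only [hc, nn]; exact h0 _
  have bc1 : ∀ x, ‖c1 x‖ ≤ a := fun x => by simp only [hc1, nn]; exact h1 _
  have bc2 : ∀ x, ‖c2 x‖ ≤ a := fun x => by simp only [hc2, nn]; exact h2 _
  have hab : 0 ≤ a * b := by positivity
  have mulb : ∀ {u v : ℂ} {n : ℝ}, ‖u‖ ≤ a → ‖v‖ ≤ n * b → ‖u * v‖ ≤ n * (a * b) := by
    intro u v n hu hv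
    rw [norm_mul]
    calc ‖u‖ * ‖v‖ ≤ a * (n * b) := mul_le_mul hu hv (norm_nonneg _) ha
      _ = _ := by ring
  refine ⟨fun x => c1 x * m x + c x * m1 x,
    fun x => (c2 x * m x + c1 x * m1 x) + (c1 x * m1 x + c x * m2 x),
    fun x => (dc x).mul (dm x), fun x => ((dc1 x).mul (dm x)).add ((dc x).mul (dm1 x)), ?_, ?_, ?_, ?_⟩
  · have cont : ∀ {f f' : ℝ → ℂ}, (∀ x, HasDerivAt f (f' x) x) → Continuous f := fun hf =>
      continuous_iff_continuousAt.2 fun x => (hf x).continuousAt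
    have contR : ∀ {f f' : ℝ → ℝ}, (∀ x, HasDerivAt f (f' x) x) → Continuous f := fun hf =>
      continuous_iff_continuousAt.2 fun x => (hf x).continuousAt
    have cc := cont dc
    have cc1 := cont dc1
    have cc2 : Continuous c2 := by
      have : Continuous (deriv (deriv unitBump)) := by
        have h3 : ContDiff ℝ 2 (unitBump : ℝ → ℝ) := unitBump.contDiff
        exact (ContDiff.iterate_deriv' 0 2 h3).continuous
      exact continuous_ofReal.comp (this.comp (by fun_prop))
    have cm := cont dm
    have cm1 := cont dm1
    have := contR dq
    have := contR dq1
    have := contR dA1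
    have ce := cont de
    have cm2 : Continuous m2 := by
      simp only [hm2]
      fun_prop
    fun_prop
  · intro x
    by_cases hx : x ∈ Icc (x0 - 3 / 2) (x0 + 3 / 2)
    · have := mulb (n := 1) (bc x) ((bm x hx).trans (by rw [one_mul]))
      linarith
    · change ‖c x * _‖ ≤ _
      rw [(c0 x hx).1, zero_mul, norm_zero]; positivity
  · intro x
    by_cases hx : x ∈ Icc (x0 - 3 / 2) (x0 + 3 / 2)
    · have e1 := mulb (n := 1) (bc1 x) ((bm x hx).trans (by rw [one_mul]))
      have e2 := mulb (bc x) (bm1 x hx)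
      linarith [norm_add_le (c1 x * m x) (c x * m1 x)]
    · simp only []
      rw [(c0 x hx).1, (c0 x hx).2.1, zero_mul, zero_mul, add_zero, norm_zero]; positivity
  · intro x
    by_cases hx : x ∈ Icc (x0 - 3 / 2) (x0 + 3 / 2)
    -- The constant 10 is 1 + 2 + 2 + 5, from the Leibniz rule for the second derivative.
    · have e1 := mulb (n := 1) (bc2 x) ((bm x hx).trans (by rw [one_mul]))
      have e2 := mulb (bc1 x) (bm1 x hx)
      have e3 := mulb (bc x) (bm2 x hx)
      have t1 := norm_add_le (c2 x * m x) (c1 x * m1 x)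
      have t2 := norm_add_le (c1 x * m1 x) (c x * m2 x)
      have t3 := norm_add_le (c2 x * m x + c1 x * m1 x) (c1 x * m1 x + c x * m2 x)
      linarith
    · simp only []
      rw [(c0 x hx).1, (c0 x hx).2.1, (c0 x hx).2.2]
      simp only [zero_mul, add_zero, norm_zero]; positivity

theorem tsupport_bump_mul_subset (x0 : ℝ) (m : ℝ → ℂ) :
    tsupport (fun x => (unitBump (x - x0) : ℂ) * m x) ⊆ Ioo (x0 - 2) (x0 + 2) := by
  have : tsupport (fun x => (unitBump (x - x0) : ℂ) * m x) ⊆ Icc (x0 - 3 / 2) (x0 + 3 / 2) := by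
    refine closure_minimal (fun x hx => ?_) isClosed_Icc
    have h : x - x0 ∈ tsupport (unitBump : ℝ → ℝ) := subset_tsupport _ fun h0 => hx (by simp [h0])
    rw [unitBump_tsupport] at h
    exact ⟨by linarith [h.1], by linarith [h.2]⟩
  exact fun x hx => ⟨by linarith [(this hx).1], by linarith [(this hx).2]⟩

end BlockAmplitude

/-! ### The bilinear form on a single block. -/

section Block

open Set ENNReal ComplexConjugate

variable {B w : ℝ} {Q : ℝ × ℝ → ℝ}

/-- The double difference of `Q` over the rectangle with corners `(x₀, y₀)` and `(x, y)`. -/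
def doubleDiff (Q : ℝ × ℝ → ℝ) (x0 y0 x y : ℝ) : ℝ :=
  Q (x, y) - Q (x, y0) - (Q (x0, y) - Q (x0, y0))

/-- The quantity controlling a bilinear form on a single block. -/
noncomputable def blockEnergy (Q : ℝ × ℝ → ℝ) (x0 y0 : ℝ) (G H : ℝ → ℂ) : ℝ≥0∞ :=
  ∫⁻ ξ : ℝ, ENNReal.ofReal (arctanWeight Q x0 y0 ξ) *
      (‖∫ s, H s * Complex.exp (Complex.I * ((ξ * s : ℝ) : ℂ))‖ₑ ^ 2 +
        ‖∫ y, G y * Complex.exp (Complex.I * ((Q (x0, y) - ξ * y : ℝ) : ℂ))‖ₑ ^ 2)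

theorem IsCore.indicator {F : ℝ → ℂ} (hF : IsCore F) {s : Set ℝ} (hs : MeasurableSet s) :
    IsCore (s.indicator F) := by
  obtain ⟨B, hB⟩ := hF.bdd
  obtain ⟨M, hM⟩ := hF.supp
  exact ⟨hF.meas.indicator hs, ⟨B, fun z => (norm_indicator_le_norm_self _ _).trans (hB z)⟩, M,
    fun z hz => indicator_apply_eq_zero.2 fun _ => hM z hz⟩

/-- The fundamental theorem of calculus in y, with the upper limit rewritten as an indicator. For
fixed t the integrand is then a function of x times the indicator of y > y0 + θt, which can be
absorbed into G: a superposition of separated phases. -/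
theorem KeyHyp.exp_doubleDiff_eq (h : KeyHyp B w Q) {θ : ℝ} (hθ : 0 < θ) {x0 y0 y : ℝ} (x : ℝ)
    (hy : y ∈ Icc y0 (y0 + θ)) :
    Complex.exp (Complex.I * doubleDiff Q x0 y0 x y) = 1 + ∫ t in Ioc (0 : ℝ) 1,
      indicator (Ioi (y0 + θ * t)) (fun _ => Complex.I *
        ((θ * (partialY Q (x, y0 + θ * t) - partialY Q (x0, y0 + θ * t)) : ℝ) : ℂ) *
        Complex.exp (Complex.I * doubleDiff Q x0 y0 x (y0 + θ * t))) y := by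
  set T := (y - y0) / θ with hT
  have hT0 : 0 ≤ T := div_nonneg (by linarith [hy.1]) hθ.le
  have hT1 : T ≤ 1 := (div_le_one hθ).2 (by linarith [hy.2])
  have hyT : y0 + θ * T = y := by rw [hT]; field_simp; ring
  set g' : ℝ → ℂ := fun t => Complex.I *
        ((θ * (partialY Q (x, y0 + θ * t) - partialY Q (x0, y0 + θ * t)) : ℝ) : ℂ) *
        Complex.exp (Complex.I * doubleDiff Q x0 y0 x (y0 + θ * t)) with hg'
  have cQ := h.smooth.continuous
  have cQy := h.smooth.partialY.continuous
  have hc : Continuous g' := by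
    have c1 : Continuous fun t => Q (x, y0 + θ * t) := cQ.comp (by fun_prop)
    have c2 : Continuous fun t => Q (x0, y0 + θ * t) := cQ.comp (by fun_prop)
    have c3 : Continuous fun t => partialY Q (x, y0 + θ * t) := cQy.comp (by fun_prop)
    have c4 : Continuous fun t => partialY Q (x0, y0 + θ * t) := cQy.comp (by fun_prop)
    simp only [hg', doubleDiff]
    fun_prop
  have hd : ∀ t, HasDerivAt (fun t : ℝ => Complex.exp (Complex.I *
      doubleDiff Q x0 y0 x (y0 + θ * t))) (g' t) t := fun t => by
    have e0 : HasDerivAt (fun t : ℝ => y0 + θ * t) θ t := by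
      simpa using ((hasDerivAt_id t).const_mul θ).const_add y0
    have e1 := ((h.smooth.hasDerivAt_partialY x (y0 + θ * t)).comp t e0).sub_const (Q (x, y0))
    have e2 := ((h.smooth.hasDerivAt_partialY x0 (y0 + θ * t)).comp t e0).sub_const (Q (x0, y0))
    have e3 := ((e1.sub e2).ofReal_comp.const_mul Complex.I).cexp
    refine e3.congr_deriv ?_
    simp only [hg', doubleDiff, Function.comp, Pi.sub_apply]
    push_cast
    ring
  have ftc := intervalIntegral.integral_eq_sub_of_hasDerivAt (fun t _ => hd t)
    (hc.intervalIntegrable 0 T)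
  have e0 : doubleDiff Q x0 y0 x (y0 + θ * 0) = 0 := by simp [doubleDiff]
  rw [hyT, e0, Complex.ofReal_zero, mul_zero, Complex.exp_zero,
    intervalIntegral.integral_of_le hT0] at ftc
  rw [sub_eq_iff_eq_add'.1 ftc.symm]
  congr 1
  have e1 : ∀ t, indicator (Ioi (y0 + θ * t)) (fun _ => g' t) y = indicator (Iio T) g' t := fun t => by
    have hiff : y ∈ Ioi (y0 + θ * t) ↔ t ∈ Iio T := by
      rw [mem_Ioi, mem_Iio, hT, lt_div_iff₀ hθ]
      constructor <;> intro <;> linarith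
    by_cases ht : t ∈ Iio T
    · rw [indicator_of_mem ht, indicator_of_mem (hiff.2 ht)]
    · rw [indicator_of_notMem ht, indicator_of_notMem fun hh => ht (hiff.1 hh)]
  simp only [hg'] at e1 ⊢
  simp only [e1]
  rw [setIntegral_indicator measurableSet_Iio, show Ioc (0 : ℝ) 1 ∩ Iio T = Ioo 0 T by
    ext t
    simp only [mem_inter_iff, mem_Ioc, mem_Iio, mem_Ioo]
    exact ⟨fun h => ⟨h.1.1, h.2⟩, fun h => ⟨⟨h.1, h.2.le.trans hT1⟩, h.2⟩⟩]
  exact setIntegral_congr_set Ioo_ae_eq_Ioc.symm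

theorem IsCore.integrable_convolution {g H : ℝ → ℂ} (hg : IsCore g) (hH : IsCore H) :
    Integrable fun z : ℝ × ℝ => g z.2 * H (z.1 + z.2) := by
  have h1 : Integrable fun z : ℝ × ℝ => H z.1 * g z.2 :=
    (hH.integrable volume).mul_prod (hg.integrable volume)
  refine (measurePreserving_shear.integrable_comp_of_integrable h1).congr (ae_of_all _ fun z => ?_)
  simp [mul_comm]

/-- Apart from the double difference, Q is a function of x plus a function of y. Expanding the
exponential of the double difference leaves forms with separated phase and amplitudes in x that are
uniformly C². -/
theorem exists_block_form_le (hB : 0 ≤ B) : ∃ C : ℝ, 0 < C ∧ ∀ (w : ℝ) (Q : ℝ × ℝ → ℝ), 0 < w →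
    KeyHyp B w Q → ∀ (θ s0 y0 : ℝ), 0 < θ → θ ≤ 1 → θ ≤ w → ∀ G H : ℝ → ℂ, IsCore G → IsCore H →
    (∀ y, G y ≠ 0 → y ∈ Icc y0 (y0 + θ)) → (∀ s, H s ≠ 0 → s ∈ Icc s0 (s0 + 1)) →
    ‖∫ z : ℝ × ℝ, Complex.exp (Complex.I * (Q z : ℂ)) * G z.2 * H (z.1 + z.2)‖ₑ ≤
      ENNReal.ofReal C * (blockEnergy Q (s0 - y0) y0 G H + ∫⁻ t in Ioc (0 : ℝ) 1,
        blockEnergy Q (s0 - y0) y0 (indicator (Ioi (y0 + θ * t)) G) H) := by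
  obtain ⟨a, ha, hb0, hb1, hb2⟩ := exists_unitBump_bound
  obtain ⟨C, hC, hsep⟩ := exists_separated_form_le
  set a0 := 10 * (a * (1 + B)) with ha0
  have ha0p : 0 < a0 := by positivity
  refine ⟨C * a0, by positivity, fun w Q hw h θ s0 y0 hθ hθ1 hθw G H hG hH hGs hHs => ?_⟩
  set x0 := s0 - y0 with hx0
  have cQ := h.smooth.continuous
  have cQy := h.smooth.partialY.continuous
  set q : ℝ → ℝ → ℝ := fun t x => θ * (partialY Q (x, y0 + θ * t) - partialY Q (x0, y0 + θ * t))
    with hq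
  -- The constant term 1 is written with the spurious factor i that fits the general form of
  -- amplitude; the factor -i below removes it.
  set ψ0 : ℝ → ℂ := fun x => (unitBump (x - x0) : ℂ) * (Complex.I * (1 : ℝ) *
    Complex.exp (Complex.I * (0 : ℝ))) with hψ0
  set ψ : ℝ → ℝ → ℂ := fun t x => (unitBump (x - x0) : ℂ) * (Complex.I * q t x *
    Complex.exp (Complex.I * doubleDiff Q x0 y0 x (y0 + θ * t))) with hψ
  obtain ⟨ψ1, ψ2, d1, d2, c2, k0, k1, k2⟩ := exists_modulated_bump (x0 := x0) (b := 1 + B)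
    (by linarith) hb0 hb1 hb2 (q := fun _ => 1) (A := fun _ => 0)
    (fun x => hasDerivAt_const x (1 : ℝ)) (fun x => hasDerivAt_const x (0 : ℝ))
    (fun x => hasDerivAt_const x (0 : ℝ)) (fun x => hasDerivAt_const x (0 : ℝ))
    continuous_const continuous_const (fun x _ => by norm_num) (fun x => by norm_num)
    (fun x => by rw [abs_zero]; linarith) (fun x => by norm_num)
    (fun x => by rw [abs_zero]; linarith)
  -- This is where θ ≤ w is needed: the third derivatives of Q, of size B/w, become bounded over one
  -- block.
  have hBw : θ * (B / w) ≤ B := by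
    calc θ * (B / w) ≤ w * (B / w) := by gcongr
      _ = B := by field_simp
  have hmod : ∀ t ∈ Ioc (0 : ℝ) 1, ∃ ψ1 ψ2 : ℝ → ℂ, (∀ x, HasDerivAt (ψ t) (ψ1 x) x) ∧
      (∀ x, HasDerivAt ψ1 (ψ2 x) x) ∧ Continuous ψ2 ∧ (∀ x, ‖ψ t x‖ ≤ a0) ∧
      (∀ x, ‖ψ1 x‖ ≤ a0) ∧ ∀ x, ‖ψ2 x‖ ≤ a0 := by
    intro t ht
    have hη : |y0 + θ * t - y0| ≤ θ := by
      rw [add_sub_cancel_left, abs_of_nonneg (mul_nonneg hθ.le ht.1.le)]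
      exact mul_le_of_le_one_right hθ.le ht.2
    refine exists_modulated_bump (x0 := x0) (b := 1 + B) (by linarith) hb0 hb1 hb2 (q := q t)
      (q1 := fun x => θ * partialX (partialY Q) (x, y0 + θ * t))
      (q2 := fun x => θ * partialX (partialX (partialY Q)) (x, y0 + θ * t))
      (A1 := fun x => partialX Q (x, y0 + θ * t) - partialX Q (x, y0))
      (A2 := fun x => partialX (partialX Q) (x, y0 + θ * t) - partialX (partialX Q) (x, y0))
      (fun x => ?_) (fun x => ?_) (fun x => ?_) (fun x => ?_) ?_ ?_ (fun x hx => ?_) (fun x => ?_)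
      (fun x => ?_) (fun x => ?_) (fun x => ?_)
    · exact ((h.smooth.partialY.hasDerivAt_partialX x _).sub_const _).const_mul θ
    · exact (h.smooth.partialY.partialX.hasDerivAt_partialX x _).const_mul θ
    · exact ((h.smooth.hasDerivAt_partialX x _).sub (h.smooth.hasDerivAt_partialX x _)).sub_const _
    · exact (h.smooth.partialX.hasDerivAt_partialX x _).sub
        (h.smooth.partialX.hasDerivAt_partialX x _)
    · exact continuous_const.mul (h.smooth.partialY.partialX.partialX.continuous.comp (by fun_prop))
    · exact (h.smooth.partialX.partialX.continuous.comp (by fun_prop)).sub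
        (h.smooth.partialX.partialX.continuous.comp (by fun_prop))
    · rw [hq]
      simp only [abs_mul]
      have e1 := h.abs_partialY_sub_le (y0 + θ * t) x x0
      have e2 : |x - x0| ≤ 3 / 2 := abs_le.2 ⟨by linarith [hx.1], by linarith [hx.2]⟩
      rw [abs_of_pos hθ]
      calc _ ≤ 1 * (1 : ℝ) := by gcongr; linarith
        _ = 1 := one_mul 1
    · rw [h.smooth.partialX_partialY_comm, abs_mul, abs_of_pos hθ]
      have := h.xy (x, y0 + θ * t)
      calc _ ≤ 1 * (1 : ℝ) := by gcongr; linarith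
        _ = 1 := one_mul 1
    · rw [h.smooth.partialX_partialY_comm, abs_mul, abs_of_pos hθ]
      have := h.xxy (x, y0 + θ * t)
      calc _ ≤ θ * (B / w) := by gcongr
        _ ≤ 1 + B := by linarith
    · have := abs_sub_le_of_hasDerivAt (f := fun y => partialX Q (x, y))
        (fun y => h.smooth.partialX.hasDerivAt_partialY x y) (fun y => h.xy _) (y0 + θ * t) y0
      linarith
    · have := abs_sub_le_of_hasDerivAt (f := fun y => partialX (partialX Q) (x, y))
        (fun y => h.smooth.partialX.partialX.hasDerivAt_partialY x y) (C := B / w) (fun y => by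
          rw [← h.smooth.partialX.partialX_partialY_comm]; exact h.xxy _) (y0 + θ * t) y0
      refine this.trans ((mul_le_mul_of_nonneg_left hη (by positivity)).trans ?_)
      linarith
  have hgH := hG.integrable_convolution hH
  have cc : Continuous fun x : ℝ => unitBump (x - x0) :=
    unitBump_contDiff.continuous.comp (by fun_prop)
  set E : ℝ × ℝ → ℂ := fun z => Complex.exp (Complex.I * (Q (z.1, y0) : ℂ)) *
    Complex.exp (Complex.I * (Q (x0, z.2) : ℂ)) with hE
  have cE : Continuous E := by
    have e1 : Continuous fun z : ℝ × ℝ => Q (z.1, y0) := cQ.comp (by fun_prop)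
    have e2 : Continuous fun z : ℝ × ℝ => Q (x0, z.2) := cQ.comp (by fun_prop)
    fun_prop
  have nE : ∀ z, ‖E z‖ = 1 := fun z => by
    simp only [hE]; rw [norm_mul, norm_exp_I_mul, norm_exp_I_mul, one_mul]
  set S0 : ℝ × ℝ → ℂ := fun z => ψ0 z.1 * Complex.exp (Complex.I * (Q (z.1, y0) : ℂ)) *
      (G z.2 * Complex.exp (Complex.I * (Q (x0, z.2) : ℂ))) * H (z.1 + z.2) with hS0
  set S : ℝ × ℝ → ℝ → ℂ := fun z t => ψ t z.1 * Complex.exp (Complex.I * (Q (z.1, y0) : ℂ)) *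
      (indicator (Ioi (y0 + θ * t)) G z.2 * Complex.exp (Complex.I * (Q (x0, z.2) : ℂ))) *
      H (z.1 + z.2) with hS
  have iS0 : Integrable S0 := by
    have m1 : Continuous fun z : ℝ × ℝ => ψ0 z.1 * E z := by
      have : Continuous fun z : ℝ × ℝ => unitBump (z.1 - x0) := cc.comp continuous_fst
      simp only [hψ0]; fun_prop
    refine (hgH.bdd_mul (c := a0) m1.aestronglyMeasurable (ae_of_all _ fun z => ?_)).congr
      (ae_of_all _ fun z => ?_)
    · rw [norm_mul, nE, mul_one]; exact k0 _
    · simp only [hS0, hE]; ring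
  have iS : Integrable (Function.uncurry S) (volume.prod (volume.restrict (Ioc (0 : ℝ) 1))) := by
    have i1 : Integrable (fun p : (ℝ × ℝ) × ℝ => (G p.1.2 * H (p.1.1 + p.1.2)) * (1 : ℂ))
        (volume.prod (volume.restrict (Ioc (0 : ℝ) 1))) :=
      hgH.mul_prod (integrable_const (1 : ℂ))
    have m1 : Continuous fun p : (ℝ × ℝ) × ℝ => ψ p.2 p.1.1 * E p.1 := by
      have e0 : Continuous fun p : (ℝ × ℝ) × ℝ => unitBump (p.1.1 - x0) :=
        cc.comp (by fun_prop : Continuous fun p : (ℝ × ℝ) × ℝ => p.1.1)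
      have e1 : Continuous fun p : (ℝ × ℝ) × ℝ => partialY Q (p.1.1, y0 + θ * p.2) :=
        cQy.comp (by fun_prop)
      have e2 : Continuous fun p : (ℝ × ℝ) × ℝ => partialY Q (x0, y0 + θ * p.2) :=
        cQy.comp (by fun_prop)
      have e3 : Continuous fun p : (ℝ × ℝ) × ℝ => Q (p.1.1, y0 + θ * p.2) := cQ.comp (by fun_prop)
      have e4 : Continuous fun p : (ℝ × ℝ) × ℝ => Q (x0, y0 + θ * p.2) := cQ.comp (by fun_prop)
      have e5 : Continuous fun p : (ℝ × ℝ) × ℝ => Q (p.1.1, y0) := cQ.comp (by fun_prop)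
      have e6 : Continuous fun p : (ℝ × ℝ) × ℝ => E p.1 := cE.comp continuous_fst
      simp only [hψ, hq, doubleDiff]
      fun_prop
    have m2 : Measurable fun p : (ℝ × ℝ) × ℝ => (if y0 + θ * p.2 < p.1.2 then (1 : ℂ) else 0) :=
      Measurable.ite (measurableSet_lt (by fun_prop) (by fun_prop)) measurable_const measurable_const
    refine (i1.bdd_mul (c := a0) (m1.measurable.mul m2).aestronglyMeasurable ?_).congr
      (ae_of_all _ fun p => ?_)
    · have hae : ∀ᵐ p : (ℝ × ℝ) × ℝ ∂(volume.prod (volume.restrict (Ioc (0 : ℝ) 1))),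
          p.2 ∈ Ioc (0 : ℝ) 1 :=
        Measure.quasiMeasurePreserving_snd.ae (ae_restrict_mem measurableSet_Ioc)
      filter_upwards [hae] with p hp
      obtain ⟨_, _, _, _, _, hk, _⟩ := hmod p.2 hp
      simp only [Pi.mul_apply]
      rw [norm_mul, norm_mul, nE, mul_one]
      refine (mul_le_mul (hk p.1.1) (?_ : _ ≤ (1 : ℝ)) (norm_nonneg _) ha0p.le).trans
        (mul_one _).le
      split_ifs <;> simp
    · simp only [hS, hE, Function.uncurry, Pi.mul_apply, indicator_apply, mem_Ioi]
      split_ifs <;> ring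
  set c0 : ℂ := Complex.exp (Complex.I * ((-Q (x0, y0) : ℝ) : ℂ)) with hc0
  have hpt : ∀ z : ℝ × ℝ, Complex.exp (Complex.I * (Q z : ℂ)) * G z.2 * H (z.1 + z.2) =
      c0 * (-Complex.I * S0 z + ∫ t in Ioc (0 : ℝ) 1, S z t) := by
    rintro ⟨x, y⟩
    by_cases hGy : G y = 0
    · have : ∀ t, S (x, y) t = 0 := fun t => by simp [hS, hGy, indicator_apply]
      simp [this, hS0, hGy]
    by_cases hHs0 : H (x + y) = 0
    · have : ∀ t, S (x, y) t = 0 := fun t => by simp [hS, hHs0]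
      simp [this, hS0, hHs0]
    have hy := hGs y hGy
    have hs := hHs _ hHs0
    -- On the block x - x0 = (s-s0) - (y-y0) lies in [-1,1], because θ ≤ 1; inserting the bump is
    -- therefore harmless.
    have hχ : unitBump (x - x0) = 1 := unitBump_eq_one (abs_le.2
      ⟨by linarith [hy.2, hs.1], by linarith [hy.1, hs.2]⟩)
    have hdd := h.exp_doubleDiff_eq hθ (x0 := x0) x hy
    have hQ : Complex.exp (Complex.I * (Q (x, y) : ℂ)) = c0 * E (x, y) *
        Complex.exp (Complex.I * doubleDiff Q x0 y0 x y) := by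
      simp only [hc0, hE]
      rw [← Complex.exp_add, ← Complex.exp_add, ← Complex.exp_add]
      congr 1
      simp only [doubleDiff]
      push_cast
      ring
    have hSt : ∀ t, S (x, y) t = E (x, y) * G y * H (x + y) * indicator (Ioi (y0 + θ * t))
        (fun _ => Complex.I * ((θ * (partialY Q (x, y0 + θ * t) - partialY Q (x0, y0 + θ * t)) : ℝ)
        : ℂ) * Complex.exp (Complex.I * doubleDiff Q x0 y0 x (y0 + θ * t))) y := fun t => by
      simp only [hS, hψ, hE, hq, hχ, indicator_apply, Complex.ofReal_one]
      split_ifs <;> ring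
    simp_rw [hSt]
    rw [integral_const_mul, hQ, hdd]
    simp only [hS0, hψ0, hχ, Complex.ofReal_one, Complex.ofReal_zero, mul_zero, Complex.exp_zero, hE]
    linear_combination (c0 * (Complex.exp (Complex.I * (Q (x, y0) : ℂ)) *
      Complex.exp (Complex.I * (Q (x0, y) : ℂ))) * G y * H (x + y)) * Complex.I_mul_I
  simp_rw [hpt]
  have nc0 : ‖c0‖ₑ = 1 := by rw [← ofReal_norm, norm_exp_I_mul, ENNReal.ofReal_one]
  have iS' : Integrable fun z => ∫ t in Ioc (0 : ℝ) 1, S z t := iS.integral_prod_left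
  rw [integral_const_mul, enorm_mul, nc0, one_mul, integral_add (iS0.const_mul _) iS', integral_const_mul, integral_integral_swap iS]
  refine (enorm_add_le _ _).trans ?_
  rw [mul_add]
  refine add_le_add ?_ ?_
  · rw [enorm_mul, enorm_neg, ← ofReal_norm Complex.I, Complex.norm_I, ENNReal.ofReal_one, one_mul]
    exact hsep B w Q h ψ0 ψ1 ψ2 a0 x0 y0 ha0p.le d1 d2 c2 (tsupport_bump_mul_subset _ _) k0 k1 k2
      G H hG hH
  · rw [← lintegral_const_mul' _ _ ENNReal.ofReal_ne_top]
    refine (enorm_integral_le_lintegral_enorm _).trans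
      (setLIntegral_mono' measurableSet_Ioc fun t ht => ?_)
    obtain ⟨ψ1, ψ2, d1, d2, c2, k0, k1, k2⟩ := hmod t ht
    exact hsep B w Q h (ψ t) ψ1 ψ2 a0 x0 y0 ha0p.le d1 d2 c2 (tsupport_bump_mul_subset _ _) k0 k1 k2
      _ H (hG.indicator measurableSet_Ioi) hH

end Block

/-! ### Summation over blocks and the normalized bilinear estimate. -/

section KeyEstimate

open Set ENNReal ComplexConjugate

variable {B w : ℝ} {Q : ℝ × ℝ → ℝ}

theorem exists_lintegral_inverse_fourier_sq_le : ∃ C : ℝ, 0 < C ∧ ∀ (w α : ℝ), 0 < w →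
    ∀ G : ℝ → ℂ, IsCore G → (∀ y, G y ≠ 0 → y ∈ Icc α (α + w)) →
    ∫⁻ ξ : ℝ, ‖∫ y, G y * Complex.exp (Complex.I * ((ξ * y : ℝ) : ℂ))‖ₑ ^ 2 ≤
      ENNReal.ofReal C * ∫⁻ y, ‖G y‖ₑ ^ 2 := by
  obtain ⟨C, hC, hbd⟩ := exists_lintegral_fourier_sq_le
  refine ⟨C, hC, fun w α hw G hG hGs => le_trans (le_of_eq ?_) (hbd w α hw G hG hGs)⟩
  have hm := measurable_integral_mul_exp hG.meas (p := fun _ => 0) measurable_const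
  simp only [zero_sub] at hm
  have := (Measure.measurePreserving_neg (volume : Measure ℝ)).lintegral_comp (hm.enorm.pow_const 2)
  simpa only [neg_mul, neg_neg] using this

/-- The two halves of the energy are summed in opposite orders. For H the transform does not depend
on j, so the weights are summed first and Bessel's inequality follows; for G the sum over k is the
almost orthogonality estimate. -/
theorem KeyHyp.exists_sum_blockEnergy_le (hB : 0 ≤ B) : ∃ C : ℝ, 0 < C ∧
    ∀ (w : ℝ) (Q : ℝ × ℝ → ℝ), 0 < w → KeyHyp B w Q → ∀ (N : ℕ) (θ α : ℝ), (N = 1 ∨ 1 / 2 ≤ θ) →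
    θ ≤ w → ∀ (F : Finset ℤ) (G : ℕ → ℝ → ℂ) (H : ℤ → ℝ → ℂ), (∀ j, IsCore (G j)) →
    (∀ k, IsCore (H k)) → (∀ j y, G j y ≠ 0 → y ∈ Icc (α + j * θ) (α + j * θ + θ)) →
    (∀ k s, H k s ≠ 0 → s ∈ Icc (k : ℝ) (k + 1)) →
    ∑ j ∈ Finset.range N, ∑ k ∈ F, blockEnergy Q (k - (α + j * θ)) (α + j * θ) (G j) (H k) ≤
      ENNReal.ofReal C * ((∑ j ∈ Finset.range N, ∫⁻ y, ‖G j y‖ₑ ^ 2) +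
        ∑ k ∈ F, ∫⁻ s, ‖H k s‖ₑ ^ 2) := by
  obtain ⟨C1, hC1, hG1⟩ := KeyHyp.exists_sum_arctanWeight_le hB
  obtain ⟨C2, hC2, hH1⟩ := exists_lintegral_inverse_fourier_sq_le
  refine ⟨C1 + 10 * Real.pi * C2, by positivity, ?_⟩
  intro w Q hw h N θ α hθ hθw F G H hG hH hGs hHs
  have hm : ∀ k, Measurable fun ξ : ℝ =>
      ‖∫ s, H k s * Complex.exp (Complex.I * ((ξ * s : ℝ) : ℂ))‖ₑ ^ 2 := fun k => by
    have h2 := (measurable_integral_mul_exp (hH k).meas (p := fun _ => 0) measurable_const).comp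
      measurable_neg
    simp only [zero_sub, Function.comp_def, neg_mul, neg_neg] at h2
    exact h2.enorm.pow_const 2
  have hmM : ∀ x y, Measurable fun ξ => ENNReal.ofReal (arctanWeight Q x y ξ) := fun x y =>
    (measurable_arctanWeight x y).ennreal_ofReal
  have hsplit : ∀ (j : ℕ) (k : ℤ), blockEnergy Q (k - (α + j * θ)) (α + j * θ) (G j) (H k) =
      (∫⁻ ξ : ℝ, ENNReal.ofReal (arctanWeight Q (k - (α + j * θ)) (α + j * θ) ξ) *
        ‖∫ s, H k s * Complex.exp (Complex.I * ((ξ * s : ℝ) : ℂ))‖ₑ ^ 2) +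
      ∫⁻ ξ : ℝ, ENNReal.ofReal (arctanWeight Q (k - (α + j * θ)) (α + j * θ) ξ) *
        ‖∫ y, G j y * Complex.exp (Complex.I *
          ((Q (k - (α + j * θ), y) - ξ * y : ℝ) : ℂ))‖ₑ ^ 2 := fun j k => by
    unfold blockEnergy
    simp_rw [mul_add]
    exact lintegral_add_left ((hmM _ _).mul (hm k)) _
  simp_rw [hsplit, Finset.sum_add_distrib]
  have hfirst : ∑ j ∈ Finset.range N, ∑ k ∈ F,
      ∫⁻ ξ : ℝ, ENNReal.ofReal (arctanWeight Q (k - (α + j * θ)) (α + j * θ) ξ) *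
        ‖∫ s, H k s * Complex.exp (Complex.I * ((ξ * s : ℝ) : ℂ))‖ₑ ^ 2 ≤
      ENNReal.ofReal (10 * Real.pi * C2) * ∑ k ∈ F, ∫⁻ s, ‖H k s‖ₑ ^ 2 := by
    rw [Finset.sum_comm, Finset.mul_sum]
    refine Finset.sum_le_sum fun k _ => ?_
    have hmul : ∀ x y, Measurable fun ξ => ENNReal.ofReal (arctanWeight Q x y ξ) *
        ‖∫ s, H k s * Complex.exp (Complex.I * ((ξ * s : ℝ) : ℂ))‖ₑ ^ 2 := fun x y =>
      (hmM x y).mul (hm k)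
    rw [← lintegral_finsetSum _ fun j _ => hmul _ _]
    calc _ ≤ ∫⁻ ξ : ℝ, ENNReal.ofReal (10 * Real.pi) *
        ‖∫ s, H k s * Complex.exp (Complex.I * ((ξ * s : ℝ) : ℂ))‖ₑ ^ 2 := by
          refine lintegral_mono fun ξ => ?_
          rw [← Finset.sum_mul, ← ENNReal.ofReal_sum_of_nonneg fun j _ =>
            h.arctanWeight_nonneg _ _ _]
          exact mul_le_mul_left (ENNReal.ofReal_le_ofReal (h.sum_arctanWeight_le hθ k α ξ)) _
      _ ≤ _ := by
          rw [lintegral_const_mul' _ _ ENNReal.ofReal_ne_top,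
            ENNReal.ofReal_mul (p := 10 * Real.pi) (by positivity), mul_assoc]
          exact mul_le_mul_right (hH1 1 k one_pos (H k) (hH k) (hHs k)) _
  have hsecond : ∑ j ∈ Finset.range N, ∑ k ∈ F,
      ∫⁻ ξ : ℝ, ENNReal.ofReal (arctanWeight Q (k - (α + j * θ)) (α + j * θ) ξ) *
        ‖∫ y, G j y * Complex.exp (Complex.I *
          ((Q (k - (α + j * θ), y) - ξ * y : ℝ) : ℂ))‖ₑ ^ 2 ≤
      ENNReal.ofReal C1 * ∑ j ∈ Finset.range N, ∫⁻ y, ‖G j y‖ₑ ^ 2 := by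
    rw [Finset.mul_sum]
    refine Finset.sum_le_sum fun j _ => ?_
    have := hG1 w Q hw h (-(α + j * θ)) (α + j * θ) (α + j * θ) F (G j) (hG j) fun y hy =>
      ⟨(hGs j y hy).1, (hGs j y hy).2.trans (by linarith)⟩
    simpa only [← sub_eq_add_neg] using this
  refine (add_le_add hfirst hsecond).trans ?_
  rw [ENNReal.ofReal_add hC1.le (by positivity), mul_add, add_mul, add_mul, add_comm]
  exact add_le_add le_self_add le_add_self

theorem sum_indicator_fiber {ι E : Type*} [DecidableEq ι] [AddCommMonoid E] (F : Finset ι)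
    (i0 : ℝ → ι) (G : ℝ → E) (y : ℝ) (hy : G y ≠ 0 → i0 y ∈ F) :
    ∑ i ∈ F, indicator (i0 ⁻¹' {i}) G y = G y := by
  by_cases h : G y = 0
  · rw [h]; exact Finset.sum_eq_zero fun i _ => indicator_apply_eq_zero.2 fun _ => h
  · rw [Finset.sum_eq_single_of_mem (i0 y) (hy h)]
    · exact indicator_of_mem (s := i0 ⁻¹' {i0 y}) rfl G
    · exact fun i _ hi => indicator_of_notMem (fun hmem => hi hmem.symm) G

theorem sum_lintegral_indicator_fiber_le {ι : Type*} [DecidableEq ι] [MeasurableSpace ι]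
    [MeasurableSingletonClass ι] (F : Finset ι) {i0 : ℝ → ι} (hi0 : Measurable i0) {f : ℝ → ℝ≥0∞} :
    ∑ i ∈ F, ∫⁻ y, indicator (i0 ⁻¹' {i}) f y ≤ ∫⁻ y, f y := by
  have hm : ∀ i ∈ F, MeasurableSet (i0 ⁻¹' {i}) := fun i _ => hi0 (measurableSet_singleton i)
  rw [← Finset.sum_congr rfl fun i hi => (lintegral_indicator (hm i hi) f).symm]
  rw [← lintegral_biUnion_finset (fun i _ j _ hij => Disjoint.preimage _
    (disjoint_singleton.2 hij)) hm]
  exact setLIntegral_le_lintegral _ _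

theorem enorm_sq_indicator {s : Set ℝ} (G : ℝ → ℂ) (y : ℝ) :
    ‖indicator s G y‖ₑ ^ 2 = indicator s (fun y => ‖G y‖ₑ ^ 2) y := by
  by_cases h : y ∈ s
  · rw [indicator_of_mem h, indicator_of_mem h]
  · rw [indicator_of_notMem h, indicator_of_notMem h]; simp

/-- This direction of additivity requires no measurability, so none has to be established for the
block energies as functions of t. -/
theorem sum_lintegral_le_lintegral_sum {ι : Type*} (F : Finset ι) {μ : Measure ℝ}
    (f : ι → ℝ → ℝ≥0∞) : ∑ i ∈ F, ∫⁻ t, f i t ∂μ ≤ ∫⁻ t, ∑ i ∈ F, f i t ∂μ := by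
  classical
  induction F using Finset.induction_on with
  | empty => simp
  | insert i F hi ih =>
    simp only [Finset.sum_insert hi]
    exact (add_le_add_right ih _).trans (le_lintegral_add _ _)

/-- Blocks must not be short when there are many of them, or their frequency windows would pile up;
an interval shorter than 1 is kept whole. -/
theorem exists_block_subdivision {w : ℝ} (hw : 0 < w) : ∃ (N : ℕ) (θ : ℝ), 0 < θ ∧ θ ≤ 1 ∧ θ ≤ w ∧
    (N = 1 ∨ 1 / 2 ≤ θ) ∧ N * θ = w := by
  rcases lt_or_ge w 1 with h | h
  · exact ⟨1, w, hw, h.le, le_rfl, Or.inl rfl, by simp⟩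
  · have hN : (0 : ℝ) < ⌈w⌉₊ := by exact_mod_cast Nat.ceil_pos.2 hw
    have h1 := Nat.le_ceil w
    have h2 := Nat.ceil_lt_add_one hw.le
    refine ⟨⌈w⌉₊, w / ⌈w⌉₊, by positivity, (div_le_one hN).2 h1, ?_, Or.inr ?_, by field_simp⟩
    · exact div_le_self hw.le (by linarith)
    · rw [le_div_iff₀ hN]; linarith

/-- The normalized bilinear estimate in additive form. -/
theorem KeyHyp.exists_bilinear_le_add (hB : 0 ≤ B) : ∃ C : ℝ, 0 < C ∧
    ∀ (w : ℝ) (Q : ℝ × ℝ → ℝ), 0 < w → KeyHyp B w Q → ∀ (α : ℝ) (G H : ℝ → ℂ), IsCore G →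
    IsCore H → (∀ y, G y ≠ 0 → y ∈ Ico α (α + w)) →
    ‖∫ z : ℝ × ℝ, Complex.exp (Complex.I * (Q z : ℂ)) * G z.2 * H (z.1 + z.2)‖ₑ ≤
      ENNReal.ofReal C * ((∫⁻ y, ‖G y‖ₑ ^ 2) + ∫⁻ s, ‖H s‖ₑ ^ 2) := by
  obtain ⟨C1, hC1, hblock⟩ := exists_block_form_le hB
  obtain ⟨C2, hC2, hsum⟩ := KeyHyp.exists_sum_blockEnergy_le hB
  refine ⟨C1 * (2 * C2), by positivity, fun w Q hw h α G H hG hH hGs => ?_⟩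
  obtain ⟨N, θ, hθ, hθ1, hθw, hN, hNθ⟩ := exists_block_subdivision hw
  obtain ⟨R, hR⟩ := hH.supp
  set F : Finset ℤ := Finset.Icc (-⌈R⌉ - 1) (⌈R⌉ + 1) with hF
  set j0 : ℝ → ℕ := fun y => ⌊(y - α) / θ⌋₊ with hj0
  set k0 : ℝ → ℤ := fun s => ⌊s⌋ with hk0
  have mj : Measurable j0 := Nat.measurable_floor.comp (by fun_prop)
  have mk : Measurable k0 := Int.measurable_floor
  set Gj : ℕ → ℝ → ℂ := fun j => indicator (j0 ⁻¹' {j}) G with hGj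
  set Hk : ℤ → ℝ → ℂ := fun k => indicator (k0 ⁻¹' {k}) H with hHk
  have cG : ∀ j, IsCore (Gj j) := fun j => hG.indicator (mj (measurableSet_singleton j))
  have cH : ∀ k, IsCore (Hk k) := fun k => hH.indicator (mk (measurableSet_singleton k))
  have sG : ∀ j y, Gj j y ≠ 0 → y ∈ Icc (α + j * θ) (α + j * θ + θ) := by
    intro j y hy
    have hy1 : j0 y = j := by
      by_contra hne
      exact hy (indicator_of_notMem (s := j0 ⁻¹' {j}) hne G)
    have hy2 : G y ≠ 0 := fun h0 => hy (indicator_apply_eq_zero.2 fun _ => h0)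
    have h0 : 0 ≤ (y - α) / θ := div_nonneg (by linarith [(hGs y hy2).1]) hθ.le
    have h1 := Nat.floor_le h0
    have h2 := Nat.lt_floor_add_one ((y - α) / θ)
    simp only [hj0] at hy1
    rw [hy1, le_div_iff₀ hθ] at h1
    rw [hy1, div_lt_iff₀ hθ] at h2
    constructor <;> linarith
  have sH : ∀ k s, Hk k s ≠ 0 → s ∈ Icc (k : ℝ) (k + 1) := by
    intro k s hs
    have hs1 : k0 s = k := by
      by_contra hne
      exact hs (indicator_of_notMem (s := k0 ⁻¹' {k}) hne H)
    rw [← hs1]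
    exact ⟨Int.floor_le s, (Int.lt_floor_add_one s).le⟩
  have dG : ∀ y, ∑ j ∈ Finset.range N, Gj j y = G y := fun y =>
    sum_indicator_fiber _ j0 G y fun hy => by
      rw [Finset.mem_range, Nat.floor_lt (div_nonneg (by linarith [(hGs y hy).1]) hθ.le),
        div_lt_iff₀ hθ, hNθ]
      linarith [(hGs y hy).2]
  have dH : ∀ s, ∑ k ∈ F, Hk k s = H s := fun s =>
    sum_indicator_fiber _ k0 H s fun hs => by
      have hs1 : |s| ≤ R := by
        by_contra hlt
        exact hs (hR s (not_le.1 hlt))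
      have hs2 := abs_le.1 (hs1.trans (Int.le_ceil R))
      rw [hF, Finset.mem_Icc]
      refine ⟨?_, ?_⟩
      · rw [Int.le_floor]; push_cast; linarith [hs2.1]
      · have : k0 s ≤ ⌈R⌉ := by
          have := (Int.floor_le s).trans hs2.2
          exact_mod_cast this
        linarith
  have nG : ∑ j ∈ Finset.range N, ∫⁻ y, ‖Gj j y‖ₑ ^ 2 ≤ ∫⁻ y, ‖G y‖ₑ ^ 2 := by
    simp only [hGj, enorm_sq_indicator]
    exact sum_lintegral_indicator_fiber_le _ mj
  have nH : ∑ k ∈ F, ∫⁻ y, ‖Hk k y‖ₑ ^ 2 ≤ ∫⁻ y, ‖H y‖ₑ ^ 2 := by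
    simp only [hHk, enorm_sq_indicator]
    exact sum_lintegral_indicator_fiber_le _ mk
  have cE : Continuous fun z : ℝ × ℝ => Complex.exp (Complex.I * (Q z : ℂ)) := by
    have := h.smooth.continuous
    fun_prop
  have hint : ∀ j k, Integrable fun z : ℝ × ℝ =>
      Complex.exp (Complex.I * (Q z : ℂ)) * Gj j z.2 * Hk k (z.1 + z.2) := fun j k => by
    simp only [mul_assoc]
    exact ((cG j).integrable_convolution (cH k)).bdd_mul (c := 1) cE.aestronglyMeasurable
      (ae_of_all _ fun z => (norm_exp_I_mul _).le)
  have hdec : ∫ z : ℝ × ℝ, Complex.exp (Complex.I * (Q z : ℂ)) * G z.2 * H (z.1 + z.2) =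
      ∑ j ∈ Finset.range N, ∑ k ∈ F, ∫ z : ℝ × ℝ,
        Complex.exp (Complex.I * (Q z : ℂ)) * Gj j z.2 * Hk k (z.1 + z.2) := by
    simp_rw [← integral_finsetSum F fun k _ => hint _ k]
    rw [← integral_finsetSum _ fun j _ => integrable_finsetSum F fun k _ => hint j k]
    refine integral_congr_ae (ae_of_all _ fun z => ?_)
    simp only []
    rw [← dG, ← dH, mul_assoc, Finset.sum_mul_sum, Finset.mul_sum]
    simp_rw [Finset.mul_sum, mul_assoc]
  rw [hdec]
  calc _ ≤ ∑ j ∈ Finset.range N, ∑ k ∈ F, ‖∫ z : ℝ × ℝ,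
        Complex.exp (Complex.I * (Q z : ℂ)) * Gj j z.2 * Hk k (z.1 + z.2)‖ₑ :=
        (enorm_sum_le _ _).trans (Finset.sum_le_sum fun j _ => enorm_sum_le _ _)
    _ ≤ ∑ j ∈ Finset.range N, ∑ k ∈ F, ENNReal.ofReal C1 *
        (blockEnergy Q (k - (α + j * θ)) (α + j * θ) (Gj j) (Hk k) + ∫⁻ t in Ioc (0 : ℝ) 1,
        blockEnergy Q (k - (α + j * θ)) (α + j * θ)
          (indicator (Ioi (α + j * θ + θ * t)) (Gj j)) (Hk k)) :=
        Finset.sum_le_sum fun j _ => Finset.sum_le_sum fun k _ =>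
          hblock w Q hw h θ k (α + j * θ) hθ hθ1 hθw _ _ (cG j) (cH k) (sG j) (sH k)
    _ = ENNReal.ofReal C1 * (∑ j ∈ Finset.range N, ∑ k ∈ F,
          blockEnergy Q (k - (α + j * θ)) (α + j * θ) (Gj j) (Hk k) +
        ∑ j ∈ Finset.range N, ∑ k ∈ F, ∫⁻ t in Ioc (0 : ℝ) 1,
        blockEnergy Q (k - (α + j * θ)) (α + j * θ)
          (indicator (Ioi (α + j * θ + θ * t)) (Gj j)) (Hk k)) := by
        simp_rw [← Finset.mul_sum, Finset.sum_add_distrib]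
    _ ≤ ENNReal.ofReal C1 * (ENNReal.ofReal C2 * ((∫⁻ y, ‖G y‖ₑ ^ 2) + ∫⁻ s, ‖H s‖ₑ ^ 2) +
        ENNReal.ofReal C2 * ((∫⁻ y, ‖G y‖ₑ ^ 2) + ∫⁻ s, ‖H s‖ₑ ^ 2)) := by
        refine mul_le_mul_right (add_le_add ?_ ?_) _
        · exact (hsum w Q hw h N θ α hN hθw F Gj Hk cG cH sG sH).trans
            (mul_le_mul_right (add_le_add nG nH) _)
        · refine (Finset.sum_le_sum fun j _ => sum_lintegral_le_lintegral_sum F _).trans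
            ((sum_lintegral_le_lintegral_sum _ _).trans ?_)
          calc _ ≤ ∫⁻ t in Ioc (0 : ℝ) 1,
                ENNReal.ofReal C2 * ((∫⁻ y, ‖G y‖ₑ ^ 2) + ∫⁻ s, ‖H s‖ₑ ^ 2) := by
                refine lintegral_mono fun t => (hsum w Q hw h N θ α hN hθw F
                  (fun j => indicator (Ioi (α + j * θ + θ * t)) (Gj j)) Hk
                  (fun j => (cG j).indicator measurableSet_Ioi) cH (fun j y hy => sG j y fun h0 =>
                  hy (indicator_apply_eq_zero.2 fun _ => h0)) sH).trans
                  (mul_le_mul_right (add_le_add (le_trans (Finset.sum_le_sum fun j _ =>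
                  lintegral_mono fun y => ?_) nG) nH) _)
                exact pow_le_pow_left' (enorm_indicator_le_enorm_self _ _) 2
            _ = _ := by simp
    _ = _ := by
        rw [← two_mul, ENNReal.ofReal_mul hC1.le, ENNReal.ofReal_mul zero_le_two, ENNReal.ofReal_ofNat]
        ring

/-- The normalized bilinear estimate. -/
theorem KeyHyp.exists_bilinear_le (hB : 0 ≤ B) : ∃ C : ℝ, 0 < C ∧
    ∀ (w : ℝ) (Q : ℝ × ℝ → ℝ), 0 < w → KeyHyp B w Q → ∀ (α : ℝ) (G H : ℝ → ℂ), IsCore G →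
    IsCore H → (∀ y, G y ≠ 0 → y ∈ Ico α (α + w)) →
    ‖∫ z : ℝ × ℝ, Complex.exp (Complex.I * (Q z : ℂ)) * G z.2 * H (z.1 + z.2)‖ ≤
      C * (√(∫ y, ‖G y‖ ^ 2) * √(∫ s, ‖H s‖ ^ 2)) := by
  obtain ⟨C, hC, hbd⟩ := KeyHyp.exists_bilinear_le_add hB
  refine ⟨2 * C, by positivity, fun w Q hw h α G H hG hH hGs => ?_⟩
  have hreal : ∀ f : ℝ → ℂ, IsCore f → ∫⁻ y, ‖f y‖ₑ ^ 2 = ENNReal.ofReal (∫ y, ‖f y‖ ^ 2) :=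
    fun f hf => by
      rw [ofReal_integral_eq_lintegral_ofReal (hf.integrable_norm_sq volume)
        (ae_of_all _ fun y => by positivity)]
      refine lintegral_congr fun y => ?_
      rw [ENNReal.ofReal_pow (norm_nonneg _), ofReal_norm]
  set g := ∫ y, ‖G y‖ ^ 2 with hg
  set k := ∫ s, ‖H s‖ ^ 2 with hk
  have hg0 : 0 ≤ g := integral_nonneg fun y => by positivity
  have hk0 : 0 ≤ k := integral_nonneg fun y => by positivity
  set I := ∫ z : ℝ × ℝ, Complex.exp (Complex.I * (Q z : ℂ)) * G z.2 * H (z.1 + z.2) with hI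
  -- The form is invariant under G → tG, H → t⁻¹H, so optimizing t turns the sum of squares into a
  -- product.
  have hscale : ∀ t : ℝ, 0 < t → ‖I‖ ≤ C * (t ^ 2 * g + (t⁻¹) ^ 2 * k) := by
    intro t ht
    have cG : IsCore fun y => (t : ℂ) * G y := by
      have := hG.mul_bounded (u := fun _ => (t : ℂ)) measurable_const (fun _ => le_rfl)
      simpa only [mul_comm] using this
    have cH : IsCore fun y => ((t⁻¹ : ℝ) : ℂ) * H y := by
      have := hH.mul_bounded (u := fun _ => ((t⁻¹ : ℝ) : ℂ)) measurable_const (fun _ => le_rfl)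
      simpa only [mul_comm] using this
    have key := hbd w Q hw h α _ _ cG cH fun y hy => hGs y fun h0 => hy (by simp [h0])
    have nn : ∀ t : ℝ, ‖(t : ℂ)‖ ^ 2 = t ^ 2 := fun t => by
      rw [Complex.norm_real, Real.norm_eq_abs, sq_abs]
    rw [hreal _ cG, hreal _ cH] at key
    simp only [norm_mul, mul_pow, nn, integral_const_mul] at key
    rw [← ENNReal.ofReal_add (by positivity) (by positivity), ← ENNReal.ofReal_mul hC.le,
      ← ofReal_norm, ENNReal.ofReal_le_ofReal_iff (by positivity)] at key
    refine le_trans (le_of_eq ?_) key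
    rw [hI]
    congr 1
    refine integral_congr_ae (ae_of_all _ fun z => ?_)
    have : (t : ℂ) ≠ 0 := by exact_mod_cast ht.ne'
    push_cast
    field_simp
  -- The slack ε serves the degenerate cases, where one norm vanishes and the optimal t is 0 or
  -- infinite.
  refine le_of_forall_pos_le_add fun ε hε => ?_
  rcases hg0.eq_or_lt with hg1 | hg1
  · rw [← hg1]
    simp only [Real.sqrt_zero, zero_mul, mul_zero, zero_add]
    by_cases hk1 : k = 0
    · have := hscale 1 one_pos
      rw [← hg1, hk1] at this
      simp only [mul_zero, add_zero] at this
      linarith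
    · have hkp := lt_of_le_of_ne hk0 (Ne.symm hk1)
      have := hscale (√(ε / (C * k)))⁻¹ (by positivity)
      rw [← hg1, inv_inv, Real.sq_sqrt (by positivity)] at this
      refine this.trans (le_of_eq ?_)
      field_simp
      ring
  rcases hk0.eq_or_lt with hk1 | hk1
  · rw [← hk1]
    simp only [Real.sqrt_zero, mul_zero, zero_add]
    have := hscale (√(ε / (C * g))) (by positivity)
    rw [← hk1, Real.sq_sqrt (by positivity)] at this
    refine this.trans (le_of_eq ?_)
    field_simp
    ring
  · have h1 := hscale (√(√k / √g)) (by positivity)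
    rw [inv_pow, Real.sq_sqrt (by positivity)] at h1
    have e1 : √k / √g * g = √g * √k := by
      nth_rewrite 2 [← Real.mul_self_sqrt hg0]
      field_simp
    have e2 : (√k / √g)⁻¹ * k = √g * √k := by
      nth_rewrite 2 [← Real.mul_self_sqrt hk0]
      field_simp
    rw [e1, e2] at h1
    linarith

end KeyEstimate

/-! ### Rescaling a vertical difference of the phase to normalized form. -/

section RowPhaseSection

open Set ENNReal ComplexConjugate

/-- Hypotheses on a smooth phase on the plane, relative to windows of length `w` in the second
variable. -/
structure RowPhase (m B w : ℝ) (S : ℝ × ℝ → ℝ) : Prop where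
  smooth : ContDiff ℝ ∞ S
  xx : ∀ z, 9 / 10 * m ≤ partialY (partialX (partialX S)) z
  xy : ∀ z, |partialY (partialY (partialX S)) z| ≤ 1 / 10 * m
  xxy : ∀ z, |partialY (partialX (partialY (partialX S))) z| ≤ B / w * m
  xyy : ∀ z, |partialY (partialY (partialY (partialX S))) z| ≤ B / w * m
  mixed : ∀ z, |partialY (opQ (partialY (partialY S))) z| ≤ B / w ^ 2 * m

/-- The difference of `F` under a translation in the second variable. -/
def shiftDiff (τ : ℝ) (F : ℝ × ℝ → ℝ) (z : ℝ × ℝ) : ℝ := F (z.1, z.2 + τ) - F z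

/-- An isotropic rescaling of `F`. -/
def rescale (a r : ℝ) (F : ℝ × ℝ → ℝ) (z : ℝ × ℝ) : ℝ := a * F (r * z.1, r * z.2)

variable {F : ℝ × ℝ → ℝ}

theorem ContDiff.shiftDiff (h : ContDiff ℝ ∞ F) (τ : ℝ) : ContDiff ℝ ∞ (shiftDiff τ F) :=
  (h.comp (by fun_prop)).sub h

theorem partialX_shiftDiff (h : ContDiff ℝ ∞ F) (τ : ℝ) :
    partialX (shiftDiff τ F) = shiftDiff τ (partialX F) :=
  funext fun z => ((h.hasDerivAt_partialX z.1 (z.2 + τ)).sub (h.hasDerivAt_partialX z.1 z.2)).deriv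

theorem partialY_shiftDiff (h : ContDiff ℝ ∞ F) (τ : ℝ) :
    partialY (shiftDiff τ F) = shiftDiff τ (partialY F) :=
  funext fun z => (((h.hasDerivAt_partialY z.1 (z.2 + τ)).comp_add_const z.2 τ).sub
    (h.hasDerivAt_partialY z.1 z.2)).deriv

theorem ContDiff.rescale (h : ContDiff ℝ ∞ F) (a r : ℝ) : ContDiff ℝ ∞ (rescale a r F) :=
  contDiff_const.mul (h.comp (by fun_prop))

theorem partialX_rescale (a r : ℝ) (F : ℝ × ℝ → ℝ) :
    partialX (rescale a r F) = rescale (a * r) r (partialX F) := by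
  funext z
  simp only [partialX, rescale]
  rw [deriv_const_mul_field, deriv_comp_mul_left r (fun t => F (t, r * z.2)), smul_eq_mul, mul_assoc]

theorem partialY_rescale (a r : ℝ) (F : ℝ × ℝ → ℝ) :
    partialY (rescale a r F) = rescale (a * r) r (partialY F) := by
  funext z
  simp only [partialY, rescale]
  rw [deriv_const_mul_field, deriv_comp_mul_left r (fun t => F (r * z.1, t)), smul_eq_mul, mul_assoc]

theorem opQ_eq_sub (h : ContDiff ℝ ∞ F) (z : ℝ × ℝ) :
    opQ F z = partialX (partialX F) z - partialX (partialY F) z :=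
  partialX_sub (contDiffOn_univ.2 h.partialX) (contDiffOn_univ.2 h.partialY) isOpen_univ
    (mem_univ z)

theorem opQ_shiftDiff (h : ContDiff ℝ ∞ F) (τ : ℝ) :
    opQ (shiftDiff τ F) = shiftDiff τ (opQ F) := by
  funext z
  rw [opQ_eq_sub (h.shiftDiff τ), partialX_shiftDiff h, partialX_shiftDiff h.partialX,
    partialY_shiftDiff h, partialX_shiftDiff h.partialY]
  simp only [shiftDiff, opQ_eq_sub h]
  ring

theorem opQ_rescale (h : ContDiff ℝ ∞ F) (a r : ℝ) :
    opQ (rescale a r F) = rescale (a * r * r) r (opQ F) := by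
  funext z
  rw [opQ_eq_sub (h.rescale a r), partialX_rescale, partialX_rescale, partialY_rescale, partialX_rescale]
  simp only [rescale, opQ_eq_sub h]
  ring

theorem abs_shiftDiff_le (h : ContDiff ℝ ∞ F) {C : ℝ} (hC : ∀ z, |partialY F z| ≤ C) (τ : ℝ)
    (z : ℝ × ℝ) : |shiftDiff τ F z| ≤ C * |τ| := by
  have := abs_sub_le_of_hasDerivAt (f := fun y => F (z.1, y))
    (fun y => h.hasDerivAt_partialY z.1 y) (fun y => hC _) (z.2 + τ) z.2
  rwa [add_sub_cancel_left] at this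

theorem le_sign_mul_shiftDiff (h : ContDiff ℝ ∞ F) {C : ℝ} (hC : ∀ z, C ≤ partialY F z) (τ : ℝ)
    (z : ℝ × ℝ) : C * |τ| ≤ SignType.sign τ * shiftDiff τ F z := by
  rcases lt_trichotomy τ 0 with hτ | rfl | hτ
  · have := le_sub_of_hasDerivAt (f := fun y => F (z.1, y)) (x := z.2) (x' := z.2 + τ)
      (fun y => h.hasDerivAt_partialY z.1 y) (fun y => hC _) (by linarith)
    rw [abs_of_neg hτ, sign_neg hτ, shiftDiff]
    simp only [SignType.coe_neg_one]
    linarith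
  · simp
  · have := le_sub_of_hasDerivAt (f := fun y => F (z.1, y)) (x := z.2 + τ) (x' := z.2)
      (fun y => h.hasDerivAt_partialY z.1 y) (fun y => hC _) (by linarith)
    rw [abs_of_pos hτ, sign_pos hτ, shiftDiff]
    simp only [SignType.coe_one]
    linarith

variable {m B w : ℝ} {S : ℝ × ℝ → ℝ}

/-- The rescaled difference phase satisfies the normalized hypotheses. -/
theorem RowPhase.keyHyp (h : RowPhase m B w S) (hm : 0 < m) (hw : 0 < w) {l τ : ℝ}
    (hl : l ≠ 0) (hτ : τ ≠ 0) {r : ℝ} (hr : 0 < r) (hr2 : |l| * |τ| * m * r ^ 2 = 1) :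
    KeyHyp B (w / r) (rescale (SignType.sign τ * |l|) r (shiftDiff τ S)) := by
  have hl' : 0 < |l| := abs_pos.2 hl
  have hs : |((SignType.sign τ : SignType) : ℝ)| = 1 := by
    rcases lt_or_gt_of_ne hτ with h1 | h1
    · rw [sign_neg h1]; simp
    · rw [sign_pos h1]; simp
  have s0 := h.smooth
  have s1 := s0.partialX
  -- The shift yields |τ| and two rescaled derivatives yield r², which together with |l|m make 1.
  -- Each further derivative contributes r, which is absorbed in the new window length w/r.
  have hsc : ∀ (n : ℕ) (G : ℝ × ℝ → ℝ), ContDiff ℝ ∞ G → ∀ C : ℝ, (∀ z, |partialY G z| ≤ C * m) →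
      ∀ z, |rescale (SignType.sign τ * |l| * r ^ 2 * r ^ n) r (shiftDiff τ G) z| ≤ C * r ^ n := by
    intro n G hG C hC z
    rw [rescale, abs_mul, abs_mul, abs_mul, abs_mul, hs, one_mul, abs_abs,
      abs_of_pos (pow_pos hr 2), abs_of_pos (pow_pos hr n)]
    refine (mul_le_mul_of_nonneg_left (abs_shiftDiff_le hG hC τ _) (by positivity)).trans
      (le_of_eq ?_)
    linear_combination (C * r ^ n) * hr2
  refine ⟨(s0.shiftDiff τ).rescale _ _, fun z => ?_, fun z => ?_, fun z => ?_, fun z => ?_,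
    fun z => ?_⟩
  · rw [partialX_rescale, partialX_rescale, partialX_shiftDiff s0, partialX_shiftDiff s1, rescale]
    have := le_sign_mul_shiftDiff s1.partialX h.xx τ (r * z.1, r * z.2)
    calc (9 / 10 : ℝ) = |l| * r * r * (9 / 10 * m * |τ|) := by linear_combination (-(9 / 10)) * hr2
      _ ≤ |l| * r * r * (SignType.sign τ * shiftDiff τ (partialX (partialX S)) (r * z.1, r * z.2)) := by
        gcongr
      _ = _ := by ring
  · have := hsc 0 _ s1.partialY (1 / 10) h.xy z
    rw [partialX_rescale, partialY_rescale, partialX_shiftDiff s0, partialY_shiftDiff s1]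
    simpa only [pow_zero, mul_one, sq, mul_assoc] using this
  · have := hsc 1 _ s1.partialY.partialX (B / w) h.xxy z
    rw [partialX_rescale, partialY_rescale, partialX_rescale, partialX_shiftDiff s0,
      partialY_shiftDiff s1, partialX_shiftDiff s1.partialY]
    rw [div_div_eq_mul_div, mul_div_right_comm]
    simpa only [pow_one, sq, mul_assoc] using this
  · have := hsc 1 _ s1.partialY.partialY (B / w) h.xyy z
    rw [partialX_rescale, partialY_rescale, partialY_rescale, partialX_shiftDiff s0,
      partialY_shiftDiff s1, partialY_shiftDiff s1.partialY]
    rw [div_div_eq_mul_div, mul_div_right_comm]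
    simpa only [pow_one, sq, mul_assoc] using this
  · have s2 := s0.partialY.partialY
    have := hsc 2 _ (contDiffOn_univ.1 ((contDiffOn_univ.2 s2).opQ isOpen_univ)) (B / w ^ 2)
      h.mixed z
    rw [partialY_rescale, partialY_rescale, partialY_shiftDiff s0, partialY_shiftDiff s0.partialY,
      opQ_rescale (s2.shiftDiff τ), opQ_shiftDiff s2]
    rw [div_pow, div_div_eq_mul_div, mul_div_right_comm]
    simpa only [sq, mul_assoc] using this

theorem IsCore.comp_mul_left {G : ℝ → ℂ} (hG : IsCore G) {r : ℝ} (hr : 0 < r) :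
    IsCore fun y => G (r * y) := by
  obtain ⟨B, hB⟩ := hG.bdd
  obtain ⟨M, hM⟩ := hG.supp
  refine ⟨hG.meas.comp (by fun_prop), ⟨B, fun y => hB _⟩, M / r, fun y hy => hM _ ?_⟩
  rw [div_lt_iff₀ hr] at hy
  rwa [norm_mul, Real.norm_of_nonneg hr.le, mul_comm]

/-- Dilating by r costs r⁻² for the integral over the plane and r^(-1/2) for each L² norm; the net
gain is r = (|l||τ|m)^(-1/2). -/
theorem RowPhase.exists_bilinear_le (hB : 0 ≤ B) : ∃ C : ℝ, 0 < C ∧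
    ∀ (m w : ℝ) (S : ℝ × ℝ → ℝ), 0 < m → 0 < w → RowPhase m B w S → ∀ (l τ : ℝ), l ≠ 0 → τ ≠ 0 →
    ∀ (α : ℝ) (G H : ℝ → ℂ), IsCore G → IsCore H → (∀ y, G y ≠ 0 → y ∈ Ico α (α + w)) →
    ‖∫ z : ℝ × ℝ, Complex.exp (Complex.I * ((-(l * shiftDiff τ S z) : ℝ) : ℂ)) * G z.2 *
      H (z.1 + z.2)‖ ≤
      C * (|l| * |τ| * m) ^ (-(1 / 2) : ℝ) * (√(∫ y, ‖G y‖ ^ 2) * √(∫ s, ‖H s‖ ^ 2)) := by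
  obtain ⟨C, hC, hbd⟩ := KeyHyp.exists_bilinear_le hB
  refine ⟨C, hC, fun m w S hm hw h l τ hl hτ α G H hG hH hGs => ?_⟩
  have hlam : 0 < |l| * |τ| * m := mul_pos (mul_pos (abs_pos.2 hl) (abs_pos.2 hτ)) hm
  set r := (|l| * |τ| * m) ^ (-(1 / 2) : ℝ) with hr
  have hr0 : 0 < r := Real.rpow_pos_of_pos hlam _
  have hr2 : |l| * |τ| * m * r ^ 2 = 1 := by
    rw [hr, ← Real.rpow_natCast, ← Real.rpow_mul hlam.le]
    norm_num
    rw [Real.rpow_neg_one]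
    exact mul_inv_cancel₀ hlam.ne'
  have hkey := h.keyHyp hm hw hl hτ hr0 hr2
  set Q := rescale (SignType.sign τ * |l|) r (shiftDiff τ S) with hQ
  have hpos : ∀ (G H : ℝ → ℂ), IsCore G → IsCore H → (∀ y, G y ≠ 0 → y ∈ Ico α (α + w)) →
      ‖∫ z : ℝ × ℝ, Complex.exp (Complex.I * ((SignType.sign τ * |l| * shiftDiff τ S z : ℝ) : ℂ)) *
        G z.2 * H (z.1 + z.2)‖ ≤ C * r * (√(∫ y, ‖G y‖ ^ 2) * √(∫ s, ‖H s‖ ^ 2)) := by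
    intro G H hG hH hGs
    have key := hbd (w / r) Q (by positivity) hkey (α / r) _ _ (hG.comp_mul_left hr0)
      (hH.comp_mul_left hr0) (fun y hy => by
        have := hGs _ hy
        rw [← add_div, mem_Ico, div_le_iff₀ hr0, lt_div_iff₀ hr0, mul_comm y]
        exact this)
    rw [Measure.integral_comp_mul_left (fun y => ‖G y‖ ^ 2),
      Measure.integral_comp_mul_left (fun y => ‖H y‖ ^ 2), smul_eq_mul, smul_eq_mul,
      Real.sqrt_mul (abs_nonneg _), Real.sqrt_mul (abs_nonneg _)] at key
    have e1 := Measure.integral_comp_smul (volume : Measure (ℝ × ℝ)) (fun z : ℝ × ℝ =>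
      Complex.exp (Complex.I * ((SignType.sign τ * |l| * shiftDiff τ S z : ℝ) : ℂ)) *
        G z.2 * H (z.1 + z.2)) r
    have e2 : ∀ z : ℝ × ℝ, (r • z).1 = r * z.1 ∧ (r • z).2 = r * z.2 := fun z => ⟨rfl, rfl⟩
    have e3 : ∀ z : ℝ × ℝ, Complex.exp (Complex.I * (Q z : ℂ)) * G (r * z.2) * H (r * (z.1 + z.2)) =
        Complex.exp (Complex.I * ((SignType.sign τ * |l| * shiftDiff τ S (r • z) : ℝ) : ℂ)) *
        G (r • z).2 * H ((r • z).1 + (r • z).2) := fun z => by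
      rw [(e2 z).1, (e2 z).2, ← mul_add]; rfl
    simp only [e3] at key
    have e4 : |r⁻¹| = r⁻¹ := abs_of_pos (by positivity)
    have e5 : ‖|(r ^ (1 + 1))⁻¹|‖ = (r ^ (1 + 1))⁻¹ := by
      rw [Real.norm_eq_abs, abs_abs, abs_of_pos (by positivity)]
    rw [e1, norm_smul, Module.finrank_prod, Module.finrank_self, e4, e5] at key
    have hsq : √(r⁻¹) * √(r⁻¹) = r⁻¹ := Real.mul_self_sqrt (by positivity)
    have : (r ^ (1 + 1))⁻¹ * ‖∫ z : ℝ × ℝ, Complex.exp (Complex.I *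
        ((SignType.sign τ * |l| * shiftDiff τ S z : ℝ) : ℂ)) * G z.2 * H (z.1 + z.2)‖ ≤
        (r ^ (1 + 1))⁻¹ * (C * r * (√(∫ y, ‖G y‖ ^ 2) * √(∫ s, ‖H s‖ ^ 2))) := by
      refine key.trans (le_of_eq ?_)
      have : (r ^ (1 + 1))⁻¹ * r = r⁻¹ := by field_simp
      linear_combination (C * (√(∫ y, ‖G y‖ ^ 2) * √(∫ s, ‖H s‖ ^ 2))) * (hsq - this)
    exact le_of_mul_le_mul_left this (by positivity)
  -- The normalization fixes the sign of the phase by the sign of τ; if it is the wrong one, complex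
  -- conjugation reverses it.
  have hsl : SignType.sign τ * |l| = -l ∨ SignType.sign τ * |l| = l := by
    rcases lt_or_gt_of_ne hτ with h1 | h1 <;> rcases abs_choice l with h2 | h2 <;>
      simp [sign_neg, sign_pos, h1, h2]
  rcases hsl with hsl | hsl
  · have := hpos G H hG hH hGs
    simpa only [hsl, neg_mul] using this
  · have mconj : Measurable (conj : ℂ → ℂ) := Complex.continuous_conj.measurable
    have hconj : ∀ {f : ℝ → ℂ}, IsCore f → IsCore fun y => conj (f y) := fun {f} hf => by
      obtain ⟨b, hb⟩ := hf.bdd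
      obtain ⟨M, hM⟩ := hf.supp
      exact ⟨mconj.comp hf.meas, ⟨b, fun z => by rw [RCLike.norm_conj]; exact hb z⟩, M,
        fun z hz => by simp [hM z hz]⟩
    have := hpos _ _ (hconj hG) (hconj hH) fun y hy => hGs y fun h0 => hy (by simp [h0])
    simp only [RCLike.norm_conj, hsl] at this
    refine le_trans (le_of_eq ?_) this
    rw [← RCLike.norm_conj, ← integral_conj]
    congr 1
    refine integral_congr_ae (ae_of_all _ fun z => ?_)
    simp only [map_mul, ← Complex.exp_conj, Complex.conj_I, Complex.conj_ofReal]
    congr 3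
    push_cast
    ring

end RowPhaseSection

/-! ### The square function for a phase on the plane and one window of g. -/

section WindowedCorrelation

open Set ENNReal ComplexConjugate

theorem ENNReal.rpow_add_three_le {r : ℝ} (hr : 1 ≤ r) (hr2 : r ≤ 2) (x y z : ℝ≥0∞) :
    (x + y + z) ^ r ≤ 4 * (x ^ r + y ^ r + z ^ r) := by
  have h2 : ∀ x y : ℝ≥0∞, (x + y) ^ r ≤ 2 * (x ^ r + y ^ r) := fun x y => by
    refine (ENNReal.rpow_add_le_mul_rpow_add_rpow x y hr).trans (mul_le_mul_left ?_ _)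
    calc (2 : ℝ≥0∞) ^ (r - 1) ≤ 2 ^ (1 : ℝ) :=
          ENNReal.rpow_le_rpow_of_exponent_le (by norm_num) (by linarith)
      _ = 2 := ENNReal.rpow_one 2
  calc (x + y + z) ^ r ≤ 2 * ((x + y) ^ r + z ^ r) := h2 _ _
    _ ≤ 2 * (2 * (x ^ r + y ^ r) + 2 * z ^ r) := by
      gcongr
      · exact h2 x y
      · exact le_mul_of_one_le_left zero_le (by norm_num)
    _ = _ := by ring

/-- The window of length `w` with index `k`. -/
def window (w : ℝ) (k : ℤ) : Set ℝ := {s | ⌊s / w⌋ = k}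

theorem measurable_floor_div (w : ℝ) : Measurable fun s : ℝ => ⌊s / w⌋ :=
  Int.measurable_floor.comp (by fun_prop)

theorem measurableSet_window (w : ℝ) (k : ℤ) : MeasurableSet (window w k) :=
  measurable_floor_div w (measurableSet_singleton k)

/-- For |τ| < w the points x and x+τ lie in the same or in adjacent windows, so the autocorrelation
is bounded by the sum of those of u on triples of windows. The factor 12 counts 4 from the power of
a sum of three and 3 from the overlap. -/
theorem exists_window_autocorr_le {b : ℝ} (hb : 0 < b) (hb1 : b < 1) : ∃ C : ℝ, 0 < C ∧
    ∀ (w : ℝ), 0 < w → ∀ u : ℝ → ℝ≥0∞, Measurable u →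
    ∫⁻ τ, ENNReal.ofReal (|τ| ^ (-b)) * indicator (Ioo (-w) w) (fun τ => ∫⁻ x, u x * u (x + τ)) τ ≤
      ENNReal.ofReal C * ∑' k : ℤ, (∫⁻ s in window w k, u s ^ (2 / (2 - b))) ^ (2 - b) := by
  obtain ⟨C, hC, hls⟩ := hls_autocorr hb hb1
  refine ⟨C * 12, by positivity, fun w hw u hu => ?_⟩
  have hfl := measurable_floor_div w
  set N : ℤ → Set ℝ := fun k => (fun s : ℝ => ⌊s / w⌋) ⁻¹' Icc (k - 1) (k + 1) with hN
  have mN : ∀ k, MeasurableSet (N k) := fun k => hfl (measurableSet_Icc)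
  set v : ℤ → ℝ → ℝ≥0∞ := fun k => indicator (N k) u with hv
  have mv : ∀ k, Measurable (v k) := fun k => hu.indicator (mN k)
  set b' : ℤ → ℝ≥0∞ := fun k => ∫⁻ s in window w k, u s ^ (2 / (2 - b)) with hb'
  have hpt : ∀ τ, indicator (Ioo (-w) w) (fun τ => ∫⁻ x, u x * u (x + τ)) τ ≤
      ∑' k : ℤ, ∫⁻ x, v k x * v k (x + τ) := by
    intro τ
    by_cases hτ : τ ∈ Ioo (-w) w
    · have mvv : ∀ k, Measurable fun x => v k x * v k (x + τ) := fun k =>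
        (mv k).mul ((mv k).comp (by fun_prop))
      rw [indicator_of_mem hτ, ← lintegral_tsum fun k => (mvv k).aemeasurable]
      refine lintegral_mono fun x => ?_
      refine le_trans (le_of_eq ?_) (ENNReal.le_tsum ⌊x / w⌋)
      have hm1 : x ∈ N ⌊x / w⌋ := ⟨by linarith, by linarith⟩
      have hm2 : x + τ ∈ N ⌊x / w⌋ := by
        have h1 := Int.floor_le (x / w)
        have h2 := Int.lt_floor_add_one (x / w)
        have h3 : (x + τ) / w = x / w + τ / w := add_div _ _ _
        have h4 : -1 < τ / w := by rw [lt_div_iff₀ hw]; linarith [hτ.1]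
        have h5 : τ / w < 1 := by rw [div_lt_one hw]; exact hτ.2
        constructor
        · rw [Int.le_floor]; push_cast; linarith
        · refine Int.lt_add_one_iff.1 (Int.floor_lt.2 ?_); push_cast; linarith
      simp only [hv, Pi.mul_apply, Function.comp]
      rw [indicator_of_mem hm1, indicator_of_mem hm2]
    · rw [indicator_of_notMem hτ]; exact zero_le
  have he1 : 1 ≤ 2 - b := by linarith
  have hsum : ∀ k, (∫⁻ x, v k x ^ (2 / (2 - b))) ^ (2 - b) ≤
      4 * (b' (k - 1) ^ (2 - b) + b' k ^ (2 - b) + b' (k + 1) ^ (2 - b)) := by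
    intro k
    refine le_trans (ENNReal.rpow_le_rpow ?_ (by linarith))
      (ENNReal.rpow_add_three_le he1 (by linarith) _ _ _)
    have e1 : ∀ x, v k x ^ (2 / (2 - b)) = indicator (N k) (fun s => u s ^ (2 / (2 - b))) x := by
      intro x
      by_cases hx : x ∈ N k
      · simp only [hv, indicator_of_mem hx]
      · simp only [hv, indicator_of_notMem hx]
        exact ENNReal.zero_rpow_of_pos (by apply div_pos <;> linarith)
    simp only [e1]
    rw [lintegral_indicator (mN k)]
    have hsub : N k ⊆ (window w (k - 1) ∪ window w k) ∪ window w (k + 1) := by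
      intro s hs
      have h1 : k - 1 ≤ ⌊s / w⌋ := hs.1
      have h2 : ⌊s / w⌋ ≤ k + 1 := hs.2
      have h3 : ⌊s / w⌋ = k - 1 ∨ ⌊s / w⌋ = k ∨ ⌊s / w⌋ = k + 1 := by omega
      rcases h3 with h3 | h3 | h3
      · exact Or.inl (Or.inl h3)
      · exact Or.inl (Or.inr h3)
      · exact Or.inr h3
    exact (lintegral_mono_set hsub).trans ((lintegral_union_le _ _ _).trans
      (add_le_add_left (lintegral_union_le _ _ _) _))
  have mcorr : ∀ k, Measurable fun τ => ∫⁻ x, v k x * v k (x + τ) := fun k =>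
    measurable_autocorr (mv k)
  calc _ ≤ ∫⁻ τ, ∑' k : ℤ, ENNReal.ofReal (|τ| ^ (-b)) * ∫⁻ x, v k x * v k (x + τ) := by
        refine lintegral_mono fun τ => ?_
        rw [ENNReal.tsum_mul_left]
        exact mul_le_mul_right (hpt τ) _
    _ = ∑' k : ℤ, ∫⁻ τ, ENNReal.ofReal (|τ| ^ (-b)) * ∫⁻ x, v k x * v k (x + τ) :=
        lintegral_tsum fun k => ((measurable_ofReal_abs_rpow _).mul (mcorr k)).aemeasurable
    _ ≤ ∑' k : ℤ, ENNReal.ofReal C *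
        (4 * (b' (k - 1) ^ (2 - b) + b' k ^ (2 - b) + b' (k + 1) ^ (2 - b))) :=
        ENNReal.tsum_le_tsum fun k => (hls (v k) (mv k)).trans (mul_le_mul_right (hsum k) _)
    _ = _ := by
        have t1 : ∑' k : ℤ, b' (k - 1) ^ (2 - b) = ∑' k : ℤ, b' k ^ (2 - b) :=
          (Equiv.subRight (1 : ℤ)).tsum_eq fun k => b' k ^ (2 - b)
        have t2 : ∑' k : ℤ, b' (k + 1) ^ (2 - b) = ∑' k : ℤ, b' k ^ (2 - b) :=
          (Equiv.addRight (1 : ℤ)).tsum_eq fun k => b' k ^ (2 - b)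
        rw [ENNReal.tsum_mul_left, ENNReal.tsum_mul_left, ENNReal.tsum_add, ENNReal.tsum_add, t1, t2,
          ENNReal.ofReal_mul hC.le, ENNReal.ofReal_ofNat]
        ring

theorem IsCore.convolution {g h : ℝ → ℂ} (hg : IsCore g) (hh : IsCore h) :
    IsCore fun z : ℝ × ℝ => g z.2 * h (z.1 + z.2) := by
  obtain ⟨Bg, hBg⟩ := hg.bdd
  obtain ⟨Mg, hMg⟩ := hg.supp
  obtain ⟨Bh, hBh⟩ := hh.bdd
  obtain ⟨Mh, hMh⟩ := hh.supp
  have hBg0 := (norm_nonneg _).trans (hBg 0)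
  refine ⟨(hg.meas.comp measurable_snd).mul (hh.meas.comp (by fun_prop)), ⟨Bg * Bh, fun z => ?_⟩,
    max Mg (Mg + Mh), fun z hz => ?_⟩
  · rw [norm_mul]
    exact mul_le_mul (hBg _) (hBh _) (norm_nonneg _) hBg0
  · by_contra hne
    have h1 : |z.2| ≤ Mg := not_lt.1 fun h' => left_ne_zero_of_mul hne (hMg _ h')
    have h2 : |z.1 + z.2| ≤ Mh := not_lt.1 fun h' => right_ne_zero_of_mul hne (hMh _ h')
    have h3 : |z.1| ≤ Mg + Mh := by
      calc |z.1| = |(z.1 + z.2) - z.2| := by ring_nf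
        _ ≤ |z.1 + z.2| + |z.2| := abs_sub _ _
        _ ≤ _ := by linarith
    refine absurd hz (not_lt.2 ?_)
    rw [Prod.norm_def]
    exact max_le (h3.trans (le_max_right _ _)) (h1.trans (le_max_left _ _))

variable {B : ℝ}

/-- The square function estimate for a smooth phase on the plane, one of the functions being
supported in a single window. -/
theorem RowPhase.exists_lintegral_sq_le (hB : 0 ≤ B) {p q : ℝ} (hp : 2 < p) (hp' : p < 4)
    (hq : 2 < q) (hq' : q < 4) (hpq : 1 / p + 1 / q = 3 / 4) : ∃ C : ℝ, 0 < C ∧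
    ∀ (m w : ℝ) (S : ℝ × ℝ → ℝ), 0 < m → 0 < w → RowPhase m B w S → ∀ l : ℝ, l ≠ 0 →
    ∀ (α : ℝ) (g h : ℝ → ℂ), IsCore g → IsCore h → (∀ y, g y ≠ 0 → y ∈ Ico α (α + w)) →
    ∫⁻ x, ‖∫ y, Complex.exp (Complex.I * ((l * S (x, y) : ℝ) : ℂ)) * (g y * h (x + y))‖ₑ ^ 2 ≤
      ENNReal.ofReal (C * (|l| * m) ^ (-(1 / 2) : ℝ)) * ((∫⁻ y, ‖g y‖ₑ ^ p) ^ (2 / p) *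
        (∑' k : ℤ, (∫⁻ s in window w k, ‖h s‖ₑ ^ q) ^ (4 / q)) ^ (1 / 2 : ℝ)) := by
  have hp0 : 0 < p := by linarith
  have hq0 : 0 < q := by linarith
  have ha : 0 < 2 - 4 / p := by
    have : 4 / p < 2 := by rw [div_lt_iff₀ hp0]; linarith
    linarith
  have hb : 0 < 2 - 4 / q := by
    have : 4 / q < 2 := by rw [div_lt_iff₀ hq0]; linarith
    linarith
  have hab : (2 - 4 / p) + (2 - 4 / q) = 1 := by
    have : 4 / p + 4 / q = 3 := by
      rw [← mul_one_div 4 p, ← mul_one_div 4 q, ← mul_add, hpq]; norm_num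
    linarith
  obtain ⟨C0, hC0, hbil⟩ := RowPhase.exists_bilinear_le hB
  obtain ⟨C1, hC1, hls⟩ := hls_autocorr ha (by linarith)
  obtain ⟨C2, hC2, hwin⟩ := exists_window_autocorr_le hb (by linarith)
  refine ⟨C0 * (C1 ^ (1 / 2 : ℝ) * C2 ^ (1 / 2 : ℝ)), by positivity, ?_⟩
  intro m w S hm hw hS l hl α g h hg hh hgs
  have mconj : Measurable (conj : ℂ → ℂ) := Complex.continuous_conj.measurable
  have cS := hS.smooth.continuous
  set e : ℝ × ℝ → ℂ := fun z => Complex.exp (Complex.I * ((l * S z : ℝ) : ℂ)) with he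
  have hF : IsCore fun z : ℝ × ℝ => e z * (g z.2 * h (z.1 + z.2)) := by
    have := (hg.convolution hh).mul_bounded (u := e) (by fun_prop) fun z => (norm_exp_I_mul _).le
    simpa only [mul_comm] using this
  refine (lintegral_sq_integral_le hF).trans ?_
  set ug : ℝ → ℝ≥0∞ := fun x => ‖g x‖ₑ ^ 2 with hug
  set uh : ℝ → ℝ≥0∞ := fun x => ‖h x‖ₑ ^ 2 with huh
  have mug : Measurable ug := hg.meas.enorm.pow_const 2
  have muh : Measurable uh := hh.meas.enorm.pow_const 2
  set U : ℝ → ℝ≥0∞ := fun τ => ∫⁻ x, ug x * ug (x + τ) with hU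
  -- Only lags below w are kept for h: at larger lags the correlation of g vanishes, its support
  -- having length w. This brings h in through its windows.
  set V : ℝ → ℝ≥0∞ := indicator (Ioo (-w) w) (fun τ => ∫⁻ x, uh x * uh (x + τ)) with hV
  have hcorr : ∀ {f : ℝ → ℂ}, IsCore f → ∀ τ, IsCore fun y => f y * conj (f (y + τ)) := by
    intro f hf τ
    obtain ⟨b, hb⟩ := hf.bdd
    exact hf.mul_bounded (mconj.comp (hf.meas.comp (by fun_prop))) fun y => by
      rw [RCLike.norm_conj]; exact hb _
  have hsq : ∀ {f : ℝ → ℂ}, IsCore f → ∀ τ, ENNReal.ofReal (√(∫ y, ‖f y * conj (f (y + τ))‖ ^ 2)) =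
      (∫⁻ x, ‖f x‖ₑ ^ 2 * ‖f (x + τ)‖ₑ ^ 2) ^ (1 / 2 : ℝ) := by
    intro f hf τ
    rw [Real.sqrt_eq_rpow, ← ENNReal.ofReal_rpow_of_nonneg (integral_nonneg fun y => by positivity)
      (by norm_num), ofReal_integral_eq_lintegral_ofReal ((hcorr hf τ).integrable_norm_sq volume)
        (ae_of_all _ fun y => by positivity)]
    congr 1
    refine lintegral_congr fun y => ?_
    rw [ENNReal.ofReal_pow (norm_nonneg _), ofReal_norm, enorm_mul, mul_pow,
      ← ofReal_norm (conj (f (y + τ))), RCLike.norm_conj, ofReal_norm]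
  have hτ : ∀ τ : ℝ, τ ≠ 0 → ‖∫ z : ℝ × ℝ, e z * (g z.2 * h (z.1 + z.2)) *
      conj (e (z.1, z.2 + τ) * (g (z.2 + τ) * h (z.1 + (z.2 + τ))))‖ₑ ≤
      ENNReal.ofReal (C0 * (|l| * m) ^ (-(1 / 2) : ℝ)) *
        (ENNReal.ofReal (|τ| ^ (-(1 / 2) : ℝ)) * (U τ ^ (1 / 2 : ℝ) * V τ ^ (1 / 2 : ℝ))) := by
    intro τ hτ
    by_cases hτw : τ ∈ Ioo (-w) w
    · have key := hbil m w S hm hw hS l τ hl hτ α _ _ (hcorr hg τ) (hcorr hh τ)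
        fun y hy => hgs y fun h0 => hy (by simp [h0])
      have e1 : ∀ z : ℝ × ℝ, e z * (g z.2 * h (z.1 + z.2)) *
          conj (e (z.1, z.2 + τ) * (g (z.2 + τ) * h (z.1 + (z.2 + τ)))) =
          Complex.exp (Complex.I * ((-(l * shiftDiff τ S z) : ℝ) : ℂ)) *
          (g z.2 * conj (g (z.2 + τ))) * (h (z.1 + z.2) * conj (h (z.1 + z.2 + τ))) := by
        intro z
        have : Complex.exp (Complex.I * ((-(l * shiftDiff τ S z) : ℝ) : ℂ)) =
            e z * conj (e (z.1, z.2 + τ)) := by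
          simp only [he, ← Complex.exp_conj, map_mul, Complex.conj_I, Complex.conj_ofReal]
          rw [← Complex.exp_add]
          congr 1
          simp only [shiftDiff]
          push_cast
          ring
        rw [this, add_assoc]
        simp only [map_mul]
        ring
      simp only [e1]
      rw [← ofReal_norm]
      refine (ENNReal.ofReal_le_ofReal key).trans (le_of_eq ?_)
      have hp1 : (|l| * |τ| * m) ^ (-(1 / 2) : ℝ) =
          (|l| * m) ^ (-(1 / 2) : ℝ) * |τ| ^ (-(1 / 2) : ℝ) := by
        rw [← Real.mul_rpow (by positivity) (abs_nonneg _)]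
        congr 1; ring
      rw [hp1, ENNReal.ofReal_mul (by positivity), ENNReal.ofReal_mul (Real.sqrt_nonneg _), hsq hg,
        hsq hh, ← mul_assoc C0, ENNReal.ofReal_mul (by positivity), mul_assoc]
      simp only [hU, hV, indicator_of_mem hτw, hug, huh]
    · have e0 : ∀ z : ℝ × ℝ, e z * (g z.2 * h (z.1 + z.2)) *
          conj (e (z.1, z.2 + τ) * (g (z.2 + τ) * h (z.1 + (z.2 + τ)))) = 0 := by
        intro z
        by_cases h1 : g z.2 = 0
        · simp [h1]
        by_cases h2 : g (z.2 + τ) = 0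
        · simp [h2]
        exfalso
        have i1 := hgs _ h1
        have i2 := hgs _ h2
        exact hτw ⟨by linarith [i1.2, i2.1], by linarith [i1.1, i2.2]⟩
      simp only [e0, integral_zero, enorm_zero]
      exact zero_le
  have h0 : ∀ᵐ τ : ℝ, τ ≠ 0 := by
    simp [ae_iff, measure_singleton]
  have mU : Measurable U := measurable_autocorr mug
  have mV : Measurable V := (measurable_autocorr muh).indicator measurableSet_Ioo
  have hpw : ∀ r : ℝ, 0 < r → 2 / (2 - (2 - 4 / r)) = r / 2 := fun r hr => by
    rw [_root_.sub_sub_cancel]; field_simp; norm_num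
  have hpow : ∀ (r : ℝ) (t : ℝ≥0∞), (t ^ 2) ^ (r / 2) = t ^ r := fun r t => by
    rw [← ENNReal.rpow_two, ← ENNReal.rpow_mul]
    congr 1
    ring
  calc ∫⁻ τ, ‖∫ z : ℝ × ℝ, e z * (g z.2 * h (z.1 + z.2)) *
      conj (e (z.1, z.2 + τ) * (g (z.2 + τ) * h (z.1 + (z.2 + τ))))‖ₑ
      ≤ ∫⁻ τ, ENNReal.ofReal (C0 * (|l| * m) ^ (-(1 / 2) : ℝ)) *
        (ENNReal.ofReal (|τ| ^ (-(1 / 2) : ℝ)) * (U τ ^ (1 / 2 : ℝ) * V τ ^ (1 / 2 : ℝ))) := by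
        refine lintegral_mono_ae ?_
        filter_upwards [h0] with τ hne using hτ τ hne
    _ ≤ _ := by
        rw [lintegral_const_mul' _ _ ENNReal.ofReal_ne_top]
        refine (mul_le_mul_right ((lintegral_sqrt_mul_le hab mU mV).trans (mul_le_mul'
          (ENNReal.rpow_le_rpow (hls ug mug) (by norm_num))
          (ENNReal.rpow_le_rpow (hwin w hw uh muh) (by norm_num)))) _).trans (le_of_eq ?_)
        simp only [hug, huh, hpw p hp0, hpw q hq0, hpow]
        rw [_root_.sub_sub_cancel, _root_.sub_sub_cancel,
          ENNReal.mul_rpow_of_nonneg _ _ (by norm_num), ENNReal.mul_rpow_of_nonneg _ _ (by norm_num),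
          ENNReal.ofReal_rpow_of_nonneg hC1.le (by norm_num),
          ENNReal.ofReal_rpow_of_nonneg hC2.le (by norm_num), ← ENNReal.rpow_mul,
          show 4 / p * (1 / 2) = 2 / p by ring, ENNReal.ofReal_mul hC0.le,
          ENNReal.ofReal_mul (p := C0 * _) (by positivity), ENNReal.ofReal_mul hC0.le,
          ENNReal.ofReal_mul (p := C1 ^ (1 / 2 : ℝ)) (by positivity)]
        ring

end WindowedCorrelation

/-! ### Smoothness of integrals depending on a parameter. -/

section ParametricIntegral

open Set

variable {G : Type} [NormedAddCommGroup G] [NormedSpace ℝ G]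

theorem hasFDerivAt_integral_of_contDiff {f : (ℝ × ℝ) × ℝ → G} (hf : ContDiff ℝ 1 f) (z : ℝ × ℝ) :
    HasFDerivAt (fun z => ∫ s in (0 : ℝ)..1, f (z, s))
      (∫ s in (0 : ℝ)..1, (fderiv ℝ f (z, s)).comp (ContinuousLinearMap.inl ℝ (ℝ × ℝ) ℝ)) z := by
  have c0 := hf.continuous
  have c1 : Continuous fun p : (ℝ × ℝ) × ℝ =>
      (fderiv ℝ f p).comp (ContinuousLinearMap.inl ℝ (ℝ × ℝ) ℝ) :=
    (hf.continuous_fderiv (by simp)).clm_comp continuous_const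
  obtain ⟨b, hb⟩ := ((isCompact_closedBall z 1).prod (isCompact_Icc (a := (0 : ℝ)) (b := 1))).exists_bound_of_continuousOn
    c1.continuousOn
  refine intervalIntegral.hasFDerivAt_integral_of_dominated_of_fderiv_le (bound := fun _ => b)
    (F' := fun z s => (fderiv ℝ f (z, s)).comp (ContinuousLinearMap.inl ℝ (ℝ × ℝ) ℝ))
    (Metric.closedBall_mem_nhds z one_pos) (Filter.Eventually.of_forall fun z => ?_) ?_ ?_
    (ae_of_all _ fun s hs z' hz' => ?_) intervalIntegrable_const (ae_of_all _ fun s _ z' _ => ?_)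
  · exact (c0.comp (by fun_prop : Continuous fun s : ℝ => (z, s))).aestronglyMeasurable
  · exact (c0.comp (by fun_prop : Continuous fun s : ℝ => (z, s))).intervalIntegrable _ _
  · exact (c1.comp (by fun_prop : Continuous fun s : ℝ => (z, s))).aestronglyMeasurable
  · rw [uIoc_of_le zero_le_one] at hs
    exact hb (z', s) ⟨hz', Ioc_subset_Icc_self hs⟩
  · have h1 := (hf.differentiable (by simp) (z', s)).hasFDerivAt
    exact h1.comp z' (hasFDerivAt_prodMk_left z' s)

/-- The induction on the order ranges over all target spaces, since each derivative takes values in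
a space of linear maps. -/
theorem contDiff_integral {f : (ℝ × ℝ) × ℝ → ℝ} (hf : ContDiff ℝ ∞ f) :
    ContDiff ℝ ∞ fun z => ∫ s in (0 : ℝ)..1, f (z, s) := by
  have main : ∀ (n : ℕ) (G : Type) [NormedAddCommGroup G] [NormedSpace ℝ G]
      (f : (ℝ × ℝ) × ℝ → G), ContDiff ℝ ∞ f →
      ContDiff ℝ n fun z => ∫ s in (0 : ℝ)..1, f (z, s) := by
    intro n
    induction n with
    | zero =>
      intro G _ _ f hf
      refine contDiff_zero.2 ?_
      exact intervalIntegral.continuous_parametric_intervalIntegral_of_continuous'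
        (f := fun z s => f (z, s)) (by simpa [Function.uncurry_def] using hf.continuous) 0 1
    | succ n ih =>
      intro G _ _ f hf
      rw [show ((n + 1 : ℕ) : WithTop ℕ∞) = (n : WithTop ℕ∞) + 1 by norm_cast,
        contDiff_succ_iff_hasFDerivAt]
      refine ⟨_, ?_, fun z => hasFDerivAt_integral_of_contDiff (hf.of_le (by simp)) z⟩
      exact ih _ (fun p => (fderiv ℝ f p).comp (ContinuousLinearMap.inl ℝ (ℝ × ℝ) ℝ))
        ((hf.fderiv_right (by simp)).clm_comp contDiff_const)
  exact contDiff_infty.2 fun n => main n ℝ f hf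

end ParametricIntegral

/-! ### Phases with prescribed DS, by integration in the three directions. -/

section Primitives

open Set

variable {F R : ℝ × ℝ → ℝ}

/-- The primitive of `F` in the first variable. -/
noncomputable def primX (F : ℝ × ℝ → ℝ) (z : ℝ × ℝ) : ℝ := ∫ t in (0 : ℝ)..z.1, F (t, z.2)

/-- The primitive of `F` in the second variable. -/
noncomputable def primY (F : ℝ × ℝ → ℝ) (z : ℝ × ℝ) : ℝ := ∫ t in (0 : ℝ)..z.2, F (z.1, t)

/-- The primitive of `F` along antidiagonals. -/
noncomputable def primA (F : ℝ × ℝ → ℝ) (z : ℝ × ℝ) : ℝ :=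
  ∫ t in (0 : ℝ)..z.1, F (t, z.1 + z.2 - t)

/-- A fixed interval of integration turns the moving endpoint into a parameter, so smoothness of
primitives follows by differentiating under the integral. -/
theorem integral_eq_mul_unit (f : ℝ → ℝ) (x : ℝ) :
    ∫ t in (0 : ℝ)..x, f t = x * ∫ s in (0 : ℝ)..1, f (x * s) := by
  rw [← smul_eq_mul, intervalIntegral.smul_integral_comp_mul_left]
  simp

theorem ContDiff.primX (h : ContDiff ℝ ∞ F) : ContDiff ℝ ∞ (primX F) := by
  have : _root_.primX F = fun z => z.1 * ∫ s in (0 : ℝ)..1, F (z.1 * s, z.2) :=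
    funext fun z => integral_eq_mul_unit (fun t => F (t, z.2)) z.1
  rw [this]
  exact contDiff_fst.mul (contDiff_integral (f := fun p => F (p.1.1 * p.2, p.1.2))
    (h.comp (by fun_prop)))

theorem ContDiff.primY (h : ContDiff ℝ ∞ F) : ContDiff ℝ ∞ (primY F) := by
  have : _root_.primY F = fun z => z.2 * ∫ s in (0 : ℝ)..1, F (z.1, z.2 * s) :=
    funext fun z => integral_eq_mul_unit (fun t => F (z.1, t)) z.2
  rw [this]
  exact contDiff_snd.mul (contDiff_integral (f := fun p => F (p.1.1, p.1.2 * p.2))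
    (h.comp (by fun_prop)))

theorem primA_eq (F : ℝ × ℝ → ℝ) :
    primA F = fun z => z.1 * ∫ s in (0 : ℝ)..1, F (z.1 * s, z.1 + z.2 - z.1 * s) :=
  funext fun z => integral_eq_mul_unit (fun t => F (t, z.1 + z.2 - t)) z.1

theorem ContDiff.primA (h : ContDiff ℝ ∞ F) : ContDiff ℝ ∞ (primA F) := by
  rw [primA_eq]
  exact contDiff_fst.mul (contDiff_integral
    (f := fun p => F (p.1.1 * p.2, p.1.1 + p.1.2 - p.1.1 * p.2)) (h.comp (by fun_prop)))

theorem partialX_primX (h : ContDiff ℝ ∞ F) : partialX (primX F) = F := funext fun z =>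
  have hc : Continuous fun t => F (t, z.2) := h.continuous.comp (by fun_prop)
  (intervalIntegral.integral_hasDerivAt_right (hc.intervalIntegrable _ _)
    (hc.stronglyMeasurableAtFilter _ _) hc.continuousAt).deriv

theorem partialY_primY (h : ContDiff ℝ ∞ F) : partialY (primY F) = F := funext fun z =>
  have hc : Continuous fun t => F (z.1, t) := h.continuous.comp (by fun_prop)
  (intervalIntegral.integral_hasDerivAt_right (hc.intervalIntegrable _ _)
    (hc.stronglyMeasurableAtFilter _ _) hc.continuousAt).deriv

/-- On the line z + t(1,-1) the sum of the coordinates is constant, and the function is an ordinary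
primitive in t. -/
theorem partialX_sub_partialY_primA (h : ContDiff ℝ ∞ F) (z : ℝ × ℝ) :
    partialX (primA F) z - partialY (primA F) z = F z := by
  have hA := contDiffOn_univ.2 h.primA
  rw [← fderiv_antidiagonal hA isOpen_univ (mem_univ z)]
  have h1 := hasDerivAt_line hA isOpen_univ (z := z) (v := (1, -1)) (t := 0) (mem_univ _)
  rw [zero_smul, add_zero] at h1
  have e : (fun t : ℝ => primA F (z + t • ((1 : ℝ), (-1 : ℝ)))) =
      fun t => ∫ u in (0 : ℝ)..z.1 + t, F (u, z.1 + z.2 - u) := by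
    funext t
    simp only [primA, Prod.fst_add, Prod.snd_add, Prod.smul_mk, smul_eq_mul]
    congr 1
    · funext u; congr 2; ring
    · ring
  rw [e] at h1
  have hc : Continuous fun u => F (u, z.1 + z.2 - u) := h.continuous.comp (by fun_prop)
  have h2 := intervalIntegral.integral_hasDerivAt_right (a := 0) (b := z.1)
    (hc.intervalIntegrable _ _) (hc.stronglyMeasurableAtFilter volume _) hc.continuousAt
  have h3 : HasDerivAt (fun t : ℝ => ∫ u in (0 : ℝ)..z.1 + t, F (u, z.1 + z.2 - u))
      (F (z.1, z.1 + z.2 - z.1)) 0 := by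
    have := HasDerivAt.comp_const_add z.1 0 (by rwa [add_zero] : HasDerivAt
      (fun b => ∫ u in (0 : ℝ)..b, F (u, z.1 + z.2 - u)) (F (z.1, z.1 + z.2 - z.1)) (z.1 + 0))
    exact this
  rw [h1.unique h3, add_sub_cancel_left]

theorem partialY_primA (h : ContDiff ℝ ∞ F) : partialY (primA F) = primA (partialY F) := by
  funext z
  have hf : ContDiff ℝ ∞ fun p : (ℝ × ℝ) × ℝ => F (p.1.1 * p.2, p.1.1 + p.1.2 - p.1.1 * p.2) :=
    h.comp (by fun_prop)
  have h1 := hasFDerivAt_integral_of_contDiff (hf.of_le (by simp)) z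
  have h2 : HasDerivAt (fun y : ℝ => (z.1, y)) ((0 : ℝ), (1 : ℝ)) z.2 :=
    (hasDerivAt_const z.2 z.1).prodMk (hasDerivAt_id z.2)
  have h3 := (h1.comp_hasDerivAt z.2 h2).const_mul z.1
  rw [primA_eq, primA_eq]
  refine h3.deriv.trans ?_
  congr 1
  have ci : IntervalIntegrable (fun s => (fderiv ℝ (fun p : (ℝ × ℝ) × ℝ =>
      F (p.1.1 * p.2, p.1.1 + p.1.2 - p.1.1 * p.2)) (z, s)).comp
      (ContinuousLinearMap.inl ℝ (ℝ × ℝ) ℝ)) volume 0 1 := by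
    refine Continuous.intervalIntegrable ?_ _ _
    exact ((hf.continuous_fderiv (by simp)).comp (by fun_prop)).clm_comp continuous_const
  rw [ContinuousLinearMap.intervalIntegral_apply ci]
  refine intervalIntegral.integral_congr fun s _ => ?_
  simp only [ContinuousLinearMap.comp_apply, ContinuousLinearMap.inl_apply]
  have h4 := (hf.differentiable (by simp) (z, s)).hasFDerivAt.comp_hasDerivAt z.2
    (h2.prodMk (hasDerivAt_const z.2 s))
  have h5 := (h.hasDerivAt_partialY (z.1 * s) (z.1 + z.2 - z.1 * s)).comp z.2
    (((hasDerivAt_id z.2).const_add z.1).sub_const (z.1 * s))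
  rw [mul_one] at h5
  exact h4.unique h5

/-- An antidiagonal crosses the horizontal strip carrying F in an interval of length 2ρ, so the
bound holds however far the primitive is taken. -/
theorem abs_primA_le {L ρ y0 : ℝ} (hL : 0 ≤ L) (hρ : 0 ≤ ρ) (hF : ∀ z, |F z| ≤ L)
    (hs : ∀ z : ℝ × ℝ, F z ≠ 0 → |z.2 - y0| ≤ ρ) (z : ℝ × ℝ) : |primA F z| ≤ 2 * ρ * L := by
  set J := Icc (z.1 + z.2 - y0 - ρ) (z.1 + z.2 - y0 + ρ) with hJ
  have hb : ∀ t, ‖F (t, z.1 + z.2 - t)‖ ≤ indicator J (fun _ => L) t := by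
    intro t
    by_cases ht : t ∈ J
    · rw [indicator_of_mem ht]; exact hF _
    · rw [indicator_of_notMem ht, norm_le_zero_iff]
      by_contra hne
      have := abs_le.1 (hs _ hne)
      exact ht ⟨by linarith [this.2], by linarith [this.1]⟩
  have hJi : Integrable (indicator J fun _ : ℝ => L) :=
    (integrable_indicator_iff measurableSet_Icc).2
      (integrableOn_const (by simp))
  calc |primA F z| ≤ |∫ t in (0 : ℝ)..z.1, indicator J (fun _ => L) t| :=
        intervalIntegral.norm_integral_le_abs_of_norm_le 
          (ae_of_all _ fun t => hb t) hJi.intervalIntegrable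
    _ ≤ ∫ t, indicator J (fun _ => L) t := by
        rw [intervalIntegral.abs_integral_eq_abs_integral_uIoc, abs_of_nonneg]
        · exact setIntegral_le_integral hJi (ae_of_all _ fun t => indicator_nonneg (fun _ _ => hL) t)
        · exact integral_nonneg fun t => indicator_nonneg (fun _ _ => hL) t
    _ = 2 * ρ * L := by
        rw [integral_indicator measurableSet_Icc, setIntegral_const, smul_eq_mul,
          Measure.real, Real.volume_Icc, ENNReal.toReal_ofReal (by linarith)]
        ring

theorem partialY_eq_zero_of_eventually {y0 ρ : ℝ} (hs : ∀ z : ℝ × ℝ, F z ≠ 0 → |z.2 - y0| ≤ ρ)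
    (z : ℝ × ℝ) (hz : partialY F z ≠ 0) : |z.2 - y0| ≤ ρ := by
  by_contra hlt
  refine hz ?_
  have : (fun t => F (z.1, t)) =ᶠ[nhds z.2] fun _ => 0 := by
    have ho : IsOpen {t : ℝ | ρ < |t - y0|} := isOpen_lt continuous_const (by fun_prop)
    filter_upwards [ho.mem_nhds (not_le.1 hlt)] with t ht
    by_contra hne
    exact not_le.2 ht (hs _ hne)
  exact this.deriv_eq.trans (deriv_const _ _)

/-- A phase on the plane with prescribed third-order derivative `D S = R`. -/
theorem exists_rowPhase {m B w y0 : ℝ} (hm : 0 < m) (hw : 0 < w) (hB : 0 ≤ B)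
    (hR : ContDiff ℝ ∞ R) (hlow : ∀ z, m ≤ R z)
    (hs : ∀ z : ℝ × ℝ, partialY R z ≠ 0 → |z.2 - y0| ≤ 3 * w)
    (h1 : ∀ z, |partialY R z| ≤ m / (60 * w)) (h2 : ∀ z, |partialY (partialY R) z| ≤ B / w ^ 2 * m) :
    ∃ S, RowPhase m (1 + 6 * B) w S ∧ opD S = R := by
  -- Z plays the role of ∂ₓ∂_yS, and DS = R becomes (∂ₓ-∂_y)Z = R. Horizontal and vertical
  -- primitives then recover S.
  set Z := primA R with hZ
  have sZ : ContDiff ℝ ∞ Z := hR.primA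
  have sX : ContDiff ℝ ∞ (primX Z) := sZ.primX
  set S := primY (primX Z) with hS
  have sS : ContDiff ℝ ∞ S := sX.primY
  have eY : partialY S = primX Z := partialY_primY sX
  have eZ : partialY (partialX S) = Z := by
    rw [← sS.partialX_partialY_comm, eY, partialX_primX sZ]
  have eZ' : partialX (partialY S) = Z := by rw [eY, partialX_primX sZ]
  have eA : ∀ z, partialX Z z - partialY Z z = R z := partialX_sub_partialY_primA hR
  have eD : opD S = R := by
    funext z
    rw [opD_eq_opQ (contDiffOn_univ.2 sS) isOpen_univ (mem_univ z), opQ_eq_sub sS.partialY, eZ',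
      sS.partialY.partialX_partialY_comm, eZ', eA]
  -- ∂_yR lives in a strip of half-width 3w and has size m/(60w): 2·3w·m/(60w) = m/10.
  have bZ1 : ∀ z, |partialY Z z| ≤ 1 / 10 * m := fun z => by
    rw [hZ, partialY_primA hR]
    refine (abs_primA_le (by positivity) (by positivity) h1 hs z).trans (le_of_eq ?_)
    field_simp; norm_num
  have bZ2 : ∀ z, |partialY (partialY Z) z| ≤ 6 * B / w * m := fun z => by
    rw [hZ, partialY_primA hR, partialY_primA hR.partialY]
    refine (abs_primA_le (by positivity) (by positivity) h2
      (partialY_eq_zero_of_eventually hs) z).trans (le_of_eq ?_)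
    field_simp; ring
  -- This identity carries the lower bound: ∂ₓZ ≥ m - m/10. It also trades x-derivatives of Z, about
  -- which nothing else is known, for R and y-derivatives.
  have eXZ : partialX Z = fun z => R z + partialY Z z := funext fun z => by linarith [eA z]
  refine ⟨S, ⟨sS, fun z => ?_, fun z => ?_, fun z => ?_, fun z => ?_, fun z => ?_⟩, eD⟩
  · rw [← sS.partialX.partialX_partialY_comm, eZ, eXZ]
    linarith [hlow z, (abs_le.1 (bZ1 z)).1]
  · rw [eZ]; exact bZ1 z
  · rw [eZ, eXZ]
    have : partialY (fun z => R z + partialY Z z) z = partialY R z + partialY (partialY Z) z :=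
      ((hR.hasDerivAt_partialY z.1 z.2).add (sZ.partialY.hasDerivAt_partialY z.1 z.2)).deriv
    rw [this]
    refine (abs_add_le _ _).trans ((add_le_add (h1 z) (bZ2 z)).trans ?_)
    calc m / (60 * w) + 6 * B / w * m = (1 / 60 + 6 * B) / w * m := by field_simp
      _ ≤ _ := by gcongr; norm_num
  · rw [eZ]
    refine (bZ2 z).trans ?_
    gcongr
    linarith
  · have e1 := partialY_opD (contDiffOn_univ.2 sS) isOpen_univ
    have e2 : opQ (partialY (partialY S)) = partialY R := funext fun z => by
      rw [← e1 (mem_univ z), eD]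
    rw [e2]
    refine (h2 z).trans ?_
    gcongr
    linarith

end Primitives

/-! ### Extending DS from a strip of the region to the whole plane. -/

section Extension

open Set

/-- A smooth bounded modification of the identity. -/
theorem exists_smooth_truncation : ∃ a : ℝ, 1 ≤ a ∧ ∀ (w y0 : ℝ), 0 < w → ∃ τ τ1 τ2 : ℝ → ℝ,
    ContDiff ℝ ∞ τ ∧ (∀ y, HasDerivAt τ (τ1 y) y) ∧ (∀ y, HasDerivAt τ1 (τ2 y) y) ∧
    (∀ y, |τ1 y| ≤ 3 * a) ∧ (∀ y, |τ2 y| ≤ 3 * a / w) ∧ (∀ y, |τ y - y0| ≤ 3 * w) ∧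
    (∀ y, |y - y0| ≤ 3 / 2 * w → τ y = y) ∧ ∀ y, τ1 y ≠ 0 → |y - y0| ≤ 3 * w := by
  obtain ⟨a, ha, b0, b1, b2⟩ := exists_unitBump_bound
  refine ⟨a, ha, fun w y0 hw => ?_⟩
  -- The bump equals 1 for |y-y0| ≤ v = 3w/2 and vanishes beyond 3v/2 = 9w/4, which stays below 3w.
  set v := 3 / 2 * w with hv
  have hvp : 0 < v := by positivity
  set s : ℝ → ℝ := fun y => (y - y0) / v with hs
  have ds : ∀ y, HasDerivAt s (1 / v) y := fun y => ((hasDerivAt_id y).sub_const y0).div_const v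
  have d0 : ∀ y, HasDerivAt (fun y => unitBump (s y)) (deriv unitBump (s y) * (1 / v)) y :=
    fun y => (hasDerivAt_unitBump (s y)).comp y (ds y)
  have d1 : ∀ y, HasDerivAt (fun y => deriv unitBump (s y))
      (deriv (deriv unitBump) (s y) * (1 / v)) y :=
    fun y => (hasDerivAt_deriv_unitBump (s y)).comp y (ds y)
  have z0 : ∀ x : ℝ, 3 / 2 < |x| → x ∉ tsupport (unitBump : ℝ → ℝ) := fun x hx h => by
    rw [unitBump_tsupport] at h
    exact absurd (abs_le.2 h) (not_le.2 hx)
  have z0' : ∀ x : ℝ, 3 / 2 < |x| → unitBump x = 0 := fun x hx =>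
    image_eq_zero_of_notMem_tsupport (z0 x hx)
  have z1 : ∀ x : ℝ, 3 / 2 < |x| → deriv unitBump x = 0 := fun x hx =>
    image_eq_zero_of_notMem_tsupport fun h => z0 x hx (tsupport_deriv_subset h)
  have z2 : ∀ x : ℝ, 3 / 2 < |x| → deriv (deriv unitBump) x = 0 := fun x hx =>
    image_eq_zero_of_notMem_tsupport fun h =>
      z0 x hx (tsupport_deriv_subset (tsupport_deriv_subset h))
  have bm : ∀ f : ℝ → ℝ, (∀ x, |f x| ≤ a) → (∀ x, 3 / 2 < |x| → f x = 0) → ∀ x,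
      |x * f x| ≤ 3 / 2 * a := fun f hf hz x => by
    rcases le_or_gt |x| (3 / 2) with h | h
    · rw [abs_mul]; exact mul_le_mul h (hf x) (abs_nonneg _) (by norm_num)
    · rw [hz x h, mul_zero, abs_zero]; positivity
  have hsy : ∀ y, y - y0 = v * s y := fun y => by rw [hs]; field_simp
  refine ⟨fun y => y0 + v * (s y * unitBump (s y)),
    fun y => unitBump (s y) + s y * deriv unitBump (s y),
    fun y => (2 * deriv unitBump (s y) + s y * deriv (deriv unitBump) (s y)) * (1 / v),
    ?_, fun y => ?_, fun y => ?_, fun y => ?_, fun y => ?_, fun y => ?_, fun y hy => ?_,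
    fun y hy => ?_⟩
  · have : ContDiff ℝ ∞ s := (contDiff_id.sub contDiff_const).div_const _
    exact contDiff_const.add (contDiff_const.mul (this.mul (unitBump_contDiff.comp this)))
  · refine (((ds y).mul (d0 y)).const_mul v |>.const_add y0).congr_deriv ?_
    field_simp
  · refine ((d0 y).add ((ds y).mul (d1 y))).congr_deriv ?_
    ring
  · have h1 := b0 (s y)
    have h2 := bm _ b1 z1 (s y)
    exact (abs_add_le _ _).trans (by linarith)
  · have h1 := b1 (s y)
    have h2 := bm _ b2 z2 (s y)
    rw [abs_mul, abs_of_pos (by positivity : 0 < 1 / v)]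
    have h3 : |2 * deriv unitBump (s y) + s y * deriv (deriv unitBump) (s y)| ≤ 9 / 2 * a := by
      refine (abs_add_le _ _).trans ?_
      rw [abs_mul, abs_two]; linarith
    calc _ ≤ 9 / 2 * a * (1 / v) := by gcongr
      _ = _ := by rw [hv]; field_simp; norm_num
  · have h2 : |s y * unitBump (s y)| ≤ 3 / 2 := by
      rcases le_or_gt |s y| (3 / 2) with h | h
      · rw [abs_mul, abs_of_nonneg unitBump.nonneg]
        nlinarith [unitBump.le_one (x := s y), unitBump.nonneg (x := s y), abs_nonneg (s y)]
      · rw [z0' _ h, mul_zero, abs_zero]; norm_num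
    rw [add_sub_cancel_left, abs_mul, abs_of_pos hvp]
    calc v * _ ≤ v * (3 / 2) := by gcongr
      _ ≤ 3 * w := by rw [hv]; linarith
  · have : |s y| ≤ 1 := by
      rw [hs, abs_div, abs_of_pos hvp, div_le_one hvp]; exact hy
    simp only
    rw [unitBump_eq_one this, mul_one, ← hsy]; ring
  · by_contra hlt
    have : 3 / 2 < |s y| := by
      rw [hs, abs_div, abs_of_pos hvp, lt_div_iff₀ hvp, hv]; linarith [not_le.1 hlt]
    exact hy (by simp only; rw [z0' _ this, z1 _ this]; ring)

/-- An intermediate open set is inserted so that the closed support of the cutoff, and not merely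
its nonvanishing set, lies in Ω. -/
theorem exists_smooth_cutoff {Ω Ω1 : Set (ℝ × ℝ)} (hΩ : IsOpen Ω) (h1Ω : closure Ω1 ⊆ Ω) :
    ∃ η : ℝ × ℝ → ℝ, ContDiff ℝ ∞ η ∧ (∀ z ∈ Ω1, η z = 1) ∧ tsupport η ⊆ Ω ∧
      ∀ z, 0 ≤ η z ∧ η z ≤ 1 := by
  obtain ⟨V, hV, h1V, hVΩ⟩ := normal_exists_closure_subset isClosed_closure hΩ h1Ω
  obtain ⟨η, h0, h1, h2⟩ := exists_contMDiffMap_zero_one_of_isClosed (n := ⊤)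
    (modelWithCornersSelf ℝ (ℝ × ℝ)) hV.isClosed_compl isClosed_closure
    (disjoint_compl_left_iff_subset.2 h1V)
  refine ⟨η, η.contMDiff.contDiff, fun z hz => h1 (subset_closure hz), ?_, h2⟩
  refine (closure_mono fun z hz => ?_).trans hVΩ
  by_contra hzV
  exact hz (h0 hzV)

theorem contDiff_mul_of_tsupport_subset {Ω : Set (ℝ × ℝ)} (hΩ : IsOpen Ω) {η F : ℝ × ℝ → ℝ}
    (hη : ContDiff ℝ ∞ η) (hs : tsupport η ⊆ Ω) (hF : ContDiffOn ℝ ∞ F Ω) :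
    ContDiff ℝ ∞ fun z => η z * F z := by
  refine contDiff_iff_contDiffAt.2 fun z => ?_
  by_cases hz : z ∈ tsupport η
  · exact hη.contDiffAt.mul (hF.contDiffAt (hΩ.mem_nhds (hs hz)))
  · refine (contDiffAt_const (c := (0 : ℝ))).congr_of_eventuallyEq ?_
    filter_upwards [notMem_tsupport_iff_eventuallyEq.1 hz] with w hw
    simp [hw]

/-- A smooth selection of points in the vertical sections of an open vertically convex set. -/
theorem exists_smooth_selection {Ω1 Ω2 : Set (ℝ × ℝ)} (h1 : IsOpen Ω1) (hv : DirConvex (0, 1) Ω1)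
    (h2 : IsCompact (closure Ω2)) (h21 : closure Ω2 ⊆ Ω1) {r ρ : ℝ} (hr : 0 < r) (hρ : r < ρ)
    (y0 : ℝ) : ∃ q : ℝ → ℝ, ContDiff ℝ ∞ q ∧ (∀ x, |q x - y0| < ρ) ∧
      ∀ z ∈ Ω2, |z.2 - y0| ≤ r → (z.1, q z.1) ∈ Ω1 := by
  set P : Set ℝ := Prod.fst '' (closure Ω2 ∩ {z : ℝ × ℝ | |z.2 - y0| ≤ r}) with hP
  have hPc : IsClosed P :=
    ((h2.inter_right (isClosed_le (by fun_prop) continuous_const)).image continuous_fst).isClosed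
  -- The admissible heights form convex sets by vertical convexity, and constants are admissible
  -- locally because Ω1 is open and P is closed; a partition of unity then gives a smooth choice.
  set T : ℝ → Set ℝ := fun x => {y | |y - y0| < ρ ∧ (x ∈ P → (x, y) ∈ Ω1)} with hT
  have hconv : ∀ x, Convex ℝ (T x) := fun x => by
    refine convex_iff_segment_subset.2 fun y hy y' hy' u hu => ⟨?_, fun hx => ?_⟩
    · have : Convex ℝ (Metric.ball y0 ρ) := convex_ball _ _
      have := this.segment_subset (by simpa [Real.dist_eq] using hy.1)
        (by simpa [Real.dist_eq] using hy'.1) hu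
      simpa [Real.dist_eq] using this
    · exact hv.vertical (hy.2 hx) (hy'.2 hx) (by rwa [segment_eq_uIcc] at hu)
  have hloc : ∀ x, ∃ y, ∀ᶠ t in nhds x, y ∈ T t := fun x => by
    by_cases hx : x ∈ P
    · obtain ⟨z, ⟨hz, hzr⟩, rfl⟩ := hx
      refine ⟨z.2, ?_⟩
      have : ∀ᶠ t in nhds z.1, (t, z.2) ∈ Ω1 :=
        (Continuous.prodMk_left z.2).continuousAt.eventually (h1.mem_nhds (h21 hz))
      filter_upwards [this] with t ht
      exact ⟨lt_of_le_of_lt hzr hρ, fun _ => ht⟩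
    · refine ⟨y0, ?_⟩
      filter_upwards [hPc.isOpen_compl.mem_nhds hx] with t ht
      exact ⟨by rw [sub_self, abs_zero]; linarith, fun h => absurd h ht⟩
  obtain ⟨q, hq⟩ := exists_contMDiffMap_forall_mem_convex_of_local_const (n := ⊤)
    (modelWithCornersSelf ℝ ℝ) hconv hloc
  refine ⟨q, q.contMDiff.contDiff, fun x => (hq x).1, fun z hz hzr => (hq z.1).2 ?_⟩
  exact ⟨z, ⟨subset_closure hz, hzr⟩, rfl⟩

/-- On a narrow horizontal strip the phase can be replaced by a phase on the plane satisfying the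
hypotheses of the bilinear estimate. -/
theorem exists_rowPhase_extension {c K : ℝ} (hc : 0 < c) (hK : 0 < K) :
    ∃ κ B : ℝ, 0 < κ ∧ κ ≤ 1 ∧ 0 ≤ B ∧ ∀ (δ μ y0 : ℝ) (Ω Ω1 Ω2 : Set (ℝ × ℝ)) (R : ℝ × ℝ → ℝ),
      0 < δ → 0 < μ → IsOpen Ω → IsOpen Ω1 → DirConvex (0, 1) Ω1 → closure Ω1 ⊆ Ω →
      IsCompact (closure Ω2) → closure Ω2 ⊆ Ω1 → ContDiffOn ℝ ∞ R Ω → (∀ z ∈ Ω, c * μ ≤ R z) →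
      (∀ z ∈ Ω, |partialY R z| ≤ K * (μ / δ)) →
      (∀ z ∈ Ω, |partialY (partialY R) z| ≤ K * (μ / δ ^ 2)) →
      ∃ S, RowPhase (c * μ / 2) B (κ * δ) S ∧
        EqOn (opD S) R (Ω2 ∩ {z | |z.2 - y0| ≤ 3 / 2 * (κ * δ)}) := by
  obtain ⟨a, ha, htr⟩ := exists_smooth_truncation
  -- B makes B·(cμ/2) equal to (9a² + 18a)Kμ, the bound obtained below for w² times the second
  -- vertical derivative of the extension.
  set B := (18 * a ^ 2 * K + 36 * a * K) / c with hB
  have hB0 : 0 ≤ B := by positivity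
  -- 2160 = 18·120: the first derivative of the extension, at most 6K(μ/δ)·3a, must not exceed
  -- (cμ/2)/(60w).
  set κ := c / (2160 * a * K + c) with hκ
  have hκ0 : 0 < κ := by positivity
  have hκ1 : κ ≤ 1 := by rw [hκ, div_le_one (by positivity)]; linarith [(by positivity : 0 < a * K)]
  have hκc : 2160 * a * K * κ ≤ c := by
    rw [hκ, mul_div_assoc', div_le_iff₀ (by positivity)]; nlinarith [sq_nonneg c]
  refine ⟨κ, 1 + 6 * B, hκ0, hκ1, by positivity, fun δ μ y0 Ω Ω1 Ω2 R hδ hμ hΩ h1 hv h1Ω h2 h21 hR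
    hlow hup1 hup2 => ?_⟩
  set w := κ * δ with hw
  have hwp : 0 < w := by positivity
  have hwδ : w ≤ δ := by rw [hw]; nlinarith
  have h1Ω' := subset_closure.trans h1Ω
  obtain ⟨τ, τ1, τ2, sτ, dτ, dτ1, bτ1, bτ2, bτ, eτ, zτ⟩ := htr w y0 hwp
  obtain ⟨η, sη, η1, hηs, hη01⟩ := exists_smooth_cutoff hΩ h1Ω
  obtain ⟨q, sq, bq, hq⟩ := exists_smooth_selection h1 hv h2 h21 (r := 3 / 2 * w) (ρ := 2 * w)
    (by positivity) (by linarith) y0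
  have hRy := hR.partialY hΩ
  have hη0 : ∀ z, z ∉ Ω → η z = 0 := fun z hz => image_eq_zero_of_notMem_tsupport fun h => hz (hηs h)
  set r0 : ℝ × ℝ → ℝ := fun z => η z * R z + (1 - η z) * (c * μ) with hr0
  set r1 : ℝ × ℝ → ℝ := fun z => η z * partialY R z with hr1
  set r2 : ℝ × ℝ → ℝ := fun z => η z * partialY (partialY R) z with hr2
  have s0 : ContDiff ℝ ∞ r0 := (contDiff_mul_of_tsupport_subset hΩ sη hηs hR).add
    ((contDiff_const.sub sη).mul contDiff_const)
  have s1 : ContDiff ℝ ∞ r1 := contDiff_mul_of_tsupport_subset hΩ sη hηs hRy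
  have s2 : ContDiff ℝ ∞ r2 := contDiff_mul_of_tsupport_subset hΩ sη hηs (hRy.partialY hΩ)
  have b0 : ∀ z, c * μ ≤ r0 z := fun z => by
    by_cases hz : z ∈ Ω
    · have := hlow z hz
      rw [hr0]
      nlinarith [hη01 z]
    · simp [hr0, hη0 z hz]
  have bη : ∀ (F : ℝ × ℝ → ℝ) (L : ℝ), 0 ≤ L → (∀ z ∈ Ω, |F z| ≤ L) → ∀ z, |η z * F z| ≤ L :=
    fun F L hL hF z => by
    by_cases hz : z ∈ Ω
    · rw [abs_mul, abs_of_nonneg (hη01 z).1]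
      exact (mul_le_of_le_one_left (abs_nonneg _) (hη01 z).2).trans (hF z hz)
    · rw [hη0 z hz, zero_mul, abs_zero]; exact hL
  have b1 := bη _ _ (by positivity) hup1
  have b2 := bη _ _ (by positivity) hup2
  have sN1 := s2.primY
  have sN2 := sN1.primY
  have eN1 : partialY (primY r2) = r2 := partialY_primY s2
  have eN2 : partialY (primY (primY r2)) = primY r2 := partialY_primY sN1
  set N1 := primY r2 with hN1
  set N2 := primY N1 with hN2
  -- G is rebuilt from the base point q(x): value, first derivative, and second derivative cut off
  -- by η, integrated twice in y. It equals R along vertical segments inside Ω1 and keeps the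
  -- y-derivative bounds everywhere; a direct cutoff of R would bring in derivatives of η.
  set G1 : ℝ → ℝ → ℝ := fun x y => r1 (x, q x) + (N1 (x, y) - N1 (x, q x)) with hG1
  set G : ℝ → ℝ → ℝ := fun x y => r0 (x, q x) + (r1 (x, q x) * (y - q x) +
    (N2 (x, y) - N2 (x, q x) - N1 (x, q x) * (y - q x))) with hG
  have dG : ∀ x y, HasDerivAt (G x) (G1 x y) y := fun x y => by
    have h1 := sN2.hasDerivAt_partialY x y
    rw [eN2] at h1
    have h2 := (hasDerivAt_id y).sub_const (q x)
    refine (((h2.const_mul (r1 (x, q x))).add ((h1.sub_const (N2 (x, q x))).sub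
      (h2.const_mul (N1 (x, q x))))).const_add (r0 (x, q x))).congr_deriv ?_
    rw [hG1]; ring
  have dG1 : ∀ x y, HasDerivAt (G1 x) (r2 (x, y)) y := fun x y => by
    have h1 := sN1.hasDerivAt_partialY x y
    rw [eN1] at h1
    exact (h1.sub_const _).const_add _
  have bG1 : ∀ x y, |y - q x| ≤ 5 * w → |G1 x y| ≤ 6 * K * (μ / δ) := fun x y hy => by
    have h := abs_sub_le_of_hasDerivAt (f := fun t => N1 (x, t)) (f' := fun t => r2 (x, t))
      (fun t => by have := sN1.hasDerivAt_partialY x t; rwa [eN1] at this) (fun t => b2 (x, t)) y (q x)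
    calc |G1 x y| ≤ K * (μ / δ) + K * (μ / δ ^ 2) * (5 * δ) :=
          (abs_add_le _ _).trans (add_le_add (b1 _) (h.trans (by gcongr; linarith)))
      _ = _ := by field_simp; norm_num
  have hτq : ∀ x y, |τ y - q x| ≤ 5 * w := fun x y => by
    have := bτ y
    have := bq x
    calc |τ y - q x| = |(τ y - y0) - (q x - y0)| := by ring_nf
      _ ≤ _ := (abs_sub _ _).trans (by linarith)
  -- Within 5w of the base point the value changes by at most 6K(μ/δ)·5w = 30Kκμ, which the choice
  -- of κ keeps below cμ/2.
  have hbw : ∀ x y, |y - q x| ≤ 5 * w → c * μ / 2 ≤ G x y := fun x y hy => by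
    have hseg : ∀ t ∈ uIcc (q x) y, |t - q x| ≤ 5 * w := fun t ht =>
      (abs_sub_left_of_mem_uIcc ht).trans hy
    have h := Convex.norm_image_sub_le_of_norm_hasDerivWithin_le (f := G x) (s := uIcc (q x) y)
      (fun t _ => (dG x t).hasDerivWithinAt) (fun t ht => bG1 x t (hseg t ht)) (convex_uIcc _ _)
      left_mem_uIcc right_mem_uIcc
    have e : G x (q x) = r0 (x, q x) := by rw [hG]; ring
    rw [e, Real.norm_eq_abs, Real.norm_eq_abs] at h
    have h2 : 6 * K * (μ / δ) * |y - q x| ≤ c * μ / 2 := by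
      calc 6 * K * (μ / δ) * |y - q x| ≤ 6 * K * (μ / δ) * (5 * w) := by gcongr
        _ = 30 * K * κ * μ := by rw [hw]; field_simp; norm_num
        _ ≤ c / 2 * μ := by
          gcongr
          have : 1 * (K * κ) ≤ a * (K * κ) := by gcongr
          nlinarith [(by positivity : 0 < K * κ)]
        _ = _ := by ring
    linarith [b0 (x, q x), (abs_le.1 (h.trans h2)).1]
  -- Composing with τ keeps the height within 3w + 2w of q(x) and makes the y-derivative vanish off
  -- the strip, as the primitive along antidiagonals requires.
  set R' : ℝ × ℝ → ℝ := fun z => G z.1 (τ z.2) with hR'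
  have sR' : ContDiff ℝ ∞ R' := by
    have t1 : ContDiff ℝ ∞ fun z : ℝ × ℝ => q z.1 := sq.comp contDiff_fst
    have t2 : ContDiff ℝ ∞ fun z : ℝ × ℝ => τ z.2 := sτ.comp contDiff_snd
    have t3 : ContDiff ℝ ∞ fun z : ℝ × ℝ => (z.1, q z.1) := contDiff_fst.prodMk t1
    have t4 : ContDiff ℝ ∞ fun z : ℝ × ℝ => (z.1, τ z.2) := contDiff_fst.prodMk t2
    exact (s0.comp t3).add (((s1.comp t3).mul (t2.sub t1)).add
      (((sN2.comp t4).sub (sN2.comp t3)).sub ((sN1.comp t3).mul (t2.sub t1))))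
  have d1 : ∀ x y, HasDerivAt (fun y => R' (x, y)) (G1 x (τ y) * τ1 y) y := fun x y =>
    (dG x (τ y)).comp y (dτ y)
  have e1 : partialY R' = fun z => G1 z.1 (τ z.2) * τ1 z.2 := funext fun z => (d1 z.1 z.2).deriv
  have d2 : ∀ x y, HasDerivAt (fun y => G1 x (τ y) * τ1 y)
      (r2 (x, τ y) * τ1 y * τ1 y + G1 x (τ y) * τ2 y) y := fun x y =>
    ((dG1 x (τ y)).comp y (dτ y)).mul (dτ1 y)
  have e2 : partialY (partialY R') = fun z =>
      r2 (z.1, τ z.2) * τ1 z.2 * τ1 z.2 + G1 z.1 (τ z.2) * τ2 z.2 := by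
    rw [e1]; exact funext fun z => (d2 z.1 z.2).deriv
  obtain ⟨S, hS, eS⟩ := exists_rowPhase (m := c * μ / 2) (B := B) (w := w) (y0 := y0)
    (by positivity) hwp hB0 sR' (fun z => hbw _ _ (hτq _ _)) (fun z hz => by
      rw [e1] at hz
      exact zτ _ (right_ne_zero_of_mul hz)) (fun z => by
      rw [e1]
      simp only [abs_mul]
      calc _ ≤ 6 * K * (μ / δ) * (3 * a) := by gcongr; exacts [bG1 _ _ (hτq _ _), bτ1 _]
        _ = 2160 * a * K * κ * (μ / (120 * w)) := by rw [hw]; field_simp; norm_num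
        _ ≤ c * (μ / (120 * w)) := by gcongr
        _ = _ := by field_simp; norm_num) (fun z => by
      rw [e2]
      refine (abs_add_le _ _).trans ?_
      simp only [abs_mul]
      calc _ ≤ K * (μ / δ ^ 2) * (3 * a) * (3 * a) + 6 * K * (μ / δ) * (3 * a / w) := by
            gcongr
            exacts [b2 _, bτ1 _, bτ1 _, bG1 _ _ (hτq _ _), bτ2 _]
        _ ≤ K * (μ / (w * w)) * (3 * a) * (3 * a) + 6 * K * (μ / w) * (3 * a / w) := by
            gcongr
            nlinarith
        _ = _ := by rw [hB]; field_simp; ring)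
  refine ⟨S, hS, fun z hz => ?_⟩
  rw [eS]
  obtain ⟨x, y⟩ := z
  have hzq : (x, q x) ∈ Ω1 := hq _ hz.1 hz.2
  have hzy : (x, y) ∈ Ω1 := h21 (subset_closure hz.1)
  have hseg : ∀ t ∈ uIcc (q x) y, (x, t) ∈ Ω1 := fun t ht => hv.vertical hzq hzy ht
  have zero : ∀ (f f' : ℝ → ℝ), (∀ t ∈ uIcc (q x) y, HasDerivAt f (f' t) t) →
      (∀ t ∈ uIcc (q x) y, f' t = 0) → ∀ t ∈ uIcc (q x) y, f t = f (q x) := fun f f' hf h0 t ht => by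
    have h := Convex.norm_image_sub_le_of_norm_hasDerivWithin_le (f := f) (s := uIcc (q x) y) (C := 0)
      (fun t ht => (hf t ht).hasDerivWithinAt) (fun t ht => by rw [h0 t ht, norm_zero])
      (convex_uIcc _ _) left_mem_uIcc ht
    rw [zero_mul, norm_le_zero_iff, sub_eq_zero] at h
    exact h
  -- Vertical convexity puts the whole segment from (x,q(x)) to (x,y) in Ω1, where η = 1; matching
  -- data at the base point then propagates along it.
  have k1 : ∀ t ∈ uIcc (q x) y, G1 x t - partialY R (x, t) = 0 := fun t ht => by
    rw [zero (fun t => G1 x t - partialY R (x, t)) (fun t => r2 (x, t) - partialY (partialY R) (x, t))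
      (fun t ht => (dG1 x t).sub (hasDerivAt_partialY hRy hΩ (h1Ω' (hseg t ht))))
      (fun t ht => by rw [hr2]; simp [η1 _ (hseg t ht)]) t ht]
    simp [hG1, hr1, η1 _ hzq]
  have k0 := zero (fun t => G x t - R (x, t)) (fun t => G1 x t - partialY R (x, t))
      (fun t ht => (dG x t).sub (hasDerivAt_partialY hR hΩ (h1Ω' (hseg t ht)))) k1 y right_mem_uIcc
  have k2 : G x (q x) - R (x, q x) = 0 := by simp [hG, hr0, η1 _ hzq]
  rw [hR']
  simp only [k2] at k0 ⊢
  rw [eτ y hz.2]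
  linarith

end Extension

/-! ### The kernel of D on regions convex in the three directions. -/

section Decomposition

open Set

/-- A continuous function on an open subset of the line has a measurable primitive. -/
theorem exists_primitive_of_continuousOn {U : Set ℝ} (hU : IsOpen U) {γ : ℝ → ℝ}
    (hγ : ContinuousOn γ U) : ∃ c : ℝ → ℝ, Measurable c ∧ ∀ s ∈ U, HasDerivAt c (γ s) s := by
  classical
  -- Each component of U has its own base point, so the integrals never leave U.
  set c : ℝ → ℝ := fun s => if h : s ∈ U then ∫ t in ordConnectedProj U ⟨s, h⟩..s, γ t else 0
    with hc
  have hd : ∀ s ∈ U, HasDerivAt c (γ s) s := by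
    intro s hs
    obtain ⟨ε, hε, hb⟩ := Metric.isOpen_iff.1 hU s hs
    set p := ordConnectedProj U ⟨s, hs⟩ with hp
    have hps : uIcc s p ⊆ U := mem_ordConnectedComponent.1
      (ordConnectedProj_mem_ordConnectedComponent U ⟨s, hs⟩)
    have e : c =ᶠ[nhds s] fun t => ∫ u in p..t, γ u := by
      filter_upwards [Metric.ball_mem_nhds s hε] with t ht
      have hseg : uIcc s t ⊆ U := by
        rw [← segment_eq_uIcc]
        exact ((convex_ball s ε).segment_subset (Metric.mem_ball_self hε) ht).trans hb
      have htU : t ∈ U := hb ht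
      have : p = ordConnectedProj U ⟨t, htU⟩ := ordConnectedProj_eq.2 hseg
      rw [hc]
      simp only [dif_pos htU, this]
    refine HasDerivAt.congr_of_eventuallyEq ?_ e
    have hci : ContinuousOn γ (uIcc p s) := hγ.mono (by rwa [uIcc_comm])
    exact intervalIntegral.integral_hasDerivAt_right hci.intervalIntegrable
      (hγ.stronglyMeasurableAtFilter hU s hs) (hγ.continuousAt (hU.mem_nhds hs))
  refine ⟨c, ?_, hd⟩
  have e : c = U.piecewise c fun _ => 0 := by
    funext s
    by_cases hs : s ∈ U
    · rw [piecewise_eq_of_mem _ _ _ hs]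
    · rw [piecewise_eq_of_notMem _ _ _ hs, hc]
      simp only [dif_neg hs]
  rw [e]
  exact ContinuousOn.measurable_piecewise (fun s hs => (hd s hs).continuousAt.continuousWithinAt)
    continuousOn_const hU.measurableSet

theorem exists_factor {Ω : Set (ℝ × ℝ)} {F π : ℝ × ℝ → ℝ}
    (h : ∀ z ∈ Ω, ∀ z' ∈ Ω, π z = π z' → F z = F z') : ∃ γ : ℝ → ℝ, ∀ z ∈ Ω, F z = γ (π z) := by
  classical
  refine ⟨fun s => if h : ∃ z ∈ Ω, π z = s then F h.choose else 0, fun z hz => ?_⟩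
  have hex : ∃ z' ∈ Ω, π z' = π z := ⟨z, hz, rfl⟩
  simp only [dif_pos hex]
  exact h z hz _ hex.choose_spec.1 hex.choose_spec.2.symm

/-- A function constant on the fibres of π descends to the image of Ω; moving along e, with π e = 1,
gives local sections that carry openness and continuity over to the image. -/
theorem exists_primitive_of_factor {Ω : Set (ℝ × ℝ)} (hΩ : IsOpen Ω) {F : ℝ × ℝ → ℝ}
    (hF : ContinuousOn F Ω) (π : ℝ × ℝ →L[ℝ] ℝ) {e : ℝ × ℝ} (he : π e = 1)
    (h : ∀ z ∈ Ω, ∀ z' ∈ Ω, π z = π z' → F z = F z') :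
    ∃ c : ℝ → ℝ, Measurable c ∧ ∀ z ∈ Ω, HasDerivAt c (F z) (π z) := by
  obtain ⟨γ, hγ⟩ := exists_factor h
  have hloc : ∀ z ∈ Ω, ∀ᶠ s in nhds (π z), z + (s - π z) • e ∈ Ω := fun z hz => by
    have hc : Continuous fun s : ℝ => z + (s - π z) • e := by fun_prop
    exact hc.continuousAt.eventually (hΩ.mem_nhds (by simpa using hz))
  have hπ : ∀ z s, π (z + (s - π z) • e) = s := fun z s => by simp [he]
  have hU : IsOpen (π '' Ω) := isOpen_iff_mem_nhds.2 (by
    rintro _ ⟨z, hz, rfl⟩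
    filter_upwards [hloc z hz] with s hs using ⟨_, hs, hπ z s⟩)
  have hγc : ContinuousOn γ (π '' Ω) := by
    rintro _ ⟨z, hz, rfl⟩
    refine ContinuousAt.continuousWithinAt ?_
    have hc : Continuous fun s : ℝ => z + (s - π z) • e := by fun_prop
    have h1 : ContinuousAt F (z + (π z - π z) • e) := by
      simpa using hF.continuousAt (hΩ.mem_nhds hz)
    refine (ContinuousAt.comp (f := fun s : ℝ => z + (s - π z) • e) h1
      hc.continuousAt).congr ?_
    filter_upwards [hloc z hz] with s hs
    simp only [Function.comp, hγ _ hs, hπ]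
  obtain ⟨c, mc, hc⟩ := exists_primitive_of_continuousOn hU hγc
  exact ⟨c, mc, fun z hz => by rw [hγ z hz]; exact hc _ (mem_image_of_mem _ hz)⟩

theorem eq_of_hasDerivAt_zero {f : ℝ → ℝ} {a b : ℝ} (h : ∀ t ∈ uIcc a b, HasDerivAt f 0 t) :
    f a = f b := by
  have h := Convex.norm_image_sub_le_of_norm_hasDerivWithin_le (f := f) (f' := fun _ => 0)
    (s := uIcc a b) (C := 0) (fun t ht => (h t ht).hasDerivWithinAt) (fun t _ => by rw [norm_zero])
    (convex_uIcc _ _) right_mem_uIcc left_mem_uIcc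
  rwa [zero_mul, norm_le_zero_iff, sub_eq_zero] at h

theorem opD_eq_sub {Ω : Set (ℝ × ℝ)} (hΩ : IsOpen Ω) {S : ℝ × ℝ → ℝ} (hS : ContDiffOn ℝ ∞ S Ω)
    {z : ℝ × ℝ} (hz : z ∈ Ω) : opD S z =
      partialX (partialX (partialY S)) z - partialY (partialX (partialY S)) z := by
  have sY := hS.partialY hΩ
  rw [opD_eq_opQ hS hΩ hz, opQ, partialX_sub (sY.partialX hΩ) (sY.partialY hΩ) hΩ hz]
  simp only [partialX_partialY_comm sY hΩ hz]

/-- The kernel of the operator `D` on a set convex in the fibre directions. -/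
theorem exists_decomposition_of_opD_eq_zero {Ω : Set (ℝ × ℝ)} (hΩ : IsOpen Ω)
    (hconv : ∀ v ∈ fibreDirections, DirConvex v Ω) {W : ℝ × ℝ → ℝ} (hW : ContDiffOn ℝ ∞ W Ω)
    (h0 : ∀ z ∈ Ω, opD W z = 0) : ∃ a b c : ℝ → ℝ, Measurable b ∧ Measurable c ∧
      ∀ z ∈ Ω, W z = a z.1 + b z.2 + c (z.1 + z.2) := by
  have hX : DirConvex (1, 0) Ω := hconv _ (by simp [fibreDirections])
  have hY : DirConvex (0, 1) Ω := hconv _ (by simp [fibreDirections])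
  have hA : DirConvex (-1, 1) Ω := hconv _ (by simp [fibreDirections])
  have sY := hW.partialY hΩ
  set V := partialX (partialY W) with hV
  have sV : ContDiffOn ℝ ∞ V Ω := sY.partialX hΩ
  have hD : ∀ z ∈ Ω, partialX V z - partialY V z = 0 := fun z hz => by
    rw [← h0 z hz, opD_eq_sub hΩ hW hz]
  set π : ℝ × ℝ →L[ℝ] ℝ := ContinuousLinearMap.fst ℝ ℝ ℝ + ContinuousLinearMap.snd ℝ ℝ ℝ with hπ
  have eπ : ∀ z, π z = z.1 + z.2 := fun z => rfl
  -- ∂ₓ∂_yW is constant along antidiagonal segments, hence a function of x+y by antidiagonal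
  -- convexity. It is integrated here once and then a second time to give c.
  obtain ⟨c1, -, hc1⟩ := exists_primitive_of_factor hΩ sV.continuousOn π (e := (1, 0))
    (by simp [eπ]) (fun z hz z' hz' hzz => by
    rw [eπ, eπ] at hzz
    have hm : ∀ t ∈ uIcc z.2 z'.2, (z.1 + z.2, (0 : ℝ)) + t • ((-1 : ℝ), (1 : ℝ)) ∈ Ω := by
      intro t ht
      have := hA.antidiagonal (s := z.1 + z.2) (y := z.2) (y' := z'.2)
        (by rwa [add_sub_cancel_right]) (by rw [hzz]; rwa [add_sub_cancel_right]) ht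
      simpa [sub_eq_add_neg] using this
    have := eq_of_hasDerivAt_zero (f := fun t : ℝ => V ((z.1 + z.2, (0 : ℝ)) + t • ((-1 : ℝ), (1 : ℝ))))
      (a := z.2) (b := z'.2) (fun t ht => by
        have h := hasDerivAt_line sV hΩ (hm t ht)
        rw [show ((-1 : ℝ), (1 : ℝ)) = -((1 : ℝ), (-1 : ℝ)) by simp, map_neg] at h
        rw [show ((-1 : ℝ), (1 : ℝ)) = -((1 : ℝ), (-1 : ℝ)) by simp]
        rwa [fderiv_antidiagonal sV hΩ (by simpa using hm t ht), hD _ (by simpa using hm t ht),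
          neg_zero] at h)
    have e1 : (z.1 + z.2, (0 : ℝ)) + z.2 • ((-1 : ℝ), (1 : ℝ)) = z := by ext <;> simp
    have e2 : (z.1 + z.2, (0 : ℝ)) + z'.2 • ((-1 : ℝ), (1 : ℝ)) = z' := by rw [hzz]; ext <;> simp
    rwa [e1, e2] at this)
  have cc1 : ContinuousOn (fun z => c1 (π z)) Ω := fun z hz =>
    (ContinuousAt.comp (f := π) (hc1 z hz).continuousAt π.continuous.continuousAt).continuousWithinAt
  obtain ⟨c, mc, hc⟩ := exists_primitive_of_factor hΩ cc1 π (e := (1, 0)) (by simp [eπ])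
    (fun z _ z' _ hzz => by rw [hzz])
  -- The x-derivative of F is zero, so by horizontal convexity F depends on y alone.
  set F : ℝ × ℝ → ℝ := fun z => partialY W z - c1 (π z) with hF
  obtain ⟨b, mb, hb⟩ := exists_primitive_of_factor hΩ (F := F) (sY.continuousOn.sub cc1)
    (ContinuousLinearMap.snd ℝ ℝ ℝ) (e := (0, 1)) (by simp) (fun z hz z' hz' hzz => by
    obtain ⟨x, y⟩ := z
    obtain ⟨x', y'⟩ := z'
    obtain rfl : y = y' := hzz
    refine eq_of_hasDerivAt_zero (f := fun t => F (t, y)) fun t ht => ?_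
    have hm := hX.horizontal hz hz' ht
    have h2 := (hc1 _ hm).comp_add_const t y
    exact ((hasDerivAt_partialX sY hΩ hm).sub h2).congr_deriv (by rw [hV, sub_self]))
  -- What remains is constant on vertical segments. Measurability of a is not needed: in the
  -- application e^{ila(x)} leaves the inner integral as a factor of modulus one.
  obtain ⟨a, ha⟩ := exists_factor (Ω := Ω) (π := Prod.fst)
    (F := fun z => W z - c (π z) - b z.2) (fun z hz z' hz' hzz => by
    obtain ⟨x, y⟩ := z
    obtain ⟨x', y'⟩ := z'
    obtain rfl : x = x' := hzz
    refine eq_of_hasDerivAt_zero (f := fun t => W (x, t) - c (π (x, t)) - b t) fun t ht => ?_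
    have hm := hY.vertical hz hz' ht
    have h2 := (hc _ hm).comp_const_add x t
    exact (((hasDerivAt_partialY hW hΩ hm).sub h2).sub (hb _ hm)).congr_deriv (by rw [hF]; ring))
  refine ⟨a, b, c, mb, mc, fun z hz => ?_⟩
  rw [← ha z hz, ← eπ]
  ring

theorem opD_sub {Ω : Set (ℝ × ℝ)} (hΩ : IsOpen Ω) {S S' : ℝ × ℝ → ℝ} (hS : ContDiffOn ℝ ∞ S Ω)
    (hS' : ContDiffOn ℝ ∞ S' Ω) : EqOn (opD fun z => S z - S' z) (fun z => opD S z - opD S' z) Ω := by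
  have e1 : EqOn (fun z => partialX (fun z => S z - S' z) z - partialY (fun z => S z - S' z) z)
      (fun z => (partialX S z - partialY S z) - (partialX S' z - partialY S' z)) Ω := fun z hz => by
    simp only [partialX_sub hS hS' hΩ hz, partialY_sub hS hS' hΩ hz]
    ring
  have sS := (hS.partialX hΩ).sub (hS.partialY hΩ)
  have sS' := (hS'.partialX hΩ).sub (hS'.partialY hΩ)
  have e2 := (partialY_congr hΩ e1).trans (partialY_sub sS sS' hΩ)
  exact (partialX_congr hΩ e2).trans (partialX_sub (sS.partialY hΩ) (sS'.partialY hΩ) hΩ)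

end Decomposition

/-! ### Inserting an amplitude with one controlled vertical derivative. -/

section Amplitude

open Set ENNReal

theorem sq_lintegral_le {X : Type*} [MeasurableSpace X] (ν : Measure X) {F : X → ℝ≥0∞}
    (hF : AEMeasurable F ν) : (∫⁻ x, F x ∂ν) ^ 2 ≤ ν univ * ∫⁻ x, F x ^ 2 ∂ν := by
  have h := ENNReal.lintegral_mul_le_Lp_mul_Lq ν Real.HolderConjugate.two_two
    (f := fun _ => 1) aemeasurable_const hF
  simp only [Pi.mul_apply, one_mul, ENNReal.rpow_two] at h
  refine (pow_le_pow_left' h 2).trans (le_of_eq ?_)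
  have e : ∀ X : ℝ≥0∞, (X ^ (1 / 2 : ℝ)) ^ 2 = X := fun X => by
    rw [← ENNReal.rpow_natCast, ← ENNReal.rpow_mul]; norm_num
  rw [mul_pow, e, e]
  simp

/-- Removal of an amplitude by integrating its derivative. -/
theorem integral_amplitude_mul {ψ ψ1 k : ℝ → ℂ} {α w b : ℝ} (hψ : ∀ y, HasDerivAt ψ (ψ1 y) y)
    (m1 : Measurable ψ1) (h1 : ∀ y, ‖ψ1 y‖ ≤ b) (hk : IsCore k)
    (hks : ∀ y, k y ≠ 0 → y ∈ Ico α (α + w)) :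
    ∫ y, ψ y * k y = ψ α * (∫ y, k y) +
      ∫ u in Ioc α (α + w), ψ1 u * ∫ y, indicator (Ici u) k y := by
  have hb : 0 ≤ b := (norm_nonneg _).trans (h1 0)
  have hi : ∀ s : Set ℝ, volume s ≠ ⊤ → IntegrableOn ψ1 s := fun s hs =>
    Measure.integrableOn_of_bounded hs m1.aestronglyMeasurable (ae_of_all _ h1)
  -- On the support of k, ψ(y) = ψ(α) + ∫_α^y ψ', and the upper limit is moved into an indicator
  -- acting on k.
  have hpt : ∀ y, ψ y * k y = ψ α * k y + ∫ u in Ioc α (α + w), ψ1 u * indicator (Ici u) k y := by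
    intro y
    by_cases hy : k y = 0
    · have : ∀ u, indicator (Ici u) k y = 0 := fun u => indicator_apply_eq_zero.2 fun _ => hy
      simp [hy, this]
    have hyI := hks y hy
    have e : ∀ u, ψ1 u * indicator (Ici u) k y = indicator (Iic y) ψ1 u * k y := fun u => by
      by_cases hu : u ≤ y
      · rw [indicator_of_mem (mem_Ici.2 hu), indicator_of_mem (mem_Iic.2 hu)]
      · rw [indicator_of_notMem (mt mem_Ici.1 hu), indicator_of_notMem (mt mem_Iic.1 hu)]; simp
    have hf := intervalIntegral.integral_eq_sub_of_hasDerivAt (a := α) (b := y) (fun u _ => hψ u)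
      ((intervalIntegrable_iff_integrableOn_Ioc_of_le hyI.1).2 (hi _ (by simp)))
    rw [intervalIntegral.integral_of_le hyI.1] at hf
    simp only [e]
    rw [integral_mul_const, setIntegral_indicator measurableSet_Iic, Ioc_inter_Iic,
      min_eq_right hyI.2.le, hf]
    ring
  obtain ⟨Bk, hBk⟩ := hk.bdd
  have h2 : Integrable (fun z : ℝ × ℝ => ψ1 z.2 * indicator (Ici z.2) k z.1)
      (volume.prod (volume.restrict (Ioc α (α + w)))) := by
    have hd : Integrable (fun z : ℝ × ℝ => k z.1 * ψ1 z.2)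
        (volume.prod (volume.restrict (Ioc α (α + w)))) :=
      (hk.integrable volume).mul_prod (hi _ (by simp))
    refine hd.mono ?_ (ae_of_all _ fun z => ?_)
    · have : (fun z : ℝ × ℝ => indicator (Ici z.2) k z.1) =
          indicator {z : ℝ × ℝ | z.2 ≤ z.1} fun z => k z.1 := by
        funext z
        simp only [indicator_apply, mem_Ici, mem_ofPred_eq]
      exact ((m1.comp measurable_snd).mul (this ▸ (hk.meas.comp measurable_fst).indicator
        (measurableSet_le measurable_snd measurable_fst))).aestronglyMeasurable
    · rw [norm_mul, norm_mul, mul_comm]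
      gcongr
      exact norm_indicator_le_norm_self _ _
  simp only [hpt]
  rw [integral_add ((hk.integrable volume).const_mul _) h2.integral_prod_left, integral_const_mul,
    integral_integral_swap h2]
  simp only [integral_const_mul]

theorem lintegral_superposition_le {J : Measure ℝ} [SFinite J] {F : ℝ → ℝ → ℝ≥0∞} {M : ℝ≥0∞}
    (mF : Measurable fun z : ℝ × ℝ => F z.2 z.1) (hF : ∀ u, ∫⁻ x, F u x ≤ M) (a b c : ℝ≥0∞) (α : ℝ) :
    ∫⁻ x, 2 * (a * F α x + b * (c * ∫⁻ u, F u x ∂J)) ≤ 2 * (a * M + b * (c * (M * J univ))) := by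
  have mα : Measurable fun x => F α x := mF.comp (by fun_prop : Measurable fun x : ℝ => (x, α))
  have mi : Measurable fun x => ∫⁻ u, F u x ∂J := mF.lintegral_prod_right'
  have ms : Measurable fun x => a * F α x + b * (c * ∫⁻ u, F u x ∂J) :=
    (mα.const_mul _).add ((mi.const_mul _).const_mul _)
  rw [lintegral_const_mul _ ms,
    lintegral_add_left (mα.const_mul _), lintegral_const_mul _ mα,
    lintegral_const_mul _ (mi.const_mul _), lintegral_const_mul _ mi,
    lintegral_lintegral_swap mF.aemeasurable]
  gcongr
  · exact hF α
  · refine (lintegral_mono hF).trans (le_of_eq ?_)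
    rw [lintegral_const]

/-- The bilinear estimate with an amplitude. -/
theorem RowPhase.exists_lintegral_sq_oscAmp_le {B p q : ℝ} (hB : 0 ≤ B) (hp : 2 < p) (hp' : p < 4)
    (hq : 2 < q) (hq' : q < 4) (hpq : 1 / p + 1 / q = 3 / 4) : ∃ C : ℝ, 0 < C ∧
    ∀ (m w A : ℝ) (S : ℝ × ℝ → ℝ) (ψ ψ1 : ℝ × ℝ → ℂ), 0 < m → 0 < w → RowPhase m B w S →
    Measurable ψ → Measurable ψ1 → (∀ x y, HasDerivAt (fun t => ψ (x, t)) (ψ1 (x, y)) y) →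
    (∀ z, ‖ψ z‖ ≤ A) → (∀ z, ‖ψ1 z‖ ≤ A / w) → ∀ l : ℝ, l ≠ 0 →
    ∀ (α : ℝ) (g h : ℝ → ℂ), IsCore g → IsCore h → (∀ y, g y ≠ 0 → y ∈ Ico α (α + w)) →
    ∫⁻ x, ‖∫ y, oscAmp l S ψ (x, y) * (g y * h (x + y))‖ₑ ^ 2 ≤
      ENNReal.ofReal (C * A ^ 2 * (|l| * m) ^ (-(1 / 2) : ℝ)) * ((∫⁻ y, ‖g y‖ₑ ^ p) ^ (2 / p) *
        (∑' k : ℤ, (∫⁻ s in window w k, ‖h s‖ₑ ^ q) ^ (4 / q)) ^ (1 / 2 : ℝ)) := by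
  obtain ⟨C, hC, hrow⟩ := RowPhase.exists_lintegral_sq_le hB hp hp' hq hq' hpq
  refine ⟨4 * C, by positivity, fun m w A S ψ ψ1 hm hw hS mψ mψ1 dψ bψ bψ1 l hl α g h hg hh hgs => ?_⟩
  have hA : 0 ≤ A := (norm_nonneg _).trans (bψ 0)
  have cS := hS.smooth.continuous
  set e : ℝ × ℝ → ℂ := fun z => Complex.exp (Complex.I * ((l * S z : ℝ) : ℂ)) with he
  have ce : Continuous e := by fun_prop
  -- Each T_u is the operator without amplitude applied to a truncation of g, hence satisfies the
  -- same bound. The superposition has density at most A/w over a length w, so the loss is a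
  -- constant times A².
  set T : ℝ → ℝ → ℂ := fun u x => ∫ y, e (x, y) * (indicator (Ici u) g y * h (x + y)) with hT
  set J : Measure ℝ := volume.restrict (Ioc α (α + w)) with hJ
  have mT : Measurable fun z : ℝ × ℝ => T z.2 z.1 := by
    have e1 : ∀ z : ℝ × ℝ, ∀ y, indicator (Ici z.2) g y =
        indicator {p : (ℝ × ℝ) × ℝ | p.1.2 ≤ p.2} (fun p => g p.2) (z, y) := fun z y => by
      simp only [indicator_apply, mem_Ici, mem_ofPred_eq]
    have m0 : Measurable fun p : (ℝ × ℝ) × ℝ => e (p.1.1, p.2) *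
        (indicator {p : (ℝ × ℝ) × ℝ | p.1.2 ≤ p.2} (fun p => g p.2) p * h (p.1.1 + p.2)) :=
      (ce.measurable.comp (by fun_prop)).mul (((hg.meas.comp measurable_snd).indicator
        (measurableSet_le (by fun_prop) (by fun_prop))).mul (hh.meas.comp (by fun_prop)))
    simp only [hT, e1]
    exact m0.stronglyMeasurable.integral_prod_right'.measurable
  have hpt : ∀ x, ‖∫ y, oscAmp l S ψ (x, y) * (g y * h (x + y))‖ₑ ^ 2 ≤
      2 * (ENNReal.ofReal A ^ 2 * ‖T α x‖ₑ ^ 2 +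
        ENNReal.ofReal (A / w) ^ 2 * (ENNReal.ofReal w * ∫⁻ u, ‖T u x‖ₑ ^ 2 ∂J)) := by
    intro x
    have hk : IsCore fun y => e (x, y) * (g y * h (x + y)) := by
      obtain ⟨Bh, hBh⟩ := hh.bdd
      have := (hg.mul_bounded (u := fun y => h (x + y)) (hh.meas.comp (by fun_prop))
        fun y => hBh _).mul_bounded (u := fun y => e (x, y)) (ce.measurable.comp (by fun_prop))
        fun y => (norm_exp_I_mul _).le
      simpa only [mul_comm] using this
    have key := integral_amplitude_mul (w := w) (α := α) (dψ x) (mψ1.comp (by fun_prop))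
      (fun y => bψ1 (x, y)) hk (fun y hy => hgs y (left_ne_zero_of_mul (right_ne_zero_of_mul hy)))
    have e2 : ∀ u, ∫ y, indicator (Ici u) (fun y => e (x, y) * (g y * h (x + y))) y = T u x :=
      fun u => by
      rw [hT]
      refine integral_congr_ae (ae_of_all _ fun y => ?_)
      by_cases hy : y ∈ Ici u
      · simp only [indicator_of_mem hy]
      · simp only [indicator_of_notMem hy]; ring
    have e3 : ∫ y, e (x, y) * (g y * h (x + y)) = T α x := by
      rw [hT]
      refine integral_congr_ae (ae_of_all _ fun y => ?_)
      by_cases hy : g y = 0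
      · have : indicator (Ici α) g y = 0 := indicator_apply_eq_zero.2 fun _ => hy
        simp only [this, hy]
      · simp only [indicator_of_mem (mem_Ici.2 (hgs y hy).1)]
    have e4 : ∫ y, oscAmp l S ψ (x, y) * (g y * h (x + y)) =
        ∫ y, ψ (x, y) * (e (x, y) * (g y * h (x + y))) := by
      refine integral_congr_ae (ae_of_all _ fun y => ?_)
      simp only [oscAmp, he]
      ring
    simp only [e2, e3] at key
    rw [e4, key]
    have h1 : ‖ψ (x, α) * T α x + ∫ u in Ioc α (α + w), ψ1 (x, u) * T u x‖ₑ ≤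
        ENNReal.ofReal A * ‖T α x‖ₑ + ENNReal.ofReal (A / w) * ∫⁻ u, ‖T u x‖ₑ ∂J := by
      refine (enorm_add_le _ _).trans (add_le_add ?_ ?_)
      · rw [enorm_mul, ← ofReal_norm]
        exact mul_le_mul' (ENNReal.ofReal_le_ofReal (bψ _)) le_rfl
      · refine (enorm_integral_le_lintegral_enorm _).trans ?_
        rw [← lintegral_const_mul' _ _ ENNReal.ofReal_ne_top]
        refine lintegral_mono fun u => ?_
        rw [enorm_mul, ← ofReal_norm]
        exact mul_le_mul' (ENNReal.ofReal_le_ofReal (bψ1 _)) le_rfl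
    have h2 := sq_lintegral_le J (F := fun u => ‖T u x‖ₑ)
      (mT.comp (by fun_prop : Measurable fun u : ℝ => (x, u))).enorm.aemeasurable
    have hJw : J univ = ENNReal.ofReal w := by
      rw [hJ, Measure.restrict_apply_univ, Real.volume_Ioc, add_sub_cancel_left]
    rw [hJw] at h2
    have h3 := ENNReal.rpow_add_le_mul_rpow_add_rpow (ENNReal.ofReal A * ‖T α x‖ₑ)
      (ENNReal.ofReal (A / w) * ∫⁻ u, ‖T u x‖ₑ ∂J) (p := 2) (by norm_num)
    norm_num at h3
    refine (pow_le_pow_left' h1 2).trans (h3.trans ?_)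
    rw [mul_pow, mul_pow]
    gcongr
  set M := ENNReal.ofReal (C * (|l| * m) ^ (-(1 / 2) : ℝ)) * ((∫⁻ y, ‖g y‖ₑ ^ p) ^ (2 / p) *
        (∑' k : ℤ, (∫⁻ s in window w k, ‖h s‖ₑ ^ q) ^ (4 / q)) ^ (1 / 2 : ℝ)) with hM
  have hTM : ∀ u, ∫⁻ x, ‖T u x‖ₑ ^ 2 ≤ M := fun u => by
    refine (hrow m w S hm hw hS l hl α _ h (hg.indicator measurableSet_Ici) hh
      fun y hy => hgs y fun h0 => hy (indicator_apply_eq_zero.2 fun _ => h0)).trans ?_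
    rw [hM]
    gcongr with y
    exact enorm_indicator_le_enorm_self _ _
  have h5 := lintegral_superposition_le (J := J) (F := fun u x => ‖T u x‖ₑ ^ 2)
    (mT.enorm.pow_const 2) hTM (ENNReal.ofReal A ^ 2) (ENNReal.ofReal (A / w) ^ 2)
    (ENNReal.ofReal w) α
  refine (lintegral_mono hpt).trans (h5.trans (le_of_eq ?_))
  have hJw : J univ = ENNReal.ofReal w := by
    rw [hJ, Measure.restrict_apply_univ, Real.volume_Ioc, add_sub_cancel_left]
  have h6 : ∀ M : ℝ≥0∞, 2 * (ENNReal.ofReal A ^ 2 * M + ENNReal.ofReal (A / w) ^ 2 *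
      (ENNReal.ofReal w * (M * ENNReal.ofReal w))) = ENNReal.ofReal (4 * A ^ 2) * M := fun M => by
    rw [show ENNReal.ofReal (A / w) ^ 2 * (ENNReal.ofReal w * (M * ENNReal.ofReal w)) =
      (ENNReal.ofReal (A / w) * ENNReal.ofReal w) ^ 2 * M by ring,
      ← ENNReal.ofReal_mul (by positivity), div_mul_cancel₀ _ hw.ne', ← add_mul, ← mul_assoc,
      ← two_mul, ← mul_assoc, ENNReal.ofReal_mul (by norm_num), ENNReal.ofReal_pow hA]
    norm_num
  rw [hJw, h6, hM, ← mul_assoc, ← ENNReal.ofReal_mul (by positivity)]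
  congr 2
  ring

end Amplitude

/-! ### The estimate on a region, for g in one short interval. -/

section Region

open Set

/-- Normalised hypotheses on an open region which is convex in the fibre directions, together with
an amplitude `ψ` with vertical derivative `ψ1`. -/
structure RegionHyp (A c K δ μ : ℝ) (Ω : Set (ℝ × ℝ)) (S : ℝ × ℝ → ℝ) (ψ ψ1 : ℝ × ℝ → ℂ) :
    Prop where
  pos_δ : 0 < δ
  pos_μ : 0 < μ
  isOpen : IsOpen Ω
  bounded : Bornology.IsBounded Ω
  convex : ∀ v ∈ fibreDirections, DirConvex v Ω
  phase : ContDiffOn ℝ ∞ S Ω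
  lower : ∀ z ∈ Ω, c * μ ≤ opD S z
  upper1 : ∀ z ∈ Ω, |partialY (opD S) z| ≤ K * (μ / δ)
  upper2 : ∀ z ∈ Ω, |partialY (partialY (opD S)) z| ≤ K * (μ / δ ^ 2)
  compact : ∃ K0 ⊆ Ω, IsCompact K0 ∧ ∀ z ∉ K0, ψ z = 0
  meas : Measurable ψ
  meas1 : Measurable ψ1
  deriv : ∀ x y, HasDerivAt (fun t => ψ (x, t)) (ψ1 (x, y)) y
  bound : ∀ z, ‖ψ z‖ ≤ A
  bound1 : ∀ z, ‖ψ1 z‖ ≤ A / δ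
  width : ∀ x y y', ψ (x, y) ≠ 0 → ψ (x, y') ≠ 0 → |y - y'| ≤ δ

theorem DirConvex.inter {v : ℝ × ℝ} {X Y : Set (ℝ × ℝ)} (hX : DirConvex v X) (hY : DirConvex v Y) :
    DirConvex v (X ∩ Y) := fun a ha b hb h =>
  subset_inter (hX a ha.1 b hb.1 h) (hY a ha.2 b hb.2 h)

theorem Convex.dirConvex {X : Set (ℝ × ℝ)} (hX : Convex ℝ X) (v : ℝ × ℝ) : DirConvex v X :=
  fun _ ha _ hb _ => hX.segment_subset ha hb

/-- Points at distance more than `ε` from the complement form a set with the same directions of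
convexity. -/
theorem DirConvex.lt_infDist_compl {v : ℝ × ℝ} {X : Set (ℝ × ℝ)} (hX : DirConvex v X)
    (hne : Xᶜ.Nonempty) (ε : ℝ) : DirConvex v {z | ε < Metric.infDist z Xᶜ} := by
  rintro a ha b hb ⟨r, hr⟩ z ⟨s, t, hs, ht, hst, rfl⟩
  refine lt_of_lt_of_le (lt_min ha hb) ((Metric.le_infDist hne).2 fun y hy => ?_)
  by_contra! hlt
  -- If y were too close, translating both endpoints by e would keep them in X; convexity of X would
  -- then put y, a point of the translated segment, in X.
  set e := y - (s • a + t • b) with he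
  have hn : dist (s • a + t • b) y = ‖e‖ := by rw [dist_comm, dist_eq_norm]
  rw [hn, lt_min_iff] at hlt
  have hmem : ∀ c, ‖e‖ < Metric.infDist c Xᶜ → c + e ∈ X := fun c hc => by
    by_contra hc'
    have hd : dist c (c + e) < Metric.infDist c Xᶜ := by rwa [dist_self_add_right]
    exact Metric.notMem_of_dist_lt_infDist hd hc'
  refine hy (hX _ (hmem a hlt.1) _ (hmem b hlt.2) ⟨r, by rw [add_sub_add_right_eq_sub, hr]⟩
    ⟨s, t, hs, ht, hst, ?_⟩)
  rw [smul_add, smul_add, add_add_add_comm, ← add_smul, hst, one_smul, he]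
  abel

/-- Sets of points deeper than a given depth in Ω shrink it while preserving every direction of
convexity; depths ε/3 and ε/2 leave room for cutoffs at both stages. -/
theorem exists_inner_regions {Ω K0 : Set (ℝ × ℝ)} (hΩ : IsOpen Ω) (hb : Bornology.IsBounded Ω)
    (hK : IsCompact K0) (hKΩ : K0 ⊆ Ω) : ∃ Ω1 Ω2 : Set (ℝ × ℝ), IsOpen Ω1 ∧ IsOpen Ω2 ∧ K0 ⊆ Ω2 ∧
      closure Ω2 ⊆ Ω1 ∧ closure Ω1 ⊆ Ω ∧ IsCompact (closure Ω2) ∧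
      ∀ v, DirConvex v Ω → DirConvex v Ω1 ∧ DirConvex v Ω2 := by
  have hne : Ωᶜ.Nonempty := by
    rw [nonempty_compl]
    rintro rfl
    exact NormedSpace.unbounded_univ ℝ (ℝ × ℝ) hb
  obtain ⟨ε, hε, hth⟩ := hK.exists_cthickening_subset_open hΩ hKΩ
  have hinf : ∀ z ∈ K0, ε ≤ Metric.infDist z Ωᶜ := fun z hz =>
    (Metric.le_infDist hne).2 fun y hy => by
      by_contra! hlt
      exact hy (hth (Metric.mem_cthickening_of_dist_le y z ε K0 hz (by rw [dist_comm]; exact hlt.le)))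
  have hc := Metric.continuous_infDist_pt (Ωᶜ)
  have ho : ∀ r, IsOpen {z | r < Metric.infDist z Ωᶜ} := fun r => isOpen_lt continuous_const hc
  have hcl : ∀ r, closure {z | r < Metric.infDist z Ωᶜ} ⊆ {z | r ≤ Metric.infDist z Ωᶜ} := fun r =>
    closure_minimal (fun z hz => (show r < _ from hz).le) (isClosed_le continuous_const hc)
  have hsub : ∀ r, 0 < r → {z | r ≤ Metric.infDist z Ωᶜ} ⊆ Ω := fun r hr z hz => by
    by_contra hz'
    have := Metric.infDist_zero_of_mem (s := Ωᶜ) hz'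
    rw [mem_ofPred_eq, this] at hz
    linarith
  refine ⟨_, _, ho (ε / 3), ho (ε / 2), fun z hz => ?_, (hcl _).trans fun z hz => ?_,
    (hcl _).trans (hsub _ (by positivity)), ?_, fun v hv => ⟨hv.lt_infDist_compl hne _,
      hv.lt_infDist_compl hne _⟩⟩
  · have := hinf z hz
    exact lt_of_lt_of_le (by linarith) this
  · exact lt_of_lt_of_le (by linarith : ε / 3 < ε / 2) hz
  · exact Metric.isCompact_of_isClosed_isBounded isClosed_closure
      (hb.subset ((hcl _).trans (hsub _ (by positivity))))

/-- The bilinear estimate on a region, for a function supported in a short interval. -/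
theorem RegionHyp.exists_row_le {A c K : ℝ} (hA : 0 < A) (hc : 0 < c) (hK : 0 < K) :
    ∃ κ : ℝ, 0 < κ ∧ κ ≤ 1 ∧ ∀ p q : ℝ, 2 < p → p < 4 → 2 < q → q < 4 → 1 / p + 1 / q = 3 / 4 →
      ∃ C : ℝ, 0 < C ∧ ∀ (δ μ : ℝ) (Ω : Set (ℝ × ℝ)) (S : ℝ × ℝ → ℝ)
      (ψ ψ1 : ℝ × ℝ → ℂ), RegionHyp A c K δ μ Ω S ψ ψ1 → ∀ l : ℝ, l ≠ 0 → ∀ (α : ℝ) (g h : ℝ → ℂ),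
      IsCore g → IsCore h → (∀ y, g y ≠ 0 → y ∈ Ico α (α + κ * δ)) →
      ∫⁻ x, ‖∫ y, oscAmp l S ψ (x, y) * (g y * h (x + y))‖ₑ ^ 2 ≤
        ENNReal.ofReal (C * |l * μ| ^ (-(1 / 2) : ℝ)) * ((∫⁻ y, ‖g y‖ₑ ^ p) ^ (2 / p) *
          (∑' k : ℤ, (∫⁻ s in window (κ * δ) k, ‖h s‖ₑ ^ q) ^ (4 / q)) ^ (1 / 2 : ℝ)) := by
  obtain ⟨κ, B, hκ, hκ1, hB, hext⟩ := exists_rowPhase_extension hc hK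
  refine ⟨κ, hκ, hκ1, fun p q hp hp' hq hq' hpq => ?_⟩
  obtain ⟨C, hC, hrow⟩ := RowPhase.exists_lintegral_sq_oscAmp_le hB hp hp' hq hq' hpq
  refine ⟨C * A ^ 2 * (c / 2) ^ (-(1 / 2) : ℝ), by positivity, ?_⟩
  intro δ μ Ω S ψ ψ1 H l hl α g h hg hh hgs
  have hδ := H.pos_δ
  have hμ := H.pos_μ
  set w := κ * δ with hw
  have hwp : 0 < w := by positivity
  have hwδ : w ≤ δ := by rw [hw]; nlinarith
  obtain ⟨K0, hK0, cK0, zK0⟩ := H.compact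
  obtain ⟨Ω1, Ω2, o1, o2, k2, c21, c1, cc2, hdir⟩ := exists_inner_regions H.isOpen H.bounded cK0 hK0
  set y0 := α + w / 2 with hy0
  obtain ⟨S', hS', eS'⟩ := hext δ μ y0 Ω Ω1 Ω2 (opD S) hδ hμ H.isOpen o1
    (hdir _ (H.convex _ (by simp [fibreDirections]))).1 c1 cc2 c21 (H.phase.opD H.isOpen) H.lower
    H.upper1 H.upper2
  -- The strip is convex, so Ω3 keeps the three directions of convexity, and on it S and the phase
  -- on the plane have the same image under D.
  set Ω3 := Ω2 ∩ (Prod.snd ⁻¹' Metric.ball y0 (3 / 2 * w)) with hΩ3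
  have o3 : IsOpen Ω3 := o2.inter (Metric.isOpen_ball.preimage continuous_snd)
  have h3 : Ω3 ⊆ Ω := fun z hz => c1 (subset_closure (c21 (subset_closure hz.1)))
  have sS := H.phase.mono h3
  have sS' : ContDiffOn ℝ ∞ S' Ω3 := hS'.smooth.contDiffOn
  obtain ⟨a, b, d, mb, md, hdec⟩ := exists_decomposition_of_opD_eq_zero o3 (fun v hv =>
    (hdir v (H.convex v hv)).2.inter (Convex.dirConvex
      ((convex_ball y0 _).linear_preimage (LinearMap.snd ℝ ℝ ℝ)) v)) (sS.sub sS') (fun z hz => by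
    have hz2 : |z.2 - y0| ≤ 3 / 2 * w := by
      have := hz.2
      rw [mem_preimage, Metric.mem_ball, Real.dist_eq] at this
      exact this.le
    have h1 := opD_sub o3 sS sS' hz
    simp only [eS' ⟨hz.1, hz2⟩, sub_self] at h1
    exact h1)
  set e : (ℝ → ℝ) → ℝ → ℂ := fun u t => Complex.exp (Complex.I * ((l * u t : ℝ) : ℂ)) with he
  have me : ∀ u, Measurable u → Measurable (e u) := fun u hu => by fun_prop
  have ne : ∀ u t, ‖e u t‖ = 1 := fun u t => norm_exp_I_mul _
  have hg' : IsCore fun y => g y * e b y := hg.mul_bounded (me b mb) fun y => (ne b y).le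
  have hh' : IsCore fun y => h y * e d y := hh.mul_bounded (me d md) fun y => (ne d y).le
  -- The summands in y and x+y are absorbed into g and h without changing their moduli; the summand
  -- in x drops out on taking absolute values.
  have hpt : ∀ x y, oscAmp l S ψ (x, y) * (g y * h (x + y)) =
      e a x * (oscAmp l S' ψ (x, y) * ((g y * e b y) * (h (x + y) * e d (x + y)))) := by
    intro x y
    by_cases hψ : ψ (x, y) = 0
    · simp [oscAmp, hψ]
    by_cases hgy : g y = 0
    · simp [hgy]
    have hz : (x, y) ∈ Ω3 := by
      refine ⟨k2 (by by_contra hn; exact hψ (zK0 _ hn)), ?_⟩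
      have := hgs y hgy
      rw [mem_preimage, Metric.mem_ball, Real.dist_eq, abs_lt]
      exact ⟨by linarith [this.1], by linarith [this.2]⟩
    have hS : S (x, y) = S' (x, y) + (a x + b y + d (x + y)) := by linarith [hdec _ hz]
    have : Complex.exp (Complex.I * ((l * S (x, y) : ℝ) : ℂ)) =
        Complex.exp (Complex.I * ((l * S' (x, y) : ℝ) : ℂ)) * (e a x * e b y * e d (x + y)) := by
      simp only [he]
      rw [← Complex.exp_add, ← Complex.exp_add, ← Complex.exp_add, hS]
      congr 1
      push_cast
      ring
    simp only [oscAmp, this]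
    ring
  have key := hrow (c * μ / 2) w A S' ψ ψ1 (by positivity) hwp hS' H.meas H.meas1 H.deriv H.bound
    (fun z => (H.bound1 z).trans (by gcongr)) l hl α _ _ hg' hh'
    (fun y hy => hgs y (left_ne_zero_of_mul hy))
  have en : ∀ (u : ℝ → ℝ) (f : ℝ → ℂ) t, ‖f t * e u t‖ₑ = ‖f t‖ₑ := fun u f t => by
    rw [← ofReal_norm, norm_mul, ne, mul_one, ofReal_norm]
  simp only [en] at key
  refine le_trans (le_of_eq ?_) (key.trans (le_of_eq ?_))
  · refine lintegral_congr fun x => ?_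
    simp only [hpt]
    rw [integral_const_mul, mul_comm]
    exact congrArg (· ^ 2) (en a (fun _ => _) x)
  · congr 2
    rw [abs_mul, abs_of_pos hμ, show |l| * (c * μ / 2) = c / 2 * (|l| * μ) by ring,
      Real.mul_rpow (by positivity) (by positivity)]
    ring

end Region

/-! ### The involution exchanging the roles of g and h. -/

section Column

open Set

/-- The linear involution exchanging the horizontal and the antidiagonal directions. -/
def fibreSwap : ℝ × ℝ →L[ℝ] ℝ × ℝ :=
  (-ContinuousLinearMap.fst ℝ ℝ ℝ).prod (ContinuousLinearMap.fst ℝ ℝ ℝ + ContinuousLinearMap.snd ℝ ℝ ℝ)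

theorem fibreSwap_apply (z : ℝ × ℝ) : fibreSwap z = (-z.1, z.1 + z.2) := rfl

theorem fibreSwap_involutive : Function.Involutive fibreSwap := fun z => by
  ext <;> simp [fibreSwap_apply]

theorem partialY_comp_fibreSwap (F : ℝ × ℝ → ℝ) :
    (partialY fun z => F (fibreSwap z)) = fun z => partialY F (fibreSwap z) :=
  funext fun z => deriv_comp_const_add (fun t => F (-z.1, t)) z.1 z.2

theorem partialX_comp_fibreSwap {Ω : Set (ℝ × ℝ)} (hΩ : IsOpen Ω) {F : ℝ × ℝ → ℝ}
    (hF : ContDiffOn ℝ ∞ F Ω) :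
    EqOn (partialX fun z => F (fibreSwap z))
      (fun z => partialY F (fibreSwap z) - partialX F (fibreSwap z)) (fibreSwap ⁻¹' Ω) := fun z hz => by
  have e : ∀ t : ℝ, ((0 : ℝ), z.2) + t • ((-1 : ℝ), (1 : ℝ)) = fibreSwap (t, z.2) := fun t => by
    rw [fibreSwap_apply]; ext <;> simp [add_comm]
  have h := hasDerivAt_line hF hΩ (z := (0, z.2)) (v := (-1, 1)) (t := z.1) (by rw [e]; exact hz)
  simp only [e] at h
  rw [show ((-1 : ℝ), (1 : ℝ)) = -((1 : ℝ), (-1 : ℝ)) by simp, map_neg,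
    fderiv_antidiagonal hF hΩ hz, neg_sub] at h
  exact h.deriv

/-- Under the substitution ∂_y is unchanged, ∂ₓ becomes ∂_y-∂ₓ and ∂ₓ-∂_y becomes -∂ₓ; the two signs
cancel in the product. -/
theorem opD_comp_fibreSwap {Ω : Set (ℝ × ℝ)} (hΩ : IsOpen Ω) {S : ℝ × ℝ → ℝ}
    (hS : ContDiffOn ℝ ∞ S Ω) :
    EqOn (opD fun z => S (fibreSwap z)) (fun z => opD S (fibreSwap z)) (fibreSwap ⁻¹' Ω) := by
  have hΩ' : IsOpen (fibreSwap ⁻¹' Ω) := hΩ.preimage fibreSwap.continuous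
  have hS' : ContDiffOn ℝ ∞ (fun z => S (fibreSwap z)) (fibreSwap ⁻¹' Ω) :=
    hS.comp fibreSwap.contDiff.contDiffOn fun _ h => h
  have sY := hS.partialY hΩ
  intro z hz
  set U : ℝ × ℝ → ℝ := fun z => partialY (partialY S) z - partialX (partialY S) z with hU
  have sU : ContDiffOn ℝ ∞ U Ω := (sY.partialY hΩ).sub (sY.partialX hΩ)
  have e1 : EqOn (partialX (partialY fun z => S (fibreSwap z))) (fun z => U (fibreSwap z))
      (fibreSwap ⁻¹' Ω) := fun z hz => by
    rw [partialY_comp_fibreSwap, partialX_comp_fibreSwap hΩ sY hz]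
  have e2 : partialX U (fibreSwap z) = partialY (partialX (partialY S)) (fibreSwap z) -
      partialX (partialX (partialY S)) (fibreSwap z) := by
    rw [← partialX_partialY_comm sY hΩ hz]
    exact partialX_sub (sY.partialY hΩ) (sY.partialX hΩ) hΩ hz
  rw [opD_eq_sub hΩ' hS' hz, partialX_congr hΩ' e1 hz, partialY_congr hΩ' e1 hz,
    partialX_comp_fibreSwap hΩ sU hz, partialY_comp_fibreSwap]
  simp only [e2, opD_eq_sub hΩ hS hz]
  ring

/-- All quantitative hypotheses involve only D and vertical derivatives or differences, which the
involution preserves, and it permutes the three directions up to sign. -/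
theorem RegionHyp.comp_fibreSwap {A c K δ μ : ℝ} {Ω : Set (ℝ × ℝ)} {S : ℝ × ℝ → ℝ}
    {ψ ψ1 : ℝ × ℝ → ℂ} (H : RegionHyp A c K δ μ Ω S ψ ψ1) :
    RegionHyp A c K δ μ (fibreSwap ⁻¹' Ω) (fun z => S (fibreSwap z)) (fun z => ψ (fibreSwap z))
      (fun z => ψ1 (fibreSwap z)) := by
  have hΩ' : IsOpen (fibreSwap ⁻¹' Ω) := H.isOpen.preimage fibreSwap.continuous
  have eD := opD_comp_fibreSwap H.isOpen H.phase
  have eY := partialY_congr hΩ' eD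
  have eYY := partialY_congr hΩ' eY
  rw [partialY_comp_fibreSwap] at eY eYY
  rw [partialY_comp_fibreSwap] at eYY
  obtain ⟨K0, hK0, cK0, zK0⟩ := H.compact
  have him : ∀ X, fibreSwap ⁻¹' X = fibreSwap '' X := fun X =>
    (fibreSwap_involutive.image_eq_preimage_symm ▸ rfl)
  have hdir : ∀ v, DirConvex (fibreSwap v) Ω → DirConvex v (fibreSwap ⁻¹' Ω) := by
    rintro v hv a ha b hb ⟨r, hr⟩ z ⟨s, t, hs, ht, hst, rfl⟩
    refine hv _ ha _ hb ⟨r, by rw [← map_sub, hr, map_smul]⟩ ⟨s, t, hs, ht, hst, ?_⟩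
    rw [map_add, map_smul, map_smul]
  refine ⟨H.pos_δ, H.pos_μ, hΩ', ?_, fun v hv => hdir v (H.convex _ ?_),
    H.phase.comp fibreSwap.contDiff.contDiffOn fun _ h => h, fun z hz => ?_, fun z hz => ?_,
    fun z hz => ?_, ⟨fibreSwap ⁻¹' K0, preimage_mono hK0, ?_, fun z hz => zK0 _ hz⟩,
    H.meas.comp fibreSwap.continuous.measurable, H.meas1.comp fibreSwap.continuous.measurable,
    fun x y => (H.deriv (-x) (x + y)).comp_const_add x y, fun z => H.bound _, fun z => H.bound1 _,
    fun x y y' h h' => ?_⟩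
  · rw [him]; exact fibreSwap.lipschitz.isBounded_image H.bounded
  · simp only [fibreDirections, mem_insert_iff, mem_singleton_iff] at hv ⊢
    rcases hv with rfl | rfl | rfl <;> simp [fibreSwap_apply]
  · rw [eD hz]; exact H.lower _ hz
  · rw [eY hz]; exact H.upper1 _ hz
  · rw [eYY hz]; exact H.upper2 _ hz
  · rw [him]; exact cK0.image fibreSwap.continuous
  · have := H.width (-x) (x + y) (x + y') h h'
    rwa [add_sub_add_left_eq_sub] at this

/-- Translating y by x and reflecting x exchanges the arguments y and x+y, so an estimate for the
swapped region is one for the original operator with its inputs exchanged. -/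
theorem lintegral_sq_comp_fibreSwap (l : ℝ) (S : ℝ × ℝ → ℝ) (ψ : ℝ × ℝ → ℂ) (G : ℝ → ℝ → ℂ) :
    ∫⁻ x, ‖∫ y, oscAmp l (fun z => S (fibreSwap z)) (fun z => ψ (fibreSwap z)) (x, y) *
      G (x + y) y‖ₑ ^ 2 = ∫⁻ x, ‖∫ y, oscAmp l S ψ (x, y) * G y (x + y)‖ₑ ^ 2 := by
  rw [← lintegral_neg_eq_self fun x => ‖∫ y, oscAmp l S ψ (x, y) * G y (x + y)‖ₑ ^ 2]
  refine lintegral_congr fun x => ?_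
  rw [← integral_add_left_eq_self (fun y => oscAmp l S ψ (-x, y) * G y (-x + y)) x]
  congr 3
  funext y
  simp only [oscAmp, fibreSwap_apply, neg_add_cancel_left]

end Column

/-! ### Summation over windows. -/

section WindowSum

open Set ENNReal

theorem tsum_lintegral_window_le (w : ℝ) (u : ℝ → ℝ≥0∞) :
    ∑' k : ℤ, ∫⁻ s in window w k, u s ≤ ∫⁻ s, u s := by
  rw [← lintegral_iUnion (measurableSet_window w) fun i j hij =>
    disjoint_left.2 fun s (hi : _ = i) (hj : _ = j) => hij (hi.symm.trans hj)]
  exact setLIntegral_le_lintegral _ _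

theorem tsum_rpow_mul_le {p q : ℝ} (hp : 0 < p) (hq : 0 < q) (hq' : q < 4)
    (hpq : 1 / p + 1 / q = 3 / 4) {a b : ℤ → ℝ≥0∞} {A0 B0 : ℝ≥0∞} (hA0 : A0 ≠ 0) (hA : A0 ≠ ⊤)
    (ha : ∑' j, a j ≤ A0) (hb : ∑' k, b k ≤ B0) {r : ℤ → ℤ → Prop} [∀ j k, Decidable (r j k)]
    (hr : ∀ j k, r j k → b k ≤ a j * (B0 / A0)) :
    ∑' j, a j ^ (2 / p) * (∑' k, (if r j k then b k else 0) ^ (4 / q)) ^ (1 / 2 : ℝ) ≤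
      A0 ^ (2 / p) * B0 ^ (2 / q) := by
  have hs : 0 < 4 / q - 1 := by
    have : 1 < 4 / q := by rw [lt_div_iff₀ hq]; linarith
    linarith
  have hp2 : 0 < 2 / p := by positivity
  set s := 4 / q - 1 with hsd
  -- This is the relation 1/p + 1/q = 3/4 in disguise.
  have e1 : 2 / p + s / 2 = 1 := by
    rw [hsd, ← mul_one_div 2 p, ← mul_one_div 4 q]; linarith
  have e2 : 1 / 2 + s / 2 = 2 / q := by rw [hsd]; ring
  set D := B0 / A0 with hD
  have hin : ∀ j, a j ^ (2 / p) * (∑' k, (if r j k then b k else 0) ^ (4 / q)) ^ (1 / 2 : ℝ) ≤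
      a j * (B0 ^ (1 / 2 : ℝ) * D ^ (s / 2)) := fun j => by
    have h1 : ∑' k, (if r j k then b k else 0) ^ (4 / q) ≤ B0 * (a j * D) ^ s := by
      refine (ENNReal.tsum_le_tsum fun k => ?_).trans
        ((ENNReal.tsum_mul_right (f := b) (a := (a j * D) ^ s)).le.trans (mul_le_mul' hb le_rfl))
      split_ifs with h
      · rw [show 4 / q = 1 + s by rw [hsd]; ring, ENNReal.rpow_add_of_nonneg _ _ zero_le_one hs.le,
          ENNReal.rpow_one]
        exact mul_le_mul' le_rfl (ENNReal.rpow_le_rpow (hr j k h) hs.le)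
      · rw [ENNReal.zero_rpow_of_pos (by positivity)]; exact zero_le
    calc _ ≤ a j ^ (2 / p) * (B0 * (a j * D) ^ s) ^ (1 / 2 : ℝ) := by gcongr
      _ = a j ^ (2 / p) * a j ^ (s / 2) * (B0 ^ (1 / 2 : ℝ) * D ^ (s / 2)) := by
        rw [ENNReal.mul_rpow_of_nonneg _ _ (by norm_num), ← ENNReal.rpow_mul,
          show s * (1 / 2) = s / 2 by ring, ENNReal.mul_rpow_of_nonneg _ _ (by positivity)]
        ring
      _ = _ := by
        rw [← ENNReal.rpow_add_of_nonneg _ _ hp2.le (by positivity), e1, ENNReal.rpow_one]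
  refine (ENNReal.tsum_le_tsum hin).trans ?_
  rw [ENNReal.tsum_mul_right]
  refine (mul_le_mul' ha le_rfl).trans (le_of_eq ?_)
  have hAs : A0 ^ (s / 2) ≠ 0 := (ENNReal.rpow_pos (pos_iff_ne_zero.2 hA0) hA).ne'
  have hAs' : A0 ^ (s / 2) ≠ ⊤ := ENNReal.rpow_ne_top_of_nonneg (by positivity) hA
  have hA1 : A0 = A0 ^ (2 / p) * A0 ^ (s / 2) := by
    rw [← ENNReal.rpow_add_of_nonneg _ _ hp2.le (by positivity), e1, ENNReal.rpow_one]
  rw [hD, ENNReal.div_rpow_of_nonneg _ _ (by positivity), ← e2,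
    ENNReal.rpow_add_of_nonneg _ _ (by norm_num) (by positivity)]
  nth_rewrite 1 [hA1]
  calc A0 ^ (2 / p) * A0 ^ (s / 2) * (B0 ^ (1 / 2 : ℝ) * (B0 ^ (s / 2) / A0 ^ (s / 2)))
      = A0 ^ (2 / p) * (B0 ^ (1 / 2 : ℝ) * (A0 ^ (s / 2) * (B0 ^ (s / 2) / A0 ^ (s / 2)))) := by ring
    _ = _ := by rw [ENNReal.mul_div_cancel hAs hAs']

/-- A sum in which boundedly many consecutive terms are active. -/
theorem enorm_sum_sq_le (F : Finset ℤ) (I : ℤ → ℂ) {n : ℕ}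
    (h : ∀ j j', I j ≠ 0 → I j' ≠ 0 → |j - j'| ≤ n) :
    ‖∑ j ∈ F, I j‖ₑ ^ 2 ≤ (2 * n + 1 : ℕ) * ∑ j ∈ F, ‖I j‖ₑ ^ 2 := by
  classical
  have e : ∀ z : ℂ, ‖z‖ₑ ^ 2 = ENNReal.ofReal (‖z‖ ^ 2) := fun z => by
    rw [ENNReal.ofReal_pow (norm_nonneg _), ofReal_norm]
  -- The active indices lie within n of any one of them, hence number at most 2n+1; Cauchy–Schwarz
  -- is applied to these alone.
  set F' := F.filter fun j => I j ≠ 0 with hF'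
  have hcard : F'.card ≤ 2 * n + 1 := by
    rcases F'.eq_empty_or_nonempty with h0 | ⟨j0, hj0⟩
    · rw [h0]; simp
    · have : F' ⊆ Finset.Icc (j0 - n) (j0 + n) := fun j hj => by
        have := abs_le.1 (h j j0 (Finset.mem_filter.1 hj).2 (Finset.mem_filter.1 hj0).2)
        exact Finset.mem_Icc.2 ⟨by linarith, by linarith⟩
      refine (Finset.card_le_card this).trans (le_of_eq ?_)
      rw [Int.card_Icc]
      omega
  simp only [e]
  rw [← ENNReal.ofReal_sum_of_nonneg fun _ _ => by positivity, ← ENNReal.ofReal_natCast,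
    ← ENNReal.ofReal_mul (by positivity)]
  refine ENNReal.ofReal_le_ofReal ?_
  calc ‖∑ j ∈ F, I j‖ ^ 2 = ‖∑ j ∈ F', I j‖ ^ 2 := by rw [hF', Finset.sum_filter_ne_zero]
    _ ≤ (∑ j ∈ F', ‖I j‖) ^ 2 := by gcongr; exact norm_sum_le _ _
    _ ≤ F'.card * ∑ j ∈ F', ‖I j‖ ^ 2 := sq_sum_le_card_mul_sum_sq
    _ ≤ (2 * n + 1 : ℕ) * ∑ j ∈ F, ‖I j‖ ^ 2 := by
      gcongr
      exact Finset.filter_subset _ _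

end WindowSum

/-! ### The part of the operator dominated by the windows of the first function. -/

section Assembly

open Set ENNReal

/-- S is arbitrary off Ω, but ψ vanishes there, so S may be replaced by zero to obtain
measurability. -/
theorem RegionHyp.isCore_oscAmp {A c K δ μ : ℝ} {Ω : Set (ℝ × ℝ)} {S : ℝ × ℝ → ℝ}
    {ψ ψ1 : ℝ × ℝ → ℂ} (H : RegionHyp A c K δ μ Ω S ψ ψ1) (l : ℝ) : IsCore (oscAmp l S ψ) := by
  classical
  obtain ⟨K0, hK0, cK0, zK0⟩ := H.compact
  have e : oscAmp l S ψ = oscAmp l (Ω.piecewise S fun _ => 0) ψ := by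
    funext z
    by_cases hz : z ∈ Ω
    · rw [oscAmp, oscAmp, piecewise_eq_of_mem _ _ _ hz]
    · simp [oscAmp, zK0 z fun h => hz (hK0 h)]
  have mS : Measurable (Ω.piecewise S fun _ => 0) :=
    H.phase.continuousOn.measurable_piecewise continuousOn_const H.isOpen.measurableSet
  obtain ⟨M, hM⟩ := cK0.isBounded.exists_norm_le
  refine ⟨?_, ⟨A, fun z => by rw [norm_oscAmp]; exact H.bound z⟩, M, fun z hz => ?_⟩
  · rw [e]
    have := H.meas
    unfold oscAmp
    fun_prop
  · simp [oscAmp, zK0 z fun h => absurd (hM z h) (not_le.2 hz)]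

theorem abs_floor_sub_floor_le {x y t : ℝ} (h : |x - y| ≤ t) : |⌊x⌋ - ⌊y⌋| ≤ (⌈t⌉₊ + 1 : ℕ) := by
  have h1 := Int.floor_le x
  have h2 := Int.lt_floor_add_one x
  have h3 := Int.floor_le y
  have h4 := Int.lt_floor_add_one y
  have h5 := Nat.le_ceil t
  have h6 := abs_le.1 h
  have h7 : ((|⌊x⌋ - ⌊y⌋| : ℤ) : ℝ) ≤ ((⌈t⌉₊ + 1 : ℕ) : ℤ) := by
    push_cast
    exact abs_le.2 ⟨by linarith, by linarith⟩
  exact_mod_cast h7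

/-- The part of the bilinear operator in which the window of the first function dominates. -/
theorem RegionHyp.exists_dominated_le {A c K : ℝ} (hA : 0 < A) (hc : 0 < c) (hK : 0 < K) :
    ∃ κ : ℝ, 0 < κ ∧ ∀ p q : ℝ, 2 < p → p < 4 → 2 < q → q < 4 → 1 / p + 1 / q = 3 / 4 →
      ∃ C : ℝ, 0 < C ∧ ∀ (δ μ : ℝ) (Ω : Set (ℝ × ℝ)) (S : ℝ × ℝ → ℝ) (ψ ψ1 : ℝ × ℝ → ℂ),
      RegionHyp A c K δ μ Ω S ψ ψ1 → ∀ l : ℝ, l ≠ 0 → ∀ (g h : ℝ → ℂ), IsCore g → IsCore h →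
      (∫⁻ y, ‖g y‖ₑ ^ p) ≠ 0 → ∀ (r : ℤ → ℤ → Prop) [∀ j k, Decidable (r j k)],
      (∀ j k, r j k → (∫⁻ s in window (κ * δ) k, ‖h s‖ₑ ^ q) ≤
        (∫⁻ y in window (κ * δ) j, ‖g y‖ₑ ^ p) * ((∫⁻ s, ‖h s‖ₑ ^ q) / ∫⁻ y, ‖g y‖ₑ ^ p)) →
      ∫⁻ x, ‖∫ y, oscAmp l S ψ (x, y) *
          (if r ⌊y / (κ * δ)⌋ ⌊(x + y) / (κ * δ)⌋ then g y * h (x + y) else 0)‖ₑ ^ 2 ≤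
        ENNReal.ofReal (C * |l * μ| ^ (-(1 / 2) : ℝ)) *
          ((∫⁻ y, ‖g y‖ₑ ^ p) ^ (2 / p) * (∫⁻ s, ‖h s‖ₑ ^ q) ^ (2 / q)) := by
  obtain ⟨κ, hκ, -, hrow0⟩ := RegionHyp.exists_row_le hA hc hK
  refine ⟨κ, hκ, fun p q hp hp' hq hq' hpq => ?_⟩
  obtain ⟨C, hC, hrow⟩ := hrow0 p q hp hp' hq hq' hpq
  -- For fixed x the amplitude lives in an interval of length δ in y, which is 1/κ windows; the
  -- extra 1 is for rounding.
  set n : ℕ := ⌈1 / κ⌉₊ + 1 with hn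
  refine ⟨(2 * n + 1 : ℕ) * C, by positivity, ?_⟩
  intro δ μ Ω S ψ ψ1 H l hl g h hg hh hA0 r _ hr
  have hp0 : 0 < p := by linarith
  have hq0 : 0 < q := by linarith
  have hδ := H.pos_δ
  have hE := H.isCore_oscAmp l
  set E := oscAmp l S ψ with hEd
  set w := κ * δ with hw
  have hwp : 0 < w := by positivity
  set G : ℤ → ℝ → ℂ := fun j => indicator (window w j) g with hG
  -- For each window j of g only those windows of h are kept which are related to j, so the
  -- one-window estimate applies to each j separately.
  set L : ℤ → ℝ → ℂ := fun j => indicator ((fun s => ⌊s / w⌋) ⁻¹' {k | r j k}) h with hL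
  have zG : ∀ j y, ⌊y / w⌋ ≠ j → G j y = 0 := fun j y hne =>
    indicator_of_notMem (s := window w j) hne g
  have eL : ∀ j s, L j s = if r j ⌊s / w⌋ then h s else 0 := fun j s => by
    by_cases hr : r j ⌊s / w⌋
    · rw [if_pos hr]; exact indicator_of_mem (s := (fun s => ⌊s / w⌋) ⁻¹' {k | r j k}) hr h
    · rw [if_neg hr]; exact indicator_of_notMem (s := (fun s => ⌊s / w⌋) ⁻¹' {k | r j k}) hr h
  have cG : ∀ j, IsCore (G j) := fun j => hg.indicator (measurableSet_window w j)
  have cL : ∀ j, IsCore (L j) := fun j => hh.indicator (measurable_floor_div w trivial)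
  set I : ℤ → ℝ → ℂ := fun j x => ∫ y, E (x, y) * (G j y * L j (x + y)) with hI
  have cI : ∀ j, IsCore fun z : ℝ × ℝ => E z * (G j z.2 * L j (z.1 + z.2)) := fun j => by
    obtain ⟨BE, hBE⟩ := hE.bdd
    have := ((cG j).convolution (cL j)).mul_bounded hE.meas hBE
    simpa only [mul_comm] using this
  obtain ⟨M, hM⟩ := hg.supp
  set F : Finset ℤ := Finset.Icc ⌊-M / w⌋ ⌊M / w⌋ with hF
  have hFm : ∀ y, g y ≠ 0 → ⌊y / w⌋ ∈ F := fun y hy => by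
    have := abs_le.1 (not_lt.1 fun h => hy (hM y h))
    exact Finset.mem_Icc.2 ⟨Int.floor_le_floor (by gcongr; exact this.1),
      Int.floor_le_floor (by gcongr; exact this.2)⟩
  have hsum : ∀ x, ∫ y, E (x, y) * (if r ⌊y / w⌋ ⌊(x + y) / w⌋ then g y * h (x + y) else 0) =
      ∑ j ∈ F, I j x := fun x => by
    have hi : ∀ j ∈ F, Integrable fun y => E (x, y) * (G j y * L j (x + y)) := fun j _ => by
      obtain ⟨BE, hBE⟩ := hE.bdd
      obtain ⟨BL, hBL⟩ := (cL j).bdd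
      have := (((cG j).mul_bounded (u := fun y => L j (x + y)) ((cL j).meas.comp (by fun_prop))
        fun y => hBL _).mul_bounded (u := fun y => E (x, y)) (hE.meas.comp (by fun_prop))
        fun y => hBE _).integrable volume
      simpa only [mul_comm] using this
    rw [hI, ← integral_finsetSum _ hi]
    congr 1
    funext y
    rw [← Finset.mul_sum]
    congr 1
    by_cases hy : g y = 0
    · have : ∀ j, G j y = 0 := fun j => indicator_apply_eq_zero.2 fun _ => hy
      simp [hy, this]
    · rw [Finset.sum_eq_single_of_mem _ (hFm y hy) fun j _ hj => by
        rw [zG j y hj.symm, zero_mul]]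
      have e1 : G ⌊y / w⌋ y = g y := indicator_of_mem (s := window w ⌊y / w⌋) rfl g
      rw [e1, eL]
      split_ifs <;> simp
  have hact : ∀ x j j', I j x ≠ 0 → I j' x ≠ 0 → |j - j'| ≤ n := fun x j j' hj hj' => by
    have q : ∀ j, I j x ≠ 0 → ∃ y, ψ (x, y) ≠ 0 ∧ ⌊y / w⌋ = j := fun j hj => by
      by_contra! hcon
      refine hj ?_
      rw [hI]
      simp only
      refine integral_eq_zero_of_ae (ae_of_all _ fun y => ?_)
      by_cases hψ : ψ (x, y) = 0
      · simp [hEd, oscAmp, hψ]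
      · have : G j y = 0 := zG j y (hcon y hψ)
        simp [this]
    obtain ⟨y, hy, rfl⟩ := q j hj
    obtain ⟨y', hy', rfl⟩ := q j' hj'
    refine abs_floor_sub_floor_le ?_
    rw [← sub_div, abs_div, abs_of_pos hwp, div_le_div_iff₀ hwp hκ, one_mul, hw]
    have := H.width x y y' hy hy'
    nlinarith
  have hone : ∀ j, ∫⁻ x, ‖I j x‖ₑ ^ 2 ≤ ENNReal.ofReal (C * |l * μ| ^ (-(1 / 2) : ℝ)) *
      ((∫⁻ y in window w j, ‖g y‖ₑ ^ p) ^ (2 / p) * (∑' k : ℤ, (if r j k then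
        ∫⁻ s in window w k, ‖h s‖ₑ ^ q else 0) ^ (4 / q)) ^ (1 / 2 : ℝ)) := fun j => by
    have h1 := hrow δ μ Ω S ψ ψ1 H l hl (j * w) (G j) (L j) (cG j) (cL j) fun y hy => by
      have hm : ⌊y / w⌋ = j := by
        by_contra hne
        exact hy (zG j y hne)
      obtain ⟨h1, h2⟩ := Int.floor_eq_iff.1 hm
      rw [le_div_iff₀ hwp] at h1
      rw [div_lt_iff₀ hwp] at h2
      exact ⟨h1, by linarith⟩
    refine h1.trans (le_of_eq ?_)
    have e : ∀ (s : Set ℝ) (f : ℝ → ℂ) (t : ℝ), 0 < t → ∀ y, ‖indicator s f y‖ₑ ^ t =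
        indicator s (fun y => ‖f y‖ₑ ^ t) y := fun s f t ht y => by
      by_cases hy : y ∈ s
      · rw [indicator_of_mem hy, indicator_of_mem hy]
      · rw [indicator_of_notMem hy, indicator_of_notMem hy, enorm_zero, ENNReal.zero_rpow_of_pos ht]
    congr 3
    · simp only [hG, e _ _ p hp0]
      rw [lintegral_indicator (measurableSet_window w j)]
    · congr 1
      funext k
      congr 1
      simp only [hL, e _ _ q hq0]
      split_ifs with hrk
      · refine setLIntegral_congr_fun (measurableSet_window w k) fun s (hs : _ = k) => ?_
        exact indicator_of_mem (by rw [mem_preimage, hs]; exact hrk) _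
      · refine (setLIntegral_congr_fun (g := fun _ => 0) (measurableSet_window w k)
          fun s (hs : _ = k) => ?_).trans (by simp)
        exact indicator_of_notMem (by rw [mem_preimage, hs]; exact hrk) _
  have mI : ∀ j, Measurable fun x => ‖I j x‖ₑ ^ 2 := fun j =>
    (cI j).integral_right.meas.enorm.pow_const 2
  have hAt : (∫⁻ y, ‖g y‖ₑ ^ p) ≠ ⊤ := by
    have h1 := (hg.memLp (ENNReal.ofReal p)).2
    rw [eLpNorm_eq_lintegral_rpow_enorm_toReal (by simpa using hp0) ENNReal.ofReal_ne_top,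
      ENNReal.toReal_ofReal hp0.le] at h1
    exact fun h0 => by rw [h0, ENNReal.top_rpow_of_pos (by positivity)] at h1; exact h1.ne rfl
  calc _ ≤ ∫⁻ x, (2 * n + 1 : ℕ) * ∑ j ∈ F, ‖I j x‖ₑ ^ 2 := by
        refine lintegral_mono fun x => ?_
        rw [hsum]
        exact enorm_sum_sq_le F (fun j => I j x) (hact x)
    _ = (2 * n + 1 : ℕ) * ∑ j ∈ F, ∫⁻ x, ‖I j x‖ₑ ^ 2 := by
        rw [lintegral_const_mul _ (Finset.measurable_sum _ fun j _ => mI j),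
          lintegral_finsetSum _ fun j _ => mI j]
    _ ≤ (2 * n + 1 : ℕ) * ∑ j ∈ F, ENNReal.ofReal (C * |l * μ| ^ (-(1 / 2) : ℝ)) *
        ((∫⁻ y in window w j, ‖g y‖ₑ ^ p) ^ (2 / p) * (∑' k : ℤ, (if r j k then
        ∫⁻ s in window w k, ‖h s‖ₑ ^ q else 0) ^ (4 / q)) ^ (1 / 2 : ℝ)) :=
        mul_le_mul' le_rfl (Finset.sum_le_sum fun j _ => hone j)
    _ ≤ (2 * n + 1 : ℕ) * (ENNReal.ofReal (C * |l * μ| ^ (-(1 / 2) : ℝ)) *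
        ((∫⁻ y, ‖g y‖ₑ ^ p) ^ (2 / p) * (∫⁻ s, ‖h s‖ₑ ^ q) ^ (2 / q))) := by
        rw [← Finset.mul_sum]
        refine mul_le_mul' le_rfl (mul_le_mul' le_rfl ((ENNReal.sum_le_tsum F).trans ?_))
        exact tsum_rpow_mul_le hp0 hq0 hq' hpq hA0 hAt (tsum_lintegral_window_le w _)
          (tsum_lintegral_window_le w _) hr
    _ = _ := by
        rw [← mul_assoc, ← ENNReal.ofReal_natCast, ← ENNReal.ofReal_mul (by positivity), mul_assoc]

end Assembly

/-! ### Both orders of domination combined. -/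

section RegionBound

open Set ENNReal

theorem enorm_add_sq_le (a b : ℂ) : ‖a + b‖ₑ ^ 2 ≤ 2 * (‖a‖ₑ ^ 2 + ‖b‖ₑ ^ 2) := by
  have h := ENNReal.rpow_add_le_mul_rpow_add_rpow ‖a‖ₑ ‖b‖ₑ (p := 2) (by norm_num)
  norm_num at h
  exact (pow_le_pow_left' (enorm_add_le a b) 2).trans h

theorem lintegral_enorm_add_sq_le {a b : ℝ → ℂ} (ma : Measurable a) :
    ∫⁻ x, ‖a x + b x‖ₑ ^ 2 ≤ 2 * ((∫⁻ x, ‖a x‖ₑ ^ 2) + ∫⁻ x, ‖b x‖ₑ ^ 2) := by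
  rw [← lintegral_add_left (ma.enorm.pow_const 2), ← lintegral_const_mul' _ _ (by simp)]
  exact lintegral_mono fun x => enorm_add_sq_le _ _

theorem IsCore.slice {F : ℝ × ℝ → ℂ} (hF : IsCore F) (x : ℝ) : IsCore fun y => F (x, y) := by
  obtain ⟨B, hB⟩ := hF.bdd
  obtain ⟨M, hM⟩ := hF.supp
  exact ⟨hF.meas.comp (by fun_prop), ⟨B, fun y => hB _⟩, M,
    fun y hy => hM _ (hy.trans_le (norm_snd_le (x, y)))⟩

/-- The bilinear square function estimate on a region. -/
theorem RegionHyp.exists_lintegral_sq_le {A c K p q : ℝ} (hA : 0 < A) (hc : 0 < c) (hK : 0 < K)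
    (hp : 2 < p) (hp' : p < 4) (hq : 2 < q) (hq' : q < 4) (hpq : 1 / p + 1 / q = 3 / 4) :
    ∃ C : ℝ, 0 < C ∧ ∀ (δ μ : ℝ) (Ω : Set (ℝ × ℝ)) (S : ℝ × ℝ → ℝ) (ψ ψ1 : ℝ × ℝ → ℂ),
      RegionHyp A c K δ μ Ω S ψ ψ1 → ∀ l : ℝ, l ≠ 0 → ∀ (g h : ℝ → ℂ), IsCore g → IsCore h →
      ∫⁻ x, ‖∫ y, oscAmp l S ψ (x, y) * (g y * h (x + y))‖ₑ ^ 2 ≤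
        ENNReal.ofReal (C * |l * μ| ^ (-(1 / 2) : ℝ)) *
          ((∫⁻ y, ‖g y‖ₑ ^ p) ^ (2 / p) * (∫⁻ s, ‖h s‖ₑ ^ q) ^ (2 / q)) := by
  classical
  obtain ⟨κ, hκ, hdom⟩ := RegionHyp.exists_dominated_le hA hc hK
  obtain ⟨C1, hC1, h1⟩ := hdom p q hp hp' hq hq' hpq
  obtain ⟨C2, hC2, h2⟩ := hdom q p hq hq' hp hp' (by rw [add_comm]; exact hpq)
  refine ⟨2 * (C1 + C2), by positivity, fun δ μ Ω S ψ ψ1 H l hl g h hg hh => ?_⟩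
  have hE := H.isCore_oscAmp l
  have zero : ∀ (u : ℝ → ℂ) (t : ℝ), 0 < t → IsCore u → ∫⁻ y, ‖u y‖ₑ ^ t = 0 → u =ᵐ[volume] 0 :=
    fun u t ht hu h0 => by
      filter_upwards [(lintegral_eq_zero_iff (hu.meas.enorm.pow_const t)).1 h0] with y hy
      simpa [ht.not_gt, ht] using hy
  have vanish : (∀ x, (fun y => oscAmp l S ψ (x, y) * (g y * h (x + y))) =ᵐ[volume] 0) →
      ∫⁻ x, ‖∫ y, oscAmp l S ψ (x, y) * (g y * h (x + y))‖ₑ ^ 2 ≤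
        ENNReal.ofReal (2 * (C1 + C2) * |l * μ| ^ (-(1 / 2) : ℝ)) *
          ((∫⁻ y, ‖g y‖ₑ ^ p) ^ (2 / p) * (∫⁻ s, ‖h s‖ₑ ^ q) ^ (2 / q)) := fun hx => by
    simp only [fun x => integral_eq_zero_of_ae (hx x)]
    simp
  -- Vanishing norms are set aside because relative masses are formed by division.
  by_cases hg0 : ∫⁻ y, ‖g y‖ₑ ^ p = 0
  · refine vanish fun x => ?_
    filter_upwards [zero g p (by linarith) hg hg0] with y hy
    simp [hy]
  by_cases hh0 : ∫⁻ y, ‖h y‖ₑ ^ q = 0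
  · refine vanish fun x => ?_
    filter_upwards [(measurePreserving_add_left volume x).quasiMeasurePreserving.ae
      (zero h q (by linarith) hh hh0)] with y hy
    simp only [Pi.zero_apply] at hy ⊢
    rw [hy, mul_zero, mul_zero]
  have fin : ∀ (u : ℝ → ℂ) (t : ℝ), 0 < t → IsCore u → ∫⁻ y, ‖u y‖ₑ ^ t ≠ ⊤ := fun u t ht hu h0 => by
    have h1 := (hu.memLp (ENNReal.ofReal t)).2
    rw [eLpNorm_eq_lintegral_rpow_enorm_toReal (by simpa using ht) ENNReal.ofReal_ne_top,
      ENNReal.toReal_ofReal ht.le, h0, ENNReal.top_rpow_of_pos (by positivity)] at h1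
    exact h1.ne rfl
  have hgt := fin g p (by linarith) hg
  have hht := fin h q (by linarith) hh
  set w := κ * δ with hw
  set A0 := ∫⁻ y, ‖g y‖ₑ ^ p with hA0
  set B0 := ∫⁻ s, ‖h s‖ₑ ^ q with hB0
  -- Pairs of windows are divided according to which carries the larger share of its total mass; off
  -- r the reverse comparison holds.
  obtain ⟨r, hr1, hr2⟩ : ∃ r : ℤ → ℤ → Prop,
      (∀ j k, r j k → (∫⁻ s in window w k, ‖h s‖ₑ ^ q) ≤
        (∫⁻ y in window w j, ‖g y‖ₑ ^ p) * (B0 / A0)) ∧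
      ∀ j k, ¬ r j k → (∫⁻ y in window w j, ‖g y‖ₑ ^ p) ≤
        (∫⁻ s in window w k, ‖h s‖ₑ ^ q) * (A0 / B0) := by
    refine ⟨_, fun j k hjk => hjk, fun j k hjk => ?_⟩
    have e : B0 / A0 * (A0 / B0) = 1 := by
      rw [← ENNReal.inv_div (a := B0) (Or.inl hgt) (Or.inl hg0)]
      exact ENNReal.mul_inv_cancel (ENNReal.div_ne_zero.2 ⟨hh0, hgt⟩) (ENNReal.div_ne_top hht hg0)
    have h4 := mul_le_mul' (not_le.1 hjk).le (le_refl (A0 / B0))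
    rwa [mul_assoc, e, mul_one] at h4
  have k1 := h1 δ μ Ω S ψ ψ1 H l hl g h hg hh hg0 r hr1
  -- On the complementary pairs h dominates, so the estimate is used on the swapped region with the
  -- functions and the exponents exchanged.
  have k2 := h2 δ μ _ _ _ _ H.comp_fibreSwap l hl h g hh hg hh0 (fun k j => ¬ r j k)
    fun k j hjk => hr2 j k hjk
  rw [lintegral_sq_comp_fibreSwap l S ψ fun a b => if ¬ r ⌊a / w⌋ ⌊b / w⌋ then h b * g a else 0] at k2
  have hcore : ∀ (P : ℤ → ℤ → Prop) [∀ j k, Decidable (P j k)], IsCore fun z : ℝ × ℝ => oscAmp l S ψ z *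
      (if P ⌊z.2 / w⌋ ⌊(z.1 + z.2) / w⌋ then g z.2 * h (z.1 + z.2) else 0) := fun P _ => by
    have hm : MeasurableSet {z : ℝ × ℝ | P ⌊z.2 / w⌋ ⌊(z.1 + z.2) / w⌋} := by
      have m1 : Measurable fun z : ℝ × ℝ => (⌊z.2 / w⌋, ⌊(z.1 + z.2) / w⌋) :=
        ((measurable_floor_div w).comp measurable_snd).prodMk
          ((measurable_floor_div w).comp (by fun_prop))
      exact m1 (Set.to_countable {a : ℤ × ℤ | P a.1 a.2}).measurableSet
    obtain ⟨BE, hBE⟩ := hE.bdd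
    have h3 := ((hg.convolution hh).mul_bounded hE.meas hBE).mul_bounded
      (u := fun z : ℝ × ℝ => if P ⌊z.2 / w⌋ ⌊(z.1 + z.2) / w⌋ then 1 else 0)
      (Measurable.ite hm measurable_const measurable_const) (b := 1)
      (fun z => by split_ifs <;> simp)
    convert h3 using 2 with z
    split_ifs
    · ring
    · simp
  have c1 := hcore r
  have c2 := hcore fun j k => ¬ r j k
  have hsum : ∀ x, ∫ y, oscAmp l S ψ (x, y) * (g y * h (x + y)) =
      (∫ y, oscAmp l S ψ (x, y) * (if r ⌊y / w⌋ ⌊(x + y) / w⌋ then g y * h (x + y) else 0)) +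
      ∫ y, oscAmp l S ψ (x, y) * (if ¬ r ⌊y / w⌋ ⌊(x + y) / w⌋ then g y * h (x + y) else 0) :=
    fun x => by
      refine Eq.trans ?_ (integral_add ((c1.slice x).integrable volume)
        ((c2.slice x).integrable volume))
      congr 1
      funext y
      by_cases hxy : r ⌊y / w⌋ ⌊(x + y) / w⌋ <;> simp [hxy]
  simp only [mul_comm (h _) (g _)] at k2
  simp only [hsum]
  refine (lintegral_enorm_add_sq_le c1.integral_right.meas).trans ?_
  refine (mul_le_mul' le_rfl (add_le_add k1 k2)).trans (le_of_eq ?_)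
  rw [mul_comm (B0 ^ _) (A0 ^ _), ← add_mul, ← mul_assoc, ← ENNReal.ofReal_add (by positivity)
    (by positivity), ← add_mul, show (2 : ℝ≥0∞) = ENNReal.ofReal 2 by simp,
    ← ENNReal.ofReal_mul (by norm_num), mul_assoc 2]

end RegionBound

/-! ### Reduction to open regions where DS has constant sign. -/

section Truncation

open Set Filter

/-- A smooth map of the plane vanishing near the origin and close to the identity. -/
theorem exists_smooth_threshold : ∃ (C : ℝ) (F : ℂ → ℂ), 1 ≤ C ∧ ContDiff ℝ ∞ F ∧
    (∀ z, ‖z‖ ≤ 1 → F z = 0) ∧ (∀ z, ‖F z - z‖ ≤ 2) ∧ (∀ z, ‖F z‖ ≤ ‖z‖) ∧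
    ∀ z, ‖fderiv ℝ F z‖ ≤ C := by
  set β : ContDiffBump (0 : ℂ) := ⟨1, 2, by norm_num, by norm_num⟩ with hβ
  have sD : ContDiff ℝ ∞ fun z : ℂ => β z • z := β.contDiff.smul contDiff_id
  have hD : HasCompactSupport fun z : ℂ => β z • z := β.hasCompactSupport.smul_right
  obtain ⟨C, hC⟩ := (hD.fderiv (𝕜 := ℝ)).exists_bound_of_continuous (sD.continuous_fderiv (by simp))
  have hC0 : 0 ≤ C := (norm_nonneg _).trans (hC 0)
  refine ⟨1 + C, fun z => z - β z • z, by linarith, contDiff_id.sub sD, fun z hz => ?_, fun z => ?_,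
    fun z => ?_, fun z => ?_⟩
  · simp only
    rw [β.one_of_mem_closedBall (by simpa using hz), one_smul, sub_self]
  · rw [sub_sub_cancel_left, norm_neg, norm_smul, Real.norm_of_nonneg β.nonneg]
    rcases lt_or_ge ‖z‖ 2 with h | h
    · nlinarith [β.le_one (x := z), β.nonneg (x := z), norm_nonneg z]
    · rw [β.zero_of_le_dist (by simpa using h), zero_mul]; norm_num
  · have e : z - β z • z = (1 - β z) • z := by rw [sub_smul, one_smul]
    simp only [e]
    rw [norm_smul, Real.norm_of_nonneg (by linarith [β.le_one (x := z)])]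
    nlinarith [β.le_one (x := z), β.nonneg (x := z), norm_nonneg z]
  · have h1 : fderiv ℝ (fun z => z - β z • z) z =
        ContinuousLinearMap.id ℝ ℂ - fderiv ℝ (fun z : ℂ => β z • z) z := by
      rw [fderiv_fun_sub differentiableAt_fun_id (sD.differentiable (by simp) z), fderiv_fun_id]
    rw [h1]
    exact (norm_sub_le _ _).trans (add_le_add ContinuousLinearMap.norm_id_le (hC z))

variable {A c K δ μ : ℝ} {φ : ℝ × ℝ → ℂ} {S : ℝ × ℝ → ℝ} {U : Set (ℝ × ℝ)}

theorem opD_const_mul (ε : ℝ) (S : ℝ × ℝ → ℝ) : (opD fun z => ε * S z) = fun z => ε * opD S z := by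
  have hx : ∀ F : ℝ × ℝ → ℝ, (partialX fun z => ε * F z) = fun z => ε * partialX F z := fun F =>
    funext fun z => deriv_const_mul_field (v := fun t => F (t, z.2)) ε
  have hy : ∀ F : ℝ × ℝ → ℝ, (partialY fun z => ε * F z) = fun z => ε * partialY F z := fun F =>
    funext fun z => deriv_const_mul_field (v := fun t => F (z.1, t)) ε
  simp only [opD, hx, hy, ← mul_sub]

theorem partialY_const_mul (ε : ℝ) (F : ℝ × ℝ → ℝ) :
    (partialY fun z => ε * F z) = fun z => ε * partialY F z :=
  funext fun z => deriv_const_mul_field (v := fun t => F (z.1, t)) ε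

/-- In this form the interior inherits directional convexity from `DirConvex.lt_infDist_compl` at
depth 0. -/
theorem interior_eq_infDist_pos {X : Set (ℝ × ℝ)} (hne : Xᶜ.Nonempty) :
    interior X = {z | 0 < Metric.infDist z Xᶜ} := by
  ext z
  rw [interior_eq_compl_closure_compl, mem_compl_iff, Metric.mem_closure_iff_infDist_zero hne,
    mem_ofPred_eq, lt_iff_le_and_ne]
  exact ⟨fun h => ⟨Metric.infDist_nonneg, fun h' => h h'.symm⟩, fun h h' => h.2 h'.symm⟩

/-- The part of the interior of the hull on which `D S` has the sign of `ε`. -/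
def signRegion (φ : ℝ × ℝ → ℂ) (S : ℝ × ℝ → ℝ) (ε : ℝ) : Set (ℝ × ℝ) :=
  interior (dirHull fibreDirections (tsupport φ)) ∩ (fun z => ε * opD S z) ⁻¹' Ioi 0

/-- Reduction to a region on which `D S` has constant sign, with an amplitude supported in a compact
subset. -/
theorem PhaseHyp.regionHyp (h : PhaseHyp A c K δ μ φ S U) {ε : ℝ} (hε : |ε| = 1) {A' : ℝ}
    {η η1 : ℝ × ℝ → ℂ} (mη : Measurable η) (mη1 : Measurable η1)
    (dη : ∀ x y, HasDerivAt (fun t => η (x, t)) (η1 (x, y)) y) (bη : ∀ z, ‖η z‖ ≤ A')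
    (bη1 : ∀ z, ‖η1 z‖ ≤ A' / δ) {K0 : Set (ℝ × ℝ)} (cK : IsCompact K0) (hK : ∀ z ∈ K0, φ z ≠ 0)
    (zK : ∀ z ∉ K0, η z = 0) :
    RegionHyp A' c K δ μ (signRegion φ S ε) (fun z => ε * S z)
      (indicator (signRegion φ S ε) η) (indicator (signRegion φ S ε) η1) := by
  set H := dirHull fibreDirections (tsupport φ) with hH
  have hb : Bornology.IsBounded H := by
    obtain ⟨M, hM⟩ := h.compact.isCompact.isBounded.subset_closedBall 0
    exact Metric.isBounded_closedBall.subset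
      (dirHull_subset hM fun v _ => (convex_closedBall _ _).dirConvex v)
  have hne : Hᶜ.Nonempty := by
    rw [nonempty_compl]
    exact fun h0 => NormedSpace.unbounded_univ ℝ (ℝ × ℝ) (h0 ▸ hb)
  have hIU : interior H ⊆ U := interior_subset.trans h.hull
  have sS := h.phase.mono hIU
  have cD : ContinuousOn (fun z => ε * opD S z) (interior H) :=
    continuousOn_const.mul (sS.opD isOpen_interior).continuousOn
  have sub : ∀ ε', signRegion φ S ε' ⊆ H := fun ε' z hz => interior_subset hz.1
  have ho : IsOpen (signRegion φ S ε) := cD.isOpen_inter_preimage isOpen_interior isOpen_Ioi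
  have ho' : IsOpen (signRegion φ S (-ε)) := by
    refine ContinuousOn.isOpen_inter_preimage ?_ isOpen_interior isOpen_Ioi
    exact cD.neg.congr fun z _ => neg_mul _ _
  have hpos : ∀ z ∈ H, 0 < |ε * opD S z| := fun z hz => by
    rw [abs_mul, hε, one_mul]
    exact (mul_pos h.pos_c h.pos_μ).trans_le (h.lower z hz)
  have hφI : ∀ z, φ z ≠ 0 → z ∈ interior H := fun z hz =>
    interior_maximal ((subset_tsupport φ).trans (subset_dirHull _ _))
      (h.smooth.continuous.isOpen_support) hz
  -- DS has no zero on the hull, so within K0 this sign region is the complement of the open region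
  -- of opposite sign, hence relatively closed.
  have hKΩ : IsCompact (K0 ∩ signRegion φ S ε) := by
    have : K0 ∩ signRegion φ S ε = K0 ∩ (signRegion φ S (-ε))ᶜ := by
      ext z
      refine and_congr_right fun hz => ⟨fun h1 h2 => ?_, fun h1 => ⟨hφI z (hK z hz), ?_⟩⟩
      · have h3 : 0 < ε * opD S z := h1.2
        have h4 : 0 < -ε * opD S z := h2.2
        linarith
      · by_contra hlt
        have h3 : ε * opD S z ≤ 0 := not_lt.1 hlt
        have h4 : ε * opD S z ≠ 0 := abs_pos.1 (hpos z (interior_subset (hφI z (hK z hz))))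
        exact h1 ⟨hφI z (hK z hz), by
          show 0 < -ε * opD S z
          have := lt_of_le_of_ne h3 h4
          linarith⟩
    rw [this]
    exact cK.inter_right ho'.isClosed_compl
  have abs_eq : ∀ z ∈ signRegion φ S ε, ε * opD S z = |opD S z| := fun z hz => by
    have h3 : 0 < ε * opD S z := hz.2
    rw [← abs_of_pos h3, abs_mul, hε, one_mul]
  have eD := opD_const_mul ε S
  refine ⟨h.pos_δ, h.pos_μ, ho, hb.subset (sub ε), fun v hv => ?_, contDiffOn_const.mul
    (sS.mono inter_subset_left), fun z hz => ?_, fun z hz => ?_, fun z hz => ?_,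
    ⟨_, inter_subset_right, hKΩ, fun z hz => ?_⟩, mη.indicator ho.measurableSet,
    mη1.indicator ho.measurableSet, fun x y => ?_, fun z => (norm_indicator_le_norm_self _ _).trans
    (bη z), fun z => (norm_indicator_le_norm_self _ _).trans (bη1 z), fun x y y' hy hy' => ?_⟩
  · have hI : DirConvex v (interior H) := by
      rw [interior_eq_infDist_pos hne]
      exact (dirConvex_dirHull _ _ hv).lt_infDist_compl hne 0
    intro a ha b hb' hab z hz
    have hseg := hI a ha.1 b hb'.1 hab
    refine ⟨hseg hz, ?_⟩
    by_contra hlt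
    -- A change of sign along a segment inside the hull would produce a zero of DS, which the lower
    -- bound excludes.
    obtain ⟨u, hu, hu0⟩ := (convex_segment (𝕜 := ℝ) a b).isPreconnected.intermediate_value hz
      (left_mem_segment ℝ a b) (cD.mono hseg)
      (⟨not_lt.1 hlt, (show 0 < ε * opD S a from ha.2).le⟩ : (0 : ℝ) ∈ Icc _ _)
    have := hpos u (interior_subset (hseg hu))
    simp only at hu0
    rw [hu0, abs_zero] at this
    exact lt_irrefl _ this
  · rw [eD]
    simp only [abs_eq z hz]
    exact h.lower z (sub ε hz)
  · rw [eD, partialY_const_mul, abs_mul, hε, one_mul]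
    exact h.upper1 z (sub ε hz)
  · rw [eD, partialY_const_mul, partialY_const_mul, abs_mul, hε, one_mul]
    exact h.upper2 z (sub ε hz)
  · by_cases hzΩ : z ∈ signRegion φ S ε
    · rw [indicator_of_mem hzΩ]
      exact zK z fun hzK => hz ⟨hzK, hzΩ⟩
    · exact indicator_of_notMem hzΩ _
  · have hc : ContinuousAt (fun t : ℝ => (x, t)) y := by fun_prop
    by_cases hz : (x, y) ∈ signRegion φ S ε
    · rw [indicator_of_mem hz]
      refine (dη x y).congr_of_eventuallyEq ?_
      filter_upwards [hc.eventually (ho.mem_nhds hz)] with t ht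
      exact indicator_of_mem ht _
    · rw [indicator_of_notMem hz]
      refine (hasDerivAt_const y (0 : ℂ)).congr_of_eventuallyEq ?_
      filter_upwards [hc.eventually (hKΩ.isClosed.isOpen_compl.mem_nhds fun h' => hz h'.2)] with t ht
      refine indicator_apply_eq_zero.2 fun hΩ => zK _ fun hzK => ht ⟨hzK, hΩ⟩
  · have q : ∀ y, indicator (signRegion φ S ε) η (x, y) ≠ 0 → (x, y) ∈ tsupport φ := fun y hy => by
      refine subset_tsupport _ (hK _ ?_)
      by_contra hn
      exact hy (indicator_apply_eq_zero.2 fun _ => zK _ hn)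
    exact h.width x y y' (q y hy) (q y' hy')

end Truncation

/-! ### The square function estimate and the trilinear bound for part (ii). -/

section SquareFunction

open Set Filter ENNReal

/-- The closed support of φ may touch the boundary of the hull, where no neighbourhood satisfies the
hypotheses on DS. The set φ ≠ 0 does lie in the interior, so φ is approximated by amplitudes with
compact support inside that set. -/
theorem PhaseHyp.exists_lintegral_sq_le {A c K p q : ℝ} (hA : 0 < A) (hc : 0 < c) (hK : 0 < K)
    (hp : 2 < p) (hp' : p < 4) (hq : 2 < q) (hq' : q < 4) (hpq : 1 / p + 1 / q = 3 / 4) :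
    ∃ C : ℝ, 0 < C ∧ ∀ (δ μ : ℝ) (φ : ℝ × ℝ → ℂ) (S : ℝ × ℝ → ℝ) (U : Set (ℝ × ℝ)),
      PhaseHyp A c K δ μ φ S U → ∀ l : ℝ, l ≠ 0 → ∀ g h : ℝ → ℂ, IsCore g → IsCore h →
      ∫⁻ x, ‖∫ y, oscAmp l S φ (x, y) * (g y * h (x + y))‖ₑ ^ 2 ≤
        ENNReal.ofReal (C * |l * μ| ^ (-(1 / 2) : ℝ)) *
          ((∫⁻ y, ‖g y‖ₑ ^ p) ^ (2 / p) * (∫⁻ s, ‖h s‖ₑ ^ q) ^ (2 / q)) := by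
  obtain ⟨C0, F, hC0, sF, F0, F1, F2, F3⟩ := exists_smooth_threshold
  obtain ⟨C, hC, hmain⟩ := RegionHyp.exists_lintegral_sq_le (A := C0 * (2 * A)) (by positivity) hc hK
    hp hp' hq hq' hpq
  refine ⟨4 * C, by positivity, fun δ μ φ S U H l hl g h hg hh => ?_⟩
  have hδ := H.pos_δ
  have hF00 : F 0 = 0 := F0 0 (by simp)
  set m : ℕ → ℝ := fun n => n + 1 with hm
  have hm0 : ∀ n, 0 < m n := fun n => by positivity
  -- η_n vanishes where |φ| ≤ 1/m and is within 2/m of φ. The factor m cancels in the first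
  -- derivative, so its bound is uniform; the second derivative need not stay bounded, but it is no
  -- longer used.
  set η : ℕ → ℝ × ℝ → ℂ := fun n z => (m n)⁻¹ • F (m n • φ z) with hη
  set η1 : ℕ → ℝ × ℝ → ℂ := fun n z => fderiv ℝ F (m n • φ z) (partialY φ z) with hη1
  have cφ := H.smooth.continuous
  have cφ1 := H.smooth.partialY.continuous
  have cη : ∀ n, Continuous (η n) := fun n => by
    have hc : Continuous fun z => F (m n • φ z) := sF.continuous.comp (cφ.const_smul (m n))
    exact hc.const_smul (m n)⁻¹
  have cη1 : ∀ n, Continuous (η1 n) := fun n =>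
    ((sF.continuous_fderiv (by simp)).comp (cφ.const_smul (m n))).clm_apply cφ1
  have bη0 : ∀ n z, ‖η n z‖ ≤ ‖φ z‖ := fun n z => by
    rw [hη]
    simp only
    rw [norm_smul, Real.norm_of_nonneg (inv_nonneg.2 (hm0 n).le), inv_mul_le_iff₀ (hm0 n)]
    refine (F2 _).trans (le_of_eq ?_)
    rw [norm_smul, Real.norm_of_nonneg (hm0 n).le]
  have bη : ∀ n z, ‖η n z‖ ≤ C0 * (2 * A) := fun n z => by
    refine (bη0 n z).trans ((H.norm_le z).trans ?_)
    nlinarith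
  have bη1 : ∀ n z, ‖η1 n z‖ ≤ C0 * (2 * A) / δ := fun n z => by
    refine ((fderiv ℝ F (m n • φ z)).le_opNorm _).trans ?_
    calc _ ≤ C0 * (A * δ⁻¹) := by gcongr; exacts [F3 _, H.bound1 z]
      _ ≤ C0 * (2 * A) / δ := by
        rw [mul_div_assoc, div_eq_mul_inv]; gcongr; linarith
  have dη : ∀ n x y, HasDerivAt (fun t => η n (x, t)) (η1 n (x, y)) y := fun n x y => by
    have h1 := (H.smooth.hasDerivAt_partialY x y).const_smul (m n)
    have h2 := ((sF.differentiable (by simp) (m n • φ (x, y))).hasFDerivAt.comp_hasDerivAt y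
      h1).const_smul (m n)⁻¹
    refine h2.congr_deriv ?_
    rw [map_smul, smul_smul, inv_mul_cancel₀ (hm0 n).ne', one_smul]
  have hnear : ∀ n z, ‖η n z - φ z‖ ≤ 2 * (1 / ((n : ℝ) + 1)) := fun n z => by
    have : η n z - φ z = (m n)⁻¹ • (F (m n • φ z) - m n • φ z) := by
      rw [smul_sub, smul_smul, inv_mul_cancel₀ (hm0 n).ne', one_smul]
    rw [this, norm_smul, Real.norm_of_nonneg (inv_nonneg.2 (hm0 n).le), mul_comm, one_div]
    gcongr
    exact F1 _
  have hlim : ∀ z, Tendsto (fun n => η n z) atTop (nhds (φ z)) := fun z => by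
    rw [tendsto_iff_norm_sub_tendsto_zero]
    refine squeeze_zero (fun n => norm_nonneg _) (fun n => hnear n z) ?_
    simpa using tendsto_one_div_add_atTop_nhds_zero_nat.const_mul (2 : ℝ)
  have cE : ∀ ψ : ℝ × ℝ → ℂ, Continuous ψ → (∀ z, ‖ψ z‖ ≤ ‖φ z‖) → IsCore (oscAmp l S ψ) := by
    intro ψ cψ hψ
    have hE := H.isCore_oscAmp l
    obtain ⟨B, hB⟩ := hE.bdd
    obtain ⟨M, hM⟩ := hE.supp
    have e : oscAmp l S ψ = fun z => oscAmp l S φ z * (ψ z / φ z) := by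
      funext z
      by_cases hz : φ z = 0
      · have : ψ z = 0 := norm_le_zero_iff.1 ((hψ z).trans (by simp [hz]))
        simp [oscAmp, this]
      · rw [oscAmp, oscAmp]; field_simp
    rw [e]
    refine hE.mul_bounded (cψ.measurable.div cφ.measurable) (b := 1) fun z => ?_
    rw [norm_div]
    exact div_le_one_of_le₀ (hψ z) (norm_nonneg _)
  have hcore : ∀ ψ : ℝ × ℝ → ℂ, Continuous ψ → (∀ z, ‖ψ z‖ ≤ ‖φ z‖) →
      IsCore fun z : ℝ × ℝ => oscAmp l S ψ z * (g z.2 * h (z.1 + z.2)) := fun ψ cψ hψ => by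
    obtain ⟨B, hB⟩ := (cE ψ cψ hψ).bdd
    have := (hg.convolution hh).mul_bounded (cE ψ cψ hψ).meas hB
    simpa only [mul_comm] using this
  set N := ENNReal.ofReal (C * |l * μ| ^ (-(1 / 2) : ℝ)) *
          ((∫⁻ y, ‖g y‖ₑ ^ p) ^ (2 / p) * (∫⁻ s, ‖h s‖ₑ ^ q) ^ (2 / q)) with hN
  have hbound : ∀ n, ∫⁻ x, ‖∫ y, oscAmp l S (η n) (x, y) * (g y * h (x + y))‖ₑ ^ 2 ≤ 2 * (N + N) := by
    intro n
    set K0 := tsupport φ ∩ {z | (m n)⁻¹ ≤ ‖φ z‖} with hK0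
    have cK : IsCompact K0 := H.compact.isCompact.inter_right (isClosed_le continuous_const cφ.norm)
    have hKφ : ∀ z ∈ K0, φ z ≠ 0 := fun z hz h0 => by
      have h1 : (m n)⁻¹ ≤ ‖φ z‖ := hz.2
      rw [h0, norm_zero] at h1
      exact absurd h1 (not_le.2 (inv_pos.2 (hm0 n)))
    have zK : ∀ z ∉ K0, η n z = 0 := fun z hz => by
      rw [hη]
      simp only
      rw [F0, smul_zero]
      rw [norm_smul, Real.norm_of_nonneg (hm0 n).le]
      by_contra! h1
      refine hz ⟨subset_tsupport _ fun h0 => ?_, ?_⟩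
      · rw [h0, norm_zero, mul_zero] at h1; linarith
      · rw [mem_ofPred_eq, inv_le_iff_one_le_mul₀' (hm0 n)]; exact h1.le
    -- Changing the sign of both l and S leaves the oscillating factor unchanged and makes DS
    -- positive on the region.
    set E : ℝ → ℝ × ℝ → ℂ := fun ε => oscAmp (ε * l) (fun z => ε * S z)
      (indicator (signRegion φ S ε) (η n)) with hE
    have hR := fun (ε : ℝ) (hε : |ε| = 1) => H.regionHyp hε (cη n).measurable (cη1 n).measurable
      (dη n) (bη n) (bη1 n) cK hKφ zK
    have hcE : ∀ ε, |ε| = 1 → IsCore fun z : ℝ × ℝ => E ε z * (g z.2 * h (z.1 + z.2)) :=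
      fun ε hε => by
      have h1 := (hR ε hε).isCore_oscAmp (ε * l)
      obtain ⟨B, hB⟩ := h1.bdd
      have e : (fun z : ℝ × ℝ => E ε z * (g z.2 * h (z.1 + z.2))) =
          fun z => g z.2 * h (z.1 + z.2) * E ε z := funext fun z => mul_comm _ _
      rw [e]
      exact (hg.convolution hh).mul_bounded h1.meas hB
    have hb : ∀ ε, |ε| = 1 → ∫⁻ x, ‖∫ y, E ε (x, y) * (g y * h (x + y))‖ₑ ^ 2 ≤ N := fun ε hε => by
      have := hmain δ μ _ _ _ _ (hR ε hε) (ε * l)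
        (mul_ne_zero (abs_pos.1 (by rw [hε]; exact one_pos)) hl) g h hg hh
      rwa [mul_assoc ε l μ, abs_mul ε, hε, one_mul] at this
    have hsplit : ∀ z, oscAmp l S (η n) z = E 1 z + E (-1) z := fun z => by
      have e1 : ∀ ε : ℝ, |ε| = 1 → E ε z = Complex.exp (Complex.I * ((l * S z : ℝ) : ℂ)) *
          indicator (signRegion φ S ε) (η n) z := fun ε hε => by
        have : ε * ε = 1 := by rw [← abs_mul_abs_self, hε, one_mul]
        rw [hE]
        simp only [oscAmp]
        rw [show ε * l * (ε * S z) = ε * ε * (l * S z) by ring, this, one_mul]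
      rw [e1 1 (by simp), e1 (-1) (by simp), ← mul_add, oscAmp]
      congr 1
      by_cases hz : η n z = 0
      · have : ∀ ε, indicator (signRegion φ S ε) (η n) z = 0 := fun ε =>
          indicator_apply_eq_zero.2 fun _ => hz
        rw [hz, this, this, add_zero]
      have hφz : φ z ≠ 0 := hKφ z (by by_contra hn; exact hz (zK z hn))
      have hzI : z ∈ interior (dirHull fibreDirections (tsupport φ)) :=
        interior_maximal ((subset_tsupport φ).trans (subset_dirHull _ _)) cφ.isOpen_support hφz
      have hpos := (mul_pos hc H.pos_μ).trans_le (H.lower z (interior_subset hzI))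
      rcases lt_or_gt_of_ne (abs_pos.1 hpos) with h0 | h0
      · have h1 : z ∈ signRegion φ S (-1) := ⟨hzI, by rw [mem_preimage, mem_Ioi]; linarith⟩
        have h2 : z ∉ signRegion φ S 1 := fun h' => by
          have := h'.2
          rw [mem_preimage, mem_Ioi] at this
          linarith
        rw [indicator_of_mem h1, indicator_of_notMem h2, zero_add]
      · have h1 : z ∈ signRegion φ S 1 := ⟨hzI, by rw [mem_preimage, mem_Ioi]; linarith⟩
        have h2 : z ∉ signRegion φ S (-1) := fun h' => by
          have := h'.2
          rw [mem_preimage, mem_Ioi] at this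
          linarith
        rw [indicator_of_mem h1, indicator_of_notMem h2, add_zero]
    have c1 := hcE 1 (by simp)
    have c2 := hcE (-1) (by simp)
    have hsum : ∀ x, ∫ y, oscAmp l S (η n) (x, y) * (g y * h (x + y)) =
        (∫ y, E 1 (x, y) * (g y * h (x + y))) + ∫ y, E (-1) (x, y) * (g y * h (x + y)) := fun x => by
      simp only [hsplit, add_mul]
      exact integral_add ((c1.slice x).integrable volume) ((c2.slice x).integrable volume)
    simp only [hsum]
    refine (lintegral_enorm_add_sq_le c1.integral_right.meas).trans ?_
    gcongr
    exacts [hb 1 (by simp), hb (-1) (by simp)]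
  have htend : ∀ x, Tendsto (fun n => ∫ y, oscAmp l S (η n) (x, y) * (g y * h (x + y))) atTop
      (nhds (∫ y, oscAmp l S φ (x, y) * (g y * h (x + y)))) := fun x => by
    have c1 := (hcore φ cφ fun z => le_rfl).slice x
    refine tendsto_integral_of_dominated_convergence
      (fun y => ‖oscAmp l S φ (x, y) * (g y * h (x + y))‖)
      (fun n => ((hcore (η n) (cη n) (bη0 n)).slice x).meas.aestronglyMeasurable)
      (c1.integrable volume).norm (fun n => ae_of_all _ fun y => ?_) (ae_of_all _ fun y => ?_)
    · rw [norm_mul, norm_mul (oscAmp l S φ (x, y)), norm_oscAmp, norm_oscAmp]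
      exact mul_le_mul_of_nonneg_right (bη0 n _) (norm_nonneg _)
    · exact ((hlim (x, y)).const_mul _).mul_const _
  -- The bound is uniform in n and the inner integrals converge by dominated convergence, so Fatou's
  -- lemma suffices.
  have hfatou : ∫⁻ x, ‖∫ y, oscAmp l S φ (x, y) * (g y * h (x + y))‖ₑ ^ 2 ≤
      liminf (fun n => ∫⁻ x, ‖∫ y, oscAmp l S (η n) (x, y) * (g y * h (x + y))‖ₑ ^ 2) atTop := by
    refine le_trans (le_of_eq (lintegral_congr fun x => ?_)) (lintegral_liminf_le fun n =>
      ((hcore (η n) (cη n) (bη0 n)).integral_right.meas.enorm.pow_const 2))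
    have : Continuous fun z : ℂ => ‖z‖ₑ ^ 2 := (ENNReal.continuous_pow 2).comp continuous_enorm
    exact ((this.tendsto _).comp (htend x)).liminf_eq.symm
  refine hfatou.trans (((liminf_le_liminf (Eventually.of_forall hbound)).trans
    (le_of_eq (liminf_const _))).trans (le_of_eq ?_))
  rw [← two_mul, ← mul_assoc, hN, ← mul_assoc, show (2 : ℝ≥0∞) * 2 = ENNReal.ofReal 4 by norm_num,
    ← ENNReal.ofReal_mul (by norm_num), mul_assoc 4]

/-- The bound with `f` in `L²`. -/
theorem exists_trilinear_bound_first {A c K p q : ℝ} (hA : 0 < A) (hc : 0 < c) (hK : 0 < K)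
    (hp : 2 < p) (hp' : p < 4) (hq : 2 < q) (hq' : q < 4) (hpq : 1 / p + 1 / q = 3 / 4) :
    ∃ C : ℝ, 0 < C ∧ ∀ (δ μ : ℝ) (φ : ℝ × ℝ → ℂ) (S : ℝ × ℝ → ℝ) (U : Set (ℝ × ℝ)),
      PhaseHyp A c K δ μ φ S U → ∀ l : ℝ, l ≠ 0 → ∀ f g h : ℝ → ℂ,
      MemLp f (ENNReal.ofReal 2) volume → MemLp g (ENNReal.ofReal p) volume →
      MemLp h (ENNReal.ofReal q) volume →
        Integrable (trilinearIntegrand l S φ f g h) volume ∧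
        ‖trilinearForm l S φ f g h‖ ≤
          C * |l * μ| ^ (-(1 / 4) : ℝ) * normLp 2 f * normLp p g * normLp q h := by
  obtain ⟨C, hC, hmain⟩ := PhaseHyp.exists_lintegral_sq_le hA hc hK hp hp' hq hq' hpq
  refine ⟨C ^ (1 / 2 : ℝ), by positivity, fun δ μ φ S U H l hl f g h hf hg hh => ?_⟩
  rw [trilinearForm, trilinearIntegrand_eq]
  have hE := H.isCore_oscAmp l
  refine trilinear_bound_of_core hE le_rfl hp.le hq.le (by positivity) ?_ hf hg hh
  intro f g h hf hg hh
  obtain ⟨B, hB⟩ := hE.bdd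
  have hG : IsCore fun z : ℝ × ℝ => oscAmp l S φ z * (g z.2 * h (z.1 + z.2)) := by
    have := (hg.convolution hh).mul_bounded hE.meas hB
    simpa only [mul_comm] using this
  have key := norm_integral_mul_le_of_sq hG hf (by positivity) (by linarith) (by linarith) hg hh
    (hmain δ μ φ S U H l hl g h hg hh)
  rw [rpow_neg_half_sqrt hC.le (abs_nonneg _)] at key
  refine le_trans (le_of_eq ?_) key
  congr 2
  funext z
  ring

end SquareFunction

/-! ### Both bounds with a common constant. -/

theorem theorem2p2 (p q : ℝ) (hp : 2 < p) (hp' : p < 4) (hq : 2 < q) (hq' : q < 4)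
    (hpq : 1 / p + 1 / q = 3 / 4)
    -- the implicit constants of the hypotheses
    (A c K : ℝ) (hA : 0 < A) (hc : 0 < c) (hK : 0 < K) :
    ∃ C : ℝ, 0 < C ∧
      ∀ (δ₁ δ₂ μ : ℝ), 0 < δ₁ → 0 < δ₂ → 0 < μ →
      ∀ φ : ℝ × ℝ → ℂ, ContDiff ℝ ∞ φ → HasCompactSupport φ →
      -- the horizontal and vertical cross-sections of the support have width at most `δ₁`, `δ₂`
      (∀ x x' y : ℝ, (x, y) ∈ tsupport φ → (x', y) ∈ tsupport φ → |x - x'| ≤ δ₁) →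
      (∀ x y y' : ℝ, (x, y) ∈ tsupport φ → (x, y') ∈ tsupport φ → |y - y'| ≤ δ₂) →
      (∀ z : ℝ × ℝ, ‖partialY φ z‖ ≤ A * δ₂⁻¹) →
      (∀ z : ℝ × ℝ, ‖partialY (partialY φ) z‖ ≤ A * (δ₂ ^ 2)⁻¹) →
      ∀ (S : ℝ × ℝ → ℝ) (U : Set (ℝ × ℝ)), IsOpen U →
      dirHull {((1 : ℝ), (0 : ℝ)), ((0 : ℝ), (1 : ℝ)), ((-1 : ℝ), (1 : ℝ))} (tsupport φ) ⊆ U →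
      ContDiffOn ℝ ∞ S U →
      (∀ z ∈ dirHull {((1 : ℝ), (0 : ℝ)), ((0 : ℝ), (1 : ℝ)), ((-1 : ℝ), (1 : ℝ))} (tsupport φ),
        c * μ ≤ |opD S z| ∧
        |partialY (opD S) z| ≤ K * (μ / δ₂) ∧
        |partialY (partialY (opD S)) z| ≤ K * (μ / δ₂ ^ 2)) →
      ∀ l : ℝ, l ≠ 0 →
      (∀ f g h : ℝ → ℂ, MemLp f (ENNReal.ofReal p) volume → MemLp g (ENNReal.ofReal q) volume →
        MemLp h (ENNReal.ofReal 2) volume →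
        Integrable (trilinearIntegrand l S φ f g h) volume ∧
        ‖trilinearForm l S φ f g h‖ ≤
          C * |l * μ| ^ (-(1 / 4) : ℝ) * normLp p f * normLp q g * normLp 2 h) ∧
      (∀ f g h : ℝ → ℂ, MemLp f (ENNReal.ofReal 2) volume → MemLp g (ENNReal.ofReal p) volume →
        MemLp h (ENNReal.ofReal q) volume →
        Integrable (trilinearIntegrand l S φ f g h) volume ∧
        ‖trilinearForm l S φ f g h‖ ≤
          C * |l * μ| ^ (-(1 / 4) : ℝ) * normLp 2 f * normLp p g * normLp q h) := by
  obtain ⟨C₁, hC₁, h₁⟩ := exists_trilinear_bound_sum hA hc hK hp hp' hq hq' hpq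
  obtain ⟨C₂, hC₂, h₂⟩ := exists_trilinear_bound_first hA hc hK hp hp' hq hq' hpq
  refine ⟨max C₁ C₂, lt_max_of_lt_left hC₁, fun δ₁ δ₂ μ _ hδ₂ hμ φ sφ cφ _ hw hb₁ hb₂ S U hU hH hS
    hD l hl => ?_⟩
  have H : PhaseHyp A c K δ₂ μ φ S U := ⟨hA, hc, hK, hδ₂, hμ, sφ, cφ, hw, hb₁, hb₂, hU, hH, hS,
    fun z hz => (hD z hz).1, fun z hz => (hD z hz).2.1, fun z hz => (hD z hz).2.2⟩
  have enlarge : ∀ {C' a b d : ℝ}, C' ≤ max C₁ C₂ → 0 ≤ a → 0 ≤ b → 0 ≤ d →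
      C' * |l * μ| ^ (-(1 / 4) : ℝ) * a * b * d ≤
        max C₁ C₂ * |l * μ| ^ (-(1 / 4) : ℝ) * a * b * d := fun h ha hb hd => by gcongr
  have nn : ∀ (r : ℝ) (u : ℝ → ℂ), 0 ≤ normLp r u := fun r u => ENNReal.toReal_nonneg
  exact ⟨fun f g h hf hg hh => (h₁ δ₂ μ φ S U H l hl f g h hf hg hh).imp_right fun k =>
      k.trans (enlarge (le_max_left _ _) (nn _ _) (nn _ _) (nn _ _)),
    fun f g h hf hg hh => (h₂ δ₂ μ φ S U H l hl f g h hf hg hh).imp_right fun k =>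
      k.trans (enlarge (le_max_right _ _) (nn _ _) (nn _ _) (nn _ _))⟩
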